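/- Let ${\bf k}$ be a graded commutative $\mathbb{Q}$-algebra. All modules are $\mathbb Z$-graded, and signs follow the Koszul convention; in particular a ${\bf k}$-module map $\phi$ of degree $1$ satisfies $\phi(\lambda a)=(-1)^{|\lambda|}\lambda\,\phi(a)$. Let $({\cal A},\cdot,{\frak d})$ be a differential graded algebra over ${\bf k}$ (associative, not necessarily unital, ${\frak d}$ of degree $1$), with a cohomological splitting ${\cal A}={\cal H}\oplus{\frak d}M\oplus M$ into graded submodules: ${\cal H}\subset\ker{\frak d}$, the natural map ${\cal H}\to H({\cal A},{\frak d})$ is an isomorphism, and ${\frak d}|_M$ is injective. For $a=a^H+{\frak d}x+y$ with $a^H\in{\cal H}$ and $x,y\in M$ put $Q(a)=x$. Suppose that ${\cal H}$ is free with a homogeneous basis $\{\alpha_j\}$, and let $X^j$, of degree $1-|\alpha_j|$, be the dual basis of $\{s^{-1}\alpha_j\}$. Let $\overline T(s{\cal H}^t)$ be the algebra of formal power series in the noncommuting variables $X^j$ over ${\bf k}$ (when the basis is finite, this is the completed tensor algebra $\prod_n T^n(s{\cal H}^t)$), and let ${\cal A}\otimes\overline T(s{\cal H}^t)$ be the algebra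 of formal power series with coefficients in ${\cal A}$, where $(\alpha X^u)(\beta X^v)=(-1)^{|X^u||\beta|}\alpha\beta X^uX^v$, ${\frak d}(\alpha X^u)=({\frak d}\alpha)X^u$ and $\partial(\alpha X^u)=(-1)^{|\alpha|}\alpha\,\partial X^u$. Derivations are understood to be continuous: each coefficient of $\partial f$ depends on finitely many coefficients of $f$. The subscript $[n]$ denotes the component of word length $n$, and $\partial_{[n]}$ the derivation determined by the components $s{\cal H}^t\to T^n(s{\cal H}^t)$ of $\partial$. (1) There are a formal power series connection $\omega=\omega_{[1]}+\omega_{[2]}+\cdots\in{\cal A}\otimes\overline T(s{\cal H}^t)$, of total degree $1$, and a differential $\partial=\partial_{[1]}+\partial_{[2]}+\cdots$ on $\overline T(s{\cal H}^t)$ (a derivation of degree $1$ with $\partial^2=0$) which are given by Chen's induction $$\omega_{[1]}=\sum_j\alpha_jX^j,\qquad \partial_{[1]}=0,\qquad \partial_{[n+1]}\omega_{[1]}=-\Gamma_{[n+1]}^H,\qquad \omega_{[n+1]}=-Q\,\Gamma_{[n+1]}\qquad(n\ge1),$$ where $\Gamma_{[n+1]}$ is the component of length $n+1$ of $\partial_n\omega_n+{\frak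 d}\omega_n+\omega_n\cdot\omega_n$, with $\omega_n=\sum_{i\le n}\omega_{[i]}$ and $\partial_n=\sum_{i\le n}\partial_{[i]}$. They satisfy $$\partial\omega+{\frak d}\omega+\omega\cdot\omega=0 .$$ (2) There is a codifferential $b$ on the tensor coalgebra $T^c(s^{-1}{\cal H})$ (a coderivation of degree $1$ with $b(1)=0$ and $b^2=0$) with $\langle\partial f,x\rangle=-(-1)^{|f|}\langle f,bx\rangle$, and there are an $A_\infty$-algebra structure $\{m_n\}_{n\ge 1}$ on ${\cal H}$ and an $A_\infty$-algebra structure on $H({\cal A},{\frak d})$, corresponding to it under ${\cal H}\cong H({\cal A},{\frak d})$, such that the component $b_{[n]}:T^n(s^{-1}{\cal H})\to s^{-1}{\cal H}$ of $b$ is $$b_{[n]}(s^{-1}v_1,\dots,s^{-1}v_n)=(-1)^{\sum_j(n-j)|v_j|}s^{-1}m_n(v_1,\dots,v_n).$$ Here an $A_\infty$-algebra structure on $V$ consists of ${\bf k}$-module maps $m_n:V^{\otimes n}\to V$ of degree $2-n$ with $$\sum_{r+s=n+1}\sum_{l=1}^r(-1)^{(s+1)l+s(n+|v_1|+\cdots+|v_{l-1}|)}m_r(v_1,\dots,m_s(v_l,\dots,v_{l+s-1}),\dots,v_n)=0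 .$$ (3) The map $\tau=-\langle\omega,\cdot\rangle:(T^c(s^{-1}{\cal H}),b)\to({\cal A},{\frak d})$ is a twisting cochain: it is a ${\bf k}$-module map of degree $1$ with $\tau b+{\frak d}\tau=\tau\cup\tau$. (4) Let $({\cal L},[\cdot,\cdot],{\frak d})$ be a differential graded Lie algebra over ${\bf k}$ with a cohomological splitting ${\cal L}={\cal H}\oplus{\frak d}M\oplus M$ and a homogeneous basis of ${\cal H}$ as above. Then the analogous induction, with the completed graded symmetric algebra $\overline S(s{\cal H}^t)$ in place of $\overline T(s{\cal H}^t)$ and $\frac12[\omega,\omega]$ in place of $\omega\cdot\omega$, gives a formal power series connection $\omega\in{\cal L}\otimes\overline S(s{\cal H}^t)$ of total degree $1$ and a differential $\partial$ on $\overline S(s{\cal H}^t)$ with $$\partial\omega+{\frak d}\omega+\tfrac12[\omega,\omega]=0,$$ and $\partial$ corresponds in the same way, by dualizing its components $s{\cal H}^t\to S^n(s{\cal H}^t)$, to an $L_\infty$-algebra structure $\{l_n\}_{n\ge 1}$ on ${\cal H}$, hence on $H({\cal L},{\frak d})$. Here an $L_\infty$-algebra structure on $V$ consists of graded antisymmetric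 ${\bf k}$-module maps $l_n:V^{\otimes n}\to V$ of degree $2-n$ with $$\sum_{r+s=n+1}\ \sum_{\sigma}(-1)^{s(r-1)}(-1)^\sigma(-1)^{\epsilon(\sigma,v)}\,l_r\bigl(l_s(v_{\sigma(1)},\dots,v_{\sigma(s)}),v_{\sigma(s+1)},\dots,v_{\sigma(n)}\bigr)=0,$$ where $\sigma$ runs over the permutations of $\{1,\dots,n\}$ with $\sigma(1)<\cdots<\sigma(s)$ and $\sigma(s+1)<\cdots<\sigma(n)$, $(-1)^\sigma$ is the sign of $\sigma$ and $(-1)^{\epsilon(\sigma,v)}$ is the Koszul sign of the permutation of the $v_i$. -/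

import Mathlib

open scoped BigOperators

namespace ChenHPT

noncomputable section

/-! ### Signs and gradings -/

/-- The sign `(-1)^n` of an integer `n`. -/
def sgn (n : ℤ) : ℤ := (Int.negOnePow n : ℤˣ)

/-- The Koszul sign of `v₁ ⋯ vₙ ↦ v_{σ 1} ⋯ v_{σ n}` for elements `vᵢ` of degree `p i`. -/
def koszulSign {n : ℕ} (σ : Equiv.Perm (Fin n)) (p : Fin n → ℤ) : ℤ :=
  ∏ i : Fin n, ∏ j : Fin n, if i < j ∧ σ j < σ i then sgn (p (σ i) * p (σ j)) else 1

theorem sgn_mul_self (n : ℤ) : sgn n * sgn n = 1 := by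
  simp [sgn, ← Units.val_mul]

theorem koszulSign_mul_self {n : ℕ} (σ : Equiv.Perm (Fin n)) (p : Fin n → ℤ) :
    koszulSign σ p * koszulSign σ p = 1 := by
  simp only [koszulSign, ← Finset.prod_mul_distrib]
  refine Finset.prod_eq_one fun i _ => Finset.prod_eq_one fun j _ => ?_
  split_ifs
  · exact sgn_mul_self _
  · simp

/-- A product over the pairs `i < j` of a symmetric function is invariant under permutations. -/
theorem prod_pairs_comp {n : ℕ} (σ : Equiv.Perm (Fin n)) (F : Fin n → Fin n → ℤ)
    (hF : ∀ i j, F i j = F j i) :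
    (∏ i : Fin n, ∏ j : Fin n, if i < j then F (σ i) (σ j) else 1) =
      ∏ i : Fin n, ∏ j : Fin n, if i < j then F i j else 1 := by
  have conv : ∀ G : Fin n → Fin n → ℤ,
      (∏ i : Fin n, ∏ j : Fin n, if i < j then G i j else 1) =
        ∏ x ∈ (Finset.univ : Finset (Fin n × Fin n)).filter (fun x => x.1 < x.2), G x.1 x.2 := by
    intro G
    rw [Finset.prod_filter, ← Finset.univ_product_univ, Finset.prod_product]
  rw [conv F, conv fun i j => F (σ i) (σ j)]
  have key : ∀ (ρ : Equiv.Perm (Fin n)) (x y : Fin n), x < y →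
      min (ρ x) (ρ y) < max (ρ x) (ρ y) := fun ρ x y h => by
    have : ρ x ≠ ρ y := fun e => h.ne (ρ.injective e)
    exact min_lt_max.2 this
  refine Finset.prod_bij'
    (fun x _ => (min (σ x.1) (σ x.2), max (σ x.1) (σ x.2)))
    (fun x _ => (min (σ.symm x.1) (σ.symm x.2), max (σ.symm x.1) (σ.symm x.2)))
    ?_ ?_ ?_ ?_ ?_
  · intro x hx
    simpa only [Finset.mem_filter, Finset.mem_univ, true_and] using
      key σ x.1 x.2 (by simpa using hx)
  · intro x hx
    simpa only [Finset.mem_filter, Finset.mem_univ, true_and] using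
      key σ.symm x.1 x.2 (by simpa using hx)
  · rintro ⟨x, y⟩ hx
    have hxy : x < y := by simpa using hx
    rcases le_total (σ x) (σ y) with h | h <;> simp [h, hxy.le]
  · rintro ⟨x, y⟩ hx
    have hxy : x < y := by simpa using hx
    rcases le_total (σ.symm x) (σ.symm y) with h | h <;> simp [h, hxy.le]
  · rintro ⟨x, y⟩ hx
    rcases le_total (σ x) (σ y) with h | h
    · simp [h]
    · simp [h, hF (σ x) (σ y)]

theorem koszulSign_mul {n : ℕ} (τ σ : Equiv.Perm (Fin n)) (p : Fin n → ℤ) :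
    koszulSign (τ * σ) p = koszulSign τ p * koszulSign σ (p ∘ τ) := by
  have h := prod_pairs_comp σ
    (fun a b => if (a < b ↔ τ b < τ a) then sgn (p (τ a) * p (τ b)) else 1) (by
      intro a b
      rcases eq_or_ne a b with rfl | hab
      · rfl
      · have hτ : τ a ≠ τ b := fun e => hab (τ.injective e)
        rw [mul_comm (p (τ a))]
        congr 1
        rcases lt_or_gt_of_ne hab with h1 | h1 <;> rcases lt_or_gt_of_ne hτ with h2 | h2 <;>
          simp [h1, h2, h1.not_gt, h2.not_gt])
  have e : koszulSign τ p = ∏ i : Fin n, ∏ j : Fin n, if i < j then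
      (if (i < j ↔ τ j < τ i) then sgn (p (τ i) * p (τ j)) else 1) else 1 := by
    refine Finset.prod_congr rfl fun i _ => Finset.prod_congr rfl fun j _ => ?_
    by_cases hij : i < j <;> simp [hij]
  rw [e, ← h]
  simp only [koszulSign, ← Finset.prod_mul_distrib]
  refine Finset.prod_congr rfl fun i _ => Finset.prod_congr rfl fun j _ => ?_
  by_cases hij : i < j
  · have hσ : σ i ≠ σ j := fun e => hij.ne (σ.injective e)
    have hτ : τ (σ i) ≠ τ (σ j) := fun e => hσ (τ.injective e)
    rcases lt_or_gt_of_ne hσ with h1 | h1 <;> rcases lt_or_gt_of_ne hτ with h2 | h2 <;>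
      simp [hij, h1, h2, h1.not_gt, h2.not_gt, sgn_mul_self]
  · simp [hij]

section Twist

variable {V : Type*} [AddCommGroup V] (𝒱 : ℤ → AddSubgroup V) [DirectSum.Decomposition 𝒱]

/-- The additive map with `twist 𝒱 n v = (-1)^(n * p) v` for `v` of degree `p`. -/
def twist (n : ℤ) : V →+ V :=
  (DirectSum.toAddMonoid fun p => sgn (n * p) • (𝒱 p).subtype).comp
    (DirectSum.decomposeAddEquiv 𝒱).toAddMonoidHom

theorem twist_of_mem (n : ℤ) {p : ℤ} {v : V} (hv : v ∈ 𝒱 p) :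
    twist 𝒱 n v = sgn (n * p) • v := by
  lift v to 𝒱 p using hv
  simp [twist]

end Twist

section Ground

variable {k : Type*} [Ring k] (𝓀 : ℤ → AddSubgroup k) [GradedRing 𝓀]

/-- The ring `k` is graded commutative: `x y = (-1)^(|x| |y|) y x`. -/
def IsGradedComm (𝓀 : ℤ → AddSubgroup k) : Prop :=
  ∀ (p q : ℤ) (x y : k), x ∈ 𝓀 p → y ∈ 𝓀 q → x * y = sgn (p * q) • (y * x)

/-- The grading automorphism `x ↦ (-1)^|x| x` of `k`.  Over a graded commutative ring, the
`k`-module maps of odd degree are, by the Koszul convention `φ(x a) = (-1)^|x| x φ(a)`, the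
additive maps that are semilinear for this automorphism. -/
def koszul : k →+* k where
  toFun := twist 𝓀 1
  map_zero' := map_zero _
  map_add' := map_add _
  map_one' := by
    rw [twist_of_mem 𝓀 1 (SetLike.GradedOne.one_mem (A := 𝓀))]
    simp [sgn]
  map_mul' x y := by
    induction x using DirectSum.Decomposition.inductionOn 𝓀 with
    | zero => simp
    | add a b ha hb => simp only [add_mul, map_add, ha, hb]
    | @homogeneous i a =>
      induction y using DirectSum.Decomposition.inductionOn 𝓀 with
      | zero => simp
      | add c e hc he => simp only [mul_add, map_add, hc, he]
      | @homogeneous j c =>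
        rw [twist_of_mem 𝓀 1 a.2, twist_of_mem 𝓀 1 c.2,
          twist_of_mem 𝓀 1 (SetLike.mul_mem_graded a.2 c.2)]
        simp only [sgn, one_mul, Int.negOnePow_add, Units.val_mul, smul_mul_assoc, mul_smul_comm,
          smul_smul]
        rw [mul_comm]

theorem koszul_koszul (x : k) : koszul 𝓀 (koszul 𝓀 x) = x := by
  induction x using DirectSum.Decomposition.inductionOn 𝓀 with
  | zero => simp
  | add a b ha hb => simp only [map_add, ha, hb]
  | @homogeneous i a =>
    change twist 𝓀 1 (twist 𝓀 1 (a : k)) = a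
    rw [twist_of_mem 𝓀 1 a.2, map_zsmul, twist_of_mem 𝓀 1 a.2, smul_smul, mul_comm]
    simp [sgn, ← Units.val_mul]

instance : RingHomSurjective (koszul 𝓀) :=
  ⟨fun x => ⟨koszul 𝓀 x, koszul_koszul 𝓀 x⟩⟩

variable {V : Type*} [AddCommGroup V] [Module k V] (𝒱 : ℤ → AddSubgroup V)
  [DirectSum.Decomposition 𝒱]

/-- The right action of `k` on a graded left `k`-module: `a x = (-1)^(|a| |x|) x a`. -/
def rightSMul (a : V) (x : k) : V :=
  DirectSum.toAddMonoid
    (fun q => ((smulAddHom k V).flip (twist 𝒱 q a)).comp (𝓀 q).subtype)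
    (DirectSum.decompose 𝓀 x)

end Ground

/-! ### Differential graded algebras, differential graded Lie algebras, splittings -/

section DG

variable {k : Type*} [Ring k] (𝓀 : ℤ → AddSubgroup k) [GradedRing 𝓀]

/-- `A = ⊕ 𝒜 n` with the differential `d` is a differential graded algebra over the graded
commutative ring `k` (associative, not necessarily unital). -/
structure IsDGA {A : Type*} [NonUnitalRing A] [Module k A] (𝒜 : ℤ → AddSubgroup A)
    (d : A →ₛₗ[koszul 𝓀] A) : Prop where
  smul_mem : ∀ (p q : ℤ) (x : k) (a : A), x ∈ 𝓀 p → a ∈ 𝒜 q → x • a ∈ 𝒜 (p + q)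
  mul_mem : ∀ (p q : ℤ) (a b : A), a ∈ 𝒜 p → b ∈ 𝒜 q → a * b ∈ 𝒜 (p + q)
  smul_mul : ∀ (x : k) (a b : A), (x • a) * b = x • (a * b)
  mul_smul : ∀ (p q : ℤ) (x : k) (a b : A), x ∈ 𝓀 p → a ∈ 𝒜 q →
    a * (x • b) = sgn (p * q) • x • (a * b)
  d_mem : ∀ (p : ℤ) (a : A), a ∈ 𝒜 p → d a ∈ 𝒜 (p + 1)
  d_mul : ∀ (p : ℤ) (a b : A), a ∈ 𝒜 p → d (a * b) = d a * b + sgn p • (a * d b)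
  d_d : ∀ a : A, d (d a) = 0

/-- `L = ⊕ ℒ n` with the bracket `br` and the differential `d` is a differential graded Lie
algebra over the graded commutative ring `k`. -/
structure IsDGLA {L : Type*} [AddCommGroup L] [Module k L] (ℒ : ℤ → AddSubgroup L)
    (br : L →+ L →+ L) (d : L →ₛₗ[koszul 𝓀] L) : Prop where
  smul_mem : ∀ (p q : ℤ) (x : k) (a : L), x ∈ 𝓀 p → a ∈ ℒ q → x • a ∈ ℒ (p + q)
  br_mem : ∀ (p q : ℤ) (a b : L), a ∈ ℒ p → b ∈ ℒ q → br a b ∈ ℒ (p + q)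
  smul_br : ∀ (x : k) (a b : L), br (x • a) b = x • br a b
  antisymm : ∀ (p q : ℤ) (a b : L), a ∈ ℒ p → b ∈ ℒ q → br a b = -(sgn (p * q) • br b a)
  jacobi : ∀ (p q : ℤ) (a b c : L), a ∈ ℒ p → b ∈ ℒ q →
    br a (br b c) = br (br a b) c + sgn (p * q) • br b (br a c)
  d_mem : ∀ (p : ℤ) (a : L), a ∈ ℒ p → d a ∈ ℒ (p + 1)
  d_br : ∀ (p : ℤ) (a b : L), a ∈ ℒ p → d (br a b) = br (d a) b + sgn p • br a (d b)
  d_d : ∀ a : L, d (d a) = 0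

variable {𝓀} {A : Type*} [AddCommGroup A] [Module k A]

/-- The cohomology `Ker d / Im d`. -/
abbrev Cohomology (d : A →ₛₗ[koszul 𝓀] A) : Type _ :=
  LinearMap.ker d ⧸ (LinearMap.range d).submoduleOf (LinearMap.ker d)

/-- The degree `n` part of the cohomology: the classes of the cocycles of degree `n`. -/
def cohomologyGrading (𝒜 : ℤ → AddSubgroup A) (d : A →ₛₗ[koszul 𝓀] A) (n : ℤ) :
    AddSubgroup (Cohomology d) :=
  ((𝒜 n).comap (LinearMap.ker d).subtype.toAddMonoidHom).map
    ((LinearMap.range d).submoduleOf (LinearMap.ker d)).mkQ.toAddMonoidHom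

/-- The grading induced on a submodule. -/
def subGrading (𝒜 : ℤ → AddSubgroup A) (H : Submodule k A) (n : ℤ) : AddSubgroup H :=
  (𝒜 n).comap H.subtype.toAddMonoidHom

/-- The natural map `H → H(A, d)` for a submodule `H` of cocycles. -/
def classMap (d : A →ₛₗ[koszul 𝓀] A) (H : Submodule k A) (h : H ≤ LinearMap.ker d) :
    H →ₗ[k] Cohomology d :=
  ((LinearMap.range d).submoduleOf (LinearMap.ker d)).mkQ.comp (Submodule.inclusion h)

/-- A cohomological splitting `A = H ⊕ dM ⊕ M` into graded submodules. -/
structure IsCohSplitting (𝒜 : ℤ → AddSubgroup A) [DirectSum.Decomposition 𝒜]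
    (d : A →ₛₗ[koszul 𝓀] A) (H M : Submodule k A) : Prop where
  homogeneous_H : ∀ a ∈ H, ∀ n : ℤ, (DirectSum.decompose 𝒜 a n : A) ∈ H
  homogeneous_M : ∀ a ∈ M, ∀ n : ℤ, (DirectSum.decompose 𝒜 a n : A) ∈ M
  span : ∀ a : A, ∃ h ∈ H, ∃ x ∈ M, ∃ y ∈ M, a = h + d x + y
  independent : ∀ h ∈ H, ∀ x ∈ M, ∀ y ∈ M, h + d x + y = 0 → h = 0 ∧ d x = 0 ∧ y = 0
  le_ker : H ≤ LinearMap.ker d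
  bijective : Function.Bijective (classMap d H le_ker)
  injOn : ∀ x ∈ M, d x = 0 → x = 0

/-- The component `a^H` of `a = a^H + d x + y` with `a^H ∈ H` and `x, y ∈ M`. -/
def projH (d : A →ₛₗ[koszul 𝓀] A) (H M : Submodule k A) (a : A) : A :=
  Classical.epsilon fun h => h ∈ H ∧ ∃ x ∈ M, ∃ y ∈ M, a = h + d x + y

/-- The operator `Q a = x` for `a = a^H + d x + y` with `a^H ∈ H` and `x, y ∈ M`. -/
def opQ (d : A →ₛₗ[koszul 𝓀] A) (H M : Submodule k A) (a : A) : A :=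
  Classical.epsilon fun x => x ∈ M ∧ ∃ h ∈ H, ∃ y ∈ M, a = h + d x + y

end DG

/-! ### Noncommutative formal power series

Let `α j` (`j : ι`) be a homogeneous basis of `H`, of degrees `deg j`.  The dual basis
`X j` of `s H^t` has the degrees `1 - deg j`, and `s⁻¹ (α j)` has the degree `deg j - 1`.
A function `f : List ι → V` stands for the formal power series `∑ f(j₁ ⋯ jₙ) X j₁ ⋯ X jₙ`; for
`V = k` these are the elements of the completed tensor algebra `T̄(s H^t)`, for `V = A` those
of `A ⊗ T̄(s H^t)`. -/

section Series

variable {ι : Type*} (deg : ι → ℤ)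

/-- The degree of the monomial `X j₁ ⋯ X jₙ`. -/
def xdeg (u : List ι) : ℤ := (u.map fun j => 1 - deg j).sum

/-- The monomial with the word `u`, as a series with coefficients in `k`. -/
def mono (k : Type*) [Ring k] (u : List ι) : List ι → k :=
  open Classical in Pi.single u 1

section Coeff

variable {V : Type*} [AddCommGroup V] (𝒱 : ℤ → AddSubgroup V)

/-- The series `f` is homogeneous of total degree `p`. -/
def HasDeg (p : ℤ) (f : List ι → V) : Prop := ∀ u, f u ∈ 𝒱 (p - xdeg deg u)

/-- The component of word length `n`. -/
def comp (n : ℕ) (f : List ι → V) : List ι → V := fun u => if u.length = n then f u else 0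

/-- The sum of the components of word length at most `n`. -/
def trunc (n : ℕ) (f : List ι → V) : List ι → V := fun u => if u.length ≤ n then f u else 0

variable [DirectSum.Decomposition 𝒱]

/-- The extension of a biadditive operation `B` on `V` to series:
`B(a X^u, b X^v) = (-1)^(|X^u| |b|) B(a, b) X^u X^v`. -/
def conv (B : V →+ V →+ V) (f g : List ι → V) : List ι → V := fun u =>
  ∑ i ∈ Finset.range (u.length + 1),
    B (f (u.take i)) (twist 𝒱 (xdeg deg (u.take i)) (g (u.drop i)))

end Coeff

variable {k : Type*} [Ring k] (𝓀 : ℤ → AddSubgroup k) [GradedRing 𝓀]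

/-- A (continuous) derivation of degree `1` of `T̄(s H^t)`.  Continuity: each coefficient of the
image depends on finitely many coefficients of the argument. -/
structure IsDerivationT (D : (List ι → k) →ₛₗ[koszul 𝓀] (List ι → k)) : Prop where
  degree : ∀ (p : ℤ) (f : List ι → k), HasDeg deg 𝓀 p f → HasDeg deg 𝓀 (p + 1) (D f)
  leibniz : ∀ (p : ℤ) (f g : List ι → k), HasDeg deg 𝓀 p f →
    D (conv deg 𝓀 AddMonoidHom.mul f g) =
      conv deg 𝓀 AddMonoidHom.mul (D f) g + sgn p • conv deg 𝓀 AddMonoidHom.mul f (D g)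
  continuous : ∀ u : List ι, ∃ S : Finset (List ι), ∀ f : List ι → k,
    (∀ w ∈ S, f w = 0) → D f u = 0

/-- The extension of a map `∂` of power series with coefficients in `k` to coefficients in `V`,
`∂(a X^w) = (-1)^|a| a ∂(X^w)`, where `E w` stands for `∂(X^w)`. -/
def extend {V : Type*} [AddCommGroup V] [Module k V] (𝒱 : ℤ → AddSubgroup V)
    [DirectSum.Decomposition 𝒱] (E : List ι → List ι → k) (f : List ι → V) : List ι → V :=
  fun u => ∑ᶠ w : List ι, rightSMul 𝓀 𝒱 (twist 𝒱 1 (f w)) (E w u)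

/-- The extension of `∂` on `T̄(s H^t)` to `A ⊗ T̄(s H^t)`. -/
def extendT {A : Type*} [AddCommGroup A] [Module k A] (𝒜 : ℤ → AddSubgroup A)
    [DirectSum.Decomposition 𝒜] (D : (List ι → k) →ₛₗ[koszul 𝓀] (List ι → k))
    (f : List ι → A) : List ι → A :=
  extend 𝓀 𝒜 (fun w => D (mono k w)) f

/-- `∂ ω + d ω + ω · ω`. -/
def curvT {A : Type*} [NonUnitalRing A] [Module k A] (𝒜 : ℤ → AddSubgroup A)
    [DirectSum.Decomposition 𝒜] (d : A →ₛₗ[koszul 𝓀] A)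
    (D : (List ι → k) →ₛₗ[koszul 𝓀] (List ι → k)) (ω : List ι → A) : List ι → A :=
  extendT 𝓀 𝒜 D ω + (fun u => d (ω u)) + conv deg 𝒜 AddMonoidHom.mul ω ω

/-- Chen's inductive construction: `ω = ω_[1] + ω_[2] + ⋯` and `∂ = ∂_[1] + ∂_[2] + ⋯`, where
`∂_[n] = part n` is the derivation determined by the components `s H^t → T^n(s H^t)`, start with
`ω_[1] = ∑ α j X j` and `∂_[1] = 0`; and if `Γ` is the component of length `n + 1` of
`∂_n ω_n + d ω_n + ω_n · ω_n` (`∂_n`, `ω_n` the partial sums), then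
`∂_[n+1] ω_[1] = - Γ^H` and `ω_[n+1] = - Q Γ`. -/
structure IsChenT {A : Type*} [NonUnitalRing A] [Module k A] (𝒜 : ℤ → AddSubgroup A)
    [DirectSum.Decomposition 𝒜] (d : A →ₛₗ[koszul 𝓀] A) (H M : Submodule k A)
    (α : Module.Basis ι k H) (ω : List ι → A) (D : (List ι → k) →ₛₗ[koszul 𝓀] (List ι → k))
    (part : ℕ → ((List ι → k) →ₛₗ[koszul 𝓀] (List ι → k))) : Prop where
  part_derivation : ∀ n, IsDerivationT deg 𝓀 (part n)
  part_gen : ∀ n j, part n (mono k [j]) = comp n (D (mono k [j]))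
  part_zero : part 0 = 0
  part_one : part 1 = 0
  omega_nil : ω [] = 0
  omega_one : ∀ j, ω [j] = α j
  step : ∀ n : ℕ, 1 ≤ n → ∀ u : List ι, u.length = n + 1 →
    extendT 𝓀 𝒜 (part (n + 1)) (comp 1 ω) u =
        -projH d H M (curvT deg 𝓀 𝒜 d (∑ i ∈ Finset.range (n + 1), part i) (trunc n ω) u) ∧
      ω u = -opQ d H M (curvT deg 𝓀 𝒜 d (∑ i ∈ Finset.range (n + 1), part i) (trunc n ω) u)

/-! ### The tensor coalgebra `T^c(s⁻¹ H)`

It is the free `k`-module on the words `s⁻¹(α j₁) ⊗ ⋯ ⊗ s⁻¹(α jₙ)`, whose degree is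
`- xdeg deg u`; its tensor square is the free `k`-module on the pairs of words. -/

/-- The element `x` of `T^c(s⁻¹ H)` is homogeneous of degree `p`. -/
def HasCodeg (p : ℤ) (x : List ι →₀ k) : Prop := ∀ u, x u ∈ 𝓀 (p + xdeg deg u)

/-- The comultiplication `T^c → T^c ⊗ T^c` (deconcatenation). -/
def comul (x : List ι →₀ k) : (List ι × List ι) →₀ k :=
  x.sum fun u c => ∑ i ∈ Finset.range (u.length + 1), Finsupp.single (u.take i, u.drop i) c

/-- `b ⊗ 1` on `T^c ⊗ T^c`. -/
def tensorLeft (b : (List ι →₀ k) →ₛₗ[koszul 𝓀] (List ι →₀ k))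
    (y : (List ι × List ι) →₀ k) : (List ι × List ι) →₀ k :=
  y.sum fun p c => (b (Finsupp.single p.1 c)).sum fun v e => Finsupp.single (v, p.2) e

/-- `1 ⊗ b` on `T^c ⊗ T^c`, for `b` of degree `1`:
`(1 ⊗ b)(c x ⊗ y) = (-1)^(|c| + |x|) c x ⊗ b y`, and `x ⊗ e v = (-1)^(|x| |e|) e x ⊗ v`. -/
def tensorRight (b : (List ι →₀ k) →ₛₗ[koszul 𝓀] (List ι →₀ k))
    (y : (List ι × List ι) →₀ k) : (List ι × List ι) →₀ k :=
  y.sum fun p c => (b (Finsupp.single p.2 1)).sum fun v e =>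
    Finsupp.single (p.1, v)
      (sgn (xdeg deg p.1) • (koszul 𝓀 c * twist 𝓀 (xdeg deg p.1) e))

/-- A codifferential of `T^c(s⁻¹ H)`: a coderivation `b` of degree `1` with `b(1) = 0` and
`b² = 0`. -/
structure IsCodifferential (b : (List ι →₀ k) →ₛₗ[koszul 𝓀] (List ι →₀ k)) : Prop where
  degree : ∀ (p : ℤ) (x : List ι →₀ k), HasCodeg deg 𝓀 p x → HasCodeg deg 𝓀 (p + 1) (b x)
  coderivation : ∀ x, comul (b x) = tensorLeft 𝓀 b (comul x) + tensorRight deg 𝓀 b (comul x)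
  counit : b (Finsupp.single [] 1) = 0
  square : ∀ x, b (b x) = 0

/-- The sign of `⟨X j₁ ⋯ X jₙ, w₁ ⊗ ⋯ ⊗ wₙ⟩` for `wᵢ = s⁻¹(α jᵢ)`, which is `(-1)` to the power
`∑_{i < l} |wᵢ| |X jₗ|`. -/
def pairSign : List ι → ℤ
  | [] => 1
  | j :: u => sgn ((deg j - 1) * xdeg deg u) * pairSign u

/-- The pairing of `T̄(s H^t)` with `T^c(s⁻¹ H)`. -/
def pairing (f : List ι → k) (x : List ι →₀ k) : k :=
  x.sum fun u c => pairSign deg u • (f u * twist 𝓀 (xdeg deg u) c)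

/-- `b` is the transpose of the differential `∂`, with the sign of the differential of a dual
complex: `⟨∂ f, x⟩ = - (-1)^|f| ⟨f, b x⟩`. -/
def IsTranspose (D : (List ι → k) →ₛₗ[koszul 𝓀] (List ι → k))
    (b : (List ι →₀ k) →ₛₗ[koszul 𝓀] (List ι →₀ k)) : Prop :=
  ∀ (p : ℤ) (f : List ι → k) (x : List ι →₀ k), HasDeg deg 𝓀 p f →
    pairing deg 𝓀 (D f) x = -(sgn p • pairing deg 𝓀 f (b x))

/-- The cup product `m ∘ (f ⊗ g) ∘ Δ` of two maps of degree `1` from `T^c(s⁻¹ H)` to `A`. -/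
def cup {A : Type*} [NonUnitalRing A] [Module k A] (f g : (List ι →₀ k) →ₛₗ[koszul 𝓀] A)
    (x : List ι →₀ k) : A :=
  x.sum fun u c => ∑ i ∈ Finset.range (u.length + 1),
    sgn (xdeg deg (u.take i)) •
      (f (Finsupp.single (u.take i) (koszul 𝓀 c)) * g (Finsupp.single (u.drop i) 1))

/-- A twisting cochain `τ : (T^c(s⁻¹ H), b) → (A, d)`. -/
structure IsTwistingCochain {A : Type*} [NonUnitalRing A] [Module k A]
    (𝒜 : ℤ → AddSubgroup A) (d : A →ₛₗ[koszul 𝓀] A)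
    (b : (List ι →₀ k) →ₛₗ[koszul 𝓀] (List ι →₀ k))
    (τ : (List ι →₀ k) →ₛₗ[koszul 𝓀] A) : Prop where
  degree : ∀ (p : ℤ) (x : List ι →₀ k), HasCodeg deg 𝓀 p x → τ x ∈ 𝒜 (p + 1)
  equation : ∀ x, τ (b x) + d (τ x) = cup deg 𝓀 τ τ x

end Series

/-! ### Graded symmetric formal power series

Since `k` is a `ℚ`-algebra, the graded symmetric algebra is the space of graded symmetric tensors
with the symmetrized product.  So the completed symmetric algebra `S̄(s H^t)` consists of the
graded symmetric formal power series, and `X j₁ ⊙ ⋯ ⊙ X jₙ` is the symmetrization of the monomial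
`X j₁ ⋯ X jₙ`. -/

section Symmetric

variable {ι : Type*} (deg : ι → ℤ)
variable {k : Type*} [Ring k] [Algebra ℚ k]

section Coeff

variable {V : Type*} [AddCommGroup V] [Module k V]

/-- The series `f` is graded symmetric: `f(j_{σ 1} ⋯ j_{σ n}) = ± f(j₁ ⋯ jₙ)` with the Koszul sign
for the degrees of the variables `X j`. -/
def IsSymm (f : List ι → V) : Prop :=
  ∀ (n : ℕ) (v : Fin n → ι) (σ : Equiv.Perm (Fin n)),
    f (List.ofFn (v ∘ σ)) = koszulSign σ (fun i => 1 - deg (v i)) • f (List.ofFn v)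

/-- The symmetrization of a series, for words given as tuples. -/
def symmTuple (k : Type*) [Ring k] [Algebra ℚ k] [Module k V] (f : List ι → V)
    (w : Σ n, Fin n → ι) : V :=
  algebraMap ℚ k (w.1.factorial : ℚ)⁻¹ • ∑ σ : Equiv.Perm (Fin w.1),
    koszulSign σ (fun i => 1 - deg (w.2 i)) • f (List.ofFn (w.2 ∘ σ))

/-- The symmetrization of a series. -/
def symm (k : Type*) [Ring k] [Algebra ℚ k] [Module k V] (f : List ι → V) : List ι → V :=
  fun u => symmTuple deg k f ⟨u.length, u.get⟩

theorem symm_ofFn (f : List ι → V) {n : ℕ} (v : Fin n → ι) :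
    symm deg k f (List.ofFn v) = symmTuple deg k f ⟨n, v⟩ :=
  congrArg (symmTuple deg k f) (List.equivSigmaTuple.right_inv ⟨n, v⟩)

theorem isSymm_symm (f : List ι → V) : IsSymm deg (symm deg k f) := by
  intro n v σ
  rw [symm_ofFn, symm_ofFn]
  simp only [symmTuple]
  rw [smul_comm]
  congr 1
  rw [Finset.smul_sum,
    ← Equiv.sum_comp (Equiv.mulLeft σ) fun ρ => koszulSign σ (fun i => 1 - deg (v i)) •
      koszulSign ρ (fun i => 1 - deg (v i)) • f (List.ofFn (v ∘ ρ))]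
  refine Finset.sum_congr rfl fun ρ _ => ?_
  rw [Equiv.coe_mulLeft, koszulSign_mul, smul_smul, ← mul_assoc, koszulSign_mul_self, one_mul]
  rfl

end Coeff

/-- The completed symmetric algebra `S̄(s H^t)`. -/
def symmSeries (k : Type*) [Ring k] : Submodule k (List ι → k) where
  carrier := {f | IsSymm deg f}
  zero_mem' := by intro n v σ; simp
  add_mem' {f g} hf hg := by
    intro n v σ
    simp only [Pi.add_apply, hf n v σ, hg n v σ, smul_add]
  smul_mem' c f hf := by
    intro n v σ
    simp only [Pi.smul_apply, hf n v σ, smul_comm c]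

/-- The monomial `X j₁ ⊙ ⋯ ⊙ X jₙ`. -/
def symmMono (k : Type*) [Ring k] [Algebra ℚ k] (u : List ι) : symmSeries deg k :=
  ⟨symm deg k (mono k u), isSymm_symm deg _⟩

variable (𝓀 : ℤ → AddSubgroup k) [GradedRing 𝓀]

/-- The product of `S̄(s H^t)`. -/
def symmMul (f g : symmSeries deg k) : symmSeries deg k :=
  ⟨symm deg k (conv deg 𝓀 AddMonoidHom.mul (f : List ι → k) g), isSymm_symm deg _⟩

/-- A (continuous) derivation of degree `1` of `S̄(s H^t)`. -/
structure IsDerivationS (D : symmSeries deg k →ₛₗ[koszul 𝓀] symmSeries deg k) : Prop where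
  degree : ∀ (p : ℤ) (f : symmSeries deg k), HasDeg deg 𝓀 p (f : List ι → k) →
    HasDeg deg 𝓀 (p + 1) (D f : List ι → k)
  leibniz : ∀ (p : ℤ) (f g : symmSeries deg k), HasDeg deg 𝓀 p (f : List ι → k) →
    D (symmMul deg 𝓀 f g) = symmMul deg 𝓀 (D f) g + sgn p • symmMul deg 𝓀 f (D g)
  continuous : ∀ u : List ι, ∃ S : Finset (List ι), ∀ f : symmSeries deg k,
    (∀ w ∈ S, (f : List ι → k) w = 0) → (D f : List ι → k) u = 0

variable {L : Type*} [AddCommGroup L] [Module k L] (ℒ : ℤ → AddSubgroup L)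
  [DirectSum.Decomposition ℒ]

/-- The extension of `∂` on `S̄(s H^t)` to `L ⊗ S̄(s H^t)`. -/
def extendS (D : symmSeries deg k →ₛₗ[koszul 𝓀] symmSeries deg k) (f : List ι → L) :
    List ι → L :=
  extend 𝓀 ℒ (fun w => (D (symmMono deg k w) : List ι → k)) f

/-- `∂ ω + d ω + ½ [ω, ω]`. -/
def curvS (br : L →+ L →+ L) (d : L →ₛₗ[koszul 𝓀] L)
    (D : symmSeries deg k →ₛₗ[koszul 𝓀] symmSeries deg k) (ω : List ι → L) : List ι → L :=
  extendS deg 𝓀 ℒ D ω + (fun u => d (ω u)) +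
    algebraMap ℚ k (1 / 2) • symm deg k (conv deg ℒ br ω ω)

/-- Chen's inductive construction for a differential graded Lie algebra. -/
structure IsChenS (br : L →+ L →+ L) (d : L →ₛₗ[koszul 𝓀] L) (H M : Submodule k L)
    (α : Module.Basis ι k H) (ω : List ι → L)
    (D : symmSeries deg k →ₛₗ[koszul 𝓀] symmSeries deg k)
    (part : ℕ → (symmSeries deg k →ₛₗ[koszul 𝓀] symmSeries deg k)) : Prop where
  part_derivation : ∀ n, IsDerivationS deg 𝓀 (part n)
  part_gen : ∀ n j, (part n (symmMono deg k [j]) : List ι → k) =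
    comp n (D (symmMono deg k [j]) : List ι → k)
  part_zero : part 0 = 0
  part_one : part 1 = 0
  omega_symm : IsSymm deg ω
  omega_nil : ω [] = 0
  omega_one : ∀ j, ω [j] = α j
  step : ∀ n : ℕ, 1 ≤ n → ∀ u : List ι, u.length = n + 1 →
    extendS deg 𝓀 ℒ (part (n + 1)) (comp 1 ω) u =
        -projH d H M
          (curvS deg 𝓀 ℒ br d (∑ i ∈ Finset.range (n + 1), part i) (trunc n ω) u) ∧
      ω u = -opQ d H M
        (curvS deg 𝓀 ℒ br d (∑ i ∈ Finset.range (n + 1), part i) (trunc n ω) u)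

/-- The element `w₁ ⊙ ⋯ ⊙ wₙ = ∑_σ ± w_{σ 1} ⊗ ⋯ ⊗ w_{σ n}` of `S^c(s⁻¹ H) ⊆ T^c(s⁻¹ H)`, for
`wᵢ = s⁻¹(α jᵢ)`. -/
def symmWord (k : Type*) [Ring k] (u : List ι) : List ι →₀ k :=
  ∑ σ : Equiv.Perm (Fin u.length),
    koszulSign σ (fun i => deg (u.get i) - 1) • Finsupp.single (List.ofFn (u.get ∘ σ)) 1

end Symmetric

/-! ### `A∞` and `L∞` structures -/

section Infinity

variable {k : Type*} [Ring k] (𝓀 : ℤ → AddSubgroup k) [GradedRing 𝓀]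
variable {V : Type*} [AddCommGroup V] [Module k V] (𝒱 : ℤ → AddSubgroup V)

/-- `m n : ⊗ⁿ V → V` (`n ≥ 1`) are `k`-module maps of degree `2 - n` (multilinear over the graded
commutative ring `k` in the sense of the Koszul convention). -/
structure IsOperations (m : ∀ n : ℕ, MultilinearMap ℤ (fun _ : Fin n => V) V) : Prop where
  degree : ∀ n : ℕ, 1 ≤ n → ∀ (p : Fin n → ℤ) (v : Fin n → V), (∀ i, v i ∈ 𝒱 (p i)) →
    m n v ∈ 𝒱 (∑ i, p i + 2 - n)
  smul : ∀ n : ℕ, 1 ≤ n → ∀ (p : Fin n → ℤ) (v : Fin n → V), (∀ i, v i ∈ 𝒱 (p i)) →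
    ∀ (i : Fin n) (q : ℤ) (x : k), x ∈ 𝓀 q →
      m n (Function.update v i (x • v i)) =
        sgn (q * (n + ∑ t ∈ Finset.univ.filter (· < i), p t)) • x • m n v

/-- An `A∞` algebra structure on the graded `k`-module `V`: with
`ε = (s + 1) l + s (n + |v₁| + ⋯ + |v_{l-1}|)`,
`∑_{r + s = n + 1} ∑_{l = 1}^r (-1)^ε m_r(v₁, …, m_s(v_l, …, v_{l+s-1}), …, vₙ) = 0`.
In the code the arguments are numbered from `0`, and `l` is replaced by `l + 1`. -/
structure IsAInfinity (m : ∀ n : ℕ, MultilinearMap ℤ (fun _ : Fin n => V) V) : Prop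
    extends IsOperations 𝓀 𝒱 m where
  relation : ∀ n : ℕ, 1 ≤ n → ∀ (p : ℕ → ℤ) (v : ℕ → V), (∀ i, v i ∈ 𝒱 (p i)) →
    ∑ s ∈ Finset.Icc 1 n, ∑ l ∈ Finset.range (n + 1 - s),
      sgn ((s + 1) * (l + 1) + s * (n + ∑ i ∈ Finset.range l, p i)) •
        m (n + 1 - s) (fun t : Fin (n + 1 - s) =>
          if (t : ℕ) < l then v t
          else if (t : ℕ) = l then m s (fun q : Fin s => v (l + q))
          else v (t + s - 1)) = 0

/-- The `(s, n)`-unshuffles. -/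
def unshuffles (s n : ℕ) : Finset (Equiv.Perm (Fin n)) :=
  open Classical in Finset.univ.filter fun σ =>
    ∀ i j : Fin n, i < j → ((j : ℕ) < s ∨ s ≤ (i : ℕ)) → σ i < σ j

/-- An `L∞` algebra structure on the graded `k`-module `V`: graded antisymmetric operations with
`∑_{r + s = n + 1} ∑_{σ ∈ Sh^u(s, n)} (-1)^{s (r - 1)} (-1)^σ (-1)^{ε(σ, v)}
l_r(l_s(v_{σ(1)}, …, v_{σ(s)}), v_{σ(s+1)}, …, v_{σ(n)}) = 0`. -/
structure IsLInfinity (l : ∀ n : ℕ, MultilinearMap ℤ (fun _ : Fin n => V) V) : Prop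
    extends IsOperations 𝓀 𝒱 l where
  antisymm : ∀ n : ℕ, 1 ≤ n → ∀ (p : Fin n → ℤ) (v : Fin n → V), (∀ i, v i ∈ 𝒱 (p i)) →
    ∀ σ : Equiv.Perm (Fin n),
      l n (v ∘ σ) = (((Equiv.Perm.sign σ : ℤˣ) : ℤ) * koszulSign σ p) • l n v
  relation : ∀ n : ℕ, 1 ≤ n → ∀ (p : Fin n → ℤ) (v : Fin n → V), (∀ i, v i ∈ 𝒱 (p i)) →
    ∑ s ∈ Finset.Icc 1 n, ∑ σ ∈ unshuffles s n,
      (sgn (s * (n - s)) * ((Equiv.Perm.sign σ : ℤˣ) : ℤ) * koszulSign σ p) •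
        l (n + 1 - s) (fun t : Fin (n + 1 - s) =>
          let vσ : ℕ → V := fun i => if h : i < n then v (σ ⟨i, h⟩) else 0
          if (t : ℕ) = 0 then l s (fun q : Fin s => vσ q) else vσ (t + s - 1)) = 0

variable {A : Type*} [AddCommGroup A] [Module k A] {H : Submodule k A}
variable {ι : Type*} (deg : ι → ℤ)

/-- The element `(-1)^(∑ (n - i) |α jᵢ|) s⁻¹ m_n(α j₁, …, α jₙ)` of `s⁻¹ H ⊆ T^c(s⁻¹ H)`, where
`s⁻¹(c α j) = (-1)^|c| c s⁻¹(α j)` for `c` in `k`. -/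
def bar (α : Module.Basis ι k H) (m : ∀ n : ℕ, MultilinearMap ℤ (fun _ : Fin n => H) H)
    (u : List ι) : List ι →₀ k :=
  sgn (∑ i : Fin u.length, (u.length - 1 - (i : ℕ)) * deg (u.get i)) •
    (α.repr (m u.length fun i => α (u.get i))).sum fun j c => Finsupp.single [j] (koszul 𝓀 c)

/-- The codifferential `b` corresponds to the operations `m n`: the component of `b` in `s⁻¹ H`
is `b(s⁻¹ v₁, …, s⁻¹ vₙ) = (-1)^(∑ (n - i) |vᵢ|) s⁻¹ m_n(v₁, …, vₙ)`. -/
def Corresponds (α : Module.Basis ι k H) (m : ∀ n : ℕ, MultilinearMap ℤ (fun _ : Fin n => H) H)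
    (b : (List ι →₀ k) →ₛₗ[koszul 𝓀] (List ι →₀ k)) : Prop :=
  ∀ u : List ι, u ≠ [] → ∀ j : ι, b (Finsupp.single u 1) [j] = bar 𝓀 deg α m u [j]

/-- The operations `l n` correspond to the differential `∂` of `S̄(s H^t)`: the map
`b(s⁻¹ v₁ ⊙ ⋯ ⊙ s⁻¹ vₙ) = (-1)^(∑ (n - i) |vᵢ|) s⁻¹ l_n(v₁, …, vₙ)` from `S^n(s⁻¹ H)` to `s⁻¹ H` is
the transpose of the component of `∂` from `s H^t` to `S^n(s H^t)`,
`⟨∂ (X j), w₁ ⊙ ⋯ ⊙ wₙ⟩ = - (-1)^|X j| ⟨X j, b(w₁ ⊙ ⋯ ⊙ wₙ)⟩`. -/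
def CorrespondsS [Algebra ℚ k] (α : Module.Basis ι k H)
    (l : ∀ n : ℕ, MultilinearMap ℤ (fun _ : Fin n => H) H)
    (D : symmSeries deg k →ₛₗ[koszul 𝓀] symmSeries deg k) : Prop :=
  ∀ u : List ι, u ≠ [] → ∀ j : ι,
    pairing deg 𝓀 (D (symmMono deg k [j]) : List ι → k) (symmWord deg k u) =
      -(sgn (1 - deg j) • pairing deg 𝓀 (symmMono deg k [j] : List ι → k) (bar 𝓀 deg α l u))

/-- The operations `m' n` on the cohomology are the operations `m n` on `H` transported along the
natural isomorphism `H ≅ H(A, d)`. -/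
def IsTransported {d : A →ₛₗ[koszul 𝓀] A} (h : H ≤ LinearMap.ker d)
    (m : ∀ n : ℕ, MultilinearMap ℤ (fun _ : Fin n => H) H)
    (m' : ∀ n : ℕ, MultilinearMap ℤ (fun _ : Fin n => Cohomology d) (Cohomology d)) : Prop :=
  ∀ (n : ℕ) (v : Fin n → H), m' n (fun i => classMap d H h (v i)) = classMap d H h (m n v)

end Infinity

end

end ChenHPT

open ChenHPT

namespace ChenHPT

noncomputable section

set_option linter.unusedSectionVars false

/-! ### Signs -/

/-! A derivation `∂` of the series algebra is encoded by structure constants: `e v j` is the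
coefficient of `X^v` in `∂ (X j)`. For each word `v` the row `e v` has finite support. This
finiteness expresses continuity, and it lets `∂` act on series with coefficients in any graded
module even when the basis is infinite. Recursion on the word length produces `e` and `ω`
simultaneously (`exists_isChenData`).

Flatness and `∂² = 0` are proved together. Let `Ω` be the curvature. In length `n + 1` it differs
from `Γ` only by `∂_[n+1] ω_[1] = -Γ^H` and `d ω_[n+1] = -d Q Γ`, so `Ω` is the `M`-component of `Γ`
(`curv_mem`). The Bianchi identity is `d Ω = -∂ Ω + ∂² ω + Ω ω - ω Ω` (`map_curv`). Suppose that `Ω`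
and all the `∂² (X j)` vanish in lengths below `n`. As `∂` raises the length and `ω` starts in
length one, the identity in length `n` reduces to `d Ω = ∑ ± (∂² (X j)) α j`. The left side lies in
`d M` and the right side in `H`, so both vanish. Injectivity of `d` on `M` gives `Ω = 0`, and linear
independence of the `α j` gives `∂² (X j) = 0` (`curv_eq_zero_and`).

The Lie case is the same argument with `½ [·,·]` as the product, every product and derivation being
followed by symmetrization; the Boolean in `proj` selects the case. Two extra facts are needed.
Derivations descend to the symmetric quotient (`symm_der`). Associativity is replaced by the
vanishing of the symmetrizations of `[ω, [ω, ω]]` and `[[ω, ω], ω]`, which follows from the Jacobi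
identity because `3` is invertible (`symm_bracket_bracket`).

The remaining structures transcribe these identities. Transposing the rows of `∂` gives `b`: the
Leibniz rule becomes the coderivation property (`comul_transpose`), and flatness becomes the
twisting cochain equation. A coefficient of `∂² (X j)` at a word is a sum over its subwords, which
after a change of signs (`opSign_insert`) is the `A∞` relation on basis elements; multilinearity
does the rest (`vanish_of_basis`). In the symmetric case all positions of a subword of given length
contribute equally, and every permutation is uniquely an unshuffle times a block permutation. The
resulting factorials are exactly those introduced by `factorialGen`, and the `L∞` relation remains.
-/

theorem sgn_add (a b : ℤ) : sgn (a + b) = sgn a * sgn b := by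
  simp [sgn, Int.negOnePow_add]

@[simp] theorem sgn_zero : sgn 0 = 1 := by simp [sgn]

theorem sgn_of_even {a : ℤ} (h : Even a) : sgn a = 1 := by
  simp [sgn, Int.negOnePow_even a h]

theorem sgn_of_odd {a : ℤ} (h : Odd a) : sgn a = -1 := by
  simp [sgn, Int.negOnePow_odd a h]

@[simp] theorem sgn_one : sgn 1 = -1 := sgn_of_odd odd_one

/-- Signs are compared through the parities of their exponents; once these are expanded into the
parities of the degrees involved, a propositional tautology is left. -/
theorem sgn_congr {a b : ℤ} (h : Even a ↔ Even b) : sgn a = sgn b := by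
  by_cases hb : Even b
  · rw [sgn_of_even hb, sgn_of_even (h.2 hb)]
  · rw [sgn_of_odd (Int.not_even_iff_odd.1 hb), sgn_of_odd (Int.not_even_iff_odd.1 (mt h.1 hb))]

theorem sgn_smul_sgn_smul {V : Type*} [AddCommGroup V] (a b : ℤ) (v : V) :
    sgn a • sgn b • v = sgn (a + b) • v := by
  rw [smul_smul, sgn_add]

theorem sgn_smul_self {V : Type*} [AddCommGroup V] (a : ℤ) (v : V) :
    sgn a • sgn a • v = v := by
  rw [smul_smul, sgn_mul_self, one_smul]

theorem sgn_sum {ι : Type*} (s : Finset ι) (f : ι → ℤ) :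
    sgn (∑ i ∈ s, f i) = ∏ i ∈ s, sgn (f i) := by
  classical
  induction s using Finset.induction_on with
  | empty => simp
  | insert a s ha ih => rw [Finset.sum_insert ha, Finset.prod_insert ha, sgn_add, ih]

/-! ### The parity operators -/

section Twist

variable {V : Type*} [AddCommGroup V] (𝒱 : ℤ → AddSubgroup V) [DirectSum.Decomposition 𝒱]

/-- Two additive maps on a graded group agree if they agree on homogeneous elements. -/
theorem addHom_ext_homogeneous {W : Type*} [AddCommMonoid W] {φ ψ : V →+ W}
    (h : ∀ p, ∀ v ∈ 𝒱 p, φ v = ψ v) (v : V) : φ v = ψ v := by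
  induction v using DirectSum.Decomposition.inductionOn 𝒱 with
  | zero => simp
  | add a b ha hb => rw [map_add, map_add, ha, hb]
  | @homogeneous i a => exact h i a a.2

theorem twist_mem (n : ℤ) {p : ℤ} {v : V} (hv : v ∈ 𝒱 p) : twist 𝒱 n v ∈ 𝒱 p := by
  rw [twist_of_mem 𝒱 n hv]
  exact AddSubgroup.zsmul_mem _ hv _

theorem twist_twist (n m : ℤ) (v : V) : twist 𝒱 n (twist 𝒱 m v) = twist 𝒱 (n + m) v := by
  refine addHom_ext_homogeneous 𝒱 (φ := (twist 𝒱 n).comp (twist 𝒱 m)) (fun p v hv => ?_) v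
  rw [AddMonoidHom.comp_apply, twist_of_mem 𝒱 m hv, map_zsmul, twist_of_mem 𝒱 n hv,
    twist_of_mem 𝒱 _ hv, sgn_smul_sgn_smul, add_mul, add_comm]

theorem twist_congr {n m : ℤ} (h : Even n ↔ Even m) (v : V) : twist 𝒱 n v = twist 𝒱 m v := by
  refine addHom_ext_homogeneous 𝒱 (fun p v hv => ?_) v
  rw [twist_of_mem 𝒱 n hv, twist_of_mem 𝒱 m hv]
  congr 1
  apply sgn_congr
  simp only [Int.even_mul, h]

theorem twist_of_even {n : ℤ} (h : Even n) (v : V) : twist 𝒱 n v = v := by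
  refine addHom_ext_homogeneous 𝒱 (ψ := AddMonoidHom.id V) (fun p v hv => ?_) v
  rw [twist_of_mem 𝒱 n hv, sgn_of_even (h.mul_right p), one_smul, AddMonoidHom.id_apply]

end Twist

/-! ### Graded modules and bilinear operations -/

section Graded

variable {k : Type*} [Ring k] (𝓀 : ℤ → AddSubgroup k) [GradedRing 𝓀]
variable {V : Type*} [AddCommGroup V] [Module k V] (𝒱 : ℤ → AddSubgroup V)

/-- The scalar multiplication is compatible with the gradings. -/
def GradedSMulMem : Prop :=
  ∀ (p q : ℤ) (x : k) (a : V), x ∈ 𝓀 p → a ∈ 𝒱 q → x • a ∈ 𝒱 (p + q)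

/-- A biadditive operation of degree `0` which is `k`-bilinear in the sense of the Koszul
convention. -/
structure IsGradedBilin (B : V →+ V →+ V) : Prop where
  smul_mem : GradedSMulMem 𝓀 𝒱
  mem : ∀ (p q : ℤ) (a b : V), a ∈ 𝒱 p → b ∈ 𝒱 q → B a b ∈ 𝒱 (p + q)
  smul_left : ∀ (x : k) (a b : V), B (x • a) b = x • B a b
  smul_right : ∀ (p q : ℤ) (x : k) (a b : V), x ∈ 𝓀 p → a ∈ 𝒱 q →
    B a (x • b) = sgn (p * q) • x • B a b

theorem gradedSMulMem_self : GradedSMulMem 𝓀 𝓀 := fun _ _ _ _ hx ha =>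
  SetLike.GradedMul.mul_mem hx ha

theorem koszul_apply (x : k) : koszul 𝓀 x = twist 𝓀 1 x := rfl

@[simp] theorem twist_one_ground (n : ℤ) : twist 𝓀 n (1 : k) = 1 := by
  rw [twist_of_mem 𝓀 n (SetLike.GradedOne.one_mem (A := 𝓀)), mul_zero, sgn_zero, one_smul]

variable {𝓀} in
theorem IsGradedComm.isGradedBilin_mul (hk : IsGradedComm 𝓀) :
    IsGradedBilin 𝓀 𝓀 (AddMonoidHom.mul : k →+ k →+ k) where
  smul_mem := gradedSMulMem_self 𝓀
  mem _ _ _ _ ha hb := SetLike.GradedMul.mul_mem ha hb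
  smul_left x a b := mul_assoc x a b
  smul_right p q x a b hx ha := by
    simp only [AddMonoidHom.mul_apply, smul_eq_mul]
    rw [← mul_assoc, hk q p a x ha hx, smul_mul_assoc, mul_assoc, mul_comm q]

variable [DirectSum.Decomposition 𝒱] {𝓀 𝒱}

theorem GradedSMulMem.twist_smul (h : GradedSMulMem 𝓀 𝒱) (n : ℤ) (x : k) (v : V) :
    twist 𝒱 n (x • v) = twist 𝓀 n x • twist 𝒱 n v := by
  refine addHom_ext_homogeneous 𝓀 (φ := (twist 𝒱 n).comp ((smulAddHom k V).flip v))
    (ψ := ((smulAddHom k V).flip (twist 𝒱 n v)).comp (twist 𝓀 n)) (fun p x hx => ?_) x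
  refine addHom_ext_homogeneous 𝒱 (φ := (twist 𝒱 n).comp (smulAddHom k V x))
    (ψ := (smulAddHom k V (twist 𝓀 n x)).comp (twist 𝒱 n)) (fun q v hv => ?_) v
  simp only [AddMonoidHom.comp_apply, smulAddHom_apply]
  rw [twist_of_mem 𝒱 n (h p q x v hx hv), twist_of_mem 𝓀 n hx, twist_of_mem 𝒱 n hv,
    smul_assoc, smul_comm x, sgn_smul_sgn_smul, mul_add]

theorem twist_mul (n : ℤ) (x y : k) : twist 𝓀 n (x * y) = twist 𝓀 n x * twist 𝓀 n y :=
  (gradedSMulMem_self 𝓀).twist_smul n x y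

theorem IsGradedBilin.twist {B : V →+ V →+ V} (h : IsGradedBilin 𝓀 𝒱 B) (n : ℤ) (a b : V) :
    twist 𝒱 n (B a b) = B (twist 𝒱 n a) (twist 𝒱 n b) := by
  refine addHom_ext_homogeneous 𝒱 (φ := (ChenHPT.twist 𝒱 n).comp (B.flip b))
    (ψ := (B.flip (ChenHPT.twist 𝒱 n b)).comp (ChenHPT.twist 𝒱 n)) (fun p a ha => ?_) a
  refine addHom_ext_homogeneous 𝒱 (φ := (ChenHPT.twist 𝒱 n).comp (B a))
    (ψ := (B (ChenHPT.twist 𝒱 n a)).comp (ChenHPT.twist 𝒱 n)) (fun q b hb => ?_) b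
  simp only [AddMonoidHom.comp_apply]
  rw [twist_of_mem 𝒱 n (h.mem p q a b ha hb), twist_of_mem 𝒱 n ha, twist_of_mem 𝒱 n hb,
    map_zsmul, map_zsmul, AddMonoidHom.zsmul_apply, sgn_smul_sgn_smul, mul_add, add_comm]

/-- The parity operator absorbs the Koszul sign, so that only the scalar needs a degree and `a` may
be inhomogeneous. -/
theorem IsGradedBilin.smul_right_eq {B : V →+ V →+ V} (h : IsGradedBilin 𝓀 𝒱 B) {p : ℤ} {x : k}
    (hx : x ∈ 𝓀 p) (a b : V) : B a (x • b) = x • B (ChenHPT.twist 𝒱 p a) b := by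
  refine addHom_ext_homogeneous 𝒱 (φ := B.flip (x • b))
    (ψ := (smulAddHom k V x).comp ((B.flip b).comp (ChenHPT.twist 𝒱 p))) (fun q a ha => ?_) a
  simp only [AddMonoidHom.comp_apply, AddMonoidHom.flip_apply, smulAddHom_apply]
  rw [h.smul_right p q x a b hx ha, twist_of_mem 𝒱 p ha, map_zsmul, AddMonoidHom.zsmul_apply,
    smul_comm]

/-- Commutation with a homogeneous scalar in a graded commutative ring. -/
theorem IsGradedComm.mul_eq (hk : IsGradedComm 𝓀) {p : ℤ} {x : k} (hx : x ∈ 𝓀 p) (c : k) :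
    c * x = x * ChenHPT.twist 𝓀 p c := by
  simpa using hk.isGradedBilin_mul.smul_right_eq hx c 1

theorem IsGradedComm.mul_eq' (hk : IsGradedComm 𝓀) {p : ℤ} {x : k} (hx : x ∈ 𝓀 p) (c : k) :
    x * c = ChenHPT.twist 𝓀 p c * x := by
  rw [hk.mul_eq hx, twist_twist, twist_of_even _ (Even.add_self p)]

theorem map_twist_of_degree_one {d : V →ₛₗ[koszul 𝓀] V}
    (hd : ∀ (p : ℤ) (a : V), a ∈ 𝒱 p → d a ∈ 𝒱 (p + 1)) (n : ℤ) (v : V) :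
    d (twist 𝒱 n v) = sgn n • twist 𝒱 n (d v) := by
  refine addHom_ext_homogeneous 𝒱 (φ := d.toAddMonoidHom.comp (twist 𝒱 n))
    (ψ := sgn n • (twist 𝒱 n).comp d.toAddMonoidHom) (fun p v hv => ?_) v
  simp only [AddMonoidHom.comp_apply, AddMonoidHom.zsmul_apply, LinearMap.toAddMonoidHom_coe]
  rw [twist_of_mem 𝒱 n hv, twist_of_mem 𝒱 n (hd p v hv), map_zsmul, sgn_smul_sgn_smul]
  congr 1
  apply sgn_congr
  simp only [Int.even_add, Int.even_mul, Int.not_even_one]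
  tauto

theorem rightSMul_of_mem (a : V) {q : ℤ} {x : k} (hx : x ∈ 𝓀 q) :
    rightSMul 𝓀 𝒱 a x = x • twist 𝒱 q a := by
  lift x to 𝓀 q using hx
  simp [rightSMul]

end Graded

/-! ### Sums over the decompositions of a word -/

section Cut

variable {ι : Type*} {V W : Type*} [AddCommGroup V] [AddCommGroup W]

/-- The sum of `F a b` over the decompositions `u = a b`. -/
def cut (F : List ι → List ι → V) (u : List ι) : V :=
  ∑ i ∈ Finset.range (u.length + 1), F (u.take i) (u.drop i)

@[simp] theorem cut_nil (F : List ι → List ι → V) : cut F [] = F [] [] := by simp [cut]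

theorem cut_cons (F : List ι → List ι → V) (x : ι) (u : List ι) :
    cut F (x :: u) = F [] (x :: u) + cut (fun a b => F (x :: a) b) u := by
  simp only [cut, List.length_cons]
  rw [Finset.sum_range_succ']
  simp [add_comm]

theorem cut_congr {F G : List ι → List ι → V} {u : List ι}
    (h : ∀ a b, a ++ b = u → F a b = G a b) : cut F u = cut G u :=
  Finset.sum_congr rfl fun i _ => h _ _ (List.take_append_drop i u)

theorem cut_add (F G : List ι → List ι → V) (u : List ι) :
    cut (fun a b => F a b + G a b) u = cut F u + cut G u := Finset.sum_add_distrib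

theorem map_cut (φ : V →+ W) (F : List ι → List ι → V) (u : List ι) :
    φ (cut F u) = cut (fun a b => φ (F a b)) u := map_sum φ _ _

theorem cut_apply {U : Type*} [AddCommGroup U] (φ : V →+ W →+ U) (F : List ι → List ι → V)
    (u : List ι) (w : W) : φ (cut F u) w = cut (fun a b => φ (F a b) w) u := map_cut (φ.flip w) F u

theorem cut_eq_zero {F : List ι → List ι → V} {u : List ι}
    (h : ∀ a b, a ++ b = u → F a b = 0) : cut F u = 0 :=
  Finset.sum_eq_zero fun i _ => h _ _ (List.take_append_drop i u)

theorem cut_mem {S : AddSubgroup V} {F : List ι → List ι → V} {u : List ι}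
    (h : ∀ a b, a ++ b = u → F a b ∈ S) : cut F u ∈ S :=
  AddSubgroup.sum_mem _ fun i _ => h _ _ (List.take_append_drop i u)

/-- Both sides sum over the decompositions of `u` into three words: this is the coassociativity of
deconcatenation. -/
theorem cut_cut (F : List ι → List ι → List ι → V) (u : List ι) :
    cut (fun a b => cut (fun c d => F a c d) b) u =
      cut (fun b d => cut (fun a c => F a c d) b) u := by
  induction u generalizing F with
  | nil => simp
  | cons x u ih =>
    simp only [cut_cons, cut_nil, cut_add, ih, add_assoc]

/-- A cut falls to the left or to the right of the letter `j`. This dichotomy is the combinatorial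
source of the Leibniz rule. -/
theorem cut_append_cons (F : List ι → List ι → V) (a : List ι) (j : ι) (c : List ι) :
    cut F (a ++ j :: c) = cut (fun a₁ a₂ => F a₁ (a₂ ++ j :: c)) a +
      cut (fun c₁ c₂ => F (a ++ j :: c₁) c₂) c := by
  induction a generalizing F with
  | nil => simp [cut_cons]
  | cons x a ih => simp only [List.cons_append, cut_cons, ih, add_assoc]

/-- The decomposition `u = u []` alone contributes. -/
theorem cut_eq_last {F : List ι → List ι → V} {u : List ι}
    (h : ∀ a b, a ++ b = u → b ≠ [] → F a b = 0) : cut F u = F u [] := by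
  rw [cut, Finset.sum_eq_single u.length]
  · simp
  · intro i hi hne
    refine h _ _ (List.take_append_drop i u) fun h0 => ?_
    have := List.drop_eq_nil_iff.1 h0
    have := Finset.mem_range.1 hi
    omega
  · simp

/-- The decomposition `u = [] u` alone contributes. -/
theorem cut_eq_first {F : List ι → List ι → V} {u : List ι}
    (h : ∀ a b, a ++ b = u → a ≠ [] → F a b = 0) : cut F u = F [] u := by
  rw [cut, Finset.sum_eq_single 0]
  · simp
  · intro i hi hne
    refine h _ _ (List.take_append_drop i u) fun h0 => ?_
    have := List.take_eq_nil_iff.1 h0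
    rcases this with h | h
    · exact hne h
    · simp only [h, List.length_nil, zero_add, Finset.range_one, Finset.mem_singleton] at hi
      exact hne hi
  · simp

end Cut

/-! ### Series operators with finite coefficient rows -/

section Words

variable {ι : Type*} (deg : ι → ℤ)

@[simp] theorem xdeg_nil : xdeg deg [] = 0 := by simp [xdeg]

@[simp] theorem xdeg_cons (j : ι) (u : List ι) : xdeg deg (j :: u) = 1 - deg j + xdeg deg u := by
  simp [xdeg]

@[simp] theorem xdeg_append (u v : List ι) : xdeg deg (u ++ v) = xdeg deg u + xdeg deg v := by
  simp [xdeg]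

/-- All coefficients at words of length less than `n` vanish. -/
def VanishBelow {V : Type*} [AddCommGroup V] (n : ℕ) (f : List ι → V) : Prop :=
  ∀ u : List ι, u.length < n → f u = 0

end Words

theorem mono_apply {ι : Type*} {k : Type*} [Ring k] [DecidableEq (List ι)] (u w : List ι) :
    mono k u w = if w = u then 1 else 0 := by
  simp only [mono, Pi.single_apply]
  congr

theorem mono_self {ι : Type*} {k : Type*} [Ring k] (u : List ι) : mono k u u = 1 := by
  classical simp [mono_apply]

theorem mono_of_ne {ι : Type*} {k : Type*} [Ring k] {u w : List ι} (h : w ≠ u) :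
    mono k u w = 0 := by
  classical simp [mono_apply, h]

section Operators

variable {ι : Type*} (deg : ι → ℤ)
variable {k : Type*} [Ring k] {𝓀 : ℤ → AddSubgroup k} [GradedRing 𝓀]
variable {V : Type*} [AddCommGroup V] [Module k V] {𝒱 : ℤ → AddSubgroup V}
  [DirectSum.Decomposition 𝒱]

variable (𝒱) in
/-- Evaluation of a row of coefficients on a series. -/
def evalRow (f : List ι → V) (n : ℤ) : (List ι →₀ k) →+ V :=
  Finsupp.liftAddHom fun w => (smulAddHom k V).flip (twist 𝒱 (xdeg deg w + n) (f w))

variable (𝒱) in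
@[simp] theorem evalRow_single (f : List ι → V) (n : ℤ) (w : List ι) (x : k) :
    evalRow deg 𝒱 f n (Finsupp.single w x) = x • twist 𝒱 (xdeg deg w + n) (f w) := by
  simp [evalRow]

variable (𝒱) in
/-- The operator `f ↦ ∑_w t(u)_w f(w)` on series, with the Koszul signs of an operator of
degree `1`. -/
def op (t : List ι → List ι →₀ k) (f : List ι → V) : List ι → V := fun u =>
  (t u).sum fun w x => x • twist 𝒱 (xdeg deg w + xdeg deg u) (f w)

variable (𝒱) in
theorem op_eq_evalRow (t : List ι → List ι →₀ k) (f : List ι → V) (u : List ι) :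
    op deg 𝒱 t f u = evalRow deg 𝒱 f (xdeg deg u) (t u) := rfl

variable (𝓀) in
/-- The coefficients are those of an operator of degree `1`. -/
def IsHomogeneousRows (t : List ι → List ι →₀ k) : Prop :=
  ∀ u w, t u w ∈ 𝓀 (xdeg deg w + 1 - xdeg deg u)

theorem op_add (t : List ι → List ι →₀ k) (f g : List ι → V) :
    op deg 𝒱 t (f + g) = op deg 𝒱 t f + op deg 𝒱 t g := by
  funext u
  simp only [op, Pi.add_apply, map_add, smul_add, Finsupp.sum_add]

variable (𝒱) in
/-- `op` as an additive map. -/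
def opHom (t : List ι → List ι →₀ k) : (List ι → V) →+ (List ι → V) :=
  AddMonoidHom.mk' (op deg 𝒱 t) (op_add deg t)

variable (𝒱) in
theorem opHom_apply (t : List ι → List ι →₀ k) (f : List ι → V) :
    opHom deg 𝒱 t f = op deg 𝒱 t f := rfl

/-- The support of the row `t u` is a finite set of words, so this is the continuity of the
operator. -/
theorem op_eq_zero {t : List ι → List ι →₀ k} {f : List ι → V} {u : List ι}
    (h : ∀ w ∈ (t u).support, f w = 0) : op deg 𝒱 t f u = 0 :=
  Finset.sum_eq_zero fun w hw => by simp only [h w hw, map_zero, smul_zero]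

/-- The rows of an operator are recovered from its values on monomials, so that identities between
rows can be tested on monomials. -/
theorem op_mono (t : List ι → List ι →₀ k) (u w : List ι) :
    op deg 𝓀 t (mono k w) u = t u w := by
  classical
  rw [op, Finsupp.sum, Finset.sum_eq_single w]
  · rw [mono_self, twist_one_ground, smul_eq_mul, mul_one]
  · intro v _ hv
    rw [mono_of_ne hv, map_zero, smul_zero]
  · intro h
    rw [Finsupp.notMem_support_iff.1 h, zero_smul]

theorem HasDeg.op {t : List ι → List ι →₀ k} (ht : IsHomogeneousRows deg 𝓀 t)
    (hV : GradedSMulMem 𝓀 𝒱) {p : ℤ} {f : List ι → V} (hf : HasDeg deg 𝒱 p f) :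
    HasDeg deg 𝒱 (p + 1) (op deg 𝒱 t f) := fun u =>
  AddSubgroup.sum_mem _ fun w _ => by
    have := hV _ _ _ _ (ht u w) (twist_mem 𝒱 (xdeg deg w + xdeg deg u) (hf w))
    rwa [show xdeg deg w + 1 - xdeg deg u + (p - xdeg deg w) = p + 1 - xdeg deg u by ring] at this

/-- Moving the scalar across the entry `t u w` twists it by the degree `xdeg w + 1 - xdeg u` of that
entry. Together with the twist by `xdeg w + xdeg u` already present, only an odd twist survives. -/
theorem op_smul (hk : IsGradedComm 𝓀) {t : List ι → List ι →₀ k}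
    (ht : IsHomogeneousRows deg 𝓀 t) (hV : GradedSMulMem 𝓀 𝒱) (c : k) (f : List ι → V) :
    op deg 𝒱 t (c • f) = koszul 𝓀 c • op deg 𝒱 t f := by
  funext u
  rw [Pi.smul_apply, op, op, Finsupp.smul_sum]
  refine Finset.sum_congr rfl fun w _ => ?_
  simp only [Pi.smul_apply]
  rw [hV.twist_smul, smul_smul, smul_smul, hk.mul_eq' (ht u w), twist_twist, koszul_apply]
  congr 2
  apply twist_congr
  simp only [Int.even_add, Int.even_sub, Int.not_even_one]
  tauto

variable (𝓀) in
/-- `op` as a semilinear map. -/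
def opLin (hk : IsGradedComm 𝓀) {t : List ι → List ι →₀ k} (ht : IsHomogeneousRows deg 𝓀 t) :
    (List ι → k) →ₛₗ[koszul 𝓀] (List ι → k) where
  toFun := op deg 𝓀 t
  map_add' := op_add deg t
  map_smul' := op_smul deg hk ht (gradedSMulMem_self 𝓀)

/-- The Koszul rule for two operators of degree one, of which one acts on the coefficients and the
other on the words. -/
theorem map_op {t : List ι → List ι →₀ k} (ht : IsHomogeneousRows deg 𝓀 t)
    {d : V →ₛₗ[koszul 𝓀] V} (hd : ∀ (p : ℤ) (a : V), a ∈ 𝒱 p → d a ∈ 𝒱 (p + 1))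
    (f : List ι → V) (u : List ι) :
    d (op deg 𝒱 t f u) = -op deg 𝒱 t (fun w => d (f w)) u := by
  rw [op, op, Finsupp.sum, Finsupp.sum, map_sum, ← Finset.sum_neg_distrib]
  refine Finset.sum_congr rfl fun w _ => ?_
  rw [LinearMap.map_smulₛₗ, koszul_apply, twist_of_mem 𝓀 1 (ht u w), map_twist_of_degree_one hd,
    smul_comm _ (sgn (xdeg deg w + xdeg deg u)), smul_assoc, sgn_smul_sgn_smul, sgn_of_odd,
    neg_smul, one_smul]
  rw [← Int.not_even_iff_odd]
  simp only [Int.even_add, Int.even_sub, one_mul, Int.not_even_one]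
  tauto

variable (𝒱) in
/-- The grading automorphism for the total degree. -/
def totalParity (f : List ι → V) : List ι → V := fun u => sgn (xdeg deg u) • twist 𝒱 1 (f u)

theorem HasDeg.totalParity_eq {p : ℤ} {f : List ι → V} (hf : HasDeg deg 𝒱 p f) :
    totalParity deg 𝒱 f = sgn p • f := by
  funext u
  rw [totalParity, twist_of_mem 𝒱 1 (hf u), sgn_smul_sgn_smul, Pi.smul_apply]
  congr 2
  ring

theorem totalParity_op {t : List ι → List ι →₀ k} (ht : IsHomogeneousRows deg 𝓀 t)
    (hV : GradedSMulMem 𝓀 𝒱) (f : List ι → V) :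
    totalParity deg 𝒱 (op deg 𝒱 t f) = -op deg 𝒱 t (totalParity deg 𝒱 f) := by
  funext u
  rw [Pi.neg_apply, totalParity, op, op, Finsupp.sum, Finsupp.sum, map_sum, Finset.smul_sum,
    ← Finset.sum_neg_distrib]
  refine Finset.sum_congr rfl fun w _ => ?_
  rw [hV.twist_smul, twist_of_mem 𝓀 1 (ht u w), twist_twist, totalParity, map_zsmul, twist_twist,
    smul_assoc, sgn_smul_sgn_smul, smul_comm _ (sgn _), ← neg_smul, add_comm (1 : ℤ) (_ + _)]
  congr 1
  rw [neg_eq_neg_one_mul, ← sgn_one, ← sgn_add]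
  apply sgn_congr
  simp only [Int.even_add, Int.even_sub, one_mul, Int.not_even_one]
  tauto

theorem totalParity_totalParity (f : List ι → V) :
    totalParity deg 𝒱 (totalParity deg 𝒱 f) = f := by
  funext u
  rw [totalParity, totalParity, map_zsmul, sgn_smul_self, twist_twist,
    twist_of_even _ (by decide)]

variable (𝓀) in
/-- The coefficients of the composite of two operators. -/
def compRows (t t' : List ι → List ι →₀ k) : List ι → List ι →₀ k := fun u =>
  (t u).sum fun w x => (t' w).sum fun w' y =>
    Finsupp.single w' (x * twist 𝓀 (xdeg deg w + xdeg deg u) y)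

/-- The operator of degree `2` (or `0`) with the given coefficients. -/
theorem op_op (hV : GradedSMulMem 𝓀 𝒱) (t t' : List ι → List ι →₀ k) (f : List ι → V) :
    op deg 𝒱 t (op deg 𝒱 t' f) = op deg 𝒱 (compRows deg 𝓀 t t') f := by
  funext u
  rw [op_eq_evalRow, op_eq_evalRow, compRows, Finsupp.sum, map_sum, evalRow]
  rw [Finsupp.liftAddHom_apply, Finsupp.sum]
  refine Finset.sum_congr rfl fun w _ => ?_
  rw [Finsupp.sum, map_sum, AddMonoidHom.flip_apply, smulAddHom_apply, op, Finsupp.sum, map_sum,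
    Finset.smul_sum]
  refine Finset.sum_congr rfl fun w' _ => ?_
  rw [evalRow_single, hV.twist_smul, twist_twist, smul_smul]
  congr 1
  apply twist_congr
  simp only [Int.even_add]
  tauto

/-- The extension of an operator to series with coefficients in `V` has the same coefficients. -/
theorem extend_eq_op {t : List ι → List ι →₀ k} (ht : IsHomogeneousRows deg 𝓀 t)
    (E : List ι → List ι → k) (hE : ∀ w u, E w u = t u w) (f : List ι → V) :
    extend 𝓀 𝒱 E f = op deg 𝒱 t f := by
  classical
  funext u
  rw [extend, op, Finsupp.sum]
  -- The coefficient is twisted once for the degree one of `∂` and once for the degree of the entry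
  -- `t u w`; modulo 2 the total is `xdeg w + xdeg u`.
  have key : ∀ w, rightSMul 𝓀 𝒱 (twist 𝒱 1 (f w)) (E w u) =
      t u w • twist 𝒱 (xdeg deg w + xdeg deg u) (f w) := by
    intro w
    rw [hE, rightSMul_of_mem _ (ht u w), twist_twist]
    congr 1
    apply twist_congr
    simp only [Int.even_add, Int.even_sub, Int.not_even_one]
    tauto
  rw [finsum_congr key]
  apply finsum_eq_sum_of_support_subset
  intro w hw
  rw [Finset.mem_coe, Finsupp.mem_support_iff]
  rintro h0
  exact hw (by simp only [h0, zero_smul])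

end Operators

/-! ### Products of series -/

section Conv

variable {ι : Type*} (deg : ι → ℤ)
variable {k : Type*} [Ring k] {𝓀 : ℤ → AddSubgroup k} [GradedRing 𝓀]
variable {U W : Type*} [AddCommGroup U] [AddCommGroup W]
variable {V : Type*} [AddCommGroup V] [Module k V] {𝒱 : ℤ → AddSubgroup V}
  [DirectSum.Decomposition 𝒱]

variable (𝒱) in
/-- `conv` for operations between different groups. -/
def hconv (B : U →+ V →+ W) (f : List ι → U) (g : List ι → V) : List ι → W :=
  cut fun a b => B (f a) (twist 𝒱 (xdeg deg a) (g b))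

variable (𝒱) in
theorem conv_eq_hconv (B : V →+ V →+ V) (f g : List ι → V) :
    conv deg 𝒱 B f g = hconv deg 𝒱 B f g := rfl

variable (𝒱) in
theorem conv_apply (B : V →+ V →+ V) (f g : List ι → V) (u : List ι) :
    conv deg 𝒱 B f g u = cut (fun a b => B (f a) (twist 𝒱 (xdeg deg a) (g b))) u := rfl

variable (𝒱) in
/-- `hconv` as a biadditive map. -/
def hconvHom (B : U →+ V →+ W) : (List ι → U) →+ (List ι → V) →+ (List ι → W) :=
  AddMonoidHom.mk' (fun f => AddMonoidHom.mk' (hconv deg 𝒱 B f) fun g h => by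
    funext u
    simp only [hconv, Pi.add_apply, map_add, cut_add]) fun f g => by
    ext h u
    simp only [AddMonoidHom.mk'_apply, hconv, AddMonoidHom.add_apply, Pi.add_apply, map_add,
      cut_add]

variable (𝒱) in
theorem hconvHom_apply (B : U →+ V →+ W) (f : List ι → U) (g : List ι → V) :
    hconvHom deg 𝒱 B f g = hconv deg 𝒱 B f g := rfl

theorem VanishBelow.hconv {B : U →+ V →+ W} {n m : ℕ} {f : List ι → U} {g : List ι → V}
    (hf : VanishBelow n f) (hg : VanishBelow m g) :
    VanishBelow (n + m) (hconv deg 𝒱 B f g) := fun u hu =>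
  cut_eq_zero fun a b hab => by
    have : a.length + b.length = u.length := by rw [← hab, List.length_append]
    rcases lt_or_ge a.length n with h | h
    · rw [hf a h, map_zero, AddMonoidHom.zero_apply]
    · rw [hg b (by omega), map_zero, map_zero]

theorem HasDeg.conv {B : V →+ V →+ V} (hB : IsGradedBilin 𝓀 𝒱 B) {p q : ℤ} {f g : List ι → V}
    (hf : HasDeg deg 𝒱 p f) (hg : HasDeg deg 𝒱 q g) :
    HasDeg deg 𝒱 (p + q) (conv deg 𝒱 B f g) := fun u => by
  rw [conv_apply]
  refine cut_mem fun a b hab => ?_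
  · have := hB.mem _ _ _ _ (hf a) (twist_mem 𝒱 (xdeg deg a) (hg b))
    rwa [show p - xdeg deg a + (q - xdeg deg b) = p + q - xdeg deg u by
      rw [← hab, xdeg_append]; ring] at this

/-- Both sides run over the decompositions of a word into three parts, and the signs agree because
the parity operators are multiplicative for `B`. -/
theorem conv_assoc {B : V →+ V →+ V} (hB : IsGradedBilin 𝓀 𝒱 B)
    (hassoc : ∀ a b c, B (B a b) c = B a (B b c)) (f g h : List ι → V) :
    conv deg 𝒱 B (conv deg 𝒱 B f g) h = conv deg 𝒱 B f (conv deg 𝒱 B g h) := by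
  funext u
  have h : ∀ a b, B (f a) (twist 𝒱 (xdeg deg a) (conv deg 𝒱 B g h b)) =
      cut (fun c d => B (f a) (twist 𝒱 (xdeg deg a) (B (g c) (twist 𝒱 (xdeg deg c) (h d))))) b :=
    fun a b => by rw [conv_apply, map_cut, map_cut]
  rw [conv_apply, conv_apply]
  simp only [h]
  rw [cut_cut]
  refine cut_congr fun b d hbd => ?_
  rw [conv_apply, cut_apply]
  refine cut_congr fun a c hac => ?_
  rw [hassoc, hB.twist, twist_twist, ← hac, xdeg_append]

theorem mono_append (u w : List ι) :
    conv deg 𝓀 AddMonoidHom.mul (mono k u) (mono k w) = mono k (u ++ w) := by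
  classical
  funext v
  rw [conv_apply]
  by_cases hv : v = u ++ w
  · subst hv
    rw [mono_self, cut, Finset.sum_eq_single u.length]
    · simp [mono_self]
    · intro i hi hne
      rw [mono_of_ne, map_zero, AddMonoidHom.zero_apply]
      intro h
      apply hne
      have := congrArg List.length h
      simp only [List.length_take] at this
      have := Finset.mem_range.1 hi
      omega
    · simp
  · rw [mono_of_ne hv]
    refine cut_eq_zero fun a b hab => ?_
    by_cases ha : a = u
    · rw [mono_of_ne (u := w) (w := b), map_zero, map_zero]
      rintro rfl
      exact hv (by rw [← hab, ha])
    · rw [mono_of_ne ha, map_zero, AddMonoidHom.zero_apply]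

theorem hasDeg_mono (u : List ι) : HasDeg deg 𝓀 (xdeg deg u) (mono k u) := by
  intro w
  by_cases h : w = u
  · subst h
    rw [mono_self, sub_self]
    exact SetLike.GradedOne.one_mem
  · rw [mono_of_ne h]
    exact AddSubgroup.zero_mem _

theorem map_conv {B : V →+ V →+ V} {d : V →ₛₗ[koszul 𝓀] V}
    (hd : ∀ (p : ℤ) (a : V), a ∈ 𝒱 p → d a ∈ 𝒱 (p + 1))
    (hdB : ∀ (p : ℤ) (a b : V), a ∈ 𝒱 p → d (B a b) = B (d a) b + sgn p • B a (d b))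
    {p : ℤ} {f : List ι → V} (hf : HasDeg deg 𝒱 p f) (g : List ι → V) (u : List ι) :
    d (conv deg 𝒱 B f g u) =
      (conv deg 𝒱 B (fun w => d (f w)) g + sgn p • conv deg 𝒱 B f (fun w => d (g w))) u := by
  rw [Pi.add_apply, Pi.smul_apply]
  simp only [conv_apply]
  rw [← zsmulAddGroupHom_apply (sgn p)]
  rw [show d (cut _ u) = d.toAddMonoidHom (cut _ u) from rfl, map_cut, map_cut, ← cut_add]
  refine cut_congr fun a b _ => ?_
  rw [LinearMap.toAddMonoidHom_coe, hdB _ _ _ (hf a), map_twist_of_degree_one hd, map_zsmul,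
    sgn_smul_sgn_smul, zsmulAddGroupHom_apply]
  congr 3
  ring

end Conv

/-! ### Derivations determined by their values on the generators -/

section Derivation

variable {ι : Type*} (deg : ι → ℤ)
variable {k : Type*} [Ring k] {𝓀 : ℤ → AddSubgroup k} [GradedRing 𝓀]
variable {V : Type*} [AddCommGroup V] [Module k V] {𝒱 : ℤ → AddSubgroup V}
  [DirectSum.Decomposition 𝒱]

/-- The coefficients of the derivation which maps `X j` to `∑_v e(v)_j X^v`. -/
def derRows (e : List ι → ι →₀ k) : List ι → List ι →₀ k :=
  cut fun a => cut fun v c => (e v).sum fun j x =>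
    Finsupp.single (a ++ j :: c) (sgn (xdeg deg a * (1 - deg j + xdeg deg v)) • x)

variable (𝒱) in
/-- The derivation which maps `X j` to `∑_v e(v)_j X^v`, extended to coefficients in `V`. -/
def der (e : List ι → ι →₀ k) (f : List ι → V) : List ι → V := op deg 𝒱 (derRows deg e) f

-- The coefficient at `u = a v c` collects the words `a j c` from which `u` arises when the letter
-- `j` is replaced by the term `X^v` of `∂ (X j)`. In the exponent of the twist the letters of `a`
-- and `c` occur twice and cancel.
variable (𝒱) in
theorem der_apply (e : List ι → ι →₀ k) (f : List ι → V) (u : List ι) :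
    der deg 𝒱 e f u = cut (fun a => cut fun v c => (e v).sum fun j x =>
      sgn (xdeg deg a * (1 - deg j + xdeg deg v)) • x •
        twist 𝒱 (1 - deg j + xdeg deg v) (f (a ++ j :: c))) u := by
  rw [der, op_eq_evalRow, derRows, map_cut]
  refine cut_congr fun a b hab => ?_
  rw [map_cut]
  refine cut_congr fun v c hvc => ?_
  rw [Finsupp.sum, map_sum]
  refine Finset.sum_congr rfl fun j _ => ?_
  simp only [evalRow_single, smul_assoc]
  congr 2
  apply twist_congr
  simp only [← hab, ← hvc, xdeg_append, xdeg_cons, Int.even_add]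
  tauto

variable (𝓀) in
/-- The coefficients are those of a derivation of degree `1`. -/
def IsHomogeneousGen (e : List ι → ι →₀ k) : Prop := ∀ v j, e v j ∈ 𝓀 (2 - deg j - xdeg deg v)

theorem IsHomogeneousGen.rows {e : List ι → ι →₀ k} (he : IsHomogeneousGen deg 𝓀 e) :
    IsHomogeneousRows deg 𝓀 (derRows deg e) := by
  classical
  intro u w
  rw [derRows, ← Finsupp.applyAddHom_apply, map_cut]
  refine cut_mem fun a b hab => ?_
  rw [map_cut]
  refine cut_mem fun v c hvc => ?_
  rw [Finsupp.sum, map_sum]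
  refine AddSubgroup.sum_mem _ fun j _ => ?_
  rw [Finsupp.applyAddHom_apply, Finsupp.single_apply]
  split_ifs with h
  · refine AddSubgroup.zsmul_mem _ ?_ _
    have := he v j
    rwa [show 2 - deg j - xdeg deg v = xdeg deg w + 1 - xdeg deg u by
      rw [← h, ← hab, ← hvc]; simp only [xdeg_append, xdeg_cons]; ring] at this
  · exact AddSubgroup.zero_mem _

/-- In a word `a j c` the cut between the two factors lies on one side of the replaced letter `j`,
and this decides on which factor `∂` acts. The total parity replaces a degree of `f`, so the rule
holds for all series and can be iterated. -/
theorem der_conv {e : List ι → ι →₀ k} (he : IsHomogeneousGen deg 𝓀 e) {B : V →+ V →+ V}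
    (hB : IsGradedBilin 𝓀 𝒱 B) (f g : List ι → V) :
    der deg 𝒱 e (conv deg 𝒱 B f g) =
      conv deg 𝒱 B (der deg 𝒱 e f) g + conv deg 𝒱 B (totalParity deg 𝒱 f) (der deg 𝒱 e g) := by
  funext u
  -- In the first sum the cut lies to the left of `j`, so that `∂` falls on `g`; in the second one
  -- it lies to the right, and `∂` falls on `f`.
  have h1 : der deg 𝒱 e (conv deg 𝒱 B f g) u =
      cut (fun a => cut fun v c => (cut (fun a₁ a₂ => (e v).sum fun j x =>
        sgn (xdeg deg a * (1 - deg j + xdeg deg v)) • x • B (twist 𝒱 (1 - deg j + xdeg deg v) (f a₁))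
          (twist 𝒱 (1 - deg j + xdeg deg v + xdeg deg a₁) (g (a₂ ++ j :: c)))) a)) u +
      cut (fun a => cut fun v c => (cut (fun c₁ c₂ => (e v).sum fun j x =>
        sgn (xdeg deg a * (1 - deg j + xdeg deg v)) • x •
        B (twist 𝒱 (1 - deg j + xdeg deg v) (f (a ++ j :: c₁)))
          (twist 𝒱 (xdeg deg a + xdeg deg v + xdeg deg c₁) (g c₂))) c)) u := by
    rw [der_apply, ← cut_add]
    refine cut_congr fun a b _ => ?_
    rw [← cut_add]
    refine cut_congr fun v c _ => ?_
    simp only [conv_apply, cut_append_cons, Finsupp.sum]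
    simp only [cut]
    rw [Finset.sum_comm, Finset.sum_comm (s := Finset.range (c.length + 1)),
      ← Finset.sum_add_distrib]
    refine Finset.sum_congr rfl fun j _ => ?_
    rw [map_add, smul_add, smul_add, map_sum, map_sum, Finset.smul_sum, Finset.smul_sum,
      Finset.smul_sum, Finset.smul_sum]
    congr 1
    · refine Finset.sum_congr rfl fun i _ => ?_
      rw [hB.twist, twist_twist]
    · refine Finset.sum_congr rfl fun i _ => ?_
      rw [hB.twist, twist_twist]
      congr 3
      apply twist_congr
      simp only [xdeg_append, xdeg_cons, Int.even_add]
      tauto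
  have h2 : conv deg 𝒱 B (der deg 𝒱 e f) g u =
      cut (fun a => cut fun v c => (cut (fun c₁ c₂ => (e v).sum fun j x =>
        sgn (xdeg deg a * (1 - deg j + xdeg deg v)) • x •
        B (twist 𝒱 (1 - deg j + xdeg deg v) (f (a ++ j :: c₁)))
          (twist 𝒱 (xdeg deg a + xdeg deg v + xdeg deg c₁) (g c₂))) c)) u := by
    have e1 : ∀ a b : List ι, cut (fun v c => (cut (fun c₁ c₂ => (e v).sum fun j x =>
        sgn (xdeg deg a * (1 - deg j + xdeg deg v)) • x •
        B (twist 𝒱 (1 - deg j + xdeg deg v) (f (a ++ j :: c₁)))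
          (twist 𝒱 (xdeg deg a + xdeg deg v + xdeg deg c₁) (g c₂))) c)) b =
        cut (fun q c₂ => cut (fun v c₁ => (e v).sum fun j x =>
        sgn (xdeg deg a * (1 - deg j + xdeg deg v)) • x •
        B (twist 𝒱 (1 - deg j + xdeg deg v) (f (a ++ j :: c₁)))
          (twist 𝒱 (xdeg deg a + xdeg deg v + xdeg deg c₁) (g c₂))) q) b := fun a b => cut_cut _ b
    refine Eq.trans ?_ (cut_congr fun a b _ => (e1 a b).symm)
    rw [cut_cut, conv_apply]
    refine cut_congr fun p c₂ _ => ?_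
    rw [der_apply, cut_apply]
    refine cut_congr fun a q haq => ?_
    rw [cut_apply]
    refine cut_congr fun v c₁ hvc => ?_
    rw [Finsupp.sum, Finsupp.sum, map_sum, AddMonoidHom.finsetSum_apply]
    refine Finset.sum_congr rfl fun j _ => ?_
    rw [map_zsmul, AddMonoidHom.zsmul_apply, hB.smul_left]
    congr 3
    rw [← haq, ← hvc, xdeg_append, xdeg_append, add_assoc]
  have h3 : conv deg 𝒱 B (totalParity deg 𝒱 f) (der deg 𝒱 e g) u =
      cut (fun a => cut fun v c => (cut (fun a₁ a₂ => (e v).sum fun j x =>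
        sgn (xdeg deg a * (1 - deg j + xdeg deg v)) • x • B (twist 𝒱 (1 - deg j + xdeg deg v) (f a₁))
          (twist 𝒱 (1 - deg j + xdeg deg v + xdeg deg a₁) (g (a₂ ++ j :: c)))) a)) u := by
    have e1 : ∀ a b : List ι, cut (fun v c => (cut (fun a₁ a₂ => (e v).sum fun j x =>
        sgn (xdeg deg a * (1 - deg j + xdeg deg v)) • x • B (twist 𝒱 (1 - deg j + xdeg deg v) (f a₁))
          (twist 𝒱 (1 - deg j + xdeg deg v + xdeg deg a₁) (g (a₂ ++ j :: c)))) a)) b =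
        cut (fun a₁ a₂ => cut (fun v c => (e v).sum fun j x =>
        sgn (xdeg deg a * (1 - deg j + xdeg deg v)) • x • B (twist 𝒱 (1 - deg j + xdeg deg v) (f a₁))
          (twist 𝒱 (1 - deg j + xdeg deg v + xdeg deg a₁) (g (a₂ ++ j :: c)))) b) a :=
      fun a b => Finset.sum_comm
    refine Eq.trans ?_ (cut_congr fun a b _ => (e1 a b).symm)
    rw [← cut_cut (fun a₁ a₂ b => cut (fun v c => (e v).sum fun j x =>
        sgn (xdeg deg (a₁ ++ a₂) * (1 - deg j + xdeg deg v)) • x •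
        B (twist 𝒱 (1 - deg j + xdeg deg v) (f a₁))
          (twist 𝒱 (1 - deg j + xdeg deg v + xdeg deg a₁) (g (a₂ ++ j :: c)))) b) u |>.trans
        (cut_congr fun a b _ => cut_congr fun a₁ a₂ h => by rw [h]), conv_apply]
    refine cut_congr fun a₁ q _ => ?_
    rw [der_apply, map_cut, map_cut]
    refine cut_congr fun a₂ b _ => ?_
    rw [map_cut, map_cut]
    refine cut_congr fun v c _ => ?_
    rw [Finsupp.sum, Finsupp.sum, map_sum, map_sum]
    refine Finset.sum_congr rfl fun j _ => ?_
    rw [totalParity, map_zsmul, map_zsmul, hB.smul_mem.twist_smul, twist_of_mem 𝓀 _ (he v j),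
      map_zsmul, AddMonoidHom.zsmul_apply, smul_assoc, map_zsmul, hB.smul_right_eq (he v j),
      sgn_smul_sgn_smul, sgn_smul_sgn_smul, twist_twist, twist_twist]
    -- The sign for moving `∂` past the first factor is shared between the total parity of `f` and
    -- the twist of the coefficient `e v j`, whose degree is `2 - deg j - xdeg v`.
    have s1 : sgn (xdeg deg a₂ * (1 - deg j + xdeg deg v) + (xdeg deg a₁ +
        xdeg deg a₁ * (2 - deg j - xdeg deg v))) =
        sgn (xdeg deg (a₁ ++ a₂) * (1 - deg j + xdeg deg v)) := by
      apply sgn_congr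
      simp only [xdeg_append, Int.even_add, Int.even_mul, Int.even_sub, Int.not_even_one,
        even_two]
      tauto
    have s2 : twist 𝒱 (2 - deg j - xdeg deg v + 1) (f a₁) =
        twist 𝒱 (1 - deg j + xdeg deg v) (f a₁) := by
      apply twist_congr
      simp only [Int.even_add, Int.even_sub, Int.not_even_one, even_two]
      tauto
    rw [s2, add_comm (1 - deg j + xdeg deg v) (xdeg deg a₁), ← s1]
    congr 2
    ring
  rw [Pi.add_apply, h1, h2, h3, add_comm]

end Derivation

/-! ### Koszul signs -/

section KoszulSign

/-- The Koszul sign of a bijection `Fin n ≃ Fin m` (where necessarily `n = m`). -/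
def koszulSignEquiv {n m : ℕ} (σ : Fin n ≃ Fin m) (p : Fin m → ℤ) : ℤ :=
  ∏ i : Fin n, ∏ j : Fin n, if i < j ∧ σ j < σ i then sgn (p (σ i) * p (σ j)) else 1

@[simp] theorem koszulSign_one {n : ℕ} (p : Fin n → ℤ) : koszulSign 1 p = 1 := by
  refine Finset.prod_eq_one fun i _ => Finset.prod_eq_one fun j _ => if_neg ?_
  rintro ⟨h1, h2⟩
  exact absurd h1 h2.not_gt

/-- The permutation of `Fin (n + m)` which acts by `σ` on the first block and by `τ` on the
second one. -/
def blockPerm {n m : ℕ} (σ : Equiv.Perm (Fin n)) (τ : Equiv.Perm (Fin m)) :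
    Equiv.Perm (Fin (n + m)) :=
  finSumFinEquiv.permCongr (Equiv.Perm.sumCongr σ τ)

@[simp] theorem blockPerm_castAdd {n m : ℕ} (σ : Equiv.Perm (Fin n)) (τ : Equiv.Perm (Fin m))
    (i : Fin n) : blockPerm σ τ (Fin.castAdd m i) = Fin.castAdd m (σ i) := by
  simp [blockPerm, Equiv.permCongr_apply]

@[simp] theorem blockPerm_natAdd {n m : ℕ} (σ : Equiv.Perm (Fin n)) (τ : Equiv.Perm (Fin m))
    (i : Fin m) : blockPerm σ τ (Fin.natAdd n i) = Fin.natAdd n (τ i) := by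
  simp [blockPerm, Equiv.permCongr_apply]

theorem castAdd_lt_natAdd {n m : ℕ} (i : Fin n) (j : Fin m) :
    Fin.castAdd m i < Fin.natAdd n j := by
  simp only [Fin.lt_def, Fin.val_castAdd, Fin.val_natAdd]
  omega

theorem koszulSign_blockPerm {n m : ℕ} (σ : Equiv.Perm (Fin n)) (τ : Equiv.Perm (Fin m))
    (p : Fin (n + m) → ℤ) :
    koszulSign (blockPerm σ τ) p =
      koszulSign σ (fun i => p (Fin.castAdd m i)) * koszulSign τ (fun i => p (Fin.natAdd n i)) := by
  have h1 : ∀ (i : Fin n) (j : Fin m), ¬ Fin.natAdd n j < Fin.castAdd m i := fun i j =>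
    (castAdd_lt_natAdd i j).not_gt
  simp only [koszulSign, Fin.prod_univ_add, blockPerm_castAdd, blockPerm_natAdd, h1, false_and,
    and_false, if_false, Finset.prod_const_one, mul_one, one_mul, Fin.natAdd_lt_natAdd_iff]
  simp only [Fin.lt_def, Fin.val_castAdd]

/-- The inverted pairs are precisely those with one index in each block. -/
theorem koszulSignEquiv_finAddFlip {n m : ℕ} (p : Fin (m + n) → ℤ) :
    koszulSignEquiv (finAddFlip : Fin (n + m) ≃ Fin (m + n)) p =
      sgn ((∑ i, p (Fin.natAdd m i)) * ∑ j, p (Fin.castAdd n j)) := by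
  have h1 : ∀ (i : Fin n) (j : Fin m), ¬ Fin.natAdd n j < Fin.castAdd m i := fun i j =>
    (castAdd_lt_natAdd i j).not_gt
  have h2 : ∀ (i j : Fin n), ¬ (Fin.castAdd m i < Fin.castAdd m j ∧
      Fin.natAdd m j < Fin.natAdd m i) := fun i j h => by
    simp only [Fin.lt_def, Fin.val_castAdd, Fin.val_natAdd] at h
    omega
  have h3 : ∀ (i j : Fin m), ¬ (Fin.natAdd n i < Fin.natAdd n j ∧
      Fin.castAdd n j < Fin.castAdd n i) := fun i j h => by
    simp only [Fin.lt_def, Fin.val_castAdd, Fin.val_natAdd] at h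
    omega
  simp only [koszulSignEquiv, Fin.prod_univ_add, finAddFlip_apply_castAdd,
    finAddFlip_apply_natAdd, h1, h2, h3, if_false, false_and, Finset.prod_const_one, mul_one,
    one_mul, castAdd_lt_natAdd, and_self, if_true, Finset.sum_mul_sum, sgn_sum]

/-- An adjacent transposition has a single inversion. -/
theorem koszulSign_swap {n : ℕ} (i : Fin n) (p : Fin (n + 1) → ℤ) :
    koszulSign (Equiv.swap i.castSucc i.succ) p = sgn (p i.castSucc * p i.succ) := by
  have hlt : i.castSucc < i.succ := Fin.castSucc_lt_succ
  have hne : ∀ a b : Fin (n + 1), a < b → Equiv.swap i.castSucc i.succ b <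
      Equiv.swap i.castSucc i.succ a → a = i.castSucc ∧ b = i.succ := by
    intro a b hab h
    simp only [Equiv.swap_apply_def] at h
    simp only [Fin.ext_iff, Fin.lt_def] at *
    split_ifs at h <;> simp_all <;> omega
  rw [koszulSign, Finset.prod_eq_single i.castSucc, Finset.prod_eq_single i.succ]
  · simp [hlt, mul_comm]
  · intro b _ hb
    exact if_neg fun h => hb (hne _ _ h.1 h.2).2
  · simp
  · intro a _ ha
    exact Finset.prod_eq_one fun b _ => if_neg fun h => ha (hne _ _ h.1 h.2).1
  · simp

end KoszulSign

/-! ### Rational scalars -/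

section Rational

variable {k : Type*} [Ring k] [Algebra ℚ k]
variable {V W : Type*} [AddCommGroup V] [Module k V] [AddCommGroup W] [Module k W]

/-- Additive maps between rational vector spaces are `ℚ`-linear. This covers the differential and
the parity operators, which are not `k`-linear. -/
theorem map_algebraMap_smul' (φ : V →+ W) (q : ℚ) (v : V) :
    φ (algebraMap ℚ k q • v) = algebraMap ℚ k q • φ v := by
  let _ := Module.compHom V (algebraMap ℚ k)
  let _ := Module.compHom W (algebraMap ℚ k)
  exact map_rat_smul φ q v

/-- The projection to degree zero is additive, hence `ℚ`-linear, and it fixes `1`. -/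
theorem algebraMap_mem_zero {𝓀 : ℤ → AddSubgroup k} [GradedRing 𝓀] (q : ℚ) :
    algebraMap ℚ k q ∈ 𝓀 0 := by
  let φ : k →+ k := (𝓀 0).subtype.comp ((DFinsupp.evalAddMonoidHom 0).comp
    (DirectSum.decomposeAddEquiv 𝓀).toAddMonoidHom)
  have h1 : φ 1 = 1 := by
    have := DirectSum.decompose_of_mem_same 𝓀 (SetLike.GradedOne.one_mem (A := 𝓀))
    exact this
  have h := map_algebraMap_smul' (k := k) φ q (1 : k)
  rw [h1, smul_eq_mul, mul_one] at h
  rw [← h]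
  exact SetLike.coe_mem _

theorem inv_factorial_smul_factorial (n : ℕ) (v : V) :
    algebraMap ℚ k (n.factorial : ℚ)⁻¹ • (n.factorial • v) = v := by
  rw [← Nat.cast_smul_eq_nsmul k, smul_smul, ← map_natCast (algebraMap ℚ k), ← map_mul,
    inv_mul_cancel₀ (by exact_mod_cast n.factorial_ne_zero), map_one, one_smul]

/-- A module over a `ℚ`-algebra is torsion free. -/
theorem eq_zero_of_nsmul {n : ℕ} (hn : n ≠ 0) {v : V} (h : n • v = 0)
    (k : Type*) [Ring k] [Algebra ℚ k] [Module k V] : v = 0 := by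
  have := congrArg (fun w => algebraMap ℚ k (n : ℚ)⁻¹ • w) h
  simpa only [← Nat.cast_smul_eq_nsmul k, smul_smul, ← map_natCast (algebraMap ℚ k), ← map_mul,
    inv_mul_cancel₀ (show (n : ℚ) ≠ 0 by exact_mod_cast hn), map_one, one_smul, smul_zero] using this

end Rational

/-! ### Symmetrization -/

section Symm

variable {ι : Type*} (deg : ι → ℤ)

/-- The symmetrization of a series at the word of `v`, without the factor `1 / n!`. -/
def permSum {V : Type*} [AddCommGroup V] {n : ℕ} (v : Fin n → ι) : (List ι → V) →+ V :=
  ∑ σ : Equiv.Perm (Fin n), koszulSign σ (fun i => 1 - deg (v i)) •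
    Pi.evalAddMonoidHom (fun _ : List ι => V) (List.ofFn (v ∘ σ))

theorem permSum_apply {V : Type*} [AddCommGroup V] {n : ℕ} (v : Fin n → ι) (f : List ι → V) :
    permSum deg v f = ∑ σ : Equiv.Perm (Fin n), koszulSign σ (fun i => 1 - deg (v i)) •
      f (List.ofFn (v ∘ σ)) := by
  simp [permSum, AddMonoidHom.finsetSum_apply]

theorem xdeg_ofFn {n : ℕ} (v : Fin n → ι) : xdeg deg (List.ofFn v) = ∑ i, (1 - deg (v i)) := by
  simp [xdeg, List.sum_ofFn]

theorem xdeg_ofFn_comp {n : ℕ} (v : Fin n → ι) (σ : Equiv.Perm (Fin n)) :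
    xdeg deg (List.ofFn (v ∘ σ)) = xdeg deg (List.ofFn v) := by
  rw [xdeg_ofFn, xdeg_ofFn]
  exact Equiv.sum_comp σ fun i => 1 - deg (v i)

theorem funext_ofFn {V : Type*} {f g : List ι → V}
    (h : ∀ (n : ℕ) (v : Fin n → ι), f (List.ofFn v) = g (List.ofFn v)) : f = g := by
  funext u
  rw [← List.ofFn_get u]
  exact h _ _

theorem permSum_congr {V : Type*} [AddCommGroup V] {n : ℕ} {v : Fin n → ι} {f g : List ι → V}
    (h : ∀ u : List ι, u.length = n → f u = g u) : permSum deg v f = permSum deg v g := by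
  rw [permSum_apply, permSum_apply]
  exact Finset.sum_congr rfl fun σ _ => by rw [h _ (List.length_ofFn)]

/-- The sum over all permutations is reindexed by a translation with `ρ`. The two index types are
kept apart so that the exchange of blocks `Fin (n + m) ≃ Fin (m + n)` can be used as `ρ`. -/
theorem permSum_equiv {V : Type*} [AddCommGroup V] {n m : ℕ} (hnm : n = m) (ρ : Fin n ≃ Fin m)
    (v : Fin m → ι) {f g : List ι → V}
    (h : ∀ v : Fin m → ι, f (List.ofFn v) =
      koszulSignEquiv ρ (fun i => 1 - deg (v i)) • g (List.ofFn (v ∘ ρ))) :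
    permSum deg v f = permSum deg v g := by
  subst hnm
  rw [permSum_apply, permSum_apply,
    ← Equiv.sum_comp (Equiv.mulRight (ρ : Equiv.Perm (Fin n))) fun σ =>
      koszulSign σ (fun i => 1 - deg (v i)) • g (List.ofFn (v ∘ σ))]
  refine Finset.sum_congr rfl fun σ _ => ?_
  rw [h, Equiv.coe_mulRight, koszulSign_mul, smul_smul]
  rfl

theorem permSum_perm {V : Type*} [AddCommGroup V] {n : ℕ} (ρ : Equiv.Perm (Fin n))
    (v : Fin n → ι) {f g : List ι → V}
    (h : ∀ v : Fin n → ι, f (List.ofFn v) =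
      koszulSign ρ (fun i => 1 - deg (v i)) • g (List.ofFn (v ∘ ρ))) :
    permSum deg v f = permSum deg v g := permSum_equiv deg rfl ρ v h

variable {k : Type*} [Ring k] [Algebra ℚ k]
variable {V : Type*} [AddCommGroup V] [Module k V]

theorem symm_ofFn_eq (f : List ι → V) {n : ℕ} (v : Fin n → ι) :
    symm deg k f (List.ofFn v) =
      algebraMap ℚ k (n.factorial : ℚ)⁻¹ • permSum deg v f := by
  rw [symm_ofFn, permSum_apply, symmTuple]

theorem symm_eq_of_permSum {f g : List ι → V}
    (h : ∀ (n : ℕ) (v : Fin n → ι), permSum deg v f = permSum deg v g) :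
    symm deg k f = symm deg k g :=
  funext_ofFn fun n v => by rw [symm_ofFn_eq, symm_ofFn_eq, h]

theorem permSum_eq_of_isSymm {f : List ι → V} (h : IsSymm deg f) {n : ℕ} (v : Fin n → ι) :
    permSum deg v f = n.factorial • f (List.ofFn v) := by
  rw [permSum_apply, Finset.sum_congr rfl fun σ _ => by
    rw [h n v σ, smul_smul, koszulSign_mul_self, one_smul]]
  rw [Finset.sum_const, Finset.card_univ, Fintype.card_perm, Fintype.card_fin]

theorem symm_eq_self {f : List ι → V} (h : IsSymm deg f) : symm deg k f = f :=
  funext_ofFn fun n v => by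
    rw [symm_ofFn_eq, permSum_eq_of_isSymm deg h, inv_factorial_smul_factorial]

theorem symm_symm (f : List ι → V) : symm deg k (symm deg k f) = symm deg k f :=
  symm_eq_self deg (isSymm_symm deg f)

variable (k) in
/-- `symm` as an additive map. -/
def symmHom : (List ι → V) →+ (List ι → V) :=
  AddMonoidHom.mk' (symm deg k) fun f g => funext_ofFn fun n v => by
    rw [Pi.add_apply, symm_ofFn_eq, symm_ofFn_eq, symm_ofFn_eq, map_add, smul_add]

theorem symmHom_apply (f : List ι → V) : symmHom deg k f = symm deg k f := rfl

/-- Additive maps commute with symmetrization. -/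
theorem map_symm {W : Type*} [AddCommGroup W] [Module k W] (φ : V →+ W) (f : List ι → V)
    (u : List ι) : φ (symm deg k f u) = symm deg k (fun w => φ (f w)) u := by
  refine congrFun (funext_ofFn (f := fun u => φ (symm deg k f u)) fun n v => ?_) u
  rw [symm_ofFn_eq, symm_ofFn_eq, map_algebraMap_smul', permSum_apply, permSum_apply, map_sum]
  simp only [map_zsmul]

theorem symm_congr {f g : List ι → V} {u : List ι}
    (h : ∀ w : List ι, w.length = u.length → f w = g w) : symm deg k f u = symm deg k g u := by
  rw [← List.ofFn_get u, symm_ofFn_eq, symm_ofFn_eq, permSum_congr deg h]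

theorem symm_apply_eq_zero {f : List ι → V} {u : List ι}
    (h : ∀ w : List ι, w.length = u.length → f w = 0) : symm deg k f u = 0 := by
  rw [symm_congr deg (g := 0) h, ← symmHom_apply, map_zero, Pi.zero_apply]

theorem isSymm_of_length_le_one {f : List ι → V} (h : ∀ u : List ι, 1 < u.length → f u = 0) :
    IsSymm deg f := by
  intro n v σ
  rcases lt_or_ge 1 n with hn | hn
  · rw [h _ (by simpa using hn), h _ (by simpa using hn), smul_zero]
  · have : Subsingleton (Fin n) := by
      rcases Nat.le_one_iff_eq_zero_or_eq_one.1 hn with rfl | rfl <;> infer_instance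
    have hσ : σ = 1 := Subsingleton.elim _ _
    rw [hσ, koszulSign_one, one_smul]
    rfl

theorem exists_ofFn_swap {ι : Type*} {n : ℕ} (v : Fin (n + 1) → ι) (i : Fin n) :
    ∃ a c : List ι, List.ofFn v = a ++ v i.castSucc :: v i.succ :: c ∧
      List.ofFn (v ∘ Equiv.swap i.castSucc i.succ) = a ++ v i.succ :: v i.castSucc :: c := by
  set a := (List.ofFn v).take i with ha
  set c := (List.ofFn v).drop (i + 2) with hc
  have e1 : List.ofFn v = a ++ v i.castSucc :: v i.succ :: c := by
    apply List.ext_getElem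
    · simp only [ha, hc, List.length_append, List.length_cons, List.length_take,
        List.length_drop, List.length_ofFn]
      omega
    · intro t h1 h2
      simp only [ha, hc, List.getElem_append, List.getElem_cons, List.length_take,
        List.length_ofFn, List.getElem_take, List.getElem_drop, List.getElem_ofFn]
      have hi := i.isLt
      simp only [List.length_ofFn] at h1
      split_ifs <;> congr 1 <;> simp only [Fin.ext_iff, Fin.val_castSucc, Fin.val_succ] <;> omega
  have e2 : List.ofFn (v ∘ Equiv.swap i.castSucc i.succ) =
      a ++ v i.succ :: v i.castSucc :: c := by
    apply List.ext_getElem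
    · simp only [ha, hc, List.length_append, List.length_cons, List.length_take,
        List.length_drop, List.length_ofFn]
      omega
    · intro t h1 h2
      simp only [ha, hc, List.getElem_append, List.getElem_cons, List.length_take,
        List.length_ofFn, List.getElem_take, List.getElem_drop, List.getElem_ofFn,
        Function.comp_apply, Equiv.swap_apply_def]
      have hi := i.isLt
      simp only [List.length_ofFn] at h1
      simp only [Fin.ext_iff, Fin.val_castSucc, Fin.val_succ]
      split_ifs <;> first | omega | rfl |
        (congr 1; simp only [Fin.ext_iff]; omega)
  exact ⟨a, c, e1, e2⟩

/-- A series is symmetric if it is symmetric for the exchange of adjacent letters. -/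
theorem isSymm_of_swap {f : List ι → V}
    (h : ∀ (a : List ι) (x y : ι) (c : List ι),
      f (a ++ x :: y :: c) = sgn ((1 - deg x) * (1 - deg y)) • f (a ++ y :: x :: c)) :
    IsSymm deg f := by
  intro n v σ
  rcases n with _ | n
  · rw [Subsingleton.elim σ 1, koszulSign_one, one_smul]
    rfl
  -- Adjacent transpositions generate the symmetric group as a monoid, and the Koszul sign is
  -- multiplicative along compositions.
  have hσ : σ ∈ Submonoid.closure (Set.range fun i : Fin n => Equiv.swap i.castSucc i.succ) := by
    rw [Equiv.Perm.mclosure_swap_castSucc_succ]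
    trivial
  induction hσ using Submonoid.closure_induction generalizing v with
  | one =>
    rw [koszulSign_one, one_smul]
    rfl
  | mul σ τ _ _ h1 h2 =>
    rw [koszulSign_mul, Equiv.Perm.coe_mul, ← Function.comp_assoc, h2, h1, smul_smul, mul_comm]
    rfl
  | mem σ hσ =>
    obtain ⟨i, rfl⟩ := hσ
    rw [koszulSign_swap]
    obtain ⟨a, c, e1, e2⟩ := exists_ofFn_swap v i
    rw [e1, e2, h, mul_comm]

end Symm

/-! ### Symmetrized products -/

section SymmProduct

variable {ι : Type*} (deg : ι → ℤ)
variable {k : Type*} [Ring k] [Algebra ℚ k]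
variable {U V W : Type*} [AddCommGroup U] [Module k U] [AddCommGroup V] [Module k V]
  [AddCommGroup W] [Module k W]

theorem permSum_cut {n : ℕ} (v : Fin n → ι) (F : List ι → List ι → V) :
    permSum deg v (cut F) =
      ∑ i ∈ Finset.range (n + 1), permSum deg v fun u => F (u.take i) (u.drop i) := by
  rw [← map_sum]
  refine permSum_congr deg fun u hu => ?_
  rw [cut, hu, Finset.sum_apply]

theorem take_ofFn_add {n m : ℕ} (v : Fin (n + m) → ι) :
    (List.ofFn v).take n = List.ofFn fun i => v (Fin.castAdd m i) := by
  rw [List.ofFn_add, List.take_left' (by simp)]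
  rfl

theorem drop_ofFn_add {n m : ℕ} (v : Fin (n + m) → ι) :
    (List.ofFn v).drop n = List.ofFn fun i => v (Fin.natAdd n i) := by
  rw [List.ofFn_add, List.drop_left' (by simp)]

theorem symm_cut_congr {F G : List ι → List ι → V}
    (h : ∀ (n m : ℕ) (v : Fin (n + m) → ι), (permSum deg v fun u => F (u.take n) (u.drop n)) =
      permSum deg v fun u => G (u.take n) (u.drop n)) :
    symm deg k (cut F) = symm deg k (cut G) := by
  refine symm_eq_of_permSum deg fun n v => ?_
  rw [permSum_cut, permSum_cut]
  refine Finset.sum_congr rfl fun i hi => ?_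
  obtain ⟨m, rfl⟩ := Nat.exists_eq_add_of_le (Nat.lt_succ_iff.1 (Finset.mem_range.1 hi))
  exact h i m v

/-- The two factors of the symmetrized product can be exchanged. -/
theorem symm_cut_flip {F G : List ι → List ι → V}
    (h : ∀ a b, F a b = sgn (xdeg deg a * xdeg deg b) • G b a) :
    symm deg k (cut F) = symm deg k (cut G) := by
  refine symm_eq_of_permSum deg fun n v => ?_
  -- The exchange of blocks moves a cut after `i` letters to a cut after `n - i` letters, so one of
  -- the two sums is reversed.
  rw [permSum_cut, permSum_cut, ← Finset.sum_range_reflect]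
  refine Finset.sum_congr rfl fun i hi => ?_
  obtain ⟨m, rfl⟩ := Nat.exists_eq_add_of_le (Nat.lt_succ_iff.1 (Finset.mem_range.1 hi))
  rw [show i + m + 1 - 1 - i = m by omega]
  have key : ∀ (a b : ℕ) (hab : a + b = i + m) (v : Fin (a + b) → ι),
      (permSum deg v fun u => F (u.take a) (u.drop a)) =
        permSum deg v fun u => G (u.take b) (u.drop b) := by
    intro a b _ v
    refine permSum_equiv deg (Nat.add_comm b a) finAddFlip v fun v => ?_
    rw [take_ofFn_add, drop_ofFn_add, take_ofFn_add, drop_ofFn_add, koszulSignEquiv_finAddFlip, h,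
      xdeg_ofFn, xdeg_ofFn, mul_comm]
    simp only [Function.comp_apply, finAddFlip_apply_castAdd, finAddFlip_apply_natAdd]
  have gen : ∀ (N : ℕ) (hN : N = i + m) (v : Fin N → ι),
      (permSum deg v fun u => F (u.take m) (u.drop m)) =
        permSum deg v fun u => G (u.take i) (u.drop i) := by
    intro N hN v
    obtain rfl : N = m + i := by omega
    exact key m i (by omega) v
  exact gen _ rfl v

variable {𝒱 : ℤ → AddSubgroup V} [DirectSum.Decomposition 𝒱]

/-- The action of a permutation of `Fin n` on the coefficients at the words of length `n`. -/
def permAct {V : Type*} [AddCommGroup V] {n : ℕ} (ρ : Equiv.Perm (Fin n)) (f : List ι → V) :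
    List ι → V := fun u =>
  if h : u.length = n then koszulSign ρ (fun i => 1 - deg (u.get (i.cast h.symm))) •
    f (List.ofFn fun i => u.get ((ρ i).cast h.symm)) else 0

theorem permAct_ofFn {n : ℕ} (ρ : Equiv.Perm (Fin n)) (f : List ι → V) (v : Fin n → ι) :
    permAct deg ρ f (List.ofFn v) =
      koszulSign ρ (fun i => 1 - deg (v i)) • f (List.ofFn (v ∘ ρ)) := by
  rw [permAct, dif_pos List.length_ofFn]
  simp only [List.get_ofFn]
  rfl

theorem symm_eq_sum_permAct {f : List ι → V} {u : List ι} {n : ℕ} (hu : u.length = n) :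
    symm deg k f u =
      algebraMap ℚ k (n.factorial : ℚ)⁻¹ • ∑ ρ : Equiv.Perm (Fin n), permAct deg ρ f u := by
  obtain ⟨v, rfl⟩ : ∃ v : Fin n → ι, u = List.ofFn v := by
    subst hu
    exact ⟨u.get, (List.ofFn_get u).symm⟩
  simp only [symm_ofFn_eq, permSum_apply, permAct_ofFn]

/-- A mean of `a!` functions with the same symmetrization: the factor `1 / a!` cancels the number of
summands. -/
theorem permSum_eq_average {n a : ℕ} {v : Fin n → ι} {F : List ι → V}
    {G : Equiv.Perm (Fin a) → List ι → V}
    (hF : ∀ u : List ι, u.length = n →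
      F u = algebraMap ℚ k (a.factorial : ℚ)⁻¹ • ∑ ρ, G ρ u) {H : List ι → V}
    (hG : ∀ ρ, permSum deg v (G ρ) = permSum deg v H) : permSum deg v F = permSum deg v H := by
  have h1 : permSum deg v F =
      permSum deg v (algebraMap ℚ k (a.factorial : ℚ)⁻¹ • ∑ ρ, G ρ) :=
    permSum_congr deg fun u hu => by rw [hF u hu, Pi.smul_apply, Finset.sum_apply]
  rw [h1, map_algebraMap_smul', map_sum, Finset.sum_congr rfl fun ρ _ => hG ρ, Finset.sum_const,
    Finset.card_univ, Fintype.card_perm, Fintype.card_fin, inv_factorial_smul_factorial]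

/-- Symmetrizing one factor averages over the permutations of one block, and the outer
symmetrization absorbs each of them. Together with `symm_hconv_right` this says that the kernel of
`symm` is an ideal, so that the symmetrized product is that of a quotient of the tensor algebra. -/
theorem symm_hconv_left (B : U →+ V →+ W) (f : List ι → U) (g : List ι → V) :
    symm deg k (hconv deg 𝒱 B (symm deg k f) g) = symm deg k (hconv deg 𝒱 B f g) := by
  refine symm_cut_congr deg fun n m v => permSum_eq_average (k := k) deg (a := n)
    (G := fun ρ u => B (permAct deg ρ f (u.take n)) (twist 𝒱 (xdeg deg (u.take n)) (g (u.drop n))))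
    (fun u hu => ?_) fun ρ => permSum_perm deg (blockPerm ρ 1) v fun v => ?_
  · rw [symm_eq_sum_permAct deg (n := n) (by rw [List.length_take, hu]; omega),
      ← AddMonoidHom.flip_apply, map_algebraMap_smul', map_sum]
    rfl
  · rw [koszulSign_blockPerm, koszulSign_one, mul_one, take_ofFn_add, drop_ofFn_add,
      take_ofFn_add, drop_ofFn_add, permAct_ofFn, map_zsmul, AddMonoidHom.zsmul_apply,
      ← xdeg_ofFn_comp deg _ ρ]
    simp only [Function.comp_apply, blockPerm_castAdd, blockPerm_natAdd, Equiv.Perm.one_apply,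
      Function.comp_def]

theorem symm_hconv_right (B : U →+ V →+ W) (f : List ι → U) (g : List ι → V) :
    symm deg k (hconv deg 𝒱 B f (symm deg k g)) = symm deg k (hconv deg 𝒱 B f g) := by
  refine symm_cut_congr deg fun n m v => permSum_eq_average (k := k) deg (a := m)
    (G := fun ρ u => B (f (u.take n)) (twist 𝒱 (xdeg deg (u.take n)) (permAct deg ρ g (u.drop n))))
    (fun u hu => ?_) fun ρ => permSum_perm deg (blockPerm 1 ρ) v fun v => ?_
  · rw [symm_eq_sum_permAct deg (n := m) (by rw [List.length_drop, hu]; omega),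
      map_algebraMap_smul', map_algebraMap_smul', map_sum, map_sum]
  · rw [koszulSign_blockPerm, koszulSign_one, one_mul, take_ofFn_add, drop_ofFn_add,
      take_ofFn_add, drop_ofFn_add, permAct_ofFn, map_zsmul, map_zsmul]
    simp only [Function.comp_apply, blockPerm_castAdd, blockPerm_natAdd, Equiv.Perm.one_apply,
      Function.comp_def]

end SymmProduct

/-! ### Closure properties of homogeneous series -/

section HasDeg

variable {ι : Type*} {deg : ι → ℤ} {V : Type*} [AddCommGroup V] {𝒱 : ℤ → AddSubgroup V}

theorem HasDeg.add {p : ℤ} {f g : List ι → V} (hf : HasDeg deg 𝒱 p f) (hg : HasDeg deg 𝒱 p g) :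
    HasDeg deg 𝒱 p (f + g) := fun u => AddSubgroup.add_mem _ (hf u) (hg u)

theorem HasDeg.sub {p : ℤ} {f g : List ι → V} (hf : HasDeg deg 𝒱 p f) (hg : HasDeg deg 𝒱 p g) :
    HasDeg deg 𝒱 p (f - g) := fun u => AddSubgroup.sub_mem _ (hf u) (hg u)

theorem HasDeg.zsmul {p : ℤ} {f : List ι → V} (hf : HasDeg deg 𝒱 p f) (n : ℤ) :
    HasDeg deg 𝒱 p (n • f) := fun u => AddSubgroup.zsmul_mem _ (hf u) n

theorem HasDeg.of_eq {p q : ℤ} {f : List ι → V} (hf : HasDeg deg 𝒱 p f) (h : p = q) :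
    HasDeg deg 𝒱 q f := h ▸ hf

end HasDeg

/-! ### Symmetrization of operators and of derivations -/

section SymmOperators

variable {ι : Type*} (deg : ι → ℤ)
variable {k : Type*} [Ring k] [Algebra ℚ k] {𝓀 : ℤ → AddSubgroup k} [GradedRing 𝓀]
variable {V : Type*} [AddCommGroup V] [Module k V] {𝒱 : ℤ → AddSubgroup V}
  [DirectSum.Decomposition 𝒱]

theorem HasDeg.symm (hV : GradedSMulMem 𝓀 𝒱) {p : ℤ} {f : List ι → V}
    (hf : HasDeg deg 𝒱 p f) : HasDeg deg 𝒱 p (symm deg k f) := by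
  intro u
  rw [← List.ofFn_get u, symm_ofFn_eq, permSum_apply]
  rw [← zero_add (p - _)]
  refine hV _ _ _ _ (algebraMap_mem_zero _) (AddSubgroup.sum_mem _ fun σ _ => ?_)
  refine AddSubgroup.zsmul_mem _ ?_ _
  have := hf (List.ofFn (u.get ∘ σ))
  rwa [xdeg_ofFn_comp] at this

/-- The output word enters the signs only through `xdeg`, which permutations preserve;
symmetrization therefore acts on the rows alone. -/
theorem symm_op (t : List ι → List ι →₀ k) (f : List ι → V) :
    symm deg k (op deg 𝒱 t f) = op deg 𝒱 (symm deg k t) f := by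
  refine funext_ofFn fun n v => ?_
  rw [symm_ofFn_eq, permSum_apply, op_eq_evalRow, symm_ofFn_eq, map_algebraMap_smul',
    permSum_apply, map_sum]
  congr 1
  refine Finset.sum_congr rfl fun σ _ => ?_
  rw [map_zsmul, op_eq_evalRow, xdeg_ofFn_comp]

theorem IsHomogeneousRows.symm {t : List ι → List ι →₀ k} (ht : IsHomogeneousRows deg 𝓀 t) :
    IsHomogeneousRows deg 𝓀 (symm deg k t) := by
  intro u w
  have h : HasDeg deg 𝓀 (xdeg deg w + 1) fun u => t u w := fun u => ht u w
  have := h.symm deg (gradedSMulMem_self 𝓀) u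
  have h2 : ChenHPT.symm deg k t u w = ChenHPT.symm deg k (fun u => t u w) u :=
    map_symm (k := k) deg (Finsupp.applyAddHom w) t u
  rwa [h2]

/-- A symmetric row of coefficients does not distinguish a series from its symmetrization. -/
theorem evalRow_symm (t : List ι →₀ k) (ht : IsSymm deg (t : List ι → k)) (f : List ι → V)
    (n : ℤ) : evalRow deg 𝒱 (symm deg k f) n t = evalRow deg 𝒱 f n t := by
  classical
  -- Words are regrouped as tuples by their length, since the symmetric group acts on tuples.
  have h0 : ∀ f : List ι → V, evalRow deg 𝒱 f n t =
      (t.equivMapDomain List.equivSigmaTuple).sum fun w x =>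
        x • twist 𝒱 (xdeg deg (List.ofFn w.2) + n) (f (List.ofFn w.2)) := by
    intro f
    rw [Finsupp.equivMapDomain_eq_mapDomain, Finsupp.sum_mapDomain_index_inj
      List.equivSigmaTuple.injective]
    simp only [List.equivSigmaTuple, Equiv.coe_fn_mk, List.ofFn_get]
    rfl
  rw [h0, h0, Finsupp.sigma_sum, Finsupp.sigma_sum]
  refine Finset.sum_congr rfl fun a _ => ?_
  set q := Finsupp.split (t.equivMapDomain List.equivSigmaTuple) a with hq
  have hqv : ∀ v, q v = t (List.ofFn v) := fun v => by
    rw [hq, Finsupp.split_apply, Finsupp.equivMapDomain_apply]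
    rfl
  simp only [symm_ofFn_eq, map_algebraMap_smul']
  -- The symmetry of the row allows `σ` to be transferred from `f` to the summation variable, so
  -- every permutation contributes the same sum.
  have hperm : ∀ σ : Equiv.Perm (Fin a), (q.sum fun v x =>
      koszulSign σ (fun i => 1 - deg (v i)) • x •
        twist 𝒱 (xdeg deg (List.ofFn v) + n) (f (List.ofFn (v ∘ σ)))) =
      q.sum fun v x => x • twist 𝒱 (xdeg deg (List.ofFn v) + n) (f (List.ofFn v)) := by
    intro σ
    have hs : ∀ v, q (v ∘ σ) = koszulSign σ (fun i => 1 - deg (v i)) • q v := fun v => by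
      rw [hqv, hqv, ht]
    refine Finset.sum_equiv (σ.arrowCongr (Equiv.refl ι)).symm (fun v => ?_) fun v _ => ?_
    · rw [Finsupp.mem_support_iff, Finsupp.mem_support_iff]
      change _ ↔ q (v ∘ σ) ≠ 0
      rw [hs]
      refine not_congr ⟨fun h => by rw [h, smul_zero], fun h => ?_⟩
      have := congrArg (fun x => koszulSign σ (fun i => 1 - deg (v i)) • x) h
      simpa only [smul_smul, koszulSign_mul_self, one_smul, smul_zero] using this
    · change _ = q (v ∘ σ) • twist 𝒱 (xdeg deg (List.ofFn (v ∘ σ)) + n) (f (List.ofFn (v ∘ σ)))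
      rw [hs, xdeg_ofFn_comp, smul_assoc]
  have hc : ∀ (c : ℚ) (x : k) (y : V), x • algebraMap ℚ k c • y = algebraMap ℚ k c • x • y :=
    fun c x y => map_algebraMap_smul' (smulAddHom k V x) c y
  simp only [permSum_apply, map_sum, map_zsmul, Finsupp.sum] at hperm ⊢
  simp only [hc]
  rw [← Finset.smul_sum]
  simp only [Finset.smul_sum (s := (Finset.univ : Finset (Equiv.Perm (Fin a))))]
  rw [Finset.sum_comm]
  rw [Finset.smul_sum, ← Finset.smul_sum]
  rw [Finset.sum_congr rfl fun σ _ => (Finset.sum_congr rfl fun v _ => by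
    rw [smul_comm (q v)]).trans (hperm σ)]
  rw [Finset.sum_const, Finset.card_univ, Fintype.card_perm, Fintype.card_fin,
    inv_factorial_smul_factorial]

/-- Graded commutativity of the symmetrized product. -/
theorem symm_conv_flip {B : V →+ V →+ V} (c : ℤ)
    (hB : ∀ (p q : ℤ) (a b : V), a ∈ 𝒱 p → b ∈ 𝒱 q → B a b = c • sgn (p * q) • B b a) {p q : ℤ}
    {f g : List ι → V} (hf : HasDeg deg 𝒱 p f) (hg : HasDeg deg 𝒱 q g) :
    symm deg k (conv deg 𝒱 B f g) = c • sgn (p * q) • symm deg k (conv deg 𝒱 B g f) := by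
  have h0 : c • sgn (p * q) • symm deg k (conv deg 𝒱 B g f) =
      symm deg k (c • sgn (p * q) • conv deg 𝒱 B g f) := by
    rw [← symmHom_apply, ← symmHom_apply, map_zsmul, map_zsmul]
  have : c • sgn (p * q) • conv deg 𝒱 B g f = cut fun a b =>
      c • sgn (p * q) • B (g a) (twist 𝒱 (xdeg deg a) (f b)) := by
    funext u
    rw [Pi.smul_apply, Pi.smul_apply, conv_apply, ← zsmulAddGroupHom_apply,
      ← zsmulAddGroupHom_apply (sgn _), map_cut, map_cut]
    rfl
  rw [h0, this]
  refine symm_cut_flip deg (F := fun a b => B (f a) (twist 𝒱 (xdeg deg a) (g b))) fun a b => ?_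
  rw [twist_of_mem 𝒱 _ (hg b), twist_of_mem 𝒱 _ (hf a), map_zsmul, map_zsmul,
    hB _ _ _ _ (hf a) (hg b), smul_comm _ c, smul_comm _ c, sgn_smul_sgn_smul,
    sgn_smul_sgn_smul, sgn_smul_sgn_smul]
  congr 2
  apply sgn_congr
  simp only [Int.even_add, Int.even_mul, Int.even_sub]
  tauto

theorem symm_mul_flip (hk : IsGradedComm 𝓀) {p q : ℤ}
    {f g : List ι → k} (hf : HasDeg deg 𝓀 p f) (hg : HasDeg deg 𝓀 q g) :
    symm deg k (conv deg 𝓀 AddMonoidHom.mul f g) =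
      sgn (p * q) • symm deg k (conv deg 𝓀 AddMonoidHom.mul g f) := by
  have := symm_conv_flip (k := k) deg (B := AddMonoidHom.mul) 1 (fun p q a b ha hb => by
    rw [one_smul]
    exact hk p q a b ha hb) hf hg
  rwa [one_smul] at this

/-- Derivations map the exchange relation of two adjacent letters to null series. -/
theorem symm_der_mono_swap (hk : IsGradedComm 𝓀) {e : List ι → ι →₀ k}
    (he : IsHomogeneousGen deg 𝓀 e) (a : List ι) (x y : ι) (c : List ι) :
    symm deg k (der deg 𝓀 e (mono k (a ++ x :: y :: c))) =
      sgn ((1 - deg x) * (1 - deg y)) •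
        symm deg k (der deg 𝓀 e (mono k (a ++ y :: x :: c))) := by
  have hm := hk.isGradedBilin_mul
  set X := mono k [x] with hX
  set Y := mono k [y] with hY
  have dX : HasDeg deg 𝓀 (1 - deg x) X := (hasDeg_mono deg [x]).of_eq (by simp)
  have dY : HasDeg deg 𝓀 (1 - deg y) Y := (hasDeg_mono deg [y]).of_eq (by simp)
  have dEX : HasDeg deg 𝓀 (1 - deg x + 1) (der deg 𝓀 e X) := dX.op deg (he.rows deg) hm.smul_mem
  have dEY : HasDeg deg 𝓀 (1 - deg y + 1) (der deg 𝓀 e Y) := dY.op deg (he.rows deg) hm.smul_mem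
  set s := sgn ((1 - deg x) * (1 - deg y)) with hs
  -- `Z` is the exchange relation of the two letters. Both `Z` and `∂ Z` symmetrize to zero; since
  -- the kernel of symmetrization is an ideal (`left`, `right`), so does `∂` of the product of `Z`
  -- with monomials on both sides.
  set Z := conv deg 𝓀 AddMonoidHom.mul X Y - s • conv deg 𝓀 AddMonoidHom.mul Y X with hZ
  have dZ : HasDeg deg 𝓀 (1 - deg x + (1 - deg y)) Z :=
    (dX.conv deg hm dY).sub (((dY.conv deg hm dX).of_eq (add_comm _ _)).zsmul s)
  let S := symmHom (V := k) deg k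
  have hS : ∀ f, S f = symm deg k f := fun f => rfl
  have hDadd : ∀ f, der deg 𝓀 e f = opHom deg 𝓀 (derRows deg e) f := fun f => rfl
  have z1 : S Z = 0 := by
    rw [hZ, map_sub, map_zsmul, hS, hS, symm_mul_flip deg hk dX dY, sub_self]
  have z2 : S (der deg 𝓀 e Z) = 0 := by
    rw [hZ, hDadd, map_sub, map_zsmul, ← hDadd, ← hDadd, der_conv deg he hm, der_conv deg he hm,
      dX.totalParity_eq, dY.totalParity_eq]
    simp only [← hconvHom_apply, conv_eq_hconv, map_zsmul, AddMonoidHom.zsmul_apply, map_sub,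
      map_add]
    simp only [hconvHom_apply, ← conv_eq_hconv, hS]
    rw [symm_mul_flip deg hk dEX dY, symm_mul_flip deg hk dX dEY, smul_add, sgn_smul_sgn_smul, hs,
      sgn_smul_sgn_smul]
    rw [sgn_congr (a := (1 - deg x + 1) * (1 - deg y))
      (b := (1 - deg x) * (1 - deg y) + (1 - deg y)), sgn_congr
      (a := 1 - deg x + (1 - deg x) * (1 - deg y + 1)) (b := (1 - deg x) * (1 - deg y))]
    · abel
    all_goals
      simp only [Int.even_add, Int.even_mul, Int.even_sub, Int.not_even_one]
      tauto
  have left : ∀ f g, S f = 0 → S (conv deg 𝓀 AddMonoidHom.mul f g) = 0 := fun f g h => by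
    rw [hS, conv_eq_hconv, ← symm_hconv_left, ← hS f, h, ← hconvHom_apply, map_zero,
      AddMonoidHom.zero_apply, ← hS, map_zero]
  have right : ∀ f g, S g = 0 → S (conv deg 𝓀 AddMonoidHom.mul f g) = 0 := fun f g h => by
    rw [hS, conv_eq_hconv, ← symm_hconv_right, ← hS g, h, ← hconvHom_apply, map_zero, ← hS,
      map_zero]
  have z4 : S (der deg 𝓀 e (conv deg 𝓀 AddMonoidHom.mul (mono k a) Z)) = 0 := by
    rw [der_conv deg he hm, map_add, right _ _ z1, right _ _ z2, add_zero]
  have z5 : S (der deg 𝓀 e (conv deg 𝓀 AddMonoidHom.mul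
      (conv deg 𝓀 AddMonoidHom.mul (mono k a) Z) (mono k c))) = 0 := by
    rw [der_conv deg he hm, map_add, left _ _ z4, left, add_zero]
    rw [((hasDeg_mono deg a).conv deg hm dZ).totalParity_eq, map_zsmul, right _ _ z1, smul_zero]
  have e1 : conv deg 𝓀 AddMonoidHom.mul (conv deg 𝓀 AddMonoidHom.mul (mono k a) Z) (mono k c) =
      mono k (a ++ x :: y :: c) - s • mono k (a ++ y :: x :: c) := by
    rw [hZ, hX, hY, mono_append, mono_append, conv_eq_hconv, conv_eq_hconv]
    simp only [← hconvHom_apply, map_zsmul, AddMonoidHom.zsmul_apply, map_sub,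
      AddMonoidHom.sub_apply]
    simp only [hconvHom_apply, ← conv_eq_hconv, mono_append]
    simp
  rw [e1, hDadd, map_sub, map_zsmul, map_sub, map_zsmul, sub_eq_zero] at z5
  exact z5

/-- The entries of the row are coefficients of symmetrized images of monomials, so that the
compatibility of `∂` with the exchange relations becomes symmetry in the input word. -/
theorem isSymm_symm_derRows (hk : IsGradedComm 𝓀) {e : List ι → ι →₀ k}
    (he : IsHomogeneousGen deg 𝓀 e) (u : List ι) :
    IsSymm deg ⇑(symm deg k (derRows deg e) u) := by
  have h : ∀ w, symm deg k (derRows deg e) u w = symm deg k (der deg 𝓀 e (mono k w)) u := by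
    intro w
    rw [der, symm_op, op_mono]
  refine isSymm_of_swap deg fun a x y c => ?_
  rw [h, h, symm_der_mono_swap deg hk he]
  rfl

/-- Symmetrizing the output makes the rows symmetric in the input too, and a symmetric row does not
distinguish `f` from its symmetrization. Hence the derivation descends to `S̄(s H^t)` seen as a
quotient of the tensor algebra. -/
theorem symm_der (hk : IsGradedComm 𝓀) {e : List ι → ι →₀ k}
    (he : IsHomogeneousGen deg 𝓀 e) (f : List ι → V) :
    symm deg k (der deg 𝒱 e (symm deg k f)) = symm deg k (der deg 𝒱 e f) := by
  funext u
  rw [der, der, symm_op, symm_op, op_eq_evalRow, op_eq_evalRow,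
    evalRow_symm deg _ (isSymm_symm_derRows deg hk he u)]

end SymmOperators

/-! ### The identity and the symmetrization -/

section Proj

variable {ι : Type*} (deg : ι → ℤ) (s : Bool)
variable {k : Type*} [Ring k] [Algebra ℚ k] {𝓀 : ℤ → AddSubgroup k} [GradedRing 𝓀]
variable {U W : Type*} [AddCommGroup U] [Module k U] [AddCommGroup W] [Module k W]
variable {V : Type*} [AddCommGroup V] [Module k V] {𝒱 : ℤ → AddSubgroup V}
  [DirectSum.Decomposition 𝒱]

variable (k) in
/-- The identity (for `s = false`), or the symmetrization (for `s = true`). -/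
def proj {V : Type*} [AddCommGroup V] [Module k V] : (List ι → V) →+ (List ι → V) :=
  if s then symmHom deg k else AddMonoidHom.id _

variable (k) in
@[simp] theorem proj_true (f : List ι → V) : proj deg true k f = symm deg k f := rfl

variable (k) in
@[simp] theorem proj_false (f : List ι → V) : proj deg false k f = f := rfl

theorem proj_proj (f : List ι → V) : proj deg s k (proj deg s k f) = proj deg s k f := by
  cases s
  · rfl
  · exact symm_symm deg f

theorem proj_hconv_left (B : U →+ V →+ W) (f : List ι → U) (g : List ι → V) :
    proj deg s k (hconv deg 𝒱 B (proj deg s k f) g) = proj deg s k (hconv deg 𝒱 B f g) := by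
  cases s
  · rfl
  · exact symm_hconv_left deg B f g

theorem proj_hconv_right (B : U →+ V →+ W) (f : List ι → U) (g : List ι → V) :
    proj deg s k (hconv deg 𝒱 B f (proj deg s k g)) = proj deg s k (hconv deg 𝒱 B f g) := by
  cases s
  · rfl
  · exact symm_hconv_right deg B f g

theorem proj_der (hk : IsGradedComm 𝓀) {e : List ι → ι →₀ k}
    (he : IsHomogeneousGen deg 𝓀 e) (f : List ι → V) :
    proj deg s k (der deg 𝒱 e (proj deg s k f)) = proj deg s k (der deg 𝒱 e f) := by
  cases s
  · rfl
  · exact symm_der deg hk he f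

theorem proj_op (t : List ι → List ι →₀ k) (f : List ι → V) :
    proj deg s k (op deg 𝒱 t f) = op deg 𝒱 (proj deg s k t) f := by
  cases s
  · rfl
  · exact symm_op deg t f

theorem map_proj (φ : V →+ W) (f : List ι → V) (u : List ι) :
    φ (proj deg s k f u) = proj deg s k (fun w => φ (f w)) u := by
  cases s
  · rfl
  · exact map_symm deg φ f u

theorem proj_congr {f g : List ι → V} {u : List ι}
    (h : ∀ w : List ι, w.length = u.length → f w = g w) :
    proj deg s k f u = proj deg s k g u := by
  cases s
  · exact h u rfl
  · exact symm_congr deg h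

theorem proj_apply_eq_zero {f : List ι → V} {u : List ι}
    (h : ∀ w : List ι, w.length = u.length → f w = 0) : proj deg s k f u = 0 := by
  rw [proj_congr deg s (g := 0) h, map_zero, Pi.zero_apply]

theorem VanishBelow.proj {n : ℕ} {f : List ι → V} (h : VanishBelow n f) :
    VanishBelow n (proj deg s k f) := fun _ hu =>
  proj_apply_eq_zero deg s fun w hw => h w (hw ▸ hu)

theorem HasDeg.proj (hV : GradedSMulMem 𝓀 𝒱) {p : ℤ} {f : List ι → V}
    (hf : HasDeg deg 𝒱 p f) : HasDeg deg 𝒱 p (proj deg s k f) := by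
  cases s
  · exact hf
  · exact hf.symm deg hV

/-- Additive maps preserve the series which are fixed by `proj`. -/
theorem proj_map_of_fixed {f : List ι → V} (hf : ChenHPT.proj deg s k f = f) (φ : V →+ W) :
    ChenHPT.proj deg s k (fun u => φ (f u)) = fun u => φ (f u) := by
  funext u
  rw [← map_proj, hf]

end Proj

/-! ### Cohomological splittings -/

section Splitting

variable {k : Type*} [Ring k] {𝓀 : ℤ → AddSubgroup k} [GradedRing 𝓀]
variable {V : Type*} [AddCommGroup V] [Module k V] {𝒱 : ℤ → AddSubgroup V}
  [DirectSum.Decomposition 𝒱] {d : V →ₛₗ[koszul 𝓀] V} {H M : Submodule k V}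

theorem IsCohSplitting.unique (hs : IsCohSplitting 𝒱 d H M) {h x y h' x' y' : V} (hh : h ∈ H)
    (hx : x ∈ M) (hy : y ∈ M) (hh' : h' ∈ H) (hx' : x' ∈ M) (hy' : y' ∈ M)
    (e : h + d x + y = h' + d x' + y') : h = h' ∧ x = x' ∧ y = y' := by
  have := hs.independent (h - h') (H.sub_mem hh hh') (x - x') (M.sub_mem hx hx') (y - y')
    (M.sub_mem hy hy') (by
      rw [map_sub]
      calc h - h' + (d x - d x') + (y - y') = (h + d x + y) - (h' + d x' + y') := by abel
        _ = 0 := by rw [e, sub_self])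
  exact ⟨sub_eq_zero.1 this.1, sub_eq_zero.1 (hs.injOn _ (M.sub_mem hx hx') this.2.1),
    sub_eq_zero.1 this.2.2⟩

/-- The operators `projH` and `opQ` are chosen by `epsilon`; uniqueness of the decomposition makes
any decomposition compute them. -/
theorem IsCohSplitting.projH_eq (hs : IsCohSplitting 𝒱 d H M) {a h x y : V} (hh : h ∈ H)
    (hx : x ∈ M) (hy : y ∈ M) (e : a = h + d x + y) : projH d H M a = h := by
  have key : ∃ h, h ∈ H ∧ ∃ x ∈ M, ∃ y ∈ M, a = h + d x + y := ⟨h, hh, x, hx, y, hy, e⟩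
  obtain ⟨h1, x', hx', y', hy', e'⟩ := Classical.epsilon_spec key
  exact (hs.unique h1 hx' hy' hh hx hy (e'.symm.trans e)).1

theorem IsCohSplitting.opQ_eq (hs : IsCohSplitting 𝒱 d H M) {a h x y : V} (hh : h ∈ H)
    (hx : x ∈ M) (hy : y ∈ M) (e : a = h + d x + y) : opQ d H M a = x := by
  have key : ∃ x, x ∈ M ∧ ∃ h ∈ H, ∃ y ∈ M, a = h + d x + y := ⟨x, hx, h, hh, y, hy, e⟩
  obtain ⟨h1, h', hh', y', hy', e'⟩ := Classical.epsilon_spec key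
  exact (hs.unique hh' h1 hy' hh hx hy (e'.symm.trans e)).2.1

theorem IsCohSplitting.exists_eq (hs : IsCohSplitting 𝒱 d H M) (a : V) :
    projH d H M a ∈ H ∧ opQ d H M a ∈ M ∧
      ∃ y ∈ M, a = projH d H M a + d (opQ d H M a) + y := by
  obtain ⟨h, hh, x, hx, y, hy, e⟩ := hs.span a
  rw [hs.projH_eq hh hx hy e, hs.opQ_eq hh hx hy e]
  exact ⟨hh, hx, y, hy, e⟩

/-- `projH` as an additive map. -/
def IsCohSplitting.projHom (hs : IsCohSplitting 𝒱 d H M) : V →+ H :=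
  AddMonoidHom.mk' (fun a => ⟨projH d H M a, (hs.exists_eq a).1⟩) fun a b => by
    obtain ⟨h1, x1, y1, m1, e1⟩ := hs.exists_eq a
    obtain ⟨h2, x2, y2, m2, e2⟩ := hs.exists_eq b
    ext
    refine hs.projH_eq (H.add_mem h1 h2) (M.add_mem x1 x2) (M.add_mem m1 m2) ?_
    conv_lhs => rw [e1, e2]
    rw [map_add]
    change _ = projH d H M a + projH d H M b + _ + _
    abel

/-- `opQ` as an additive map. -/
def IsCohSplitting.opQHom (hs : IsCohSplitting 𝒱 d H M) : V →+ V :=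
  AddMonoidHom.mk' (opQ d H M) fun a b => by
    obtain ⟨h1, x1, y1, m1, e1⟩ := hs.exists_eq a
    obtain ⟨h2, x2, y2, m2, e2⟩ := hs.exists_eq b
    refine hs.opQ_eq (H.add_mem h1 h2) (M.add_mem x1 x2) (M.add_mem m1 m2) ?_
    conv_lhs => rw [e1, e2]
    rw [map_add]
    abel

theorem IsCohSplitting.projHom_coe (hs : IsCohSplitting 𝒱 d H M) (a : V) :
    (hs.projHom a : V) = projH d H M a := rfl

variable (𝒱) in
/-- The projection to the component of degree `n`. -/
def component (n : ℤ) : V →+ V :=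
  (𝒱 n).subtype.comp ((DFinsupp.evalAddMonoidHom n).comp
    (DirectSum.decomposeAddEquiv 𝒱).toAddMonoidHom)

variable (𝒱) in
theorem component_mem (n : ℤ) (v : V) : component 𝒱 n v ∈ 𝒱 n := SetLike.coe_mem _

theorem component_of_mem {n : ℤ} {v : V} (hv : v ∈ 𝒱 n) : component 𝒱 n v = v :=
  DirectSum.decompose_of_mem_same 𝒱 hv

theorem component_of_mem_ne {n m : ℤ} {v : V} (hv : v ∈ 𝒱 n) (h : n ≠ m) :
    component 𝒱 m v = 0 :=
  DirectSum.decompose_of_mem_ne 𝒱 hv h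

theorem component_map (hd : ∀ (p : ℤ) (a : V), a ∈ 𝒱 p → d a ∈ 𝒱 (p + 1)) (n : ℤ) (v : V) :
    component 𝒱 (n + 1) (d v) = d (component 𝒱 n v) := by
  refine addHom_ext_homogeneous 𝒱 (φ := (component 𝒱 (n + 1)).comp d.toAddMonoidHom)
    (ψ := d.toAddMonoidHom.comp (component 𝒱 n)) (fun p v hv => ?_) v
  simp only [AddMonoidHom.comp_apply, LinearMap.toAddMonoidHom_coe]
  by_cases h : p = n
  · subst h
    rw [component_of_mem hv, component_of_mem (hd _ _ hv)]
  · rw [component_of_mem_ne hv h, component_of_mem_ne (hd _ _ hv) (by omega), map_zero]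

/-- Taking components of the right degrees in the decomposition of `a` yields another decomposition,
because `H` and `M` are graded and `d` has degree one. Uniqueness identifies the two. -/
theorem IsCohSplitting.mem_of_mem (hs : IsCohSplitting 𝒱 d H M)
    (hd : ∀ (p : ℤ) (a : V), a ∈ 𝒱 p → d a ∈ 𝒱 (p + 1)) {p : ℤ} {a : V} (ha : a ∈ 𝒱 p) :
    projH d H M a ∈ 𝒱 p ∧ opQ d H M a ∈ 𝒱 (p - 1) := by
  obtain ⟨h, x, y, m, e⟩ := hs.exists_eq a
  have e' := congrArg (component 𝒱 p) e
  have hp : component 𝒱 p (d (opQ d H M a)) = d (component 𝒱 (p - 1) (opQ d H M a)) := by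
    rw [← component_map hd, sub_add_cancel]
  rw [map_add, map_add, component_of_mem ha, hp] at e'
  have hh := hs.homogeneous_H _ h p
  have hx := hs.homogeneous_M _ x (p - 1)
  have hy := hs.homogeneous_M _ m p
  have h1 := hs.projH_eq hh hx hy e'
  have h2 := hs.opQ_eq hh hx hy e'
  rw [h1, h2]
  exact ⟨SetLike.coe_mem _, SetLike.coe_mem _⟩

/-- If each coordinate is replaced by its component of degree `p - deg i`, the sum is still `h`,
since `h` is homogeneous of degree `p`; so the coordinates were homogeneous already. -/
theorem repr_mem {ι : Type*} {deg : ι → ℤ} (hV : GradedSMulMem 𝓀 𝒱) (α : Module.Basis ι k H)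
    (hα : ∀ j, (α j : V) ∈ 𝒱 (deg j)) {p : ℤ} {h : H} (hh : (h : V) ∈ 𝒱 p) (j : ι) :
    α.repr h j ∈ 𝓀 (p - deg j) := by
  classical
  have key : ∀ x : H, (x : V) = (α.repr x).sum fun i c => c • (α i : V) := fun x => by
    conv_lhs => rw [← α.linearCombination_repr x, Finsupp.linearCombination_apply]
    rw [Finsupp.sum, Finsupp.sum, Submodule.coe_sum]
    rfl
  let g : ι →₀ k := Finsupp.onFinset (α.repr h).support
    (fun i => component 𝓀 (p - deg i) (α.repr h i)) fun i hi => by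
      rw [Finsupp.mem_support_iff]
      intro h0
      rw [h0, map_zero] at hi
      exact hi rfl
  have hg : α.repr.symm g = h := by
    apply Subtype.ext
    rw [key, LinearEquiv.apply_symm_apply]
    refine (Finsupp.onFinset_sum (g := fun i c => c • (α i : V)) _ fun i => zero_smul k _).trans ?_
    have e := congrArg (component 𝒱 p) (key h)
    rw [component_of_mem hh, Finsupp.sum, map_sum] at e
    rw [e]
    refine Finset.sum_congr rfl fun i _ => ?_
    refine (addHom_ext_homogeneous 𝓀
      (φ := (component 𝒱 p).comp ((smulAddHom k V).flip (α i : V)))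
      (ψ := ((smulAddHom k V).flip (α i : V)).comp (component 𝓀 (p - deg i)))
      (fun q x hx => ?_) (α.repr h i)).symm
    simp only [AddMonoidHom.comp_apply, AddMonoidHom.flip_apply, smulAddHom_apply]
    have hm := hV _ _ _ _ hx (hα i)
    by_cases hq : q = p - deg i
    · subst hq
      rw [component_of_mem hx, component_of_mem]
      rwa [sub_add_cancel] at hm
    · rw [component_of_mem_ne hx hq, zero_smul, component_of_mem_ne hm (by omega)]
  rw [← hg, LinearEquiv.apply_symm_apply]
  exact component_mem 𝓀 _ _

end Splitting

/-! ### Chen's construction -/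

section Chen

variable {ι : Type*} (deg : ι → ℤ) (s : Bool)
variable {k : Type*} [Ring k] [Algebra ℚ k] {𝓀 : ℤ → AddSubgroup k} [GradedRing 𝓀]
variable {V : Type*} [AddCommGroup V] [Module k V] {𝒱 : ℤ → AddSubgroup V}
  [DirectSum.Decomposition 𝒱]

/-- Strong recursion on the length of words. -/
theorem exists_rec_length {X : Type*} [Zero X] (Φ : (List ι → X) → List ι → X) :
    ∃ g : List ι → X, ∀ u, g u = Φ (fun w => if w.length < u.length then g w else 0) u := by
  let F : (u : List ι) → ((w : List ι) → w.length < u.length → X) → X := fun u ih =>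
    Φ (fun w => if h : w.length < u.length then ih w h else 0) u
  have wf : WellFounded fun w u : List ι => w.length < u.length :=
    (measure List.length).wf
  refine ⟨wf.fix F, fun u => ?_⟩
  rw [wf.fix_eq]
  simp only [F, dite_eq_ite]

theorem trunc_of_le {X : Type*} [AddCommGroup X] {n : ℕ} {f : List ι → X} {u : List ι}
    (h : u.length ≤ n) : trunc n f u = f u := if_pos h

theorem trunc_of_lt {X : Type*} [AddCommGroup X] {n : ℕ} {f : List ι → X} {u : List ι}
    (h : n < u.length) : trunc n f u = 0 := if_neg (by omega)

theorem proj_of_length_le_one (f : List ι → V) {u : List ι} (hu : u.length ≤ 1) :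
    proj deg s k f u = f u := by
  cases s
  · rfl
  · rw [proj_congr deg true (g := trunc 1 f) fun w hw => (trunc_of_le (hw ▸ hu)).symm, proj_true,
      symm_eq_self deg (f := trunc 1 f) (isSymm_of_length_le_one deg fun w hw => trunc_of_lt hw),
      trunc_of_le hu]

/-- The function `xdeg` is constant on the permutations of a word, so maps depending on the word
only through it commute with symmetrization. -/
theorem proj_map_xdeg {W : Type*} [AddCommGroup W] [Module k W] (φ : ℤ → V →+ W)
    (f : List ι → V) (u : List ι) :
    proj deg s k (fun w => φ (xdeg deg w) (f w)) u = φ (xdeg deg u) (proj deg s k f u) := by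
  cases s
  · rfl
  · refine congrFun (funext_ofFn (f := symm deg k fun w => φ (xdeg deg w) (f w))
      (g := fun u => φ (xdeg deg u) (symm deg k f u)) fun n v => ?_) u
    simp only [symm_ofFn_eq, map_algebraMap_smul', permSum_apply, map_sum, map_zsmul,
      xdeg_ofFn_comp]

variable (𝒱) in
/-- The curvature `∂ ω + d ω + B(ω, ω)`, for the derivation with the coefficients `e`. -/
def curv (B : V →+ V →+ V) (d : V →ₛₗ[koszul 𝓀] V) (e : List ι → ι →₀ k) (ω : List ι → V) :
    List ι → V :=
  proj deg s k (der deg 𝒱 e ω) + (fun u => d (ω u)) + proj deg s k (conv deg 𝒱 B ω ω)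

variable (𝓀 𝒱) in
/-- The outcome of Chen's induction. -/
structure IsChenData (B : V →+ V →+ V) (d : V →ₛₗ[koszul 𝓀] V) (H M : Submodule k V)
    (α : Module.Basis ι k H) (e : List ι → ι →₀ k) (ω : List ι → V) : Prop where
  gen_homogeneous : IsHomogeneousGen deg 𝓀 e
  gen_fixed : proj deg s k e = e
  gen_short : ∀ u : List ι, u.length ≤ 1 → e u = 0
  omega_deg : HasDeg deg 𝒱 1 ω
  omega_fixed : proj deg s k ω = ω
  omega_nil : ω [] = 0
  omega_one : ∀ j, ω [j] = α j
  step_gen : ∀ n : ℕ, 1 ≤ n → ∀ u : List ι, u.length = n + 1 →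
    (e u).sum (fun j x => x • twist 𝒱 (1 - deg j + xdeg deg u) (α j : V)) =
      -projH d H M (curv deg s 𝒱 B d (trunc n e) (trunc n ω) u)
  step_omega : ∀ n : ℕ, 1 ≤ n → ∀ u : List ι, u.length = n + 1 →
    ω u = -opQ d H M (curv deg s 𝒱 B d (trunc n e) (trunc n ω) u)

/-- The coordinates of `h` in the basis, with the signs which turn them into coefficients of a
derivation. -/
def coefHom {H : Submodule k V} (α : Module.Basis ι k H) (n : ℤ) : H →+ (ι →₀ k) :=
  (Finsupp.liftAddHom fun j => sgn (deg j * n) • Finsupp.singleAddHom j).comp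
    α.repr.toLinearMap.toAddMonoidHom

theorem coefHom_eq {H : Submodule k V} (α : Module.Basis ι k H) (n : ℤ) (h : H) :
    coefHom deg α n h = (α.repr h).sum fun j x => sgn (deg j * n) • Finsupp.single j x := rfl

theorem coefHom_apply {H : Submodule k V} (α : Module.Basis ι k H) (n : ℤ) (h : H) (j : ι) :
    coefHom deg α n h j = sgn (deg j * n) • α.repr h j := by
  classical
  rw [coefHom_eq, Finsupp.sum, Finsupp.finsetSum_apply, Finset.sum_eq_single j]
  · simp
  · intro i _ hi
    simp [Finsupp.single_eq_of_ne (Ne.symm hi)]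
  · intro hj
    rw [Finsupp.notMem_support_iff.1 hj]
    simp

/-- The signs in `coefHom` cancel the twists with which an operator acts on the `α j`. With these
coefficients `∂_[n+1] ω_[1]` takes the prescribed value in `H`. -/
theorem sum_coefHom {H : Submodule k V} (α : Module.Basis ι k H)
    (hα : ∀ j, (α j : V) ∈ 𝒱 (deg j)) (n : ℤ) (h : H) :
    (coefHom deg α n h).sum (fun j x => x • twist 𝒱 (1 - deg j + n) (α j : V)) = h := by
  have h1 : (coefHom deg α n h).sum (fun j x => x • twist 𝒱 (1 - deg j + n) (α j : V)) =
      (Finsupp.liftAddHom fun j => (smulAddHom k V).flip (twist 𝒱 (1 - deg j + n) (α j : V)))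
        (coefHom deg α n h) := rfl
  rw [h1, coefHom_eq, Finsupp.sum, map_sum]
  conv_rhs => rw [← α.linearCombination_repr h, Finsupp.linearCombination_apply, Finsupp.sum,
    Submodule.coe_sum]
  refine Finset.sum_congr rfl fun j _ => ?_
  rw [map_zsmul,
    Finsupp.liftAddHom_apply_single, AddMonoidHom.flip_apply, smulAddHom_apply,
    twist_of_mem 𝒱 _ (hα j), smul_comm _ (sgn _), sgn_smul_sgn_smul, sgn_of_even, one_smul]
  · rfl
  · simp only [Int.even_add, Int.even_mul, Int.even_sub, Int.not_even_one]
    tauto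

theorem HasDeg.curv {B : V →+ V →+ V} (hB : IsGradedBilin 𝓀 𝒱 B) {d : V →ₛₗ[koszul 𝓀] V}
    (hd : ∀ (p : ℤ) (a : V), a ∈ 𝒱 p → d a ∈ 𝒱 (p + 1)) {e : List ι → ι →₀ k}
    (he : IsHomogeneousGen deg 𝓀 e) {ω : List ι → V} (hω : HasDeg deg 𝒱 1 ω) :
    HasDeg deg 𝒱 2 (curv deg s 𝒱 B d e ω) := by
  refine ((HasDeg.proj deg s hB.smul_mem ((hω.op deg (he.rows deg) hB.smul_mem).of_eq
    (by norm_num))).add fun u => ?_).add (HasDeg.proj deg s hB.smul_mem ((hω.conv deg hB hω).of_eq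
      (by norm_num)))
  have := hd _ _ (hω u)
  rwa [show 1 - xdeg deg u + 1 = 2 - xdeg deg u by ring] at this

theorem proj_curv {B : V →+ V →+ V} {d : V →ₛₗ[koszul 𝓀] V} {e : List ι → ι →₀ k}
    {ω : List ι → V} (hω : proj deg s k ω = ω) :
    proj deg s k (curv deg s 𝒱 B d e ω) = curv deg s 𝒱 B d e ω := by
  rw [curv, map_add, map_add, proj_proj, proj_proj]
  congr 2
  exact proj_map_of_fixed deg s hω d.toAddMonoidHom

/-- At a word of length `n + 1` the curvature is formed from the truncations, which involve shorter
words only, so recursion on the length defines `e` and `ω` together. Degrees and invariance under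
`proj` follow by a simultaneous induction. -/
theorem exists_isChenData {B : V →+ V →+ V} (hB : IsGradedBilin 𝓀 𝒱 B) {d : V →ₛₗ[koszul 𝓀] V}
    (hd : ∀ (p : ℤ) (a : V), a ∈ 𝒱 p → d a ∈ 𝒱 (p + 1)) {H M : Submodule k V}
    (hs : IsCohSplitting 𝒱 d H M) (α : Module.Basis ι k H) (hα : ∀ j, (α j : V) ∈ 𝒱 (deg j)) :
    ∃ (e : List ι → ι →₀ k) (ω : List ι → V), IsChenData deg s 𝓀 𝒱 B d H M α e ω := by
  let Γ : (List ι → V × (ι →₀ k)) → List ι → V := fun G =>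
    curv deg s 𝒱 B d (fun w => (G w).2) fun w => (G w).1
  -- The words of length zero and one carry the initial values. There `e` is zero, which encodes
  -- `∂_[0] = ∂_[1] = 0`, so that `∂` strictly raises the length.
  let Φ : (List ι → V × (ι →₀ k)) → List ι → V × (ι →₀ k) := fun G u =>
    match u with
    | [] => 0
    | [j] => (α j, 0)
    | i :: j :: u => (-opQ d H M (Γ G (i :: j :: u)),
        -coefHom deg α (xdeg deg (i :: j :: u)) (hs.projHom (Γ G (i :: j :: u))))
  obtain ⟨g, hg⟩ := exists_rec_length Φ
  set e : List ι → ι →₀ k := fun w => (g w).2 with he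
  set ω : List ι → V := fun w => (g w).1 with hω
  have hg0 : g [] = 0 := by rw [hg]
  have hg1 : ∀ j, g [j] = (↑(α j), 0) := fun j => by rw [hg]
  have hg2 : ∀ n : ℕ, 1 ≤ n → ∀ u : List ι, u.length = n + 1 →
      g u = (-opQ d H M (curv deg s 𝒱 B d (trunc n e) (trunc n ω) u),
        -coefHom deg α (xdeg deg u) (hs.projHom (curv deg s 𝒱 B d (trunc n e) (trunc n ω) u))) := by
    intro n hn u hu
    have e1 : (fun w => (if w.length < u.length then g w else 0).2) = trunc n e := by
      funext w
      by_cases h : w.length ≤ n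
      · rw [if_pos (by omega), trunc_of_le h]
      · rw [if_neg (by omega), trunc_of_lt (by omega)]
        rfl
    have e2 : (fun w => (if w.length < u.length then g w else 0).1) = trunc n ω := by
      funext w
      by_cases h : w.length ≤ n
      · rw [if_pos (by omega), trunc_of_le h]
      · rw [if_neg (by omega), trunc_of_lt (by omega)]
        rfl
    rw [hg]
    rcases u with _ | ⟨i, _ | ⟨j, u⟩⟩
    · simp at hu
    · simp at hu; omega
    · simp only [Φ, Γ, e1, e2]
  have hshort : ∀ u : List ι, u.length ≤ 1 → e u = 0 := by
    intro u hu
    rcases u with _ | ⟨i, _ | ⟨j, u⟩⟩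
    · simp only [he, hg0, Prod.snd_zero]
    · simp only [he, hg1]
    · simp at hu
  have hpe : ∀ n : ℕ, 1 ≤ n → ∀ u : List ι, u.length = n + 1 → e u = -coefHom deg α (xdeg deg u)
      (hs.projHom (curv deg s 𝒱 B d (trunc n e) (trunc n ω) u)) := fun n hn u hu => by
    simp only [he]
    rw [hg2 n hn u hu]
  have hpω : ∀ n : ℕ, 1 ≤ n → ∀ u : List ι, u.length = n + 1 →
      ω u = -opQ d H M (curv deg s 𝒱 B d (trunc n e) (trunc n ω) u) := fun n hn u hu => by
    simp only [hω]
    rw [hg2 n hn u hu]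
  -- The splitting operators and the coordinates are additive and homogeneous. They therefore pass
  -- the degree and the invariance under `proj` from the curvature of the truncations on to the next
  -- length.
  have main : ∀ n : ℕ, ∀ u : List ι, u.length ≤ n → (∀ j, e u j ∈ 𝓀 (2 - deg j - xdeg deg u)) ∧
      ω u ∈ 𝒱 (1 - xdeg deg u) ∧ proj deg s k e u = e u ∧ proj deg s k ω u = ω u := by
    intro n
    induction n with
    | zero =>
      intro u hu
      obtain rfl := List.length_eq_zero_iff.1 (Nat.le_zero.1 hu)
      refine ⟨fun j => ?_, ?_, proj_of_length_le_one deg s _ (by simp),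
        proj_of_length_le_one deg s _ (by simp)⟩
      · rw [hshort [] (by simp)]
        exact AddSubgroup.zero_mem _
      · simp only [hω, hg0]
        exact AddSubgroup.zero_mem _
    | succ n ih =>
      intro u hu
      rcases Nat.lt_or_ge u.length (n + 1) with h | h
      · exact ih u (by omega)
      have hu : u.length = n + 1 := le_antisymm hu h
      rcases Nat.eq_zero_or_pos n with rfl | hn
      · refine ⟨fun j => ?_, ?_, proj_of_length_le_one deg s _ hu.le,
          proj_of_length_le_one deg s _ hu.le⟩
        · rw [hshort u hu.le]
          exact AddSubgroup.zero_mem _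
        · obtain ⟨j, rfl⟩ := List.length_eq_one_iff.1 hu
          simp only [hω, hg1]
          have := hα j
          rwa [show deg j = 1 - xdeg deg [j] by simp] at this
      · have h1 : IsHomogeneousGen deg 𝓀 (trunc n e) := fun v j => by
          by_cases h : v.length ≤ n
          · rw [trunc_of_le h]
            exact (ih v h).1 j
          · rw [trunc_of_lt (by omega)]
            exact AddSubgroup.zero_mem _
        have h2 : HasDeg deg 𝒱 1 (trunc n ω) := fun v => by
          by_cases h : v.length ≤ n
          · rw [trunc_of_le h]
            exact (ih v h).2.1
          · rw [trunc_of_lt (by omega)]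
            exact AddSubgroup.zero_mem _
        have h4 : proj deg s k (trunc n ω) = trunc n ω := by
          funext v
          by_cases h : v.length ≤ n
          · rw [trunc_of_le h, ← (ih v h).2.2.2]
            exact proj_congr deg s fun w hw => by rw [trunc_of_le (by omega)]
          · rw [trunc_of_lt (by omega)]
            exact proj_apply_eq_zero deg s fun w hw => by rw [trunc_of_lt (by omega)]
        have hΓ := h2.curv deg s hB hd h1 u
        have hΓ' := proj_curv (𝒱 := 𝒱) (B := B) (d := d) deg s (e := trunc n e) h4
        refine ⟨fun j => ?_, ?_, ?_, ?_⟩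
        · rw [hpe n hn u hu, Finsupp.neg_apply, coefHom_apply]
          refine AddSubgroup.neg_mem _ (AddSubgroup.zsmul_mem _ ?_ _)
          have := repr_mem hB.smul_mem α hα (h := hs.projHom _) (hs.mem_of_mem hd hΓ).1 j
          rwa [show 2 - xdeg deg u - deg j = 2 - deg j - xdeg deg u by ring] at this
        · rw [hpω n hn u hu]
          refine AddSubgroup.neg_mem _ ?_
          have := (hs.mem_of_mem hd hΓ).2
          rwa [show 2 - xdeg deg u - 1 = 1 - xdeg deg u by ring] at this
        · rw [proj_congr deg s (g := fun w => (-(coefHom deg α (xdeg deg w)).comp hs.projHom)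
            (curv deg s 𝒱 B d (trunc n e) (trunc n ω) w)) fun w hw => hpe n hn w (hw.trans hu),
            proj_map_xdeg deg s fun m => -(coefHom deg α m).comp hs.projHom, hΓ', hpe n hn u hu]
          rfl
        · rw [proj_congr deg s (g := fun w => (-hs.opQHom)
            (curv deg s 𝒱 B d (trunc n e) (trunc n ω) w)) fun w hw => hpω n hn w (hw.trans hu),
            ← map_proj, hΓ', hpω n hn u hu]
          rfl
  refine ⟨e, ω, fun u j => (main _ u le_rfl).1 j, funext fun u => (main _ u le_rfl).2.2.1, hshort,
    fun u => (main _ u le_rfl).2.1, funext fun u => (main _ u le_rfl).2.2.2, ?_, fun j => ?_,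
    fun n hn u hu => ?_, hpω⟩
  · simp only [hω, hg0, Prod.fst_zero]
  · simp only [hω, hg1]
  · rw [hpe n hn u hu, ← hs.projHom_coe, ← map_neg, sum_coefHom deg α hα]
    rfl

end Chen

/-! ### Vanishing of the curvature and of the square of the derivation -/

section Vanishing

variable {ι : Type*} {deg : ι → ℤ} {s : Bool}
variable {k : Type*} [Ring k] [Algebra ℚ k] {𝓀 : ℤ → AddSubgroup k} [GradedRing 𝓀]
variable {V : Type*} [AddCommGroup V] [Module k V] {𝒱 : ℤ → AddSubgroup V}
  [DirectSum.Decomposition 𝒱]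

/-- Singles out the decomposition with empty outer words, in which a derivation acts on a one-letter
word. -/
theorem cut_single (v₀ : List ι → V) (u : List ι) :
    cut (fun a => cut fun v c => if a = [] ∧ c = [] then v₀ v else 0) u = v₀ u := by
  rw [cut_eq_first, cut_eq_last, if_pos ⟨rfl, rfl⟩]
  · intro v c _ hc
    rw [if_neg fun h => hc h.2]
  · intro a b _ ha
    exact cut_eq_zero fun v c _ => if_neg fun h => ha h.1

/-- Each letter is replaced by words of length at least two, so the length grows. -/
theorem VanishBelow.der {e : List ι → ι →₀ k} (he : ∀ u : List ι, u.length ≤ 1 → e u = 0)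
    {n : ℕ} {f : List ι → V} (hf : VanishBelow n f) : VanishBelow (n + 1) (der deg 𝒱 e f) := by
  intro u hu
  rw [der_apply]
  refine cut_eq_zero fun a b hab => cut_eq_zero fun v c hvc => ?_
  rcases Nat.lt_or_ge 1 v.length with hv | hv
  · refine Finset.sum_eq_zero fun j _ => ?_
    beta_reduce
    rw [hf, map_zero, smul_zero, smul_zero]
    rw [← hab, ← hvc] at hu
    simp only [List.length_append, List.length_cons] at hu ⊢
    omega
  · rw [he v hv, Finsupp.sum_zero_index]

theorem VanishBelow.mono (u : List ι) : VanishBelow u.length (ChenHPT.mono k u) := fun w hw =>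
  mono_of_ne fun h => by rw [h] at hw; exact lt_irrefl _ hw

theorem der_mono_nil (e : List ι → ι →₀ k) : der deg 𝓀 e (mono k []) = 0 := by
  funext u
  rw [der_apply]
  refine cut_eq_zero fun a b _ => cut_eq_zero fun v c _ => Finset.sum_eq_zero fun j _ => ?_
  beta_reduce
  rw [mono_of_ne (by simp), map_zero, smul_zero, smul_zero]

/-- The cross terms cancel because `∂` reverses the total parity: the square of an odd derivation is
an even derivation. -/
theorem der_der_conv {e : List ι → ι →₀ k} (he : IsHomogeneousGen deg 𝓀 e) {B : V →+ V →+ V}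
    (hB : IsGradedBilin 𝓀 𝒱 B) (f g : List ι → V) :
    der deg 𝒱 e (der deg 𝒱 e (conv deg 𝒱 B f g)) =
      conv deg 𝒱 B (der deg 𝒱 e (der deg 𝒱 e f)) g +
        conv deg 𝒱 B f (der deg 𝒱 e (der deg 𝒱 e g)) := by
  have hadd : ∀ f g : List ι → V, der deg 𝒱 e (f + g) = der deg 𝒱 e f + der deg 𝒱 e g :=
    op_add deg _
  have hp : totalParity deg 𝒱 (der deg 𝒱 e f) = -der deg 𝒱 e (totalParity deg 𝒱 f) :=
    totalParity_op deg (he.rows deg) hB.smul_mem f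
  rw [der_conv deg he hB, hadd, der_conv deg he hB, der_conv deg he hB, hp,
    totalParity_totalParity, conv_eq_hconv deg 𝒱 B (-_), ← hconvHom_apply, map_neg,
    AddMonoidHom.neg_apply, hconvHom_apply, ← conv_eq_hconv]
  abel

/-- The square of the derivation vanishes on a monomial if it does so on the generators. -/
theorem vanishBelow_proj_der_der_mono (hk : IsGradedComm 𝓀) {e : List ι → ι →₀ k}
    (he : IsHomogeneousGen deg 𝓀 e) {n : ℕ}
    (h : ∀ j, VanishBelow n (proj deg s k (der deg 𝓀 e (der deg 𝓀 e (mono k [j])))))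
    (w : List ι) (j : ι) : VanishBelow (n + w.length)
      (proj deg s k (der deg 𝓀 e (der deg 𝓀 e (mono k (j :: w))))) := by
  induction w generalizing j with
  | nil => exact h j
  | cons i w ih =>
    have e1 : mono k (j :: i :: w) =
        conv deg 𝓀 AddMonoidHom.mul (mono k [j]) (mono k (i :: w)) := by
      rw [mono_append]
      rfl
    -- The square acts on the first letter or on the rest; `proj` is pushed into that factor, to
    -- which the hypothesis or the induction applies.
    rw [e1, der_der_conv he hk.isGradedBilin_mul, map_add, conv_eq_hconv, conv_eq_hconv,
      ← proj_hconv_left, ← proj_hconv_right deg s _ (mono k [j])]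
    have v1 := (VanishBelow.hconv deg (𝒱 := 𝓀) (B := AddMonoidHom.mul) (h j)
      (VanishBelow.mono (k := k) (i :: w))).proj deg s (k := k)
    have v2 := (VanishBelow.hconv deg (𝒱 := 𝓀) (B := AddMonoidHom.mul)
      (VanishBelow.mono (k := k) [j]) (ih i)).proj deg s (k := k)
    intro u hu
    rw [Pi.add_apply, v1 u hu, v2 u (by simp only [List.length_cons, List.length_nil] at hu ⊢; omega),
      add_zero]

theorem proj_der_der (f : List ι → V) (hV : GradedSMulMem 𝓀 𝒱) (e : List ι → ι →₀ k) :
    proj deg s k (der deg 𝒱 e (der deg 𝒱 e f)) =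
      op deg 𝒱 (proj deg s k (compRows deg 𝓀 (derRows deg e) (derRows deg e))) f := by
  rw [der, der, op_op deg hV, proj_op]

variable {B : V →+ V →+ V} {d : V →ₛₗ[koszul 𝓀] V} {H M : Submodule k V}
  {α : Module.Basis ι k H} {e : List ι → ι →₀ k} {ω : List ι → V}

theorem IsChenData.vanishBelow_omega (h : IsChenData deg s 𝓀 𝒱 B d H M α e ω) :
    VanishBelow 1 ω := fun u hu => by
  obtain rfl := List.length_eq_zero_iff.1 (Nat.lt_one_iff.1 hu)
  exact h.omega_nil

/-- In a decomposition `u = a v c` with `a` or `c` nonempty, `v` has length at most `n`, and `a j c`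
has length at most `n` unless `e v = 0`. Only `v = u`, which is `∂_[n+1] ω_[1]`, escapes the
truncations. -/
theorem IsChenData.der_eq (h : IsChenData deg s 𝓀 𝒱 B d H M α e ω) {n : ℕ} {u : List ι}
    (hu : u.length = n + 1) : der deg 𝒱 e ω u = der deg 𝒱 (trunc n e) (trunc n ω) u +
      (e u).sum fun j x => x • twist 𝒱 (1 - deg j + xdeg deg u) (α j : V) := by
  rw [der_apply, der_apply, ← cut_single (fun v => (e v).sum fun j x =>
    x • twist 𝒱 (1 - deg j + xdeg deg v) (α j : V)) u, ← cut_add]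
  refine cut_congr fun a b hab => ?_
  rw [← cut_add]
  refine cut_congr fun v c hvc => ?_
  have hl : a.length + (v.length + c.length) = n + 1 := by
    rw [← hu, ← hab, ← hvc, List.length_append, List.length_append]
  split_ifs with h0
  · obtain ⟨rfl, rfl⟩ := h0
    simp only [List.length_nil, zero_add, add_zero] at hl
    rw [trunc_of_lt (f := e) (by omega), Finsupp.sum_zero_index, zero_add]
    refine Finset.sum_congr rfl fun j _ => ?_
    simp only [xdeg_nil, zero_mul, sgn_zero, one_smul, List.nil_append, h.omega_one]
  · have hpos : 0 < a.length + c.length := by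
      by_contra hc
      exact h0 ⟨List.length_eq_zero_iff.1 (by omega), List.length_eq_zero_iff.1 (by omega)⟩
    rw [trunc_of_le (f := e) (by omega), add_zero]
    rcases Nat.lt_or_ge 1 v.length with hv | hv
    · refine Finset.sum_congr rfl fun j _ => ?_
      simp only
      rw [trunc_of_le (f := ω) (by
        simp only [List.length_append, List.length_cons]
        omega)]
    · rw [h.gen_short v hv, Finsupp.sum_zero_index, Finsupp.sum_zero_index]

/-- Since `ω` has no constant term, both factors have positive length, hence length at most `n`. -/
theorem IsChenData.conv_eq (h : IsChenData deg s 𝓀 𝒱 B d H M α e ω) {n : ℕ} {u : List ι}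
    (hu : u.length = n + 1) :
    conv deg 𝒱 B ω ω u = conv deg 𝒱 B (trunc n ω) (trunc n ω) u := by
  have h0 : trunc n ω [] = 0 := by rw [trunc_of_le (by simp), h.omega_nil]
  rw [conv_apply, conv_apply]
  refine cut_congr fun a b hab => ?_
  have hl : a.length + b.length = n + 1 := by rw [← hu, ← hab, List.length_append]
  rcases List.eq_nil_or_concat a with rfl | ha
  · rw [h.omega_nil, h0, map_zero, AddMonoidHom.zero_apply, AddMonoidHom.zero_apply]
  · rcases List.eq_nil_or_concat b with rfl | hb
    · rw [h.omega_nil, h0, map_zero, map_zero, map_zero]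
    · have ha' : 0 < a.length := by obtain ⟨x, y, rfl⟩ := ha; simp
      have hb' : 0 < b.length := by obtain ⟨x, y, rfl⟩ := hb; simp
      rw [trunc_of_le (by omega), trunc_of_le (by omega)]

/-- The curvature takes its values in `M`. -/
theorem IsChenData.curv_mem (h : IsChenData deg s 𝓀 𝒱 B d H M α e ω)
    (hs : IsCohSplitting 𝒱 d H M) (u : List ι) : curv deg s 𝒱 B d e ω u ∈ M := by
  rcases Nat.lt_or_ge u.length 2 with hu | hu
  · have h1 := ((h.vanishBelow_omega).der (deg := deg) (𝒱 := 𝒱) h.gen_short).proj deg s (k := k)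
    have h2 := (VanishBelow.hconv deg (B := B) (𝒱 := 𝒱) h.vanishBelow_omega
      h.vanishBelow_omega).proj deg s (k := k)
    have h3 : d (ω u) = 0 := by
      rcases u with _ | ⟨j, _ | ⟨i, u⟩⟩
      · rw [h.omega_nil, map_zero]
      · rw [h.omega_one]
        exact hs.le_ker (α j).2
      · simp only [List.length_cons] at hu
        omega
    rw [curv, Pi.add_apply, Pi.add_apply, h1 u hu, conv_eq_hconv, h2 u hu, h3, add_zero, add_zero]
    exact M.zero_mem
  · obtain ⟨n, hn⟩ : ∃ n, u.length = n + 1 := ⟨u.length - 1, by omega⟩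
    obtain ⟨_, _, y, hy, e1⟩ := hs.exists_eq (curv deg s 𝒱 B d (trunc n e) (trunc n ω) u)
    suffices h : curv deg s 𝒱 B d e ω u = y by rw [h]; exact hy
    have e2 : proj deg s k (der deg 𝒱 e ω) u =
        proj deg s k (der deg 𝒱 (trunc n e) (trunc n ω)) u +
          (e u).sum fun j x => x • twist 𝒱 (1 - deg j + xdeg deg u) (α j : V) := by
      rw [proj_congr deg s (g := der deg 𝒱 (trunc n e) (trunc n ω) + fun w =>
        (Finsupp.liftAddHom fun j => (smulAddHom k V).flip
          (twist 𝒱 (1 - deg j + xdeg deg w) (α j : V))) (e w)) fun w hw => h.der_eq (hw.trans hn),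
        map_add, Pi.add_apply, proj_map_xdeg deg s fun m => Finsupp.liftAddHom fun j =>
          (smulAddHom k V).flip (twist 𝒱 (1 - deg j + m) (α j : V)), h.gen_fixed]
      rfl
    have e3 : proj deg s k (conv deg 𝒱 B ω ω) u =
        proj deg s k (conv deg 𝒱 B (trunc n ω) (trunc n ω)) u :=
      proj_congr deg s fun w hw => h.conv_eq (hw.trans hn)
    have e4 : curv deg s 𝒱 B d (trunc n e) (trunc n ω) u =
        proj deg s k (der deg 𝒱 (trunc n e) (trunc n ω)) u +
          proj deg s k (conv deg 𝒱 B (trunc n ω) (trunc n ω)) u := by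
      rw [curv, Pi.add_apply, Pi.add_apply, trunc_of_lt (by omega), map_zero, add_zero]
    -- In length `n + 1` the full curvature is `Γ - Γ^H - d Q Γ`, that is, the component of `Γ` in
    -- `M`.
    have e5 : curv deg s 𝒱 B d e ω u = curv deg s 𝒱 B d (trunc n e) (trunc n ω) u +
        -projH d H M (curv deg s 𝒱 B d (trunc n e) (trunc n ω) u) +
        d (-opQ d H M (curv deg s 𝒱 B d (trunc n e) (trunc n ω) u)) := by
      rw [← h.step_gen n (by omega) u hn, ← h.step_omega n (by omega) u hn, e4, curv,
        Pi.add_apply, Pi.add_apply, e2, e3]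
      abel
    rw [e5, map_neg]
    nth_rw 1 [e1]
    abel

/-- The Bianchi identity. -/
theorem IsChenData.map_curv (h : IsChenData deg s 𝓀 𝒱 B d H M α e ω) (hk : IsGradedComm 𝓀)
    (hB : IsGradedBilin 𝓀 𝒱 B) (hd : ∀ (p : ℤ) (a : V), a ∈ 𝒱 p → d a ∈ 𝒱 (p + 1))
    (hdd : ∀ a, d (d a) = 0)
    (hdB : ∀ (p : ℤ) (a b : V), a ∈ 𝒱 p → d (B a b) = B (d a) b + sgn p • B a (d b))
    (hassoc : proj deg s k (conv deg 𝒱 B (conv deg 𝒱 B ω ω) ω) =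
      proj deg s k (conv deg 𝒱 B ω (conv deg 𝒱 B ω ω))) :
    (fun u => d (curv deg s 𝒱 B d e ω u)) =
      -proj deg s k (der deg 𝒱 e (curv deg s 𝒱 B d e ω)) +
        proj deg s k (der deg 𝒱 e (der deg 𝒱 e ω)) +
        proj deg s k (conv deg 𝒱 B (curv deg s 𝒱 B d e ω) ω) -
        proj deg s k (conv deg 𝒱 B ω (curv deg s 𝒱 B d e ω)) := by
  set Ω := curv deg s 𝒱 B d e ω with hΩ
  have he := h.gen_homogeneous
  let D := opHom deg 𝒱 (derRows deg e)
  have hD : ∀ f, der deg 𝒱 e f = D f := fun f => rfl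
  let P := proj (V := V) deg s k
  let C := hconvHom deg 𝒱 B
  have hC : ∀ f g, conv deg 𝒱 B f g = C f g := fun f g => rfl
  set dω : List ι → V := fun u => d (ω u) with hdω
  -- `d ω` is eliminated in favour of `Ω`; the cubic terms in `ω` which this creates cancel by
  -- `hassoc`.
  have e0 : dω = Ω - P (D ω) - P (C ω ω) := by
    rw [hΩ, curv]
    simp only [hD, hC, ← hdω, P]
    abel
  -- `d` anticommutes with `∂`, is a derivation of the product, and kills `d ω`.
  have e1 : (fun u => d (Ω u)) = -P (D dω) + (P (C dω ω) - P (C ω dω)) := by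
    funext u
    have p1 : d (P (D ω) u) = -P (D dω) u := by
      have := map_proj deg s (k := k) d.toAddMonoidHom (D ω) u
      simp only [LinearMap.toAddMonoidHom_coe] at this
      rw [this]
      have h2 : (fun w => d (D ω w)) = -D dω := by
        funext w
        exact map_op deg (he.rows deg) hd ω w
      rw [h2, map_neg]
      rfl
    have p2 : d (P (C ω ω) u) = (P (C dω ω) - P (C ω dω)) u := by
      have := map_proj deg s (k := k) d.toAddMonoidHom (C ω ω) u
      simp only [LinearMap.toAddMonoidHom_coe] at this
      rw [this]
      have h2 : (fun w => d (C ω ω w)) = C dω ω - C ω dω := by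
        funext w
        have := map_conv (f := ω) deg hd hdB h.omega_deg ω w
        rw [sgn_one, neg_smul, one_smul, ← sub_eq_add_neg] at this
        exact this
      rw [h2, map_sub]
    rw [hΩ, curv, Pi.add_apply, Pi.add_apply, map_add, map_add, hdd, add_zero, hD, hC, p1, p2]
    rfl
  have e2 : D (C ω ω) = C (D ω) ω - C ω (D ω) := by
    have := der_conv deg he hB ω ω
    rw [h.omega_deg.totalParity_eq, sgn_one, neg_smul, one_smul] at this
    simp only [hC, hD, map_neg, AddMonoidHom.neg_apply] at this
    rw [this, sub_eq_add_neg]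
  -- Inside a derivation or a product, `proj` may be dropped when another `proj` stands outside.
  have q1 : P (D (P (D ω))) = P (D (D ω)) := proj_der deg s hk he _
  have q2 : P (D (P (C ω ω))) = P (D (C ω ω)) := proj_der deg s hk he _
  have q3 : ∀ f g, P (C (P f) g) = P (C f g) := fun f g => proj_hconv_left deg s B f g
  have q4 : ∀ f g, P (C f (P g)) = P (C f g) := fun f g => proj_hconv_right deg s B f g
  have hassoc' : P (C (C ω ω) ω) = P (C ω (C ω ω)) := hassoc
  rw [e1]
  change _ = -P (D Ω) + P (D (D ω)) + P (C Ω ω) - P (C ω Ω)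
  rw [e0]
  simp only [map_sub, AddMonoidHom.sub_apply, q1, q2, q3, q4, hassoc']
  rw [e2, map_sub]
  abel

/-- The two vanishing statements need a joint induction: in length `n` the Bianchi identity ties `Ω`
to the `∂² (X j)`, and the splitting then separates them. -/
theorem IsChenData.curv_eq_zero_and (h : IsChenData deg s 𝓀 𝒱 B d H M α e ω)
    (hk : IsGradedComm 𝓀)
    (hB : IsGradedBilin 𝓀 𝒱 B) (hd : ∀ (p : ℤ) (a : V), a ∈ 𝒱 p → d a ∈ 𝒱 (p + 1))
    (hdd : ∀ a, d (d a) = 0)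
    (hdB : ∀ (p : ℤ) (a b : V), a ∈ 𝒱 p → d (B a b) = B (d a) b + sgn p • B a (d b))
    (hassoc : proj deg s k (conv deg 𝒱 B (conv deg 𝒱 B ω ω) ω) =
      proj deg s k (conv deg 𝒱 B ω (conv deg 𝒱 B ω ω)))
    (hs : IsCohSplitting 𝒱 d H M) (hα : ∀ j, (α j : V) ∈ 𝒱 (deg j)) (n : ℕ) :
    VanishBelow n (curv deg s 𝒱 B d e ω) ∧
      ∀ j, VanishBelow n (proj deg s k (der deg 𝓀 e (der deg 𝓀 e (mono k [j])))) := by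
  classical
  have he := h.gen_homogeneous
  induction n with
  | zero => exact ⟨fun u hu => absurd hu (by omega), fun j u hu => absurd hu (by omega)⟩
  | succ n ih =>
    obtain ⟨ih1, ih2⟩ := ih
    suffices hn : ∀ u : List ι, u.length = n → curv deg s 𝒱 B d e ω u = 0 ∧
        ∀ j, proj deg s k (der deg 𝓀 e (der deg 𝓀 e (mono k [j]))) u = 0 by
      refine ⟨fun u hu => ?_, fun j u hu => ?_⟩
      · rcases Nat.lt_or_ge u.length n with h | h
        · exact ih1 u h
        · exact (hn u (by omega)).1
      · rcases Nat.lt_or_ge u.length n with h | h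
        · exact ih2 j u h
        · exact (hn u (by omega)).2 j
    intro u hu
    set r := proj deg s k (compRows deg 𝓀 (derRows deg e) (derRows deg e)) with hr
    have hrw : ∀ w, r u w = proj deg s k (der deg 𝓀 e (der deg 𝓀 e (mono k w))) u := fun w => by
      rw [proj_der_der _ (gradedSMulMem_self 𝓀), op_mono]
    -- Only one-letter words contribute to `∂² ω` in length `n`: `∂` kills the empty word, and on a
    -- longer word the derivation `∂²` keeps at least one more letter, so its value starts beyond
    -- length `n`.
    have hr0 : ∀ w : List ι, (∀ j, w ≠ [j]) → r u w = 0 := by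
      intro w hw
      rw [hrw]
      rcases w with _ | ⟨j, _ | ⟨i, w⟩⟩
      · rw [der_mono_nil, der, ← opHom_apply, map_zero, map_zero, Pi.zero_apply]
      · exact absurd rfl (hw j)
      · refine vanishBelow_proj_der_der_mono hk he ih2 (i :: w) j u ?_
        simp only [List.length_cons]
        omega
    have b1 := congrFun (h.map_curv hk hB hd hdd hdB hassoc) u
    simp only [Pi.sub_apply, Pi.add_apply, Pi.neg_apply] at b1
    -- `∂ Ω`, `Ω ω` and `ω Ω` start in length `n + 1`, so the Bianchi identity at `u` becomes `d Ω =
    -- ∂² ω`.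
    have b2 := (VanishBelow.der (deg := deg) (𝒱 := 𝒱) h.gen_short ih1).proj deg s (k := k) u
      (by omega)
    have b3 := (VanishBelow.hconv deg (B := B) (𝒱 := 𝒱) ih1 h.vanishBelow_omega).proj deg s
      (k := k) u (by omega)
    have b4 := (VanishBelow.hconv deg (B := B) (𝒱 := 𝒱) h.vanishBelow_omega ih1).proj deg s
      (k := k) u (by omega)
    rw [b2, conv_eq_hconv, conv_eq_hconv, b3, b4, neg_zero, zero_add, add_zero, sub_zero,
      proj_der_der _ hB.smul_mem, ← hr] at b1
    have hinj : Function.Injective fun j : ι => [j] := fun a b h => by simpa using h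
    set q : ι →₀ k := (r u).comapDomain (fun j : ι => [j]) hinj.injOn with hq
    have hqj : ∀ j, q j = r u [j] := fun j => Finsupp.comapDomain_apply _ _ _ _
    -- `x` is the coefficient of `∂² ω` at `u`: the combination of the `α j` with the coefficients
    -- of `∂² (X j)` at `u`, up to signs.
    set x : H := ∑ j ∈ q.support, (q j * (sgn ((xdeg deg [j] + xdeg deg u) * deg j) : k)) • α j
      with hx
    have b5 : op deg 𝒱 r ω u = x := by
      have hb : Set.BijOn (fun j : ι => [j]) ((fun j : ι => [j]) ⁻¹' ↑(r u).support)
          ↑(r u).support := by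
        refine ⟨fun j hj => hj, hinj.injOn, fun w hw => ?_⟩
        by_contra hc
        refine (Finsupp.mem_support_iff.1 hw) (hr0 w fun j hj => hc ?_)
        subst hj
        exact ⟨j, hw, rfl⟩
      rw [op, ← Finsupp.sum_comapDomain (fun j : ι => [j]) (r u) _ hb, hx, Submodule.coe_sum]
      refine Finset.sum_congr rfl fun j _ => ?_
      simp only [Function.comp_apply]
      rw [h.omega_one, twist_of_mem 𝒱 _ (hα j), Submodule.coe_smul, mul_smul, Int.cast_smul_eq_zsmul]
    rw [b5] at b1
    -- The equation `d Ω = x` has its left side in `d M` and its right side in `H`, so both sides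
    -- are zero.
    have b6 := hs.independent (-x : V) (H.neg_mem x.2) _ (h.curv_mem hs u) 0 M.zero_mem (by
      rw [b1]
      abel)
    refine ⟨hs.injOn _ (h.curv_mem hs u) b6.2.1, fun j => ?_⟩
    have hx0 : x = 0 := Subtype.ext (neg_eq_zero.1 b6.1)
    rw [← hrw, ← hqj]
    by_contra hj
    have := linearIndependent_iff'.1 α.linearIndependent q.support _ hx0 j
      (Finsupp.mem_support_iff.2 hj)
    apply hj
    have h2 := congrArg (fun y => y * (sgn ((xdeg deg [j] + xdeg deg u) * deg j) : k)) this
    simpa only [mul_assoc, ← Int.cast_mul, sgn_mul_self, Int.cast_one, mul_one, zero_mul] using h2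

theorem IsChenData.curv_eq_zero (h : IsChenData deg s 𝓀 𝒱 B d H M α e ω)
    (hk : IsGradedComm 𝓀)
    (hB : IsGradedBilin 𝓀 𝒱 B) (hd : ∀ (p : ℤ) (a : V), a ∈ 𝒱 p → d a ∈ 𝒱 (p + 1))
    (hdd : ∀ a, d (d a) = 0)
    (hdB : ∀ (p : ℤ) (a b : V), a ∈ 𝒱 p → d (B a b) = B (d a) b + sgn p • B a (d b))
    (hassoc : proj deg s k (conv deg 𝒱 B (conv deg 𝒱 B ω ω) ω) =
      proj deg s k (conv deg 𝒱 B ω (conv deg 𝒱 B ω ω)))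
    (hs : IsCohSplitting 𝒱 d H M) (hα : ∀ j, (α j : V) ∈ 𝒱 (deg j)) :
    curv deg s 𝒱 B d e ω = 0 ∧ ∀ f : List ι → k,
      proj deg s k (der deg 𝓀 e (der deg 𝓀 e f)) = 0 := by
  have key := h.curv_eq_zero_and hk hB hd hdd hdB hassoc hs hα
  refine ⟨funext fun u => (key (u.length + 1)).1 u (Nat.lt_succ_self _), fun f => ?_⟩
  rw [proj_der_der _ (gradedSMulMem_self 𝓀)]
  funext u
  refine Finset.sum_eq_zero fun w _ => ?_
  -- Vanishing on the generators passes to all monomials, hence to the rows, and the rows determine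
  -- the operator.
  have : proj deg s k (compRows deg 𝓀 (derRows deg e) (derRows deg e)) u w = 0 := by
    rw [← op_mono deg (𝓀 := 𝓀), ← proj_der_der _ (gradedSMulMem_self 𝓀)]
    rcases w with _ | ⟨j, w⟩
    · rw [der_mono_nil, der, ← opHom_apply, map_zero, map_zero, Pi.zero_apply]
    · exact vanishBelow_proj_der_der_mono hk h.gen_homogeneous (key (u.length + 1)).2 w j u
        (by omega)
  simp only [this, zero_smul]

end Vanishing

/-! ### Derivations of the completed tensor algebra -/

section Generators

variable {ι : Type*} (deg : ι → ℤ)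
variable {k : Type*} [Ring k] {𝓀 : ℤ → AddSubgroup k} [GradedRing 𝓀]
variable {V : Type*} [AddCommGroup V] [Module k V] {𝒱 : ℤ → AddSubgroup V}
  [DirectSum.Decomposition 𝒱]

variable (k) in
/-- `derRows` as an additive map. -/
def derRowsHom : (List ι → ι →₀ k) →+ (List ι → List ι →₀ k) :=
  AddMonoidHom.mk' (derRows deg) fun e e' => by
    funext u
    rw [Pi.add_apply, derRows, derRows, derRows, ← cut_add]
    refine cut_congr fun a b _ => ?_
    rw [← cut_add]
    refine cut_congr fun v c _ => ?_
    rw [Pi.add_apply, Finsupp.sum_add_index']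
    · intro j
      rw [smul_zero, Finsupp.single_zero]
    · intro j x y
      rw [smul_add, Finsupp.single_add]

variable (𝒱) in
/-- `der` as an additive map of the coefficients. -/
def derGenHom (f : List ι → V) : (List ι → ι →₀ k) →+ (List ι → V) :=
  AddMonoidHom.mk' (fun e => der deg 𝒱 e f) fun e e' => by
    funext u
    rw [Pi.add_apply, der, der, der, op_eq_evalRow, op_eq_evalRow, op_eq_evalRow, ← map_add]
    exact congrArg _ (congrFun (map_add (derRowsHom deg k) e e') u)

variable (𝒱) in
theorem derGenHom_apply (f : List ι → V) (e : List ι → ι →₀ k) :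
    derGenHom deg 𝒱 f e = der deg 𝒱 e f := rfl

theorem der_mono_single (e : List ι → ι →₀ k) (j : ι) (u : List ι) :
    der deg 𝓀 e (mono k [j]) u = e u j := by
  rw [der_apply, ← cut_single (fun v => e v j) u]
  refine cut_congr fun a b _ => cut_congr fun v c _ => ?_
  split_ifs with h
  · obtain ⟨rfl, rfl⟩ := h
    rw [Finsupp.sum, Finset.sum_eq_single j]
    · simp [mono_self]
    · intro i _ hi
      rw [List.nil_append, mono_of_ne (by simpa using hi), map_zero, smul_zero, smul_zero]
    · intro hj
      rw [Finsupp.notMem_support_iff.1 hj, zero_smul, smul_zero]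
  · refine Finset.sum_eq_zero fun i _ => ?_
    beta_reduce
    rw [mono_of_ne, map_zero, smul_zero, smul_zero]
    intro h1
    apply h
    have := congrArg List.length h1
    simp only [List.length_append, List.length_cons, List.length_nil] at this
    exact ⟨List.length_eq_zero_iff.1 (by omega), List.length_eq_zero_iff.1 (by omega)⟩

theorem comp_of_eq {X : Type*} [AddCommGroup X] {n : ℕ} {f : List ι → X} {u : List ι}
    (h : u.length = n) : comp n f u = f u := if_pos h

theorem comp_of_ne {X : Type*} [AddCommGroup X] {n : ℕ} {f : List ι → X} {u : List ι}
    (h : u.length ≠ n) : comp n f u = 0 := if_neg h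

theorem sum_comp {X : Type*} [AddCommGroup X] (n : ℕ) (f : List ι → X) :
    ∑ i ∈ Finset.range (n + 1), comp i f = trunc n f := by
  funext u
  rw [Finset.sum_apply]
  simp only [comp, trunc, Finset.sum_ite_eq, Finset.mem_range, Nat.lt_succ_iff]

variable {deg} in
theorem IsHomogeneousGen.comp {e : List ι → ι →₀ k} (he : IsHomogeneousGen deg 𝓀 e) (n : ℕ) :
    IsHomogeneousGen deg 𝓀 (comp n e) := fun v j => by
  by_cases h : v.length = n
  · rw [comp_of_eq h]
    exact he v j
  · rw [comp_of_ne h]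
    exact AddSubgroup.zero_mem _

variable {deg} in
theorem IsHomogeneousGen.trunc {e : List ι → ι →₀ k} (he : IsHomogeneousGen deg 𝓀 e) (n : ℕ) :
    IsHomogeneousGen deg 𝓀 (trunc n e) := fun v j => by
  by_cases h : v.length ≤ n
  · rw [trunc_of_le h]
    exact he v j
  · rw [trunc_of_lt (by omega)]
    exact AddSubgroup.zero_mem _

/-- The component of the derivation of the length of the word acts on the linear part only. -/
theorem der_comp (e : List ι → ι →₀ k) (ω : List ι → V) {n : ℕ} {u : List ι}
    (hu : u.length = n) : der deg 𝒱 (comp n e) (comp 1 ω) u =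
      (e u).sum fun j x => x • twist 𝒱 (1 - deg j + xdeg deg u) (ω [j]) := by
  rw [der_apply, ← cut_single (fun v => (e v).sum fun j x =>
    x • twist 𝒱 (1 - deg j + xdeg deg v) (ω [j])) u]
  refine cut_congr fun a b hab => cut_congr fun v c hvc => ?_
  have hl : a.length + (v.length + c.length) = n := by
    rw [← hu, ← hab, ← hvc, List.length_append, List.length_append]
  split_ifs with h
  · obtain ⟨rfl, rfl⟩ := h
    simp only [List.length_nil, zero_add, add_zero] at hl
    rw [comp_of_eq (f := e) hl]
    refine Finset.sum_congr rfl fun j _ => ?_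
    simp only [xdeg_nil, zero_mul, sgn_zero, one_smul, List.nil_append]
    rw [comp_of_eq (by simp)]
  · rw [comp_of_ne (f := e), Finsupp.sum_zero_index]
    intro hv
    exact h ⟨List.length_eq_zero_iff.1 (by omega), List.length_eq_zero_iff.1 (by omega)⟩

end Generators

/-! ### The derivation of the completed tensor algebra and Chen's induction for algebras -/

section TensorAlgebra

variable {ι : Type*} {deg : ι → ℤ}
variable {k : Type*} [Ring k] {𝓀 : ℤ → AddSubgroup k} [GradedRing 𝓀]

variable (𝓀) in
/-- The derivation of the completed tensor algebra with the coefficients `e`. -/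
def derT (hk : IsGradedComm 𝓀) {e : List ι → ι →₀ k} (he : IsHomogeneousGen deg 𝓀 e) :
    (List ι → k) →ₛₗ[koszul 𝓀] (List ι → k) := opLin deg 𝓀 hk (he.rows deg)

theorem derT_apply (hk : IsGradedComm 𝓀) {e : List ι → ι →₀ k} (he : IsHomogeneousGen deg 𝓀 e)
    (f : List ι → k) : derT 𝓀 hk he f = der deg 𝓀 e f := rfl

theorem isDerivationT_derT (hk : IsGradedComm 𝓀) {e : List ι → ι →₀ k}
    (he : IsHomogeneousGen deg 𝓀 e) : IsDerivationT deg 𝓀 (derT 𝓀 hk he) where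
  degree p f hf := hf.op deg (he.rows deg) (gradedSMulMem_self 𝓀)
  leibniz p f g hf := by
    rw [derT_apply, der_conv deg he hk.isGradedBilin_mul, hf.totalParity_eq]
    congr 1
    rw [conv_eq_hconv, ← hconvHom_apply, map_zsmul, AddMonoidHom.zsmul_apply]
    rfl
  continuous u := ⟨(derRows deg e u).support, fun f hf => op_eq_zero deg hf⟩

variable {A : Type*} [AddCommGroup A] [Module k A] {𝒜 : ℤ → AddSubgroup A}
  [DirectSum.Decomposition 𝒜]

theorem extendT_derT (hk : IsGradedComm 𝓀) {e : List ι → ι →₀ k}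
    (he : IsHomogeneousGen deg 𝓀 e) (f : List ι → A) :
    extendT 𝓀 𝒜 (derT 𝓀 hk he) f = der deg 𝒜 e f :=
  extend_eq_op deg (he.rows deg) _ (fun w u => op_mono deg (derRows deg e) u w) f

theorem extendT_sum_derT (hk : IsGradedComm 𝓀) {e : List ι → ι →₀ k}
    (he : IsHomogeneousGen deg 𝓀 e) (n : ℕ) (f : List ι → A) :
    extendT 𝓀 𝒜 (∑ i ∈ Finset.range (n + 1), derT 𝓀 hk (he.comp i)) f =
      der deg 𝒜 (trunc n e) f := by
  refine extend_eq_op deg ((he.trunc n).rows deg) _ (fun w u => ?_) f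
  rw [LinearMap.sum_apply, ← op_mono deg (𝓀 := 𝓀), ← der, ← derGenHom_apply, ← sum_comp, map_sum]
  rfl

end TensorAlgebra

theorem IsDGA.isGradedBilin {k : Type*} [Ring k] {𝓀 : ℤ → AddSubgroup k} [GradedRing 𝓀]
    {A : Type*} [NonUnitalRing A] [Module k A] {𝒜 : ℤ → AddSubgroup A}
    {d : A →ₛₗ[koszul 𝓀] A} (hA : IsDGA 𝓀 𝒜 d) :
    IsGradedBilin 𝓀 𝒜 (AddMonoidHom.mul : A →+ A →+ A) where
  smul_mem := hA.smul_mem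
  mem := hA.mul_mem
  smul_left := hA.smul_mul
  smul_right := hA.mul_smul

/-- Chen's induction for a differential graded algebra. -/
theorem IsChenData.isChenT {ι : Type*} {deg : ι → ℤ} {k : Type*} [Ring k] [Algebra ℚ k]
    {𝓀 : ℤ → AddSubgroup k} [GradedRing 𝓀] (hk : IsGradedComm 𝓀)
    {A : Type*} [NonUnitalRing A] [Module k A] {𝒜 : ℤ → AddSubgroup A}
    [DirectSum.Decomposition 𝒜] {d : A →ₛₗ[koszul 𝓀] A} {H M : Submodule k A}
    {α : Module.Basis ι k H} {e : List ι → ι →₀ k} {ω : List ι → A}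
    (h : IsChenData deg false 𝓀 𝒜 AddMonoidHom.mul d H M α e ω) :
    IsChenT deg 𝓀 𝒜 d H M α ω (derT 𝓀 hk h.gen_homogeneous)
      fun n => derT 𝓀 hk (h.gen_homogeneous.comp n) where
  part_derivation n := isDerivationT_derT hk _
  part_gen n j := by
    funext u
    rw [derT_apply, derT_apply, der_mono_single, comp, comp, der_mono_single]
    split_ifs <;> rfl
  part_zero := by
    refine LinearMap.ext fun f => ?_
    have h0 : comp 0 e = 0 := funext fun u => by
      by_cases hu : u.length = 0
      · rw [comp_of_eq hu, h.gen_short u (by omega), Pi.zero_apply]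
      · rw [comp_of_ne hu, Pi.zero_apply]
    rw [derT_apply, h0, ← derGenHom_apply, map_zero, LinearMap.zero_apply]
  part_one := by
    refine LinearMap.ext fun f => ?_
    have h0 : comp 1 e = 0 := funext fun u => by
      by_cases hu : u.length = 1
      · rw [comp_of_eq hu, h.gen_short u (by omega), Pi.zero_apply]
      · rw [comp_of_ne hu, Pi.zero_apply]
    rw [derT_apply, h0, ← derGenHom_apply, map_zero, LinearMap.zero_apply]
  omega_nil := h.omega_nil
  omega_one := h.omega_one
  step n hn u hu := by
    have hc : curvT deg 𝓀 𝒜 d (∑ i ∈ Finset.range (n + 1), derT 𝓀 hk (h.gen_homogeneous.comp i))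
        (trunc n ω) = curv deg false 𝒜 AddMonoidHom.mul d (trunc n e) (trunc n ω) := by
      rw [curvT, extendT_sum_derT hk h.gen_homogeneous]
      rfl
    rw [hc, extendT_derT, der_comp deg e ω hu]
    refine ⟨?_, h.step_omega n hn u hu⟩
    rw [← h.step_gen n hn u hu]
    simp only [h.omega_one]

/-! ### The codifferential of the tensor coalgebra -/

section Coalgebra

variable {ι : Type*} (deg : ι → ℤ)
variable {k : Type*} [Ring k] (𝓀 : ℤ → AddSubgroup k) [GradedRing 𝓀]

theorem pairSign_append (u w : List ι) :
    pairSign deg (u ++ w) = sgn (xdeg deg u * xdeg deg w) * (pairSign deg u * pairSign deg w) := by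
  induction u with
  | nil => simp [pairSign]
  | cons j u ih =>
    simp only [List.cons_append, pairSign, ih, xdeg_append, xdeg_cons]
    have : sgn ((deg j - 1) * (xdeg deg u + xdeg deg w)) * sgn (xdeg deg u * xdeg deg w) =
        sgn ((1 - deg j + xdeg deg u) * xdeg deg w) * sgn ((deg j - 1) * xdeg deg u) := by
      rw [← sgn_add, ← sgn_add]
      apply sgn_congr
      simp only [Int.even_add, Int.even_mul, Int.even_sub, Int.not_even_one]
      tauto
    calc _ = (sgn ((deg j - 1) * (xdeg deg u + xdeg deg w)) * sgn (xdeg deg u * xdeg deg w)) *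
          (pairSign deg u * pairSign deg w) := by ring
      _ = _ := by rw [this]; ring

theorem pairSign_mul_self (u : List ι) : pairSign deg u * pairSign deg u = 1 := by
  induction u with
  | nil => rfl
  | cons j u ih =>
    calc _ = (sgn ((deg j - 1) * xdeg deg u) * sgn ((deg j - 1) * xdeg deg u)) *
          (pairSign deg u * pairSign deg u) := by simp only [pairSign]; ring
      _ = 1 := by rw [sgn_mul_self, ih, one_mul]

@[simp] theorem koszul_one : koszul 𝓀 (1 : k) = 1 := map_one _

section Ext

variable {X : Type*} {W : Type*} [AddCommGroup W] [Module k W]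

/-- The semilinear map with prescribed values on the basis of a free module. -/
def semilinearExt (g : X → W) : (X →₀ k) →ₛₗ[koszul 𝓀] W where
  toFun x := x.sum fun u c => koszul 𝓀 c • g u
  map_add' x y := Finsupp.sum_add_index' (fun u => by rw [map_zero, zero_smul])
    fun u a b => by rw [map_add, add_smul]
  map_smul' c x := by
    rw [Finsupp.sum_smul_index' fun u => by rw [map_zero, zero_smul], Finsupp.smul_sum]
    simp only [smul_eq_mul, map_mul, mul_smul]

theorem semilinearExt_apply (g : X → W) (x : X →₀ k) :
    semilinearExt 𝓀 g x = x.sum fun u c => koszul 𝓀 c • g u := rfl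

theorem semilinearExt_single (g : X → W) (u : X) (c : k) :
    semilinearExt 𝓀 g (Finsupp.single u c) = koszul 𝓀 c • g u := by
  rw [semilinearExt_apply, Finsupp.sum_single_index (by rw [map_zero, zero_smul])]

end Ext

/-- The sign of a coefficient of the transpose. -/
def transposeSign (u w : List ι) : ℤ :=
  -(sgn (xdeg deg w + xdeg deg w * xdeg deg u) * (pairSign deg u * pairSign deg w))

/-- The transpose of the operator with the rows `t`, on a word. -/
def transposeWord (t : List ι → List ι →₀ k) (u : List ι) : List ι →₀ k :=
  (t u).sum fun w x => Finsupp.single w (transposeSign deg u w • x)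

theorem transposeWord_apply (t : List ι → List ι →₀ k) (u w : List ι) :
    transposeWord deg t u w = transposeSign deg u w • t u w := by
  classical
  rw [transposeWord, Finsupp.sum, Finsupp.finsetSum_apply, Finset.sum_eq_single w]
  · rw [Finsupp.single_eq_same]
  · intro v _ hv
    rw [Finsupp.single_eq_of_ne (Ne.symm hv)]
  · intro hw
    rw [Finsupp.notMem_support_iff.1 hw, smul_zero, Finsupp.single_zero, Finsupp.zero_apply]

/-- The transpose of the operator with the rows `t`. -/
def transpose (t : List ι → List ι →₀ k) : (List ι →₀ k) →ₛₗ[koszul 𝓀] (List ι →₀ k) :=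
  semilinearExt 𝓀 (transposeWord deg t)

theorem transpose_single (t : List ι → List ι →₀ k) (u : List ι) (c : k) :
    transpose deg 𝓀 t (Finsupp.single u c) = koszul 𝓀 c • transposeWord deg t u :=
  semilinearExt_single 𝓀 _ u c

variable {deg} in
/-- The pairing as an additive map. -/
def pairingHom (deg : ι → ℤ) (f : List ι → k) : (List ι →₀ k) →+ k :=
  Finsupp.liftAddHom fun u => pairSign deg u •
    (AddMonoidHom.mulLeft (f u)).comp (twist 𝓀 (xdeg deg u))

theorem pairing_eq (f : List ι → k) (x : List ι →₀ k) :
    pairing deg 𝓀 f x = pairingHom 𝓀 deg f x := rfl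

theorem pairing_single (f : List ι → k) (u : List ι) (c : k) :
    pairing deg 𝓀 f (Finsupp.single u c) =
      pairSign deg u • (f u * twist 𝓀 (xdeg deg u) c) := by
  rw [pairing, Finsupp.sum_single_index]
  rw [map_zero, mul_zero, smul_zero]

variable {𝓀 deg}

/-- Both sides are additive in `x`, so a single word with a coefficient `c` suffices, and the sums
over the row `t u` are compared term by term. The coefficient has to be carried along, since the
maps are only semilinear. -/
theorem isTranspose_transpose (hk : IsGradedComm 𝓀) {t : List ι → List ι →₀ k}
    (ht : IsHomogeneousRows deg 𝓀 t) : IsTranspose deg 𝓀 (opLin deg 𝓀 hk ht) (transpose deg 𝓀 t) := by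
  classical
  intro p f x hf
  have hlin : ∀ x, pairingHom 𝓀 deg (opLin deg 𝓀 hk ht f) x =
      (-(sgn p • (pairingHom 𝓀 deg f).comp (transpose deg 𝓀 t).toAddMonoidHom)) x := by
    intro x
    refine DFunLike.congr_fun (Finsupp.addHom_ext fun u c => ?_) x
    rw [AddMonoidHom.neg_apply, AddMonoidHom.zsmul_apply, AddMonoidHom.comp_apply,
      LinearMap.toAddMonoidHom_coe, transpose_single, ← pairing_eq, ← pairing_eq, pairing_single]
    change pairSign deg u • (op deg 𝓀 t f u * _) = _
    have e1 : pairing deg 𝓀 f (koszul 𝓀 c • transposeWord deg t u) = (t u).sum fun w x =>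
        pairSign deg w • (f w * twist 𝓀 (xdeg deg w) (koszul 𝓀 c * (transposeSign deg u w • x))) := by
      rw [transposeWord, Finsupp.smul_sum, pairing_eq, Finsupp.sum, map_sum]
      refine Finset.sum_congr rfl fun w _ => ?_
      rw [Finsupp.smul_single, ← pairing_eq, pairing_single, smul_eq_mul]
    rw [e1, op, Finsupp.sum, Finsupp.sum, Finset.sum_mul, Finset.smul_sum, Finset.smul_sum,
      ← Finset.sum_neg_distrib]
    refine Finset.sum_congr rfl fun w _ => ?_
    set q := xdeg deg w + 1 - xdeg deg u with hq
    have hx : t u w ∈ 𝓀 q := ht u w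
    have hC : twist 𝓀 (xdeg deg u) c = twist 𝓀 (q + (xdeg deg w + 1)) c := by
      refine twist_congr 𝓀 ?_ c
      rw [hq]
      simp only [Int.even_add, Int.even_sub, Int.not_even_one]
      tauto
    have hR : f w * (twist 𝓀 (xdeg deg w + 1) c * t u w) = sgn ((p - xdeg deg w) * q) •
        (t u w * f w * twist 𝓀 (q + (xdeg deg w + 1)) c) := by
      rw [hk.mul_eq hx, twist_twist, ← mul_assoc, hk _ _ _ _ (hf w) hx, smul_mul_assoc]
    have hL : (t u w • sgn ((xdeg deg w + xdeg deg u) * (p - xdeg deg w)) • f w) *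
        twist 𝓀 (xdeg deg u) c = sgn ((xdeg deg w + xdeg deg u) * (p - xdeg deg w)) •
          (t u w * f w * twist 𝓀 (q + (xdeg deg w + 1)) c) := by
      rw [hC, smul_eq_mul, mul_smul_comm, smul_mul_assoc]
    rw [twist_of_mem 𝓀 _ (hf w), hL, koszul_apply, twist_mul, twist_twist, map_zsmul,
      twist_of_mem 𝓀 _ hx]
    simp only [mul_smul_comm]
    rw [hR]
    simp only [smul_smul]
    rw [← neg_smul]
    congr 1
    -- The signs depend only on the parities of `xdeg w`, `xdeg u` and `p`; the eight cases are
    -- checked.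
    have hs : sgn ((xdeg deg w + xdeg deg u) * (p - xdeg deg w)) =
        sgn (p + (xdeg deg w + xdeg deg w * xdeg deg u) + xdeg deg w * q +
          (p - xdeg deg w) * q) := by
      clear_value q
      subst hq
      apply sgn_congr
      by_cases h1 : Even (xdeg deg w) <;> by_cases h2 : Even (xdeg deg u) <;>
        by_cases h3 : Even p <;>
        simp only [Int.even_add, Int.even_mul, Int.even_sub, Int.not_even_one, h1, h2, h3] <;> decide
    rw [hs, sgn_add, sgn_add, sgn_add, transposeSign]
    have := pairSign_mul_self deg w
    linear_combination -(pairSign deg u * (sgn p * sgn (xdeg deg w + xdeg deg w * xdeg deg u) *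
      sgn (xdeg deg w * q) * sgn ((p - xdeg deg w) * q))) * this
  rw [pairing_eq, pairing_eq]
  exact hlin x

end Coalgebra

/-! ### Square zero and the coderivation property of the transpose -/

section Coalgebra

variable {ι : Type*} {deg : ι → ℤ}
variable {k : Type*} [Ring k] {𝓀 : ℤ → AddSubgroup k} [GradedRing 𝓀]

theorem koszul_mem {p : ℤ} {c : k} (hc : c ∈ 𝓀 p) : koszul 𝓀 c ∈ 𝓀 p := twist_mem 𝓀 1 hc

theorem HasCodeg.transpose {t : List ι → List ι →₀ k} (ht : IsHomogeneousRows deg 𝓀 t) {p : ℤ}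
    {x : List ι →₀ k} (hx : HasCodeg deg 𝓀 p x) :
    HasCodeg deg 𝓀 (p + 1) (transpose deg 𝓀 t x) := fun w => by
  rw [ChenHPT.transpose, semilinearExt_apply, Finsupp.sum, Finsupp.finsetSum_apply]
  refine AddSubgroup.sum_mem _ fun u _ => ?_
  rw [Finsupp.smul_apply, transposeWord_apply, smul_eq_mul, mul_smul_comm]
  refine AddSubgroup.zsmul_mem _ ?_ _
  have h := SetLike.mul_mem_graded (koszul_mem (hx u)) (ht u w)
  rwa [show p + xdeg deg u + (xdeg deg w + 1 - xdeg deg u) = p + 1 + xdeg deg w by ring] at h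

theorem pairing_mono (w : List ι) (x : List ι →₀ k) :
    pairing deg 𝓀 (mono k w) x = pairSign deg w • twist 𝓀 (xdeg deg w) (x w) := by
  rw [pairing, Finsupp.sum, Finset.sum_eq_single w]
  · rw [mono_self, one_mul]
  · intro u _ hu
    rw [mono_of_ne hu, zero_mul, smul_zero]
  · intro hw
    rw [Finsupp.notMem_support_iff.1 hw, map_zero, mul_zero, smul_zero]

/-- Nondegeneracy of the pairing: a monomial reads off one coordinate up to a sign and a parity
operator, both of which are involutions. -/
theorem eq_zero_of_pairing_mono {x : List ι →₀ k} (h : ∀ w, pairing deg 𝓀 (mono k w) x = 0) :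
    x = 0 := by
  ext w
  have h1 := congrArg (fun y => twist 𝓀 (xdeg deg w) (pairSign deg w • y)) (h w)
  beta_reduce at h1
  rw [pairing_mono, smul_smul, pairSign_mul_self, one_smul, twist_twist,
    twist_of_even 𝓀 ⟨_, rfl⟩, smul_zero, map_zero] at h1
  exact h1

/-- Two applications of the transpose relation give `⟨f, b (b x)⟩ = ± ⟨∂ (∂ f), x⟩`, and monomials
detect whether an element is zero. -/
theorem transpose_transpose (hk : IsGradedComm 𝓀) {t : List ι → List ι →₀ k}
    (ht : IsHomogeneousRows deg 𝓀 t) (h : ∀ f, op deg 𝓀 t (op deg 𝓀 t f) = 0)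
    (x : List ι →₀ k) : transpose deg 𝓀 t (transpose deg 𝓀 t x) = 0 := by
  refine eq_zero_of_pairing_mono (deg := deg) (𝓀 := 𝓀) fun w => ?_
  have h1 := isTranspose_transpose hk ht _ _ (transpose deg 𝓀 t x) (hasDeg_mono deg (𝓀 := 𝓀) w)
  have h2 := isTranspose_transpose hk ht _ _ x
    ((hasDeg_mono deg (𝓀 := 𝓀) w).op deg ht (gradedSMulMem_self 𝓀))
  have h3 : opLin deg 𝓀 hk ht (op deg 𝓀 t (mono k w)) = 0 := h _
  change pairing deg 𝓀 (op deg 𝓀 t (mono k w)) _ = _ at h1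
  have h0 : pairing deg 𝓀 (0 : List ι → k) x = 0 := by
    rw [pairing]
    exact Finset.sum_eq_zero fun u _ => by simp only [Pi.zero_apply, zero_mul, smul_zero]
  rw [h3, h1, h0, smul_neg, neg_neg] at h2
  have h4 := congrArg (fun y => sgn (xdeg deg w) • sgn (xdeg deg w + 1) • y) h2
  simpa only [sgn_smul_self, smul_zero] using h4.symm

section Comul

/-- In coordinates the comultiplication is concatenation of words, which reduces the coderivation
property to an identity between rows. -/
theorem comul_apply (x : List ι →₀ k) (a b : List ι) : comul x (a, b) = x (a ++ b) := by
  classical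
  have h : ∀ x : List ι →₀ k, (Finsupp.applyAddHom (a, b)).comp (Finsupp.liftAddHom fun u =>
      ∑ i ∈ Finset.range (u.length + 1), Finsupp.singleAddHom (u.take i, u.drop i)) x =
      Finsupp.applyAddHom (a ++ b) x := by
    intro x
    refine DFunLike.congr_fun (Finsupp.addHom_ext fun u c => ?_) x
    rw [AddMonoidHom.comp_apply, Finsupp.liftAddHom_apply_single, AddMonoidHom.finsetSum_apply,
      map_sum]
    simp only [Finsupp.singleAddHom_apply, Finsupp.applyAddHom_apply]
    by_cases hu : u = a ++ b
    · subst hu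
      rw [Finsupp.single_eq_same, Finset.sum_eq_single a.length]
      · rw [List.take_left', List.drop_left', Finsupp.single_eq_same] <;> rfl
      · intro i hi hne
        rw [Finsupp.single_eq_of_ne]
        intro h
        have := congrArg (fun z : List ι × List ι => z.1.length) h
        rw [Finset.mem_range] at hi
        simp only [List.length_take] at this
        omega
      · intro h
        rw [Finset.mem_range, List.length_append] at h
        omega
    · rw [Finsupp.single_eq_of_ne (Ne.symm hu)]
      refine Finset.sum_eq_zero fun i _ => ?_
      rw [Finsupp.single_eq_of_ne]
      intro h
      rw [Prod.mk.injEq] at h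
      rw [h.1, h.2, List.take_append_drop] at hu
      exact hu rfl
  have h1 : comul x = Finsupp.liftAddHom (fun u =>
      ∑ i ∈ Finset.range (u.length + 1), Finsupp.singleAddHom (u.take i, u.drop i)) x := by
    rw [Finsupp.liftAddHom_apply]
    refine Finset.sum_congr rfl fun u _ => ?_
    beta_reduce
    rw [AddMonoidHom.finsetSum_apply]
    rfl
  rw [h1]
  exact h x

theorem comul_add (x y : List ι →₀ k) : comul (x + y) = comul x + comul y := by
  ext ⟨a, b⟩
  rw [Finsupp.add_apply, comul_apply, comul_apply, comul_apply, Finsupp.add_apply]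

theorem comul_single (u : List ι) (c : k) : comul (Finsupp.single u c) =
    cut (fun a b => Finsupp.single (a, b) c) u := by
  rw [comul, Finsupp.sum_single_index, cut]
  exact Finset.sum_eq_zero fun i _ => Finsupp.single_zero _

variable (b : (List ι →₀ k) →ₛₗ[koszul 𝓀] (List ι →₀ k))

theorem tensorLeft_add (x y : List ι × List ι →₀ k) :
    tensorLeft 𝓀 b (x + y) = tensorLeft 𝓀 b x + tensorLeft 𝓀 b y := by
  refine Finsupp.sum_add_index' (fun p => ?_) fun p c c' => ?_
  · rw [Finsupp.single_zero, map_zero, Finsupp.sum_zero_index]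
  · rw [Finsupp.single_add, map_add, Finsupp.sum_add_index' (fun v => Finsupp.single_zero _)
      fun v e e' => Finsupp.single_add _ _ _]

theorem tensorRight_add (x y : List ι × List ι →₀ k) :
    tensorRight deg 𝓀 b (x + y) = tensorRight deg 𝓀 b x + tensorRight deg 𝓀 b y := by
  refine Finsupp.sum_add_index' (fun p => ?_) fun p c c' => ?_
  · refine Finset.sum_eq_zero fun v _ => ?_
    beta_reduce
    rw [map_zero, zero_mul, smul_zero, Finsupp.single_zero]
  · rw [← Finsupp.sum_add]
    refine Finset.sum_congr rfl fun v _ => ?_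
    beta_reduce
    rw [map_add, add_mul, smul_add, Finsupp.single_add]

theorem tensorLeft_single_apply (p q w₁ w₂ : List ι) [Decidable (q = w₂)] (c : k) :
    tensorLeft 𝓀 b (Finsupp.single (p, q) c) (w₁, w₂) =
      if q = w₂ then b (Finsupp.single p c) w₁ else 0 := by
  classical
  rw [tensorLeft, Finsupp.sum_single_index
    (by rw [Finsupp.single_zero, map_zero, Finsupp.sum_zero_index]), Finsupp.sum,
    Finsupp.finsetSum_apply]
  split_ifs with h
  · subst h
    rw [Finset.sum_eq_single w₁]
    · exact Finsupp.single_eq_same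
    · intro v _ hv
      exact Finsupp.single_eq_of_ne fun h => hv (congrArg Prod.fst h).symm
    · intro hw
      rw [Finsupp.notMem_support_iff.1 hw, Finsupp.single_zero, Finsupp.zero_apply]
  · exact Finset.sum_eq_zero fun v _ =>
      Finsupp.single_eq_of_ne fun h' => h (congrArg Prod.snd h').symm

theorem tensorRight_single_apply (p q w₁ w₂ : List ι) [Decidable (p = w₁)] (c : k) :
    tensorRight deg 𝓀 b (Finsupp.single (p, q) c) (w₁, w₂) =
      if p = w₁ then sgn (xdeg deg p) •
        (koszul 𝓀 c * twist 𝓀 (xdeg deg p) (b (Finsupp.single q 1) w₂)) else 0 := by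
  classical
  rw [tensorRight, Finsupp.sum_single_index, Finsupp.sum, Finsupp.finsetSum_apply]
  · split_ifs with h
    · subst h
      rw [Finset.sum_eq_single w₂]
      · exact Finsupp.single_eq_same
      · intro v _ hv
        exact Finsupp.single_eq_of_ne fun h => hv (congrArg Prod.snd h).symm
      · intro hw
        rw [Finsupp.notMem_support_iff.1 hw, map_zero, mul_zero, smul_zero, Finsupp.single_zero,
          Finsupp.zero_apply]
    · exact Finset.sum_eq_zero fun v _ =>
        Finsupp.single_eq_of_ne fun h' => h (congrArg Prod.fst h').symm
  · refine Finset.sum_eq_zero fun v _ => ?_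
    beta_reduce
    rw [map_zero, zero_mul, smul_zero, Finsupp.single_zero]

end Comul

variable {e : List ι → ι →₀ k}

/-- The Leibniz rule for the product of the monomials of `w₁` and `w₂`, read as an identity between
rows. -/
theorem derRows_append (hk : IsGradedComm 𝓀) (he : IsHomogeneousGen deg 𝓀 e)
    [DecidableEq (List ι)] (u w₁ w₂ : List ι) :
    derRows deg e u (w₁ ++ w₂) = cut (fun p q =>
      (if q = w₂ then derRows deg e p w₁ else 0) +
        if p = w₁ then sgn (xdeg deg w₁) • twist 𝓀 (xdeg deg w₁) (derRows deg e q w₂)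
          else 0) u := by
  have h := congrFun (der_conv deg he hk.isGradedBilin_mul (mono k w₁) (mono k w₂)) u
  rw [mono_append, der, op_mono, (hasDeg_mono deg (𝓀 := 𝓀) w₁).totalParity_eq, Pi.add_apply,
    conv_apply, conv_apply, ← cut_add] at h
  rw [h]
  refine cut_congr fun p q _ => ?_
  rw [der, der, op_mono, op_mono, AddMonoidHom.mul_apply, AddMonoidHom.mul_apply, Pi.smul_apply]
  congr 1
  · split_ifs with hq
    · rw [hq, mono_self, twist_one_ground, mul_one]
    · rw [mono_of_ne hq, map_zero, mul_zero]
  · split_ifs with hp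
    · rw [hp, mono_self, smul_mul_assoc, one_mul]
    · rw [mono_of_ne hp, smul_zero, zero_mul]

/-- The pairing signs of the common suffix cancel. With the analogue for prefixes, the two terms of
`derRows_append` can be transposed separately. -/
theorem transposeSign_append_right (p w₁ w₂ : List ι) :
    transposeSign deg (p ++ w₂) (w₁ ++ w₂) = transposeSign deg p w₁ := by
  simp only [transposeSign, pairSign_append, xdeg_append]
  have h := pairSign_mul_self deg w₂
  have hs : sgn (xdeg deg w₁ + xdeg deg w₂ + (xdeg deg w₁ + xdeg deg w₂) *
      (xdeg deg p + xdeg deg w₂)) * (sgn (xdeg deg p * xdeg deg w₂) *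
        sgn (xdeg deg w₁ * xdeg deg w₂)) = sgn (xdeg deg w₁ + xdeg deg w₁ * xdeg deg p) := by
    rw [← sgn_add, ← sgn_add]
    apply sgn_congr
    by_cases h1 : Even (xdeg deg w₁) <;> by_cases h2 : Even (xdeg deg w₂) <;>
      by_cases h3 : Even (xdeg deg p) <;>
      simp only [Int.even_add, Int.even_mul, h1, h2, h3] <;> decide
  rw [← hs]
  linear_combination -(sgn (xdeg deg w₁ + xdeg deg w₂ + (xdeg deg w₁ + xdeg deg w₂) *
      (xdeg deg p + xdeg deg w₂)) * (sgn (xdeg deg p * xdeg deg w₂) *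
        sgn (xdeg deg w₁ * xdeg deg w₂)) * pairSign deg p * pairSign deg w₁) * h

theorem transposeSign_append_left (q w₁ w₂ : List ι) :
    transposeSign deg (w₁ ++ q) (w₁ ++ w₂) = transposeSign deg q w₂ := by
  simp only [transposeSign, pairSign_append, xdeg_append]
  have h := pairSign_mul_self deg w₁
  have hs : sgn (xdeg deg w₁ + xdeg deg w₂ + (xdeg deg w₁ + xdeg deg w₂) *
      (xdeg deg w₁ + xdeg deg q)) * (sgn (xdeg deg w₁ * xdeg deg q) *
        sgn (xdeg deg w₁ * xdeg deg w₂)) = sgn (xdeg deg w₂ + xdeg deg w₂ * xdeg deg q) := by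
    rw [← sgn_add, ← sgn_add]
    apply sgn_congr
    by_cases h1 : Even (xdeg deg w₁) <;> by_cases h2 : Even (xdeg deg w₂) <;>
      by_cases h3 : Even (xdeg deg q) <;>
      simp only [Int.even_add, Int.even_mul, h1, h2, h3] <;> decide
  rw [← hs]
  linear_combination -(sgn (xdeg deg w₁ + xdeg deg w₂ + (xdeg deg w₁ + xdeg deg w₂) *
      (xdeg deg w₁ + xdeg deg q)) * (sgn (xdeg deg w₁ * xdeg deg q) *
        sgn (xdeg deg w₁ * xdeg deg w₂)) * pairSign deg q * pairSign deg w₂) * h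

/-- This is the dual of the Leibniz rule: at `(w₁, w₂)` the two terms of `derRows_append` are the
contributions of `b ⊗ 1` and `1 ⊗ b`. -/
theorem comul_transpose (hk : IsGradedComm 𝓀) (he : IsHomogeneousGen deg 𝓀 e)
    (x : List ι →₀ k) : comul (transpose deg 𝓀 (derRows deg e) x) =
      tensorLeft 𝓀 (transpose deg 𝓀 (derRows deg e)) (comul x) +
        tensorRight deg 𝓀 (transpose deg 𝓀 (derRows deg e)) (comul x) := by
  classical
  induction x using Finsupp.induction_linear with
  | zero =>
    have h : comul (0 : List ι →₀ k) = 0 := Finsupp.sum_zero_index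
    rw [map_zero, h, tensorLeft, tensorRight, Finsupp.sum_zero_index, Finsupp.sum_zero_index,
      add_zero]
  | add x y hx hy =>
    rw [map_add, comul_add, comul_add, tensorLeft_add, tensorRight_add, hx, hy]
    abel
  | single u c =>
    ext ⟨w₁, w₂⟩
    rw [comul_apply, Finsupp.add_apply, comul_single]
    have h1 := map_cut ((Finsupp.applyAddHom (w₁, w₂)).comp
      (AddMonoidHom.mk' _ (tensorLeft_add (transpose deg 𝓀 (derRows deg e)))))
      (fun a b => Finsupp.single (a, b) c) u
    have h2 := map_cut ((Finsupp.applyAddHom (w₁, w₂)).comp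
      (AddMonoidHom.mk' _ (tensorRight_add (deg := deg) (transpose deg 𝓀 (derRows deg e)))))
      (fun a b => Finsupp.single (a, b) c) u
    simp only [AddMonoidHom.comp_apply, AddMonoidHom.mk'_apply, Finsupp.applyAddHom_apply] at h1 h2
    rw [h1, h2, ← cut_add, transpose_single, Finsupp.smul_apply, transposeWord_apply,
      derRows_append hk he, smul_eq_mul]
    have h3 := map_cut ((AddMonoidHom.mulLeft (koszul 𝓀 c)).comp
      (zsmulAddGroupHom (transposeSign deg u (w₁ ++ w₂)))) (fun p q =>
      (if q = w₂ then derRows deg e p w₁ else 0) +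
        if p = w₁ then sgn (xdeg deg w₁) • twist 𝓀 (xdeg deg w₁) (derRows deg e q w₂)
          else 0) u
    simp only [AddMonoidHom.comp_apply, AddMonoidHom.coe_mulLeft, zsmulAddGroupHom_apply] at h3
    rw [h3]
    refine cut_congr fun p q hpq => ?_
    rw [tensorLeft_single_apply, tensorRight_single_apply, smul_add, mul_add]
    congr 1
    · split_ifs with hq
      · rw [transpose_single, Finsupp.smul_apply, transposeWord_apply, ← hpq, hq,
          transposeSign_append_right, smul_eq_mul]
      · rw [smul_zero, mul_zero]
    · split_ifs with hp
      · rw [transpose_single, Finsupp.smul_apply, transposeWord_apply, ← hpq, hp,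
          transposeSign_append_left, koszul_one, one_smul, map_zsmul, smul_comm, mul_smul_comm]
      · rw [smul_zero, mul_zero]

theorem derRows_nil (h : e [] = 0) : derRows deg e [] = 0 := by
  rw [derRows, cut_nil, cut_nil, h, Finsupp.sum_zero_index]

theorem isCodifferential_transpose (hk : IsGradedComm 𝓀) (he : IsHomogeneousGen deg 𝓀 e)
    (h0 : e [] = 0) (hsq : ∀ f : List ι → k, der deg 𝓀 e (der deg 𝓀 e f) = 0) :
    IsCodifferential deg 𝓀 (transpose deg 𝓀 (derRows deg e)) where
  degree p x hx := hx.transpose (he.rows deg)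
  coderivation := comul_transpose hk he
  counit := by
    rw [transpose_single, transposeWord, derRows_nil h0, Finsupp.sum_zero_index, smul_zero]
  square := transpose_transpose hk (he.rows deg) hsq

end Coalgebra

/-! ### The twisting cochain -/

section TwistingCochain

variable {ι : Type*} {deg : ι → ℤ}
variable {k : Type*} [Ring k] {𝓀 : ℤ → AddSubgroup k} [GradedRing 𝓀]
variable {A : Type*} [NonUnitalRing A] [Module k A] {𝒜 : ℤ → AddSubgroup A}
  [DirectSum.Decomposition 𝒜] {d : A →ₛₗ[koszul 𝓀] A}

variable (deg 𝓀) in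
/-- The map `-⟨ω, ·⟩`. -/
def twistingCochain (ω : List ι → A) : (List ι →₀ k) →ₛₗ[koszul 𝓀] A :=
  semilinearExt 𝓀 fun u => -(pairSign deg u • ω u)

theorem twistingCochain_single (ω : List ι → A) (u : List ι) (c : k) :
    twistingCochain deg 𝓀 ω (Finsupp.single u c) = koszul 𝓀 c • -(pairSign deg u • ω u) :=
  semilinearExt_single 𝓀 _ u c

theorem cup_add (f g : (List ι →₀ k) →ₛₗ[koszul 𝓀] A) (x y : List ι →₀ k) :
    cup deg 𝓀 f g (x + y) = cup deg 𝓀 f g x + cup deg 𝓀 f g y := by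
  refine Finsupp.sum_add_index' (fun u => ?_) fun u c c' => ?_
  · refine Finset.sum_eq_zero fun i _ => ?_
    rw [map_zero, Finsupp.single_zero, map_zero, zero_mul, smul_zero]
  · rw [← Finset.sum_add_distrib]
    refine Finset.sum_congr rfl fun i _ => ?_
    rw [map_add, Finsupp.single_add, map_add, add_mul, smul_add]

/-- The transpose relation with coefficients in `A`: on words, `τ b` is `-⟨∂ ω, ·⟩`. -/
theorem twistingCochain_transposeWord {t : List ι → List ι →₀ k} (ht : IsHomogeneousRows deg 𝓀 t)
    {ω : List ι → A} (hω : HasDeg deg 𝒜 1 ω) (u : List ι) :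
    twistingCochain deg 𝓀 ω (transposeWord deg t u) = -(pairSign deg u • op deg 𝒜 t ω u) := by
  rw [transposeWord, Finsupp.sum, map_sum, op, Finsupp.sum, Finset.smul_sum,
    ← Finset.sum_neg_distrib]
  refine Finset.sum_congr rfl fun w _ => ?_
  rw [twistingCochain_single, map_zsmul, koszul_apply, twist_of_mem 𝓀 _ (ht u w),
    twist_of_mem 𝒜 _ (hω w), smul_neg]
  congr 1
  rw [smul_comm (t u w), smul_assoc, smul_assoc, smul_comm (t u w), smul_smul, smul_smul, smul_smul]
  congr 1
  have h := pairSign_mul_self deg w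
  have hs : sgn (xdeg deg w + xdeg deg w * xdeg deg u) *
      sgn (1 * (xdeg deg w + 1 - xdeg deg u)) =
      -sgn ((xdeg deg w + xdeg deg u) * (1 - xdeg deg w)) := by
    have : (-1 : ℤ) = sgn 1 := sgn_one.symm
    rw [neg_eq_neg_one_mul, this, ← sgn_add, ← sgn_add]
    apply sgn_congr
    by_cases h1 : Even (xdeg deg w) <;> by_cases h2 : Even (xdeg deg u) <;>
      simp only [Int.even_add, Int.even_mul, Int.even_sub, Int.not_even_one, h1, h2] <;> decide
  rw [transposeSign]
  linear_combination (-(sgn (xdeg deg w + xdeg deg w * xdeg deg u) *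
      sgn (1 * (xdeg deg w + 1 - xdeg deg u)) * pairSign deg u)) * h - pairSign deg u * hs

/-- On words `τ b + d τ` is `-⟨∂ ω + d ω, ·⟩`, while `τ ∪ τ` is `⟨ω · ω, ·⟩` because the two minus
signs of `τ` cancel. Flatness equates them. -/
theorem isTwistingCochain_twistingCochain (hA : IsDGA 𝓀 𝒜 d)
    {e : List ι → ι →₀ k} (he : IsHomogeneousGen deg 𝓀 e) {ω : List ι → A}
    (hω : HasDeg deg 𝒜 1 ω)
    (hcurv : ∀ u, der deg 𝒜 e ω u + d (ω u) + conv deg 𝒜 AddMonoidHom.mul ω ω u = 0) :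
    IsTwistingCochain deg 𝓀 𝒜 d (transpose deg 𝓀 (derRows deg e)) (twistingCochain deg 𝓀 ω) where
  degree p x hx := by
    rw [twistingCochain, semilinearExt_apply]
    refine AddSubgroup.sum_mem _ fun u _ => ?_
    have h := hA.smul_mem _ _ _ _ (koszul_mem (hx u)) (hω u)
    rw [show p + xdeg deg u + (1 - xdeg deg u) = p + 1 by ring] at h
    beta_reduce
    rw [smul_neg, smul_comm]
    exact AddSubgroup.neg_mem _ (AddSubgroup.zsmul_mem _ h _)
  equation x := by
    induction x using Finsupp.induction_linear with
    | zero =>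
      have h : cup deg 𝓀 (twistingCochain deg 𝓀 ω) (twistingCochain deg 𝓀 ω) 0 = 0 :=
        Finsupp.sum_zero_index
      rw [h, map_zero, map_zero, map_zero, add_zero]
    | add x y hx hy =>
      rw [cup_add, ← hx, ← hy]
      simp only [map_add]
      abel
    | single u c =>
      have h1 : cup deg 𝓀 (twistingCochain deg 𝓀 ω) (twistingCochain deg 𝓀 ω)
          (Finsupp.single u c) = c • (pairSign deg u • conv deg 𝒜 AddMonoidHom.mul ω ω u) := by
        rw [cup, Finsupp.sum_single_index, conv_apply]
        · have := map_cut ((smulAddHom k A c).comp (zsmulAddGroupHom (pairSign deg u)))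
            (fun a b => AddMonoidHom.mul (ω a) (twist 𝒜 (xdeg deg a) (ω b))) u
          simp only [AddMonoidHom.comp_apply, smulAddHom_apply, zsmulAddGroupHom_apply] at this
          rw [this]
          change cut (fun a b => sgn (xdeg deg a) • (twistingCochain deg 𝓀 ω
            (Finsupp.single a (koszul 𝓀 c)) * twistingCochain deg 𝓀 ω (Finsupp.single b 1))) u = _
          refine cut_congr fun a b hab => ?_
          rw [twistingCochain_single, twistingCochain_single, koszul_koszul, koszul_one, one_smul,
            hA.smul_mul, smul_comm (sgn _) c, AddMonoidHom.mul_apply, twist_of_mem 𝒜 _ (hω b),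
            neg_mul_neg, smul_mul_assoc, mul_smul_comm, mul_smul_comm, smul_smul, smul_smul,
            smul_smul, ← hab, pairSign_append]
          congr 2
          have hs : sgn (xdeg deg a) = sgn (xdeg deg a * xdeg deg b) *
              sgn (xdeg deg a * (1 - xdeg deg b)) := by
            rw [← sgn_add]
            congr 1
            ring
          rw [hs]
          ring
        · refine Finset.sum_eq_zero fun i _ => ?_
          rw [map_zero, Finsupp.single_zero, map_zero, zero_mul, smul_zero]
      rw [h1, transpose_single, LinearMap.map_smulₛₗ, koszul_koszul,
        twistingCochain_transposeWord (he.rows deg) hω, twistingCochain_single,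
        LinearMap.map_smulₛₗ, koszul_koszul, ← smul_add, map_neg, map_zsmul, ← neg_add, ← smul_add]
      have h2 := hcurv u
      rw [der] at h2
      rw [eq_neg_of_add_eq_zero_left h2, smul_neg, smul_neg, smul_neg, neg_neg]

end TwistingCochain

/-! ### Multilinear operations with prescribed values on a basis -/

section Operations

variable {ι : Type*} {deg : ι → ℤ}
variable {k : Type*} [Ring k] {𝓀 : ℤ → AddSubgroup k} [GradedRing 𝓀]
variable {V : Type*} [AddCommGroup V] [Module k V] {𝒱 : ℤ → AddSubgroup V}

variable (deg 𝓀) in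
/-- The operation with the values `g` on the words of length `n` in the basis `α`, multilinear in
the sense of the Koszul convention for an operation of degree `c`. -/
def multExt (α : Module.Basis ι k V) : ∀ (n : ℕ) (_ : List ι → V) (_ : ℤ),
    MultilinearMap ℤ (fun _ : Fin n => V) V
  | 0, g, _ => MultilinearMap.constOfIsEmpty ℤ (fun _ : Fin 0 => V) (g [])
  | n + 1, g, c =>
    -- The scalar of the first argument passes an operation of degree `c`; later scalars have to
    -- pass `α j` as well, hence `c + deg j`.
    LinearMap.uncurryLeft (((Finsupp.liftAddHom fun j =>
      ((smulAddHom k (MultilinearMap ℤ (fun _ : Fin n => V) V)).flip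
        (multExt α n (fun u => g (j :: u)) (c + deg j))).comp (twist 𝓀 c)).comp
      α.repr.toLinearMap.toAddMonoidHom).toIntLinearMap)

theorem multExt_zero (α : Module.Basis ι k V) (g : List ι → V) (c : ℤ) (v : Fin 0 → V) :
    multExt deg 𝓀 α 0 g c v = g [] := rfl

theorem multExt_succ (α : Module.Basis ι k V) (n : ℕ) (g : List ι → V) (c : ℤ)
    (v : Fin (n + 1) → V) : multExt deg 𝓀 α (n + 1) g c v =
      (α.repr (v 0)).sum fun j x => twist 𝓀 c x •
        multExt deg 𝓀 α n (fun u => g (j :: u)) (c + deg j) (fun i => v i.succ) := by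
  rw [multExt, LinearMap.uncurryLeft_apply]
  change (Finsupp.liftAddHom (fun j =>
    ((smulAddHom k (MultilinearMap ℤ (fun _ : Fin n => V) V)).flip
      (multExt deg 𝓀 α n (fun u => g (j :: u)) (c + deg j))).comp (twist 𝓀 c))
    (α.repr (v 0)) : MultilinearMap ℤ (fun _ : Fin n => V) V) (Fin.tail v) = _
  rw [Finsupp.liftAddHom_apply, Finsupp.sum, sum_apply]
  rfl

theorem multExt_basis (α : Module.Basis ι k V) {n : ℕ} (g : List ι → V) (c : ℤ)
    (u : Fin n → ι) : multExt deg 𝓀 α n g c (fun i => α (u i)) = g (List.ofFn u) := by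
  induction n generalizing g c with
  | zero => rw [multExt_zero, List.ofFn_zero]
  | succ n ih =>
    rw [multExt_succ, Module.Basis.repr_self, Finsupp.sum_single_index, ih, twist_one_ground,
      one_smul, List.ofFn_succ]
    rw [map_zero, zero_smul]

theorem multExt_mem (hV : GradedSMulMem 𝓀 𝒱) (α : Module.Basis ι k V)
    (hrepr : ∀ (p : ℤ) (v : V), v ∈ 𝒱 p → ∀ j, α.repr v j ∈ 𝓀 (p - deg j)) {n : ℕ} {D : ℤ}
    {g : List ι → V} (hg : ∀ u : Fin n → ι, g (List.ofFn u) ∈ 𝒱 (∑ i, deg (u i) + D)) (c : ℤ)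
    {p : Fin n → ℤ} {v : Fin n → V} (hv : ∀ i, v i ∈ 𝒱 (p i)) :
    multExt deg 𝓀 α n g c v ∈ 𝒱 (∑ i, p i + D) := by
  induction n generalizing g c D with
  | zero =>
    have := hg Fin.elim0
    rw [multExt_zero]
    simpa using this
  | succ n ih =>
    rw [multExt_succ]
    refine AddSubgroup.sum_mem _ fun j _ => ?_
    have h1 : ∀ u : Fin n → ι, g (j :: List.ofFn u) ∈ 𝒱 (∑ i, deg (u i) + (D + deg j)) := by
      intro u
      have h2 := hg (Fin.cons j u)
      rw [List.ofFn_succ, Fin.sum_univ_succ] at h2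
      simp only [Fin.cons_zero, Fin.cons_succ] at h2
      rwa [show deg j + ∑ i, deg (u i) + D = ∑ i, deg (u i) + (D + deg j) by ring] at h2
    have h3 := hV _ _ _ _ (twist_mem 𝓀 c (hrepr _ _ (hv 0) j))
      (ih (g := fun u => g (j :: u)) h1 (c + deg j) (fun i => hv i.succ))
    rw [Fin.sum_univ_succ]
    rwa [show p 0 - deg j + (∑ i : Fin n, p i.succ + (D + deg j)) =
      p 0 + ∑ i : Fin n, p i.succ + D by ring] at h3

theorem multExt_smul (hk : IsGradedComm 𝓀) (α : Module.Basis ι k V)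
    (hrepr : ∀ (p : ℤ) (v : V), v ∈ 𝒱 p → ∀ j, α.repr v j ∈ 𝓀 (p - deg j)) {n : ℕ}
    (g : List ι → V) (c : ℤ) {p : Fin n → ℤ} {v : Fin n → V} (hv : ∀ i, v i ∈ 𝒱 (p i))
    (i : Fin n) {q : ℤ} {x : k} (hx : x ∈ 𝓀 q) :
    multExt deg 𝓀 α n g c (Function.update v i (x • v i)) =
      sgn (q * (c + ∑ t ∈ Finset.univ.filter (· < i), p t)) • x • multExt deg 𝓀 α n g c v := by
  induction n generalizing g c with
  | zero => exact i.elim0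
  | succ n ih =>
    rw [multExt_succ, multExt_succ]
    refine Fin.cases ?_ (fun i => ?_) i
    · have h0 : (Finset.univ.filter (· < (0 : Fin (n + 1)))) = ∅ :=
        Finset.filter_false_of_mem fun t _ => Fin.not_lt_zero t
      rw [Function.update_self, map_smul, Finsupp.sum_smul_index (by simp), h0, Finset.sum_empty,
        add_zero, Finsupp.smul_sum, Finsupp.smul_sum]
      refine Finset.sum_congr rfl fun j _ => ?_
      simp only [Function.update_of_ne (Fin.succ_ne_zero _)]
      rw [twist_mul, twist_of_mem 𝓀 c hx, smul_mul_assoc, smul_assoc, mul_smul, mul_comm]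
    · have h0 : ∑ t ∈ Finset.univ.filter (· < i.succ), p t =
          p 0 + ∑ t ∈ Finset.univ.filter (· < i), p t.succ := by
        rw [Finset.sum_filter, Fin.sum_univ_succ, Finset.sum_filter]
        simp only [Fin.succ_pos, if_true, Fin.succ_lt_succ_iff]
      rw [Function.update_of_ne (Fin.succ_ne_zero _).symm, Finsupp.smul_sum, Finsupp.smul_sum, h0]
      refine Finset.sum_congr rfl fun j _ => ?_
      have h1 : (fun t : Fin n => Function.update v i.succ (x • v i.succ) t.succ) =
          Function.update (fun t => v t.succ) i (x • v i.succ) := by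
        funext t
        by_cases h : t = i
        · subst h
          rw [Function.update_self, Function.update_self]
        · rw [Function.update_of_ne h, Function.update_of_ne fun h' => h (Fin.succ_injective _ h')]
      beta_reduce
      -- A scalar from a later argument also has to cross the coordinate of the first argument,
      -- which uses graded commutativity.
      have hr := twist_mem 𝓀 c (hrepr _ _ (hv 0) j)
      rw [h1, ih (v := fun t => v t.succ) (p := fun t => p t.succ) _ _ (fun t => hv t.succ) i,
        smul_comm _ (sgn _), ← mul_smul (twist 𝓀 c _), hk _ _ _ _ hr hx, smul_assoc, mul_smul,
        sgn_smul_sgn_smul]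
      congr 1
      apply sgn_congr
      simp only [Int.even_add, Int.even_mul, Int.even_sub]
      tauto

/-- The operations with the values `g` on the words in a basis. -/
theorem isOperations_multExt (hk : IsGradedComm 𝓀) (hV : GradedSMulMem 𝓀 𝒱)
    (α : Module.Basis ι k V)
    (hrepr : ∀ (p : ℤ) (v : V), v ∈ 𝒱 p → ∀ j, α.repr v j ∈ 𝓀 (p - deg j)) {g : List ι → V}
    (hg : ∀ u : List ι, g u ∈ 𝒱 ((u.map deg).sum + (2 - u.length))) :
    IsOperations 𝓀 𝒱 fun n => multExt deg 𝓀 α n g n where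
  -- Signs see only the parity of the degree `2 - n`, so `multExt` is used with the degree `n`.
  degree n _ p v hv := by
    rw [add_sub_assoc]
    refine multExt_mem hV α hrepr (fun u => ?_) n hv
    have := hg (List.ofFn u)
    rwa [List.map_ofFn, List.sum_ofFn, List.length_ofFn] at this
  smul n _ p v hv i q x hx := multExt_smul hk α hrepr g n hv i hx

end Operations

/-! ### Reduction of multilinear identities to basis elements -/

section Reduction

variable {ι I : Type*} [DecidableEq I] {deg : ι → ℤ}
variable {k : Type*} [Ring k] {𝓀 : ℤ → AddSubgroup k} [GradedRing 𝓀]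
variable {V W : Type*} [AddCommGroup V] [Module k V] {𝒱 : ℤ → AddSubgroup V} [AddCommGroup W]

/-- An identity that is multilinear in the arguments in `S` follows from its instances for elements
of the basis. -/
theorem vanish_of_basis (α : Module.Basis ι k V) (hα : ∀ j, α j ∈ 𝒱 (deg j))
    (hrepr : ∀ (p : ℤ) (v : V), v ∈ 𝒱 p → ∀ j, α.repr v j ∈ 𝓀 (p - deg j)) (S : Finset I)
    (Φ : (I → ℤ) → (I → V) → W)
    (hadd : ∀ i ∈ S, ∀ p v x y, Φ p (Function.update v i (x + y)) =
      Φ p (Function.update v i x) + Φ p (Function.update v i y))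
    (hsmul : ∀ i ∈ S, ∀ p v, (∀ i, v i ∈ 𝒱 (p i)) → ∀ q : ℤ, ∀ x ∈ 𝓀 q, Φ p v = 0 →
      Φ (Function.update p i (q + p i)) (Function.update v i (x • v i)) = 0)
    (hbasis : ∀ p v, (∀ i, v i ∈ 𝒱 (p i)) → (∀ i ∈ S, ∃ j, p i = deg j ∧ v i = α j) → Φ p v = 0)
    (p : I → ℤ) (v : I → V) (hv : ∀ i, v i ∈ 𝒱 (p i)) : Φ p v = 0 := by
  -- Induction on the set `T` of the arguments that are not yet known to be basis elements.
  suffices h : ∀ T ⊆ S, ∀ p v, (∀ i, v i ∈ 𝒱 (p i)) →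
      (∀ i ∈ S, i ∉ T → ∃ j, p i = deg j ∧ v i = α j) → Φ p v = 0 from
    h S subset_rfl p v hv fun i hi hi' => absurd hi hi'
  intro T
  induction T using Finset.induction_on with
  | empty => exact fun _ p v hv hb => hbasis p v hv fun i hi => hb i hi (Finset.notMem_empty i)
  | insert i T hiT ih =>
    intro hTS p v hv hb
    have hiS : i ∈ S := hTS (Finset.mem_insert_self i T)
    have hsum : Φ p v = (α.repr (v i)).sum fun j x => Φ p (Function.update v i (x • α j)) := by
      have h1 := map_finsuppSum (AddMonoidHom.mk' (fun y => Φ p (Function.update v i y))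
        fun x y => hadd i hiS p v x y) (α.repr (v i)) fun j x => x • α j
      simp only [AddMonoidHom.mk'_apply] at h1
      rw [← h1, ← Finsupp.linearCombination_apply, Module.Basis.linearCombination_repr,
        Function.update_eq_self]
    rw [hsum]
    refine Finset.sum_eq_zero fun j _ => ?_
    -- The coordinate has degree `p i - deg j`, so the scaled basis element again has degree `p i`.
    -- The degrees must be tracked because the signs in `Φ` depend on them.
    have h2 := hsmul i hiS (Function.update p i (deg j)) (Function.update v i (α j)) (fun t => by
      by_cases h : t = i
      · subst h
        rw [Function.update_self, Function.update_self]
        exact hα j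
      · rw [Function.update_of_ne h, Function.update_of_ne h]
        exact hv t) _ _ (hrepr _ _ (hv i) j) (ih (fun t ht => hTS (Finset.mem_insert_of_mem ht)) _ _
          (fun t => by
            by_cases h : t = i
            · subst h
              rw [Function.update_self, Function.update_self]
              exact hα j
            · rw [Function.update_of_ne h, Function.update_of_ne h]
              exact hv t) fun t ht htT => by
            by_cases h : t = i
            · subst h
              exact ⟨j, by rw [Function.update_self], by rw [Function.update_self]⟩
            · rw [Function.update_of_ne h, Function.update_of_ne h]
              exact hb t ht fun h' => (Finset.mem_insert.1 h').elim h htT)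
    rw [Function.update_self, Function.update_self, Function.update_idem, Function.update_idem,
      sub_add_cancel, Function.update_eq_self] at h2
    exact h2

end Reduction

/-! ### Composites of two operations -/

section Nest

variable {I : Type*} [DecidableEq I]
variable {k : Type*} [Ring k] {𝓀 : ℤ → AddSubgroup k} [GradedRing 𝓀]
variable {V : Type*} [AddCommGroup V] [Module k V] {𝒱 : ℤ → AddSubgroup V}

/-- The composite `m_r(…, m_s(v_{φ 0}, v_{φ 1}, …), …)`, with the inner operation at the place `l`
and the arguments `v_{ψ t}` at the other places `t`. -/
def nest (m : ∀ n : ℕ, MultilinearMap ℤ (fun _ : Fin n => V) V) {r s : ℕ} (l : Fin r)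
    (φ : Fin s → I) (ψ : Fin r → I) (v : I → V) : V :=
  m r (Function.update (v ∘ ψ) l (m s (v ∘ φ)))

variable {m : ∀ n : ℕ, MultilinearMap ℤ (fun _ : Fin n => V) V} {r s : ℕ} {l : Fin r}
  {φ : Fin s → I} {ψ : Fin r → I}

theorem nest_update_inner (hφ : Function.Injective φ) (hd : ∀ q t, t ≠ l → φ q ≠ ψ t) (q : Fin s)
    (v : I → V) (x : V) : nest m l φ ψ (Function.update v (φ q) x) =
      m r (Function.update (v ∘ ψ) l (m s (Function.update (v ∘ φ) q x))) := by
  rw [nest, Function.update_comp_eq_of_injective v hφ]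
  congr 1
  funext t
  by_cases h : t = l
  · subst h
    rw [Function.update_self, Function.update_self]
  · rw [Function.update_of_ne h, Function.update_of_ne h, Function.comp_apply,
      Function.update_of_ne (hd q t h).symm, Function.comp_apply]

theorem nest_update_outer (hψ : ∀ t t', t ≠ l → t' ≠ l → ψ t = ψ t' → t = t')
    (hd : ∀ q t, t ≠ l → φ q ≠ ψ t) {t : Fin r} (ht : t ≠ l)
    (v : I → V) (x : V) : nest m l φ ψ (Function.update v (ψ t) x) =
      m r (Function.update (Function.update (v ∘ ψ) l (m s (v ∘ φ))) t x) := by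
  rw [nest, Function.update_comp_eq_of_forall_ne v x fun q => hd q t ht]
  congr 1
  funext t'
  by_cases h : t' = l
  · subst h
    rw [Function.update_self, Function.update_of_ne (Ne.symm ht), Function.update_self]
  · rw [Function.update_of_ne h, Function.comp_apply]
    by_cases h' : t' = t
    · subst h'
      rw [Function.update_self, Function.update_self]
    · rw [Function.update_of_ne h', Function.update_of_ne h, Function.comp_apply,
        Function.update_of_ne fun h'' => h' (hψ _ _ h ht h'')]

theorem nest_update_add (hφ : Function.Injective φ)
    (hψ : ∀ t t', t ≠ l → t' ≠ l → ψ t = ψ t' → t = t') (hd : ∀ q t, t ≠ l → φ q ≠ ψ t) {i : I}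
    (hi : (∃ q, φ q = i) ∨ ∃ t, t ≠ l ∧ ψ t = i) (v : I → V) (x y : V) :
    nest m l φ ψ (Function.update v i (x + y)) =
      nest m l φ ψ (Function.update v i x) + nest m l φ ψ (Function.update v i y) := by
  rcases hi with ⟨q, rfl⟩ | ⟨t, ht, rfl⟩
  · rw [nest_update_inner hφ hd, nest_update_inner hφ hd, nest_update_inner hφ hd,
      MultilinearMap.map_update_add, MultilinearMap.map_update_add]
  · rw [nest_update_outer hψ hd ht, nest_update_outer hψ hd ht, nest_update_outer hψ hd ht,
      MultilinearMap.map_update_add]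

/-- The degrees of the arguments of the outer operation in a composite. -/
def nestDeg (l : Fin r) (φ : Fin s → I) (ψ : Fin r → I) (p : I → ℤ) : Fin r → ℤ :=
  Function.update (p ∘ ψ) l (∑ q, p (φ q) + 2 - s)

theorem nestDeg_mem (hm : IsOperations 𝓀 𝒱 m) (hs : 1 ≤ s) {p : I → ℤ} {v : I → V} (hv : ∀ i, v i ∈ 𝒱 (p i)) (t : Fin r) :
    Function.update (v ∘ ψ) l (m s (v ∘ φ)) t ∈ 𝒱 (nestDeg l φ ψ p t) := by
  by_cases h : t = l
  · subst h
    rw [nestDeg, Function.update_self, Function.update_self]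
    exact hm.degree s hs _ _ fun q => hv (φ q)
  · rw [nestDeg, Function.update_of_ne h, Function.update_of_ne h]
    exact hv _

theorem nest_update_smul_outer (hm : IsOperations 𝓀 𝒱 m) (hr : 1 ≤ r) (hs : 1 ≤ s)
    (hψ : ∀ t t', t ≠ l → t' ≠ l → ψ t = ψ t' → t = t')
    (hd : ∀ q t, t ≠ l → φ q ≠ ψ t) {p : I → ℤ} {v : I → V} (hv : ∀ i, v i ∈ 𝒱 (p i)) {t : Fin r}
    (ht : t ≠ l) {q : ℤ} {x : k} (hx : x ∈ 𝓀 q) :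
    nest m l φ ψ (Function.update v (ψ t) (x • v (ψ t))) =
      sgn (q * (r + ∑ t' ∈ Finset.univ.filter (· < t), nestDeg l φ ψ p t')) •
        x • nest m l φ ψ v := by
  rw [nest_update_outer hψ hd ht]
  have h := hm.smul r hr _ _ (nestDeg_mem (l := l) (φ := φ) (ψ := ψ) hm hs hv) t q x hx
  rw [Function.update_of_ne ht, Function.comp_apply] at h
  exact h

/-- The scalar first crosses the inner operation and the arguments before it there, then the outer
operation and the arguments before the place `l`; the two signs multiply. -/
theorem nest_update_smul_inner (hm : IsOperations 𝓀 𝒱 m) (hr : 1 ≤ r) (hs : 1 ≤ s) (hφ : Function.Injective φ)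
    (hd : ∀ q t, t ≠ l → φ q ≠ ψ t) {p : I → ℤ} {v : I → V} (hv : ∀ i, v i ∈ 𝒱 (p i)) (t : Fin s)
    {q : ℤ} {x : k} (hx : x ∈ 𝓀 q) :
    nest m l φ ψ (Function.update v (φ t) (x • v (φ t))) =
      sgn (q * (r + ∑ t' ∈ Finset.univ.filter (· < l), nestDeg l φ ψ p t' +
        (s + ∑ t' ∈ Finset.univ.filter (· < t), p (φ t')))) • x • nest m l φ ψ v := by
  have h := hm.smul s hs _ _ (fun q => hv (φ q)) t q x hx
  have h' := hm.smul r hr _ _ (nestDeg_mem (l := l) (φ := φ) (ψ := ψ) hm hs hv) l q x hx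
  rw [Function.update_self, Function.update_idem] at h'
  rw [nest_update_inner hφ hd, show Function.update (v ∘ φ) t (x • v (φ t)) =
    Function.update (fun q => v (φ q)) t (x • v (φ t)) from rfl, h,
    MultilinearMap.map_update_smul, show (m s fun q => v (φ q)) = m s (v ∘ φ) from rfl, h',
    sgn_smul_sgn_smul, nest]
  congr 2
  ring

end Nest

/-- Turns an identity of signs into a polynomial identity over `ZMod 2`, which can be decided by
running through all values. -/
theorem sgn_eq_of_cast {a b : ℤ} (h : (a : ZMod 2) = b) : sgn a = sgn b := by
  have h1 : Even (b - a) := even_iff_two_dvd.2 ((ZMod.intCast_eq_intCast_iff_dvd_sub a b 2).1 h)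
  exact sgn_congr (Int.even_sub.1 h1).symm

theorem sum_filter_lt {n : ℕ} (t : Fin n) (f : ℕ → ℤ) :
    ∑ i ∈ Finset.univ.filter (· < t), f (i : ℕ) = ∑ i ∈ Finset.range t, f i := by
  rw [show Finset.range (t : ℕ) = (Finset.univ.filter (· < t)).map Fin.valEmbedding by
    ext i
    simp only [Finset.mem_range, Finset.mem_map, Finset.mem_filter, Finset.mem_univ, true_and,
      Fin.valEmbedding_apply]
    exact ⟨fun h => ⟨⟨i, h.trans t.2⟩, h, rfl⟩, by rintro ⟨j, hj, rfl⟩; exact hj⟩]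
  rw [Finset.sum_map]
  rfl

/-! ### The signs of the bar construction -/

section BarSign

variable {ι : Type*} (deg : ι → ℤ)

theorem xdeg_eq (u : List ι) : xdeg deg u = u.length - (u.map deg).sum := by
  induction u with
  | nil => simp
  | cons j u ih =>
    rw [xdeg_cons, ih, List.length_cons, List.map_cons, List.sum_cons]
    push_cast
    ring

/-- The exponent of the sign of the bar construction. -/
def barExp (u : List ι) : ℤ := ∑ i : Fin u.length, (u.length - 1 - (i : ℕ)) * deg (u.get i)

theorem barExp_nil : barExp deg [] = 0 := rfl

theorem barExp_cons (j : ι) (u : List ι) :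
    barExp deg (j :: u) = u.length * deg j + barExp deg u := by
  rw [barExp, barExp]
  change ∑ i : Fin (u.length + 1), _ = _
  rw [Fin.sum_univ_succ]
  congr 1
  · simp
  · refine Finset.sum_congr rfl fun i _ => ?_
    have h : (j :: u).get i.succ = u.get i := rfl
    rw [h]
    simp only [List.length_cons, Fin.val_succ]
    push_cast
    ring

theorem barExp_append (u w : List ι) :
    barExp deg (u ++ w) = barExp deg u + w.length * (u.map deg).sum + barExp deg w := by
  induction u with
  | nil => simp [barExp_nil]
  | cons j u ih =>
    rw [List.cons_append, barExp_cons, ih, barExp_cons, List.length_append, List.map_cons,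
      List.sum_cons]
    push_cast
    ring

/-- The sign relating a word in the desuspended basis to the word in the basis. -/
def barSign (u : List ι) : ℤ := sgn (barExp deg u) * pairSign deg u

theorem barSign_append (u w : List ι) : barSign deg (u ++ w) =
    sgn (w.length * (u.length - xdeg deg u) + xdeg deg u * xdeg deg w) *
      (barSign deg u * barSign deg w) := by
  have h : (u.map deg).sum = u.length - xdeg deg u := by rw [xdeg_eq]; ring
  rw [barSign, barSign, barSign, barExp_append, pairSign_append, sgn_add, sgn_add, sgn_add, h]
  ring

theorem barSign_singleton (j : ι) : barSign deg [j] = 1 := by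
  simp [barSign, barExp_cons, barExp_nil, pairSign]

/-- The sign of a structure constant of the operations. -/
def opSign (u : List ι) (j : ι) : ℤ := barSign deg u * sgn (xdeg deg u * deg j)

/-- The comparison of signs behind the `A∞` relation. On the left stand the sign of the relation,
the sign for taking a coefficient of the inner value out of the outer operation, and those of the
two structure constants. On the right stand a global sign, the Leibniz sign and the twist occurring
in `∂² (X j)`. -/
theorem opSign_insert (a v c : List ι) (i j : ι) :
    sgn ((v.length + 1) * (a.length + 1) + v.length * ((a.length + v.length + c.length) +
        (a.map deg).sum)) * (sgn ((a.length + 1 + c.length + (a.map deg).sum) *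
          (2 - deg i - xdeg deg v)) * (opSign deg v i * opSign deg (a ++ i :: c) j)) =
      opSign deg (a ++ (v ++ c)) j * (sgn (xdeg deg a * (1 - deg i + xdeg deg v)) *
        sgn ((1 - deg i + xdeg deg v) * (2 - deg j - xdeg deg (a ++ i :: c)))) := by
  have h : (a.map deg).sum = a.length - xdeg deg a := by rw [xdeg_eq]; ring
  have hc : i :: c = [i] ++ c := rfl
  simp only [opSign, hc, barSign_append, barSign_singleton, xdeg_append, xdeg_cons, xdeg_nil, h,
    List.length_append, List.length_cons, List.length_nil, one_mul]
  generalize xdeg deg a = xa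
  generalize xdeg deg v = xv
  generalize xdeg deg c = xc
  push_cast
  generalize (a.length : ℤ) = la
  generalize (v.length : ℤ) = lv
  generalize (c.length : ℤ) = lc
  generalize deg i = y
  generalize deg j = z
  -- The factors `barSign` of `a`, `v` and `c` occur once on each side, so the remaining identity
  -- involves eight parities.
  have key : sgn ((lv + 1) * (la + 1) + lv * (la + lv + lc + (la - xa))) *
      sgn ((la + 1 + lc + (la - xa)) * (2 - y - xv)) * sgn (xv * y) *
      sgn ((1 + lc) * (la - xa) + xa * (1 - y + 0 + xc)) *
      sgn (lc * (1 - (1 - y + 0)) + (1 - y + 0) * xc) * sgn ((xa + (1 - y + 0 + xc)) * z) =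
      sgn ((lv + lc) * (la - xa) + xa * (xv + xc)) * sgn (lc * (lv - xv) + xv * xc) *
      sgn ((xa + (xv + xc)) * z) * sgn (xa * (1 - y + xv)) *
      sgn ((1 - y + xv) * (2 - z - (xa + (1 - y + 0 + xc)))) := by
    simp only [← sgn_add]
    apply sgn_eq_of_cast
    push_cast
    generalize (xa : ZMod 2) = xa
    generalize (xv : ZMod 2) = xv
    generalize (xc : ZMod 2) = xc
    generalize (la : ZMod 2) = la
    generalize (lv : ZMod 2) = lv
    generalize (lc : ZMod 2) = lc
    generalize (y : ZMod 2) = y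
    generalize (z : ZMod 2) = z
    revert xa xv xc la lv lc y z
    decide
  linear_combination (barSign deg a * barSign deg v * barSign deg c) * key

end BarSign

/-! ### Elements with prescribed coordinates and expansion in the basis -/

section Values

variable {ι : Type*} {deg : ι → ℤ}
variable {k : Type*} [Ring k] {𝓀 : ℤ → AddSubgroup k} [GradedRing 𝓀]
variable {V : Type*} [AddCommGroup V] [Module k V] {𝒱 : ℤ → AddSubgroup V}

/-- The element with the coordinates `θ u j * e u j`. -/
def signedValue (α : Module.Basis ι k V) (θ : List ι → ι → ℤ) (e : List ι → ι →₀ k)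
    (u : List ι) : V := (e u).sum fun j x => (θ u j • x) • α j

theorem repr_signedValue (α : Module.Basis ι k V) (θ : List ι → ι → ℤ) (e : List ι → ι →₀ k)
    (u : List ι) (j : ι) : α.repr (signedValue α θ e u) j = θ u j • e u j := by
  rw [signedValue, Finsupp.sum, map_sum, Finsupp.finsetSum_apply, Finset.sum_eq_single j]
  · rw [map_smul, Module.Basis.repr_self, Finsupp.smul_single, Finsupp.single_eq_same, smul_eq_mul,
      mul_one]
  · intro i _ hi
    rw [map_smul, Module.Basis.repr_self, Finsupp.smul_single, Finsupp.single_eq_of_ne hi.symm]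
  · intro hj
    rw [Finsupp.notMem_support_iff.1 hj, smul_zero, zero_smul, map_zero, Finsupp.zero_apply]

theorem signedValue_mem (hV : GradedSMulMem 𝓀 𝒱) (α : Module.Basis ι k V)
    (hα : ∀ j, α j ∈ 𝒱 (deg j)) (θ : List ι → ι → ℤ) {e : List ι → ι →₀ k}
    (he : IsHomogeneousGen deg 𝓀 e) (u : List ι) :
    signedValue α θ e u ∈ 𝒱 ((u.map deg).sum + (2 - u.length)) := by
  refine AddSubgroup.sum_mem _ fun j _ => ?_
  have h := hV _ _ _ _ (AddSubgroup.zsmul_mem _ (he u j) (θ u j)) (hα j)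
  rwa [xdeg_eq, show 2 - deg j - (u.length - (u.map deg).sum) + deg j =
    (u.map deg).sum + (2 - (u.length : ℤ)) by ring] at h

/-- An operation with one argument expanded in the basis. -/
theorem map_update_eq_sum {m : ∀ n : ℕ, MultilinearMap ℤ (fun _ : Fin n => V) V}
    (hm : IsOperations 𝓀 𝒱 m) (α : Module.Basis ι k V) (hα : ∀ j, α j ∈ 𝒱 (deg j))
    (hrepr : ∀ (p : ℤ) (v : V), v ∈ 𝒱 p → ∀ j, α.repr v j ∈ 𝓀 (p - deg j)) {r : ℕ}
    (hr : 1 ≤ r) (l : Fin r) {w : Fin r → V} {p : Fin r → ℤ} (hw : ∀ t, t ≠ l → w t ∈ 𝒱 (p t))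
    {q : ℤ} {y : V} (hy : y ∈ 𝒱 q) :
    m r (Function.update w l y) = (α.repr y).sum fun i x =>
      sgn ((r + ∑ t ∈ Finset.univ.filter (· < l), p t) * (q - deg i)) •
        x • m r (Function.update w l (α i)) := by
  have h1 := map_finsuppSum (AddMonoidHom.mk' (fun z => m r (Function.update w l z))
    fun x z => MultilinearMap.map_update_add _ w l x z) (α.repr y) fun j x => x • α j
  simp only [AddMonoidHom.mk'_apply] at h1
  rw [← Finsupp.linearCombination_apply, Module.Basis.linearCombination_repr] at h1
  rw [h1]
  refine Finset.sum_congr rfl fun i _ => ?_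
  have h2 := hm.smul r hr (Function.update p l (deg i)) (Function.update w l (α i)) (fun t => by
    by_cases h : t = l
    · subst h
      rw [Function.update_self, Function.update_self]
      exact hα i
    · rw [Function.update_of_ne h, Function.update_of_ne h]
      exact hw t h) l _ _ (hrepr _ _ hy i)
  rw [Function.update_self, Function.update_idem, Finset.sum_congr rfl fun t ht =>
    Function.update_of_ne (Finset.mem_filter.1 ht).2.ne (deg i) p] at h2
  beta_reduce
  rw [h2, mul_comm]

end Values

/-! ### `A∞` structures from square zero derivations -/

section AInfinity

variable {ι : Type*} {deg : ι → ℤ}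
variable {k : Type*} [Ring k] {𝓀 : ℤ → AddSubgroup k} [GradedRing 𝓀]
variable {V : Type*} [AddCommGroup V] [Module k V] {𝒱 : ℤ → AddSubgroup V}

/-- A term of the `A∞` relation. -/
def aTerm (m : ∀ n : ℕ, MultilinearMap ℤ (fun _ : Fin n => V) V) (n s l : ℕ) (v : ℕ → V) : V :=
  m (n + 1 - s) (fun t : Fin (n + 1 - s) =>
    if (t : ℕ) < l then v t
    else if (t : ℕ) = l then m s (fun q : Fin s => v (l + q))
    else v (t + s - 1))

theorem aTerm_eq_nest (m : ∀ n : ℕ, MultilinearMap ℤ (fun _ : Fin n => V) V) {n s l : ℕ}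
    (hl : l < n + 1 - s) (v : ℕ → V) :
    aTerm m n s l v = nest m (⟨l, hl⟩ : Fin (n + 1 - s)) (fun q : Fin s => l + q)
      (fun t => if (t : ℕ) < l then (t : ℕ) else t + s - 1) v := by
  rw [aTerm, nest]
  congr 1
  funext t
  by_cases h : t = ⟨l, hl⟩
  · subst h
    rw [Function.update_self, if_neg (lt_irrefl _), if_pos rfl]
    rfl
  · have h' : (t : ℕ) ≠ l := fun h'' => h (Fin.ext h'')
    rw [Function.update_of_ne h, if_neg h', Function.comp_apply]
    split_ifs <;> rfl

/-- The inner operation takes the block `l, …, l + s - 1`, and the outer one takes the other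
indices, shifted by `s - 1` behind the block. Thus every index below `n` is used exactly once. -/
theorem aTerm_conditions {n s l : ℕ} (hs : 1 ≤ s) (hl : l < n + 1 - s) :
    (Function.Injective fun q : Fin s => l + (q : ℕ)) ∧
    (∀ t t' : Fin (n + 1 - s), t ≠ ⟨l, hl⟩ → t' ≠ ⟨l, hl⟩ →
      (if (t : ℕ) < l then (t : ℕ) else t + s - 1) =
        (if (t' : ℕ) < l then (t' : ℕ) else t' + s - 1) → t = t') ∧
    (∀ (q : Fin s) (t : Fin (n + 1 - s)), t ≠ ⟨l, hl⟩ →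
      l + (q : ℕ) ≠ if (t : ℕ) < l then (t : ℕ) else t + s - 1) ∧
    ∀ i < n, (∃ q : Fin s, l + (q : ℕ) = i) ∨ ∃ t : Fin (n + 1 - s), t ≠ ⟨l, hl⟩ ∧
      (if (t : ℕ) < l then (t : ℕ) else t + s - 1) = i := by
  refine ⟨fun q q' h => Fin.ext (by simpa using h), fun t t' ht ht' h => ?_, fun q t ht h => ?_,
    fun i hi => ?_⟩
  · rw [Ne, Fin.ext_iff] at ht ht'
    simp only at ht ht'
    apply Fin.ext
    split_ifs at h <;> omega
  · rw [Ne, Fin.ext_iff] at ht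
    simp only at ht
    have := q.2
    split_ifs at h <;> omega
  · by_cases h1 : i < l
    · exact Or.inr ⟨⟨i, by omega⟩, fun h => h1.ne (congrArg Fin.val h), if_pos h1⟩
    · by_cases h2 : i < l + s
      · exact Or.inl ⟨⟨i - l, by omega⟩, by simp only; omega⟩
      · refine Or.inr ⟨⟨i + 1 - s, by omega⟩, fun h => ?_, ?_⟩
        · have := congrArg Fin.val h
          simp only at this
          omega
        · simp only
          rw [if_neg (by omega)]
          omega

theorem aTerm_update_add (m : ∀ n : ℕ, MultilinearMap ℤ (fun _ : Fin n => V) V) {n s l : ℕ}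
    (hs : 1 ≤ s) (hl : l < n + 1 - s) {i : ℕ} (hi : i < n) (v : ℕ → V) (x y : V) :
    aTerm m n s l (Function.update v i (x + y)) =
      aTerm m n s l (Function.update v i x) + aTerm m n s l (Function.update v i y) := by
  obtain ⟨h1, h2, h3, h4⟩ := aTerm_conditions hs hl
  rw [aTerm_eq_nest m hl, aTerm_eq_nest m hl, aTerm_eq_nest m hl]
  exact nest_update_add h1 h2 h3 (h4 i hi) v x y

theorem aTerm_nestDeg {n s l : ℕ} (hl : l < n + 1 - s) (p : ℕ → ℤ)
    (t : Fin (n + 1 - s)) : nestDeg (⟨l, hl⟩ : Fin (n + 1 - s)) (fun q : Fin s => l + (q : ℕ))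
      (fun t => if (t : ℕ) < l then (t : ℕ) else t + s - 1) p t =
      if (t : ℕ) < l then p t else if (t : ℕ) = l then ∑ q ∈ Finset.range s, p (l + q) + 2 - s
        else p (t + s - 1) := by
  rw [nestDeg]
  by_cases h : t = ⟨l, hl⟩
  · subst h
    rw [Function.update_self, if_neg (lt_irrefl _), if_pos rfl,
      Fin.sum_univ_eq_sum_range (fun q => p (l + q))]
  · have h' : (t : ℕ) ≠ l := fun h'' => h (Fin.ext h'')
    rw [Function.update_of_ne h, if_neg h', Function.comp_apply]
    split_ifs <;> rfl

theorem sum_nestDeg_le {n s l : ℕ} (hl : l < n + 1 - s) (p : ℕ → ℤ) (t : Fin (n + 1 - s))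
    (ht : (t : ℕ) ≤ l) : ∑ t' ∈ Finset.univ.filter (· < t),
      nestDeg (⟨l, hl⟩ : Fin (n + 1 - s)) (fun q : Fin s => l + (q : ℕ))
      (fun t => if (t : ℕ) < l then (t : ℕ) else t + s - 1) p t' = ∑ i ∈ Finset.range t, p i := by
  rw [← sum_filter_lt]
  refine Finset.sum_congr rfl fun t' ht' => ?_
  rw [aTerm_nestDeg, if_pos]
  exact lt_of_lt_of_le (Finset.mem_filter.1 ht').2 ht

/-- Behind the place `l` the inner value contributes the degrees of its whole block together with
the degree `2 - s` of the operation. -/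
theorem sum_nestDeg_gt {n s l : ℕ} (hl : l < n + 1 - s) (p : ℕ → ℤ) (t : Fin (n + 1 - s))
    (ht : l < (t : ℕ)) : ∑ t' ∈ Finset.univ.filter (· < t),
      nestDeg (⟨l, hl⟩ : Fin (n + 1 - s)) (fun q : Fin s => l + (q : ℕ))
      (fun t => if (t : ℕ) < l then (t : ℕ) else t + s - 1) p t' =
        ∑ i ∈ Finset.range (t + s - 1), p i + 2 - s := by
  simp only [aTerm_nestDeg]
  rw [sum_filter_lt t (fun t => if t < l then p t else if t = l then
    ∑ q ∈ Finset.range s, p (l + q) + 2 - s else p (t + s - 1))]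
  generalize (t : ℕ) = t at ht
  obtain ⟨d, rfl⟩ := Nat.exists_eq_add_of_lt ht
  clear ht
  induction d with
  | zero =>
    rw [add_zero, Finset.sum_range_succ, if_neg (lt_irrefl l), if_pos rfl,
      show l + 1 + s - 1 = l + s by omega, Finset.sum_range_add]
    rw [Finset.sum_congr rfl fun i hi => if_pos (Finset.mem_range.1 hi)]
    ring
  | succ d ih =>
    rw [show l + (d + 1) + 1 = (l + d + 1) + 1 by ring, Finset.sum_range_succ, ih,
      if_neg (by omega), if_neg (by omega), show l + d + 1 + 1 + s - 1 = (l + d + 1 + s - 1) + 1 by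
        omega, Finset.sum_range_succ]
    ring

theorem sgn_aTerm_update {p : ℕ → ℤ} {n s l i : ℕ} (q : ℤ) :
    sgn ((s + 1) * (l + 1) + s * (n + ∑ j ∈ Finset.range l, Function.update p i (q + p i) j)) =
      sgn ((s + 1) * (l + 1) + s * (n + ∑ j ∈ Finset.range l, p j)) *
        sgn (if i < l then s * q else 0) := by
  rw [← sgn_add]
  congr 1
  by_cases h : i < l
  · rw [if_pos h, Finset.sum_update_of_mem (Finset.mem_range.2 h),
      ← Finset.add_sum_erase _ _ (Finset.mem_range.2 h), Finset.sdiff_singleton_eq_erase]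
    ring
  · rw [if_neg h, Finset.sum_update_of_notMem (fun h' => h (Finset.mem_range.1 h')), add_zero]

/-- The factor on the right does not depend on `s` and `l`: all terms of the relation scale alike,
so a homogeneous scalar can be taken out of the whole sum. -/
theorem aTerm_update_smul {m : ∀ n : ℕ, MultilinearMap ℤ (fun _ : Fin n => V) V}
    (hm : IsOperations 𝓀 𝒱 m) {n s l : ℕ} (hs : 1 ≤ s) (hl : l < n + 1 - s) {i : ℕ} (hi : i < n)
    {p : ℕ → ℤ} {v : ℕ → V} (hv : ∀ i, v i ∈ 𝒱 (p i)) {q : ℤ} {x : k} (hx : x ∈ 𝓀 q) :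
    sgn ((s + 1) * (l + 1) + s * (n + ∑ j ∈ Finset.range l, Function.update p i (q + p i) j)) •
        aTerm m n s l (Function.update v i (x • v i)) =
      sgn (q * (n + 1 + ∑ j ∈ Finset.range i, p j)) • x •
        sgn ((s + 1) * (l + 1) + s * (n + ∑ j ∈ Finset.range l, p j)) • aTerm m n s l v := by
  obtain ⟨h1, h2, h3, h4⟩ := aTerm_conditions hs hl
  have hr : 1 ≤ n + 1 - s := by omega
  have hns : ((n + 1 - s : ℕ) : ℤ) = n + 1 - s := by omega
  rw [sgn_aTerm_update, aTerm_eq_nest m hl, aTerm_eq_nest m hl, smul_comm x, smul_smul]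
  rcases h4 i hi with ⟨t, rfl⟩ | ⟨t, ht, rfl⟩
  · rw [nest_update_smul_inner hm hr hs h1 h3 hv t hx, sum_nestDeg_le hl p ⟨l, hl⟩ le_rfl,
      sum_filter_lt t (fun t => p (l + t)), smul_smul, if_neg (by omega), sgn_zero, mul_one,
      mul_comm (sgn (q * _)), hns]
    simp only
    rw [Finset.sum_range_add]
    congr 2
    apply congrArg
    ring
  · have h := nest_update_smul_outer hm hr hs h2 h3 hv ht hx
    rw [h, smul_smul]
    have ht' : (t : ℕ) ≠ l := fun h'' => ht (Fin.ext h'')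
    congr 1
    rw [mul_assoc, mul_comm (sgn (q * (n + 1 + _))), ← sgn_add]
    congr 1
    by_cases htl : (t : ℕ) < l
    · rw [sum_nestDeg_le hl p t htl.le, if_pos htl, if_pos htl, hns]
      apply sgn_eq_of_cast
      push_cast
      generalize (∑ j ∈ Finset.range (t : ℕ), (p j : ZMod 2)) = z
      generalize (s : ZMod 2) = s
      generalize (q : ZMod 2) = q
      generalize (n : ZMod 2) = n
      revert z s q n
      decide
    · rw [if_neg htl, if_neg (by omega), sum_nestDeg_gt hl p t (by omega), hns]
      apply sgn_eq_of_cast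
      push_cast
      generalize (∑ j ∈ Finset.range ((t : ℕ) + s - 1), (p j : ZMod 2)) = z
      generalize (s : ZMod 2) = s
      generalize (q : ZMod 2) = q
      generalize (n : ZMod 2) = n
      revert z s q n
      decide

/-- Iterated cuts sum first over the position and allow empty inner blocks, whereas the `A∞`
relation sums first over `s ≥ 1`. Empty blocks contribute nothing when `e [] = 0`. -/
theorem sum_range_range_eq {W : Type*} [AddCommMonoid W] (n : ℕ) (f : ℕ → ℕ → W)
    (h0 : ∀ l, f l 0 = 0) :
    ∑ l ∈ Finset.range (n + 1), ∑ s ∈ Finset.range (n - l + 1), f l s =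
      ∑ s ∈ Finset.Icc 1 n, ∑ l ∈ Finset.range (n + 1 - s), f l s := by
  rw [Finset.sum_comm' (t' := Finset.range (n + 1)) (s' := fun s => Finset.range (n + 1 - s))]
  · symm
    refine Finset.sum_subset (fun s hs => ?_) fun s hs hs' => ?_
    · rw [Finset.mem_Icc] at hs
      rw [Finset.mem_range]
      omega
    · rw [Finset.mem_Icc] at hs'
      rw [Finset.mem_range] at hs
      obtain rfl : s = 0 := by omega
      exact Finset.sum_eq_zero fun l _ => h0 l
  · intro l s
    simp only [Finset.mem_range]
    omega

variable (deg 𝓀) in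
/-- The operations corresponding to the derivation with the coefficients `e`. -/
def operations (α : Module.Basis ι k V) (e : List ι → ι →₀ k) (n : ℕ) :
    MultilinearMap ℤ (fun _ : Fin n => V) V :=
  multExt deg 𝓀 α n (signedValue α (opSign deg) e) n

theorem isOperations_operations (hk : IsGradedComm 𝓀) (hV : GradedSMulMem 𝓀 𝒱)
    (α : Module.Basis ι k V) (hα : ∀ j, α j ∈ 𝒱 (deg j))
    (hrepr : ∀ (p : ℤ) (v : V), v ∈ 𝒱 p → ∀ j, α.repr v j ∈ 𝓀 (p - deg j))
    {e : List ι → ι →₀ k} (he : IsHomogeneousGen deg 𝓀 e) :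
    IsOperations 𝓀 𝒱 (operations deg 𝓀 α e) :=
  isOperations_multExt hk hV α hrepr (signedValue_mem hV α hα (opSign deg) he)

theorem operations_basis (α : Module.Basis ι k V) (e : List ι → ι →₀ k) {n : ℕ} (u : Fin n → ι)
    (j : ι) : α.repr (operations deg 𝓀 α e n fun i => α (u i)) j =
      opSign deg (List.ofFn u) j • e (List.ofFn u) j := by
  rw [operations, multExt_basis, repr_signedValue]

theorem ofFn_update_eq (u : ℕ → ι) {n s l : ℕ} (hs : 1 ≤ s) (hl : l < n + 1 - s) (i : ι) :
    List.ofFn (Function.update (fun t : Fin (n + 1 - s) =>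
      u (if (t : ℕ) < l then (t : ℕ) else t + s - 1)) ⟨l, hl⟩ i) =
      (List.ofFn fun i : Fin l => u i) ++ i :: List.ofFn fun i : Fin (n - l - s) => u (l + s + i) := by
  refine List.ext_getElem ?_ fun t h1 h2 => ?_
  · simp only [List.length_append, List.length_ofFn, List.length_cons]
    omega
  · rw [List.getElem_ofFn]
    rw [List.length_ofFn] at h1
    rcases lt_trichotomy t l with h | rfl | h
    · rw [List.getElem_append_left (by simpa using h), List.getElem_ofFn,
        Function.update_of_ne (fun h' => h.ne (congrArg Fin.val h'))]
      simp only [if_pos h]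
    · rw [List.getElem_append_right (by simp), Function.update_self]
      simp
    · rw [List.getElem_append_right (by simpa using h.le),
        Function.update_of_ne (fun h' => h.ne' (congrArg Fin.val h'))]
      obtain ⟨d, rfl⟩ := Nat.exists_eq_add_of_lt h
      simp only [List.length_ofFn, show l + d + 1 - l = d + 1 by omega, List.getElem_cons_succ,
        List.getElem_ofFn]
      rw [if_neg (by omega)]
      congr 1
      omega

/-- On basis elements a term of the `A∞` relation is, up to the global sign `opSign`, the part of
`∂² (X j)` in which `X j` is replaced by a word `a i c` and then `i` by `w`. -/
theorem aTerm_basis (hk : IsGradedComm 𝓀) (hV : GradedSMulMem 𝓀 𝒱)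
    (α : Module.Basis ι k V) (hα : ∀ j, α j ∈ 𝒱 (deg j))
    (hrepr : ∀ (p : ℤ) (v : V), v ∈ 𝒱 p → ∀ j, α.repr v j ∈ 𝓀 (p - deg j))
    {e : List ι → ι →₀ k} (he : IsHomogeneousGen deg 𝓀 e) {n s l : ℕ} (hs : 1 ≤ s)
    (hl : l < n + 1 - s) (u : ℕ → ι) (v : ℕ → V) (hu : ∀ i < n, v i = α (u i)) (a w c : List ι)
    (ha : a = List.ofFn fun i : Fin l => u i) (hw : w = List.ofFn fun i : Fin s => u (l + i))
    (hc : c = List.ofFn fun i : Fin (n - l - s) => u (l + s + i)) (j : ι) :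
    sgn ((s + 1) * (l + 1) + s * (n + ∑ i ∈ Finset.range l, deg (u i))) •
        α.repr (aTerm (operations deg 𝓀 α e) n s l v) j =
      opSign deg (a ++ (w ++ c)) j • (e w).sum fun i x =>
        sgn (xdeg deg a * (1 - deg i + xdeg deg w)) •
          x • twist 𝓀 (1 - deg i + xdeg deg w) (e (a ++ i :: c) j) := by
  have hm := isOperations_operations hk hV α hα hrepr he
  have h1 : aTerm (operations deg 𝓀 α e) n s l v = operations deg 𝓀 α e (n + 1 - s)
      (Function.update (fun t : Fin (n + 1 - s) =>
        α (u (if (t : ℕ) < l then (t : ℕ) else t + s - 1))) ⟨l, hl⟩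
        (operations deg 𝓀 α e s fun q : Fin s => α (u (l + q)))) := by
    rw [aTerm_eq_nest _ hl, nest]
    have h2 : (v ∘ fun q : Fin s => l + (q : ℕ)) = fun q : Fin s => α (u (l + q)) :=
      funext fun q => hu _ (by
        have := q.2
        simp only
        omega)
    rw [h2]
    congr 1
    funext t
    by_cases h : t = ⟨l, hl⟩
    · subst h
      rw [Function.update_self, Function.update_self]
    · have h' : (t : ℕ) ≠ l := fun h'' => h (Fin.ext h'')
      rw [Function.update_of_ne h, Function.update_of_ne h, Function.comp_apply]
      refine hu _ ?_
      split_ifs <;> omega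
  have hwsum : (w.map deg).sum = ∑ q : Fin s, deg (u (l + q)) := by
    rw [hw, List.map_ofFn, List.sum_ofFn]
    rfl
  have hasum : (a.map deg).sum = ∑ i ∈ Finset.range l, deg (u i) := by
    rw [ha, List.map_ofFn, List.sum_ofFn, ← Fin.sum_univ_eq_sum_range (fun i => deg (u i))]
    rfl
  have hlw : (w.length : ℤ) = s := by rw [hw, List.length_ofFn]
  have hla : (a.length : ℤ) = l := by rw [ha, List.length_ofFn]
  have hlc : (c.length : ℤ) = n - l - s := by
    rw [hc, List.length_ofFn]
    omega
  have hy := hm.degree s hs (fun q => deg (u (l + q))) (fun q => α (u (l + q))) fun q => hα _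
  have h3 : ∑ t ∈ Finset.univ.filter (· < (⟨l, hl⟩ : Fin (n + 1 - s))),
      deg (u (if (t : ℕ) < l then (t : ℕ) else t + s - 1)) = (a.map deg).sum := by
    rw [hasum, ← sum_filter_lt (⟨l, hl⟩ : Fin (n + 1 - s)) fun i => deg (u i)]
    refine Finset.sum_congr rfl fun t ht => ?_
    rw [if_pos (show (t : ℕ) < l from (Finset.mem_filter.1 ht).2)]
  rw [h1, map_update_eq_sum hm α hα hrepr (by omega) ⟨l, hl⟩
    (p := fun t => deg (u (if (t : ℕ) < l then (t : ℕ) else t + s - 1))) (fun t _ => hα _) hy, h3]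
  have h4 : α.repr (operations deg 𝓀 α e s fun q : Fin s => α (u (l + q))) =
      (e w).sum fun i x => Finsupp.single i (opSign deg w i • x) := by
    ext i
    rw [operations_basis, ← hw, Finsupp.sum, Finsupp.finsetSum_apply,
      Finset.sum_eq_single i]
    · rw [Finsupp.single_eq_same]
    · intro i' _ hi'
      rw [Finsupp.single_eq_of_ne hi'.symm]
    · intro hi
      rw [Finsupp.notMem_support_iff.1 hi, smul_zero, Finsupp.single_zero, Finsupp.zero_apply]
  rw [h4, Finsupp.sum_sum_index, Finsupp.sum, map_sum, Finsupp.finsetSum_apply,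
    Finset.smul_sum, Finsupp.sum, Finset.smul_sum]
  · refine Finset.sum_congr rfl fun i _ => ?_
    have h5 : Function.update (fun t : Fin (n + 1 - s) =>
        α (u (if (t : ℕ) < l then (t : ℕ) else t + s - 1))) ⟨l, hl⟩ (α i) =
        fun t => α (Function.update (fun t : Fin (n + 1 - s) =>
          u (if (t : ℕ) < l then (t : ℕ) else t + s - 1)) ⟨l, hl⟩ i t) := by
      funext t
      by_cases h : t = ⟨l, hl⟩
      · subst h
        rw [Function.update_self, Function.update_self]
      · rw [Function.update_of_ne h, Function.update_of_ne h]
    rw [Finsupp.sum_single_index (by rw [zero_smul, smul_zero]), h5, map_zsmul, Finsupp.smul_apply,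
      map_smul, Finsupp.smul_apply, operations_basis, ofFn_update_eq u hs hl, ← ha, ← hc,
      twist_of_mem 𝓀 _ (he (a ++ i :: c) j)]
    have key := opSign_insert deg a w c i j
    rw [hlw, hla, hlc, show (l : ℤ) + s + (n - l - s) = n by ring] at key
    have hr : ((n + 1 - s : ℕ) : ℤ) = l + 1 + (n - l - s) := by omega
    have hq : ∑ q : Fin s, deg (u (l + q)) + 2 - (s : ℤ) = 2 - xdeg deg w := by
      rw [xdeg_eq, hwsum, hlw]
      ring
    rw [hr, hq, ← hasum, show (2 - xdeg deg w - deg i) = 2 - deg i - xdeg deg w by ring]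
    simp only [smul_assoc, smul_comm (e w i), smul_smul]
    rw [← smul_assoc, ← smul_assoc]
    congr 2
  · intro i
    rw [zero_smul, smul_zero]
  · intro i x y
    rw [add_smul, smul_add]

/-- The operations corresponding to a square zero derivation form an `A∞` structure. -/
theorem isAInfinity_operations (hk : IsGradedComm 𝓀) (hV : GradedSMulMem 𝓀 𝒱)
    (α : Module.Basis ι k V) (hα : ∀ j, α j ∈ 𝒱 (deg j))
    (hrepr : ∀ (p : ℤ) (v : V), v ∈ 𝒱 p → ∀ j, α.repr v j ∈ 𝓀 (p - deg j))
    {e : List ι → ι →₀ k} (he : IsHomogeneousGen deg 𝓀 e) (h0 : e [] = 0)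
    (hsq : ∀ f : List ι → k, der deg 𝓀 e (der deg 𝓀 e f) = 0) :
    IsAInfinity 𝓀 𝒱 (operations deg 𝓀 α e) where
  toIsOperations := isOperations_operations hk hV α hα hrepr he
  relation n hn p v hv := by
    have hm := isOperations_operations hk hV α hα hrepr he
    refine vanish_of_basis α hα hrepr (Finset.range n) (fun p v =>
      ∑ s ∈ Finset.Icc 1 n, ∑ l ∈ Finset.range (n + 1 - s),
      sgn ((s + 1) * (l + 1) + s * (n + ∑ i ∈ Finset.range l, p i)) •
        aTerm (operations deg 𝓀 α e) n s l v) ?_ ?_ ?_ p v hv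
    · intro i hi p v x y
      rw [← Finset.sum_add_distrib]
      refine Finset.sum_congr rfl fun s hs => ?_
      rw [← Finset.sum_add_distrib]
      refine Finset.sum_congr rfl fun l hl => ?_
      rw [← smul_add, aTerm_update_add _ (Finset.mem_Icc.1 hs).1 (Finset.mem_range.1 hl)
        (Finset.mem_range.1 hi)]
    · intro i hi p v hv q x hx h
      have h1 : ∀ s ∈ Finset.Icc 1 n, ∀ l ∈ Finset.range (n + 1 - s), _ := fun s hs l hl =>
        aTerm_update_smul hm (Finset.mem_Icc.1 hs).1 (Finset.mem_range.1 hl)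
          (Finset.mem_range.1 hi) hv hx
      rw [Finset.sum_congr rfl fun s hs => Finset.sum_congr rfl (h1 s hs)]
      simp only [← Finset.smul_sum]
      rw [h, smul_zero, smul_zero]
    · intro p v hv hb
      -- The first argument supplies an index, since `n ≥ 1`; it serves as the default value beyond
      -- the first `n` arguments.
      have hne : Nonempty ι := by
        obtain ⟨j, _⟩ := hb 0 (Finset.mem_range.2 hn)
        exact ⟨j⟩
      choose! u hu using hb
      refine α.repr.injective (Finsupp.ext fun j => ?_)
      rw [map_zero, Finsupp.zero_apply, map_sum, Finsupp.finsetSum_apply]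
      set U := List.ofFn (fun i : Fin n => u i) with hU
      set G : List ι → List ι → List ι → k := fun a w c => (e w).sum fun i x =>
        sgn (xdeg deg a * (1 - deg i + xdeg deg w)) •
          x • twist 𝓀 (1 - deg i + xdeg deg w) (e (a ++ i :: c) j) with hG
      -- This sum over the decompositions of `U` into three words is the coefficient of `∂² (X j)`
      -- at `U`.
      have hzero : cut (fun a b => cut (fun w c => G a w c) b) U = 0 := by
        have h1 := congrFun (hsq (mono k [j])) U
        rw [der_apply] at h1
        simp only [der_mono_single] at h1
        exact h1
      have hlen : U.length = n := List.length_ofFn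
      have h2 : ∀ s ∈ Finset.Icc 1 n, α.repr (∑ l ∈ Finset.range (n + 1 - s),
          sgn ((s + 1) * (l + 1) + s * (n + ∑ i ∈ Finset.range l, p i)) •
            aTerm (operations deg 𝓀 α e) n s l v) j = opSign deg U j •
          ∑ l ∈ Finset.range (n + 1 - s), G (U.take l) ((U.drop l).take s) ((U.drop l).drop s) := by
        intro s hs
        rw [map_sum, Finsupp.finsetSum_apply, Finset.smul_sum]
        refine Finset.sum_congr rfl fun l hl => ?_
        rw [Finset.mem_range] at hl
        rw [Finset.mem_Icc] at hs
        rw [map_zsmul, Finsupp.smul_apply, Finset.sum_congr rfl fun i hi =>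
          (hu i (Finset.mem_range.2 (by have := Finset.mem_range.1 hi; omega))).1,
          aTerm_basis hk hV α hα hrepr he hs.1 hl u v
          (fun i hi => (hu i (Finset.mem_range.2 hi)).2) (U.take l) ((U.drop l).take s)
          ((U.drop l).drop s), List.take_append_drop, List.take_append_drop]
        · refine List.ext_getElem ?_ fun t h1 h2 => ?_
          · rw [List.length_take, hlen, List.length_ofFn]
            omega
          · simp [hU]
        · refine List.ext_getElem ?_ fun t h1 h2 => ?_
          · rw [List.length_take, List.length_drop, hlen, List.length_ofFn]
            omega
          · simp [hU]
        · refine List.ext_getElem ?_ fun t h1 h2 => ?_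
          · rw [List.length_drop, List.length_drop, hlen, List.length_ofFn]
          · simp [hU]
      rw [Finset.sum_congr rfl h2, ← Finset.smul_sum]
      rw [← sum_range_range_eq n fun l s => G (U.take l) ((U.drop l).take s) ((U.drop l).drop s)]
      · have h3 : ∑ l ∈ Finset.range (n + 1), ∑ s ∈ Finset.range (n - l + 1),
            G (U.take l) ((U.drop l).take s) ((U.drop l).drop s) =
            cut (fun a b => cut (fun w c => G a w c) b) U := by
          rw [cut, hlen]
          refine Finset.sum_congr rfl fun l _ => ?_
          rw [cut, List.length_drop, hlen]
        rw [h3, hzero, smul_zero]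
      · intro l
        rw [List.take_zero]
        simp only [hG]
        rw [h0, Finsupp.sum_zero_index]

/-- The operations correspond to the codifferential. -/
theorem corresponds_operations {A : Type*} [AddCommGroup A] [Module k A] {H : Submodule k A}
    (α : Module.Basis ι k H) {e : List ι → ι →₀ k} (he : IsHomogeneousGen deg 𝓀 e) :
    Corresponds 𝓀 deg α (operations deg 𝓀 α e) (transpose deg 𝓀 (derRows deg e)) := by
  intro u _ j
  rw [transpose_single, koszul_one, one_smul, transposeWord_apply, ← op_mono deg (𝓀 := 𝓀), ← der,
    der_mono_single, bar, Finsupp.smul_apply, Finsupp.sum, Finsupp.finsetSum_apply,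
    Finset.sum_eq_single j]
  · rw [Finsupp.single_eq_same, operations_basis, List.ofFn_get, map_zsmul, koszul_apply,
      twist_of_mem 𝓀 _ (he u j), smul_smul, smul_smul]
    congr 1
    have h : sgn (∑ i : Fin u.length, (u.length - 1 - (i : ℕ)) * deg (u.get i)) =
      sgn (barExp deg u) := rfl
    rw [h, opSign, barSign, transposeSign, xdeg_cons, xdeg_nil]
    have h1 := sgn_mul_self (barExp deg u)
    have h2 : pairSign deg [j] = 1 := by simp [pairSign]
    have h3 : -sgn (1 - deg j + 0 + (1 - deg j + 0) * xdeg deg u) =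
        sgn (xdeg deg u * deg j) * sgn (1 * (2 - deg j - xdeg deg u)) := by
      have : (-1 : ℤ) = sgn 1 := sgn_one.symm
      rw [neg_eq_neg_one_mul, this, ← sgn_add, ← sgn_add]
      apply sgn_eq_of_cast
      push_cast
      generalize (xdeg deg u : ZMod 2) = x
      generalize (deg j : ZMod 2) = y
      revert x y
      decide
    rw [h2]
    linear_combination pairSign deg u * h3 - (sgn (xdeg deg u * deg j) *
      sgn (1 * (2 - deg j - xdeg deg u)) * pairSign deg u) * h1
  · intro i _ hi
    rw [Finsupp.single_eq_of_ne]
    intro h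
    exact hi (List.singleton_inj.1 h).symm
  · intro hj
    rw [Finsupp.notMem_support_iff.1 hj, map_zero, Finsupp.single_zero, Finsupp.zero_apply]

end AInfinity

/-! ### Transport to the cohomology -/

section Transport

variable {k : Type*} [Ring k] {𝓀 : ℤ → AddSubgroup k} [GradedRing 𝓀]
variable {V C : Type*} [AddCommGroup V] [Module k V] [AddCommGroup C] [Module k C]
  {𝒱 : ℤ → AddSubgroup V} {𝒞 : ℤ → AddSubgroup C}

/-- Operations transported along an isomorphism. -/
def transport (E : V ≃ₗ[k] C) (m : ∀ n : ℕ, MultilinearMap ℤ (fun _ : Fin n => V) V) (n : ℕ) :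
    MultilinearMap ℤ (fun _ : Fin n => C) C :=
  E.toLinearMap.toAddMonoidHom.toIntLinearMap.compMultilinearMap
    ((m n).compLinearMap fun _ => E.symm.toLinearMap.toAddMonoidHom.toIntLinearMap)

theorem transport_apply (E : V ≃ₗ[k] C) (m : ∀ n : ℕ, MultilinearMap ℤ (fun _ : Fin n => V) V)
    {n : ℕ} (v : Fin n → C) : transport E m n v = E (m n fun i => E.symm (v i)) := rfl

variable (E : V ≃ₗ[k] C) {m : ∀ n : ℕ, MultilinearMap ℤ (fun _ : Fin n => V) V}

theorem IsOperations.transport (hm : IsOperations 𝓀 𝒱 m) (hE : ∀ p, ∀ v ∈ 𝒱 p, E v ∈ 𝒞 p)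
    (hE' : ∀ p, ∀ c ∈ 𝒞 p, E.symm c ∈ 𝒱 p) : IsOperations 𝓀 𝒞 (transport E m) where
  degree n hn p v hv := hE _ _ (hm.degree n hn p _ fun i => hE' _ _ (hv i))
  smul n hn p v hv i q x hx := by
    rw [transport_apply, transport_apply, ← map_smul, ← map_zsmul,
      ← hm.smul n hn p _ (fun i => hE' _ _ (hv i)) i q x hx]
    congr 2
    funext t
    by_cases h : t = i
    · subst h
      rw [Function.update_self, Function.update_self, map_smul]
    · rw [Function.update_of_ne h, Function.update_of_ne h]

theorem IsAInfinity.transport (hm : IsAInfinity 𝓀 𝒱 m) (hE : ∀ p, ∀ v ∈ 𝒱 p, E v ∈ 𝒞 p)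
    (hE' : ∀ p, ∀ c ∈ 𝒞 p, E.symm c ∈ 𝒱 p) : IsAInfinity 𝓀 𝒞 (transport E m) where
  toIsOperations := hm.toIsOperations.transport E hE hE'
  relation n hn p v hv := by
    have h := congrArg E (hm.relation n hn p (fun i => E.symm (v i)) fun i => hE' _ _ (hv i))
    rw [map_zero, map_sum] at h
    refine Eq.trans ?_ h
    refine Finset.sum_congr rfl fun s _ => ?_
    rw [map_sum]
    refine Finset.sum_congr rfl fun l _ => ?_
    rw [map_zsmul, transport_apply]
    congr 3
    funext t
    split_ifs
    · rfl
    · rw [transport_apply, LinearEquiv.symm_apply_apply]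
    · rfl

theorem IsLInfinity.transport (hm : IsLInfinity 𝓀 𝒱 m) (hE : ∀ p, ∀ v ∈ 𝒱 p, E v ∈ 𝒞 p)
    (hE' : ∀ p, ∀ c ∈ 𝒞 p, E.symm c ∈ 𝒱 p) : IsLInfinity 𝓀 𝒞 (transport E m) where
  toIsOperations := hm.toIsOperations.transport E hE hE'
  antisymm n hn p v hv σ := by
    rw [transport_apply, transport_apply, ← map_zsmul,
      ← hm.antisymm n hn p _ (fun i => hE' _ _ (hv i)) σ]
    rfl
  relation n hn p v hv := by
    have h := congrArg E (hm.relation n hn p (fun i => E.symm (v i)) fun i => hE' _ _ (hv i))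
    rw [map_zero, map_sum] at h
    refine Eq.trans ?_ h
    refine Finset.sum_congr rfl fun s _ => ?_
    rw [map_sum]
    refine Finset.sum_congr rfl fun σ _ => ?_
    rw [map_zsmul, transport_apply]
    have hvσ : ∀ i : ℕ, E.symm (if h : i < n then v (σ ⟨i, h⟩) else 0) =
        if h : i < n then E.symm (v (σ ⟨i, h⟩)) else 0 := fun i => by
      split_ifs
      · rfl
      · rw [map_zero]
    congr 3
    funext t
    simp only
    split_ifs with h1 h2
    · rw [transport_apply, LinearEquiv.symm_apply_apply]
      congr 1
      funext q
      exact hvσ q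
    · rfl
    · rw [map_zero]

end Transport

/-! ### The isomorphism of `H` with the cohomology and its compatibility with degrees -/

section Cohomology

variable {k : Type*} [Ring k] {𝓀 : ℤ → AddSubgroup k} [GradedRing 𝓀]
variable {A : Type*} [AddCommGroup A] [Module k A] {𝒜 : ℤ → AddSubgroup A}
  [DirectSum.Decomposition 𝒜] {d : A →ₛₗ[koszul 𝓀] A} {H M : Submodule k A}

/-- The isomorphism of `H` with the cohomology. -/
def IsCohSplitting.equiv (hs : IsCohSplitting 𝒜 d H M) : H ≃ₗ[k] Cohomology d :=
  LinearEquiv.ofBijective _ hs.bijective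

theorem IsCohSplitting.equiv_apply (hs : IsCohSplitting 𝒜 d H M) (h : H) :
    hs.equiv h = classMap d H hs.le_ker h := rfl

theorem IsCohSplitting.equiv_mem (hs : IsCohSplitting 𝒜 d H M) (p : ℤ) (h : H)
    (hh : h ∈ subGrading 𝒜 H p) : hs.equiv h ∈ cohomologyGrading 𝒜 d p :=
  ⟨Submodule.inclusion hs.le_ker h, hh, rfl⟩

/-- A cocycle has no component in `M`, because `d` is injective there. So its class is represented
by its component in `H`, which inherits the degree of the cocycle. -/
theorem IsCohSplitting.equiv_symm_mem (hs : IsCohSplitting 𝒜 d H M)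
    (hd : ∀ (p : ℤ) (a : A), a ∈ 𝒜 p → d a ∈ 𝒜 (p + 1)) (hdd : ∀ a, d (d a) = 0) (p : ℤ)
    (c : Cohomology d) (hc : c ∈ cohomologyGrading 𝒜 d p) :
    hs.equiv.symm c ∈ subGrading 𝒜 H p := by
  obtain ⟨z, hz, rfl⟩ := hc
  have hzp : (z : A) ∈ 𝒜 p := hz
  obtain ⟨h1, h2, y, hy, e⟩ := hs.exists_eq (z : A)
  have hz0 : d (z : A) = 0 := z.2
  have hy0 : y = 0 := by
    refine hs.injOn y hy ?_
    have := congrArg d e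
    rw [hz0, map_add, map_add, hdd, LinearMap.mem_ker.1 (hs.le_ker h1), zero_add, zero_add] at this
    exact this.symm
  rw [hy0, add_zero] at e
  have h3 : hs.equiv.symm (((LinearMap.range d).submoduleOf (LinearMap.ker d)).mkQ z) =
      ⟨projH d H M z, h1⟩ := by
    rw [LinearEquiv.symm_apply_eq]
    refine (Submodule.Quotient.eq _).2 ?_
    refine ⟨opQ d H M z, ?_⟩
    change d (opQ d H M z) = (z : A) - projH d H M z
    exact (sub_eq_of_eq_add' e).symm
  change hs.equiv.symm (((LinearMap.range d).submoduleOf (LinearMap.ker d)).mkQ z) ∈ _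
  rw [h3]
  exact (hs.mem_of_mem hd hzp).1

theorem IsCohSplitting.isTransported (hs : IsCohSplitting 𝒜 d H M)
    (m : ∀ n : ℕ, MultilinearMap ℤ (fun _ : Fin n => H) H) :
    IsTransported 𝓀 hs.le_ker m (transport hs.equiv m) := fun n v => by
  rw [← hs.equiv_apply, transport_apply]
  congr 2
  funext i
  rw [← hs.equiv_apply, LinearEquiv.symm_apply_apply]

end Cohomology

/-- Chen's construction for a differential graded algebra. -/
theorem exists_formalConnection {k : Type*} [Ring k] [Algebra ℚ k] (𝓀 : ℤ → AddSubgroup k)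
    [GradedRing 𝓀] (hk : IsGradedComm 𝓀) {A : Type*} [NonUnitalRing A] [Module k A]
    (𝒜 : ℤ → AddSubgroup A) [DirectSum.Decomposition 𝒜] (d : A →ₛₗ[koszul 𝓀] A)
    (hA : IsDGA 𝓀 𝒜 d) (H M : Submodule k A) (hs : IsCohSplitting 𝒜 d H M)
    {ι : Type*} (deg : ι → ℤ) (α : Module.Basis ι k H) (hα : ∀ j, (α j : A) ∈ 𝒜 (deg j)) :
    ∃ (ω : List ι → A) (D : (List ι → k) →ₛₗ[koszul 𝓀] (List ι → k))
      (part : ℕ → ((List ι → k) →ₛₗ[koszul 𝓀] (List ι → k))),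
      IsChenT deg 𝓀 𝒜 d H M α ω D part ∧
      HasDeg deg 𝒜 1 ω ∧
      IsDerivationT deg 𝓀 D ∧ (∀ f, D (D f) = 0) ∧
      curvT deg 𝓀 𝒜 d D ω = 0 ∧
      ∃ b : (List ι →₀ k) →ₛₗ[koszul 𝓀] (List ι →₀ k),
        IsCodifferential deg 𝓀 b ∧ IsTranspose deg 𝓀 D b ∧
        (∃ m : ∀ n : ℕ, MultilinearMap ℤ (fun _ : Fin n => H) H,
          IsAInfinity 𝓀 (subGrading 𝒜 H) m ∧ Corresponds 𝓀 deg α m b ∧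
          ∃ m' : ∀ n : ℕ, MultilinearMap ℤ (fun _ : Fin n => Cohomology d) (Cohomology d),
            IsAInfinity 𝓀 (cohomologyGrading 𝒜 d) m' ∧ IsTransported 𝓀 hs.le_ker m m') ∧
        ∃ τ : (List ι →₀ k) →ₛₗ[koszul 𝓀] A,
          IsTwistingCochain deg 𝓀 𝒜 d b τ ∧
          ∀ u, τ (Finsupp.single u 1) = -(pairSign deg u • ω u) := by
  have hB := hA.isGradedBilin
  obtain ⟨e, ω, h⟩ := exists_isChenData deg false hB hA.d_mem hs α hα
  have he := h.gen_homogeneous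
  obtain ⟨hcurv, hsq⟩ := h.curv_eq_zero hk hB hA.d_mem hA.d_d hA.d_mul
    (by rw [conv_assoc deg hB fun a b c => mul_assoc a b c]) hs hα
  have h0 : e [] = 0 := h.gen_short [] (by simp)
  have hcurv' : curvT deg 𝓀 𝒜 d (derT 𝓀 hk he) ω = 0 := by
    rw [curvT, extendT_derT]
    exact hcurv
  have hV : GradedSMulMem 𝓀 (subGrading 𝒜 H) := fun p q x a hx ha => hA.smul_mem p q x a hx ha
  have hrepr : ∀ (p : ℤ) (v : H), v ∈ subGrading 𝒜 H p → ∀ j, α.repr v j ∈ 𝓀 (p - deg j) :=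
    fun p v hv j => repr_mem hA.smul_mem α hα hv j
  have hA' := isAInfinity_operations (𝒱 := subGrading 𝒜 H) hk hV α hα hrepr he h0 hsq
  refine ⟨ω, derT 𝓀 hk he, _, h.isChenT hk, h.omega_deg, isDerivationT_derT hk he, hsq, hcurv',
    transpose deg 𝓀 (derRows deg e), isCodifferential_transpose hk he h0 hsq,
    isTranspose_transpose hk (he.rows deg), ⟨operations deg 𝓀 α e, hA',
      corresponds_operations α he, transport hs.equiv (operations deg 𝓀 α e),
      hA'.transport hs.equiv hs.equiv_mem (hs.equiv_symm_mem hA.d_mem hA.d_d),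
      hs.isTransported _⟩, twistingCochain deg 𝓀 ω,
    isTwistingCochain_twistingCochain hA he h.omega_deg fun u => congrFun hcurv u, fun u => ?_⟩
  rw [twistingCochain_single, koszul_one, one_smul]

/-! ### Graded Lie algebras -/

section Lie

variable {ι : Type*} (deg : ι → ℤ)
variable {k : Type*} [Ring k] [Algebra ℚ k] {𝓀 : ℤ → AddSubgroup k} [GradedRing 𝓀]
variable {L : Type*} [AddCommGroup L] [Module k L] {ℒ : ℤ → AddSubgroup L}
  [DirectSum.Decomposition ℒ] {br : L →+ L →+ L} {d : L →ₛₗ[koszul 𝓀] L}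

variable (k) in
/-- Half of the bracket. -/
def halfBr (br : L →+ L →+ L) : L →+ L →+ L :=
  (AddMonoidHom.compHom (smulAddHom k L (algebraMap ℚ k (1 / 2)))).comp br

theorem halfBr_apply (a b : L) : halfBr k br a b = algebraMap ℚ k (1 / 2) • br a b := rfl

/-- Linearity in the second argument follows from that in the first by using antisymmetry twice. -/
theorem IsDGLA.br_smul (hL : IsDGLA 𝓀 ℒ br d) (p q : ℤ) (x : k) (a b : L) (hx : x ∈ 𝓀 p)
    (ha : a ∈ ℒ q) : br a (x • b) = sgn (p * q) • x • br a b := by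
  refine addHom_ext_homogeneous ℒ (φ := (br a).comp (smulAddHom k L x))
    (ψ := (zsmulAddGroupHom (sgn (p * q))).comp ((smulAddHom k L x).comp (br a)))
    (fun r b hb => ?_) b
  simp only [AddMonoidHom.comp_apply, smulAddHom_apply, zsmulAddGroupHom_apply]
  rw [hL.antisymm _ _ _ _ ha (hL.smul_mem _ _ _ _ hx hb), hL.smul_br,
    hL.antisymm _ _ _ _ ha hb, smul_neg, smul_neg, smul_comm x, sgn_smul_sgn_smul]
  congr 2
  apply sgn_congr
  simp only [Int.even_add, Int.even_mul]
  tauto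

theorem IsDGLA.isGradedBilin_halfBr (hL : IsDGLA 𝓀 ℒ br d) :
    IsGradedBilin 𝓀 ℒ (halfBr k br) where
  smul_mem := hL.smul_mem
  mem p q a b ha hb := by
    rw [halfBr_apply, ← zero_add (p + q)]
    exact hL.smul_mem _ _ _ _ (algebraMap_mem_zero _) (hL.br_mem _ _ _ _ ha hb)
  smul_left x a b := by
    rw [halfBr_apply, halfBr_apply, hL.smul_br, smul_smul, smul_smul, Algebra.commutes]
  smul_right p q x a b hx ha := by
    rw [halfBr_apply, halfBr_apply, hL.br_smul p q x a b hx ha, smul_comm _ (sgn _), smul_smul,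
      smul_smul x, Algebra.commutes]

theorem IsDGLA.d_halfBr (hL : IsDGLA 𝓀 ℒ br d) (p : ℤ) (a b : L) (ha : a ∈ ℒ p) :
    d (halfBr k br a b) = halfBr k br (d a) b + sgn p • halfBr k br a (d b) := by
  have h := map_algebraMap_smul' (k := k) d.toAddMonoidHom (1 / 2) (br a b)
  change d (algebraMap ℚ k (1 / 2) • br a b) = algebraMap ℚ k (1 / 2) • d (br a b) at h
  rw [halfBr_apply, h, hL.d_br p a b ha, smul_add, smul_comm _ (sgn _)]
  rfl

theorem symm_algebraMap_smul (q : ℚ) (f : List ι → L) :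
    symm deg k (algebraMap ℚ k q • f) = algebraMap ℚ k q • symm deg k f := by
  funext u
  exact (map_symm (k := k) deg (smulAddHom k L (algebraMap ℚ k q)) f u).symm

theorem conv_halfBr (f g : List ι → L) : conv deg ℒ (halfBr k br) f g =
    algebraMap ℚ k (1 / 2) • conv deg ℒ br f g := by
  funext u
  have h := map_cut (smulAddHom k L (algebraMap ℚ k (1 / 2)))
    (fun a b => br (f a) (twist ℒ (xdeg deg a) (g b))) u
  rw [Pi.smul_apply, conv_apply, conv_apply]
  exact h.symm

theorem conv_smul_left (q : ℚ) (f g : List ι → L) :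
    conv deg ℒ br (algebraMap ℚ k q • f) g = algebraMap ℚ k q • conv deg ℒ br f g := by
  funext u
  rw [conv_apply]
  refine Eq.trans (cut_congr fun a b _ => ?_) (map_cut (smulAddHom k L (algebraMap ℚ k q))
    (fun a b => br (f a) (twist ℒ (xdeg deg a) (g b))) u).symm
  exact map_algebraMap_smul' (k := k) (br.flip (twist ℒ (xdeg deg a) (g b))) q (f a)

theorem conv_smul_right (q : ℚ) (f g : List ι → L) :
    conv deg ℒ br f (algebraMap ℚ k q • g) = algebraMap ℚ k q • conv deg ℒ br f g := by
  funext u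
  rw [conv_apply]
  refine Eq.trans (cut_congr fun a b _ => ?_) (map_cut (smulAddHom k L (algebraMap ℚ k q))
    (fun a b => br (f a) (twist ℒ (xdeg deg a) (g b))) u).symm
  exact map_algebraMap_smul' (k := k) ((br (f a)).comp (twist ℒ (xdeg deg a))) q (g b)

/-- The bilinear map `(a, b) ↦ [a, [b, ·]]`. -/
def adComp (br : L →+ L →+ L) : L →+ L →+ (L →+ L) :=
  AddMonoidHom.mk' (fun a => (AddMonoidHom.compHom (br a)).comp br) fun a b => by
    ext x y
    simp

theorem adComp_apply (a b c : L) : adComp br a b c = br a (br b c) := rfl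

theorem IsDGLA.twist_br (hL : IsDGLA 𝓀 ℒ br d) (n : ℤ) (a b : L) :
    twist ℒ n (br a b) = br (twist ℒ n a) (twist ℒ n b) := by
  have hB : IsGradedBilin 𝓀 ℒ br := ⟨hL.smul_mem, hL.br_mem, hL.smul_br, hL.br_smul⟩
  exact hB.twist n a b

variable (ℒ) in
theorem hconv_apply {U W : Type*} [AddCommGroup U] [AddCommGroup W] (B : U →+ L →+ W)
    (f : List ι → U) (g : List ι → L) (u : List ι) :
    hconv deg ℒ B f g u = cut (fun a b => B (f a) (twist ℒ (xdeg deg a) (g b))) u := rfl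

/-- The double bracket is written as an operator-valued series applied to `ω`, so that the first two
factors can be symmetrized alone by `symm_hconv_left`. -/
theorem IsDGLA.conv_conv_right (hL : IsDGLA 𝓀 ℒ br d) (ω : List ι → L) :
    conv deg ℒ br ω (conv deg ℒ br ω ω) =
      hconv deg ℒ (AddMonoidHom.id (L →+ L)) (hconv deg ℒ (adComp br) ω ω) ω := by
  funext u
  rw [conv_apply, hconv_apply]
  have h1 : ∀ a b, br (ω a) (twist ℒ (xdeg deg a) (conv deg ℒ br ω ω b)) =
      cut (fun v c => br (ω a) (br (twist ℒ (xdeg deg a) (ω v))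
        (twist ℒ (xdeg deg a + xdeg deg v) (ω c)))) b := fun a b => by
    rw [conv_apply, map_cut, map_cut]
    refine cut_congr fun v c _ => ?_
    rw [hL.twist_br, twist_twist]
  have h2 : ∀ a b, AddMonoidHom.id (L →+ L) (hconv deg ℒ (adComp br) ω ω a)
      (twist ℒ (xdeg deg a) (ω b)) = cut (fun v c => br (ω v) (br (twist ℒ (xdeg deg v) (ω c))
        (twist ℒ (xdeg deg v + xdeg deg c) (ω b)))) a := fun a b => by
    change AddMonoidHom.id (L →+ L) (cut (V := L →+ L) _ a) _ = _
    rw [cut_apply]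
    refine cut_congr fun v c hvc => ?_
    rw [← hvc, xdeg_append]
    rfl
  refine (cut_congr fun a b _ => h1 a b).trans (Eq.trans ?_ (cut_congr fun a b _ => h2 a b).symm)
  exact cut_cut (fun a v c => br (ω a) (br (twist ℒ (xdeg deg a) (ω v))
        (twist ℒ (xdeg deg a + xdeg deg v) (ω c)))) u

/-- Symmetrization allows the two factors in one of the copies of `[ω, [ω, ·]]` to be exchanged. As
`ω` has total degree one, the Jacobi identity then sums the two copies to `[[ω, ω], ·]`. -/
theorem IsDGLA.jacobi_series (hL : IsDGLA 𝓀 ℒ br d) {ω : List ι → L} (hω : HasDeg deg ℒ 1 ω) :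
    symm deg k (hconv deg ℒ (adComp br) ω ω + hconv deg ℒ (adComp br) ω ω) =
      symm deg k fun u => br (conv deg ℒ br ω ω u) := by
  have h1 : symm deg k (hconv deg ℒ (adComp br) ω ω) =
      symm deg k (cut fun a b => sgn (xdeg deg a * xdeg deg b) •
        adComp br (ω b) (twist ℒ (xdeg deg b) (ω a))) := by
    refine symm_cut_flip deg (F := fun a b => adComp br (ω a) (twist ℒ (xdeg deg a) (ω b)))
      fun a b => ?_
    rw [mul_comm (xdeg deg b), sgn_smul_self]
  refine (map_add (symmHom deg k) _ _).trans ((congrArg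
    (symm deg k (hconv deg ℒ (adComp br) ω ω) + ·) h1).trans
      ((map_add (symmHom deg k) _ _).symm.trans (congrArg (symm deg k) ?_)))
  funext u
  rw [conv_apply, map_cut]
  change cut (V := L →+ L) _ u + cut (V := L →+ L) _ u = _
  rw [← cut_add]
  refine cut_congr fun a b _ => ?_
  rw [twist_of_mem ℒ _ (hω a), twist_of_mem ℒ _ (hω b)]
  ext c
  simp only [map_zsmul, AddMonoidHom.add_apply, AddMonoidHom.zsmul_apply, adComp_apply]
  rw [hL.jacobi _ _ _ _ c (hω a) (hω b), smul_add, sgn_smul_sgn_smul, sgn_smul_sgn_smul, add_assoc,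
    ← add_smul]
  have h : sgn (xdeg deg a * (1 - xdeg deg b) + (1 - xdeg deg a) * (1 - xdeg deg b)) =
      -sgn (xdeg deg a * xdeg deg b + xdeg deg b * (1 - xdeg deg a)) := by
    have : (-1 : ℤ) = sgn 1 := sgn_one.symm
    rw [neg_eq_neg_one_mul, this, ← sgn_add]
    apply sgn_eq_of_cast
    push_cast
    generalize (xdeg deg a : ZMod 2) = x
    generalize (xdeg deg b : ZMod 2) = y
    revert x y
    decide
  rw [h, neg_add_cancel, zero_smul, add_zero]

/-- With `X` and `Y` the two symmetrizations, the Jacobi identity gives `2 X = Y`. Antisymmetry,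
applied to `[ω, ω]` of degree two and `ω` of degree one, gives `Y = -X`. Hence `3 X = 0`, and there
is no torsion. -/
theorem IsDGLA.symm_bracket_bracket (hL : IsDGLA 𝓀 ℒ br d) {ω : List ι → L}
    (hω : HasDeg deg ℒ 1 ω) :
    symm deg k (conv deg ℒ br ω (conv deg ℒ br ω ω)) = 0 ∧
      symm deg k (conv deg ℒ br (conv deg ℒ br ω ω) ω) = 0 := by
  have hB : IsGradedBilin 𝓀 ℒ br := ⟨hL.smul_mem, hL.br_mem, hL.smul_br, hL.br_smul⟩
  set X := symm deg k (conv deg ℒ br ω (conv deg ℒ br ω ω)) with hX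
  set Y := symm deg k (conv deg ℒ br (conv deg ℒ br ω ω) ω) with hY
  have h1 : X + X = Y := by
    have e1 : X + X = symm deg k (hconv deg ℒ (AddMonoidHom.id (L →+ L))
        (hconv deg ℒ (adComp br) ω ω + hconv deg ℒ (adComp br) ω ω) ω) := by
      rw [← hconvHom_apply, map_add, AddMonoidHom.add_apply, hconvHom_apply,
        ← hL.conv_conv_right deg, ← symmHom_apply, map_add]
      rfl
    rw [e1, ← symm_hconv_left, hL.jacobi_series deg hω, symm_hconv_left]
    rfl
  have h2 : Y = -X := by
    have := symm_conv_flip (k := k) deg (B := br) (-1) (fun p q a b ha hb => by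
      rw [hL.antisymm p q a b ha hb, neg_one_smul]) (hω.conv deg hB hω) hω
    rw [hY, this, sgn_of_even ⟨1, by norm_num⟩, one_smul, neg_one_smul]
  have h3 : (3 : ℕ) • X = 0 := by
    rw [show (3 : ℕ) • X = (X + X) + X by abel, h1, h2, neg_add_cancel]
  have h4 : X = 0 := eq_zero_of_nsmul (by norm_num) h3 k
  exact ⟨h4, by rw [h2, h4, neg_zero]⟩

/-- Half of the bracket is not associative in general, but the Bianchi identity uses associativity
only for this cubic expression, where both sides vanish. -/
theorem IsDGLA.assoc_halfBr (hL : IsDGLA 𝓀 ℒ br d) {ω : List ι → L} (hω : HasDeg deg ℒ 1 ω) :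
    proj deg true k (conv deg ℒ (halfBr k br) (conv deg ℒ (halfBr k br) ω ω) ω) =
      proj deg true k (conv deg ℒ (halfBr k br) ω (conv deg ℒ (halfBr k br) ω ω)) := by
  obtain ⟨h1, h2⟩ := hL.symm_bracket_bracket deg hω
  rw [proj_true, proj_true, conv_halfBr, conv_halfBr, conv_halfBr, conv_smul_left,
    conv_smul_right, symm_algebraMap_smul, symm_algebraMap_smul, symm_algebraMap_smul,
    symm_algebraMap_smul, h1, h2]

end Lie

/-! ### Derivations of the completed symmetric algebra -/

section SymmetricAlgebra

variable {ι : Type*} {deg : ι → ℤ}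
variable {k : Type*} [Ring k] [Algebra ℚ k] {𝓀 : ℤ → AddSubgroup k} [GradedRing 𝓀]

variable (𝓀) in
/-- The derivation of the completed symmetric algebra with the coefficients `e`. -/
def derS (hk : IsGradedComm 𝓀) {e : List ι → ι →₀ k} (he : IsHomogeneousGen deg 𝓀 e) :
    symmSeries deg k →ₛₗ[koszul 𝓀] symmSeries deg k where
  toFun f := ⟨symm deg k (der deg 𝓀 e f), isSymm_symm deg _⟩
  map_add' f g := by
    ext1
    change symm deg k (der deg 𝓀 e ((f : List ι → k) + g)) = symm deg k _ + symm deg k _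
    rw [der, op_add, ← symmHom_apply, map_add]
    rfl
  map_smul' c f := by
    ext1
    change symm deg k (der deg 𝓀 e (c • (f : List ι → k))) = koszul 𝓀 c • symm deg k _
    rw [der, der, symm_op, symm_op, op_smul deg hk ((he.rows deg).symm deg) (gradedSMulMem_self 𝓀)]

theorem derS_coe (hk : IsGradedComm 𝓀) {e : List ι → ι →₀ k} (he : IsHomogeneousGen deg 𝓀 e)
    (f : symmSeries deg k) :
    (derS 𝓀 hk he f : List ι → k) = symm deg k (der deg 𝓀 e (f : List ι → k)) := rfl

theorem isDerivationS_derS (hk : IsGradedComm 𝓀) {e : List ι → ι →₀ k}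
    (he : IsHomogeneousGen deg 𝓀 e) : IsDerivationS deg 𝓀 (derS 𝓀 hk he) where
  degree p f hf := (hf.op deg (he.rows deg) (gradedSMulMem_self 𝓀)).symm deg (gradedSMulMem_self 𝓀)
  leibniz p f g hf := by
    ext1
    change symm deg k (der deg 𝓀 e (symm deg k (conv deg 𝓀 AddMonoidHom.mul (f : List ι → k) g))) =
      symm deg k (conv deg 𝓀 AddMonoidHom.mul (symm deg k (der deg 𝓀 e (f : List ι → k))) g) +
        sgn p • symm deg k (conv deg 𝓀 AddMonoidHom.mul (f : List ι → k)
          (symm deg k (der deg 𝓀 e (g : List ι → k))))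
    have h : hconv deg 𝓀 AddMonoidHom.mul (sgn p • (f : List ι → k)) (der deg 𝓀 e (g : List ι → k)) =
        sgn p • hconv deg 𝓀 AddMonoidHom.mul (f : List ι → k) (der deg 𝓀 e (g : List ι → k)) := by
      rw [← hconvHom_apply, map_zsmul]
      rfl
    rw [symm_der deg hk he, der_conv deg he hk.isGradedBilin_mul, hf.totalParity_eq, conv_eq_hconv,
      conv_eq_hconv, conv_eq_hconv, conv_eq_hconv, symm_hconv_left, symm_hconv_right, h,
      ← symmHom_apply, map_add, map_zsmul]
    rfl
  continuous u := ⟨(symm deg k (derRows deg e) u).support, fun f hf => by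
    rw [derS_coe, der, symm_op]
    exact op_eq_zero deg hf⟩

variable {L : Type*} [AddCommGroup L] [Module k L] {ℒ : ℤ → AddSubgroup L}
  [DirectSum.Decomposition ℒ]

theorem derS_symmMono (hk : IsGradedComm 𝓀) {e : List ι → ι →₀ k}
    (he : IsHomogeneousGen deg 𝓀 e) (w u : List ι) :
    (derS 𝓀 hk he (symmMono deg k w) : List ι → k) u = symm deg k (derRows deg e) u w := by
  rw [derS_coe]
  change symm deg k (der deg 𝓀 e (symm deg k (mono k w))) u = _
  rw [symm_der deg hk he, der, symm_op, op_mono]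

theorem extendS_derS (hk : IsGradedComm 𝓀) {e : List ι → ι →₀ k}
    (he : IsHomogeneousGen deg 𝓀 e) (f : List ι → L) :
    extendS deg 𝓀 ℒ (derS 𝓀 hk he) f = symm deg k (der deg ℒ e f) := by
  rw [der, symm_op]
  exact extend_eq_op deg ((he.rows deg).symm deg) _ (fun w u => derS_symmMono hk he w u) f

theorem extendS_sum_derS (hk : IsGradedComm 𝓀) {e : List ι → ι →₀ k}
    (he : IsHomogeneousGen deg 𝓀 e) (n : ℕ) (f : List ι → L) :
    extendS deg 𝓀 ℒ (∑ i ∈ Finset.range (n + 1), derS 𝓀 hk (he.comp i)) f =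
      symm deg k (der deg ℒ (trunc n e) f) := by
  rw [der, symm_op]
  refine extend_eq_op deg (((he.trunc n).rows deg).symm deg) _ (fun w u => ?_) f
  rw [LinearMap.sum_apply, Submodule.coe_sum, Finset.sum_apply]
  simp only [derS_symmMono]
  have h : symm deg k (derRows deg (trunc n e)) =
      ((symmHom deg k).comp (derRowsHom deg k)) (trunc n e) := rfl
  rw [h, ← sum_comp, map_sum, Finset.sum_apply, Finsupp.finsetSum_apply]
  rfl

theorem derS_symmMono_single (hk : IsGradedComm 𝓀) {e : List ι → ι →₀ k}
    (he : IsHomogeneousGen deg 𝓀 e) (hs : symm deg k e = e) (j : ι) (u : List ι) :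
    (derS 𝓀 hk he (symmMono deg k [j]) : List ι → k) u = e u j := by
  rw [derS_coe]
  change symm deg k (der deg 𝓀 e (symm deg k (mono k [j]))) u = _
  rw [symm_der deg hk he, show der deg 𝓀 e (mono k [j]) = fun u => e u j from
    funext fun u => der_mono_single deg e j u]
  have h := map_symm (k := k) deg (Finsupp.applyAddHom j : (ι →₀ k) →+ k) e u
  rw [hs] at h
  exact h.symm

theorem symm_comp {X : Type*} [AddCommGroup X] [Module k X] (n : ℕ) (f : List ι → X) :
    symm deg k (comp n f) = comp n (symm deg k f) := by
  funext u
  by_cases h : u.length = n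
  · rw [comp_of_eq h, symm_congr deg (g := f) fun w hw => comp_of_eq (hw.trans h)]
  · rw [comp_of_ne h, symm_apply_eq_zero deg fun w hw => comp_of_ne (hw ▸ h)]

theorem symm_trunc {X : Type*} [AddCommGroup X] [Module k X] (n : ℕ) (f : List ι → X) :
    symm deg k (trunc n f) = trunc n (symm deg k f) := by
  funext u
  by_cases h : u.length ≤ n
  · rw [trunc_of_le h, symm_congr deg (g := f) fun w hw => trunc_of_le (hw ▸ h)]
  · rw [trunc_of_lt (by omega), symm_apply_eq_zero deg fun w hw => trunc_of_lt (by omega)]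

/-- Chen's induction for a differential graded Lie algebra. -/
theorem IsChenData.isChenS (hk : IsGradedComm 𝓀) {br : L →+ L →+ L} {d : L →ₛₗ[koszul 𝓀] L}
    {H M : Submodule k L} (hs : IsCohSplitting ℒ d H M)
    {α : Module.Basis ι k H} {e : List ι → ι →₀ k} {ω : List ι → L}
    (h : IsChenData deg true 𝓀 ℒ (halfBr k br) d H M α e ω) :
    IsChenS deg 𝓀 ℒ br d H M α ω (derS 𝓀 hk h.gen_homogeneous)
      fun n => derS 𝓀 hk (h.gen_homogeneous.comp n) where
  part_derivation n := isDerivationS_derS hk _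
  part_gen n j := by
    have hfix : symm deg k e = e := h.gen_fixed
    funext u
    rw [derS_symmMono_single hk _ (by rw [symm_comp, hfix]), comp, comp,
      derS_symmMono_single hk _ hfix]
    split_ifs <;> rfl
  part_zero := by
    refine LinearMap.ext fun f => ?_
    have h0 : comp 0 e = 0 := funext fun u => by
      by_cases hu : u.length = 0
      · rw [comp_of_eq hu, h.gen_short u (by omega), Pi.zero_apply]
      · rw [comp_of_ne hu, Pi.zero_apply]
    ext1
    rw [derS_coe, h0, ← derGenHom_apply, map_zero, ← symmHom_apply, map_zero]
    rfl
  part_one := by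
    refine LinearMap.ext fun f => ?_
    have h0 : comp 1 e = 0 := funext fun u => by
      by_cases hu : u.length = 1
      · rw [comp_of_eq hu, h.gen_short u (by omega), Pi.zero_apply]
      · rw [comp_of_ne hu, Pi.zero_apply]
    ext1
    rw [derS_coe, h0, ← derGenHom_apply, map_zero, ← symmHom_apply, map_zero]
    rfl
  omega_symm := by
    have := h.omega_fixed
    rw [proj_true] at this
    rw [← this]
    exact isSymm_symm deg ω
  omega_nil := h.omega_nil
  omega_one := h.omega_one
  step n hn u hu := by
    have hω : symm deg k ω = ω := h.omega_fixed
    have hc : curvS deg 𝓀 ℒ br d (∑ i ∈ Finset.range (n + 1), derS 𝓀 hk (h.gen_homogeneous.comp i))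
        (trunc n ω) = curv deg true ℒ (halfBr k br) d (trunc n e) (trunc n ω) := by
      rw [curvS, extendS_sum_derS hk h.gen_homogeneous, curv, proj_true, proj_true, conv_halfBr,
        symm_algebraMap_smul]
    rw [hc, extendS_derS]
    refine ⟨?_, h.step_omega n hn u hu⟩
    have h1 : symm deg k (der deg ℒ (comp (n + 1) e) (comp 1 ω)) u =
        symm deg k (fun w => -(H.subtype.toAddMonoidHom.comp hs.projHom)
          (curv deg true ℒ (halfBr k br) d (trunc n e) (trunc n ω) w)) u := by
      refine symm_congr deg fun w hw => ?_
      rw [der_comp deg e ω (hw.trans hu)]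
      simp only [h.omega_one]
      exact h.step_gen n hn w (hw.trans hu)
    rw [h1]
    -- The curvature of the truncations is symmetric already, so the symmetrization on the right
    -- changes nothing.
    have h2 := map_symm (k := k) deg (-(H.subtype.toAddMonoidHom.comp hs.projHom))
      (curv deg true ℒ (halfBr k br) d (trunc n e) (trunc n ω)) u
    rw [← proj_true, proj_curv deg true (by rw [proj_true, symm_trunc, hω])] at h2
    exact h2.symm

end SymmetricAlgebra

/-! ### Permutations and signs -/

section PermSigns

variable {ι : Type*} (deg : ι → ℤ)

/-- The sign is a product over the pairs of letters of a factor that is symmetric in the two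
letters. -/
theorem pairSign_perm {u w : List ι} (h : u.Perm w) : pairSign deg u = pairSign deg w := by
  have hx : ∀ {u w : List ι}, u.Perm w → xdeg deg u = xdeg deg w := fun h => (h.map _).sum_eq
  induction h with
  | nil => rfl
  | cons j h ih => rw [pairSign, pairSign, ih, hx h]
  | swap i j u =>
    simp only [pairSign, xdeg_cons, ← mul_assoc, ← sgn_add]
    congr 1
    apply sgn_eq_of_cast
    push_cast
    generalize (xdeg deg u : ZMod 2) = x
    generalize (deg i : ZMod 2) = y
    generalize (deg j : ZMod 2) = z
    revert x y z
    decide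
  | trans _ _ h1 h2 => exact h1.trans h2

theorem ofFn_comp_perm {n : ℕ} (v : Fin n → ι) (σ : Equiv.Perm (Fin n)) :
    (List.ofFn (v ∘ σ)).Perm (List.ofFn v) := Equiv.Perm.ofFn_comp_perm σ v

theorem barSign_swap (a : List ι) (x y : ι) (c : List ι) :
    barSign deg (a ++ y :: x :: c) =
      -(sgn (deg x * deg y) * sgn ((1 - deg x) * (1 - deg y))) * barSign deg (a ++ x :: y :: c) := by
  have h : ∀ x y : ι, a ++ y :: x :: c = a ++ ([y] ++ ([x] ++ c)) := fun _ _ => rfl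
  rw [h, h]
  simp only [barSign_append, barSign_singleton, xdeg_append, xdeg_cons, xdeg_nil,
    List.length_append, List.length_cons, List.length_nil, one_mul]
  generalize xdeg deg a = xa
  generalize xdeg deg c = xc
  push_cast
  generalize (a.length : ℤ) = la
  generalize (c.length : ℤ) = lc
  generalize deg x = x
  generalize deg y = y
  have key : sgn ((1 + (1 + lc)) * (la - xa) + xa * (1 - y + 0 + (1 - x + 0 + xc))) *
      sgn ((1 + lc) * (1 - (1 - y + 0)) + (1 - y + 0) * (1 - x + 0 + xc)) *
      sgn (lc * (1 - (1 - x + 0)) + (1 - x + 0) * xc) =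
      sgn 1 * sgn (x * y) * sgn ((1 - x) * (1 - y)) *
      sgn ((1 + (1 + lc)) * (la - xa) + xa * (1 - x + 0 + (1 - y + 0 + xc))) *
      sgn ((1 + lc) * (1 - (1 - x + 0)) + (1 - x + 0) * (1 - y + 0 + xc)) *
      sgn (lc * (1 - (1 - y + 0)) + (1 - y + 0) * xc) := by
    simp only [← sgn_add]
    apply sgn_eq_of_cast
    push_cast
    generalize (xa : ZMod 2) = xa
    generalize (xc : ZMod 2) = xc
    generalize (la : ZMod 2) = la
    generalize (lc : ZMod 2) = lc
    generalize (x : ZMod 2) = x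
    generalize (y : ZMod 2) = y
    revert xa xc la lc x y
    decide
  rw [sgn_one] at key
  linear_combination (barSign deg a * barSign deg c) * key

/-- The sign of the bar construction turns the Koszul signs of the desuspended basis into the
Koszul signs of the basis and the signs of permutations. -/
theorem barSign_comp {n : ℕ} (v : Fin n → ι) (σ : Equiv.Perm (Fin n)) :
    barSign deg (List.ofFn (v ∘ σ)) =
      ((Equiv.Perm.sign σ : ℤˣ) : ℤ) * koszulSign σ (fun i => deg (v i)) *
        koszulSign σ (fun i => 1 - deg (v i)) * barSign deg (List.ofFn v) := by
  rcases n with _ | n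
  · rw [Subsingleton.elim σ 1, koszulSign_one, koszulSign_one]
    simp
  have hσ : σ ∈ Submonoid.closure (Set.range fun i : Fin n => Equiv.swap i.castSucc i.succ) := by
    rw [Equiv.Perm.mclosure_swap_castSucc_succ]
    trivial
  induction hσ using Submonoid.closure_induction generalizing v with
  | one =>
    rw [koszulSign_one, koszulSign_one]
    simp
  | mul σ τ _ _ h1 h2 =>
    rw [koszulSign_mul, koszulSign_mul, Equiv.Perm.coe_mul, ← Function.comp_assoc, h2, h1,
      Equiv.Perm.sign_mul, Units.val_mul]
    simp only [Function.comp_def]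
    ring
  | mem σ hσ =>
    obtain ⟨i, rfl⟩ := hσ
    obtain ⟨a, c, e1, e2⟩ := exists_ofFn_swap v i
    rw [koszulSign_swap, koszulSign_swap, e1, e2, barSign_swap,
      Equiv.Perm.sign_swap (Fin.castSucc_lt_succ (i := i)).ne]
    simp

/-- Raising the degree of the letter `i` by `q` multiplies the sign by `(-1)^(q p t)` for each
letter `t` inverted with `i`. These are the letters that precede `i` either before or after the
permutation, but not both; the common ones cancel in the sum. -/
theorem koszulSign_update {n : ℕ} (σ : Equiv.Perm (Fin n)) (p : Fin n → ℤ) (i : Fin n) (q : ℤ) :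
    koszulSign σ (Function.update p i (q + p i)) = koszulSign σ p *
      sgn (q * (∑ t ∈ Finset.univ.filter (· < i), p t +
        ∑ t ∈ Finset.univ.filter (· < σ.symm i), p (σ t))) := by
  obtain ⟨a, rfl⟩ := σ.surjective i
  rw [Equiv.symm_apply_apply]
  have h1 : koszulSign σ (Function.update p (σ a) (q + p (σ a))) = koszulSign σ p *
      ((∏ b : Fin n, if a < b ∧ σ b < σ a then sgn (q * p (σ b)) else 1) *
        ∏ b : Fin n, if b < a ∧ σ a < σ b then sgn (q * p (σ b)) else 1) := by
    have e1 : ∀ f : Fin n → Fin n → ℤ, (∏ x : Fin n, ∏ y : Fin n, if x = a then f x y else 1) =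
        ∏ y, f a y := fun f => by
      rw [Finset.prod_eq_single a (fun x _ hx => by simp [hx]) (by simp)]
      simp
    rw [← e1 fun x b => if x < b ∧ σ b < σ x then sgn (q * p (σ b)) else 1,
      ← e1 fun x b => if b < x ∧ σ x < σ b then sgn (q * p (σ b)) else 1,
      Finset.prod_comm (f := fun x y => if x = a then
        (fun x b => if b < x ∧ σ x < σ b then sgn (q * p (σ b)) else 1) x y else 1)]
    simp only [koszulSign, ← Finset.prod_mul_distrib]
    refine Finset.prod_congr rfl fun x _ => Finset.prod_congr rfl fun y _ => ?_
    by_cases hxy : x < y ∧ σ y < σ x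
    · simp only [if_pos hxy]
      by_cases hx : x = a
      · subst hx
        have hy : y ≠ x := hxy.1.ne'
        rw [Function.update_self, Function.update_of_ne (fun h => hy (σ.injective h)), if_pos rfl,
          if_neg hy, add_mul, sgn_add]
        ring
      · by_cases hy : y = a
        · subst hy
          rw [Function.update_self, Function.update_of_ne (fun h => hx (σ.injective h)), if_neg hx,
            if_pos rfl, mul_add, sgn_add, mul_comm (p (σ x)) q]
          ring
        · rw [Function.update_of_ne (fun h => hx (σ.injective h)),
            Function.update_of_ne (fun h => hy (σ.injective h)), if_neg hx, if_neg hy]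
          ring
    · simp [hxy]
  have h2 : ∑ t ∈ Finset.univ.filter (· < σ a), p t =
      ∑ b : Fin n, if σ b < σ a then p (σ b) else 0 := by
    rw [Finset.sum_filter, ← Equiv.sum_comp σ]
  rw [h1, h2, Finset.sum_filter, ← Finset.sum_add_distrib, Finset.mul_sum, sgn_sum,
    ← Finset.prod_mul_distrib]
  congr 1
  refine Finset.prod_congr rfl fun b _ => ?_
  rcases lt_trichotomy a b with h | rfl | h
  · rcases lt_or_gt_of_ne (fun e => h.ne (σ.injective e) : σ a ≠ σ b) with h' | h' <;>
      simp [h, h', h.not_gt, h'.not_gt]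
  · simp
  · rcases lt_or_gt_of_ne (fun e => h.ne' (σ.injective e) : σ a ≠ σ b) with h' | h' <;>
      simp [h, h', h.not_gt, h'.not_gt, mul_add, sgn_add, sgn_mul_self]

end PermSigns

/-! ### Unshuffles -/

section Unshuffles

theorem mem_unshuffles {s m : ℕ} (σ : Equiv.Perm (Fin (s + m))) : σ ∈ unshuffles s (s + m) ↔
    (StrictMono fun i : Fin s => σ (Fin.castAdd m i)) ∧
      StrictMono fun i : Fin m => σ (Fin.natAdd s i) := by
  classical
  rw [unshuffles, Finset.mem_filter]
  constructor
  · rintro ⟨_, h⟩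
    exact ⟨fun i j hij => h _ _ hij (Or.inl j.2),
      fun i j hij => h _ _ (Nat.add_lt_add_left hij s) (Or.inr (Nat.le_add_right s i))⟩
  · rintro ⟨h1, h2⟩
    refine ⟨Finset.mem_univ _, fun i j => ?_⟩
    refine Fin.addCases (fun i => ?_) (fun i => ?_) i <;>
      refine Fin.addCases (fun j => ?_) (fun j => ?_) j
    · exact fun hij _ => h1 hij
    · intro _ h
      simp only [Fin.val_castAdd, Fin.val_natAdd] at h
      have := i.2
      omega
    · intro hij
      simp only [Fin.lt_def, Fin.val_castAdd, Fin.val_natAdd] at hij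
      have := j.2
      omega
    · exact fun hij _ => h2 (Nat.lt_of_add_lt_add_left hij)

theorem eq_one_of_strictMono_comp {n : ℕ} {α : Type*} [LinearOrder α] {f : Fin n → α}
    (hf : StrictMono f) {ρ : Equiv.Perm (Fin n)} (h : StrictMono (f ∘ ρ)) : ρ = 1 := by
  have h1 : StrictMono ρ := fun i j hij => hf.lt_iff_lt.1 (h hij)
  have h2 : (h1.orderIsoOfSurjective ρ ρ.surjective) = OrderIso.refl _ := Subsingleton.elim _ _
  ext i
  exact congrArg Fin.val (congrArg (fun e : Fin n ≃o Fin n => e i) h2)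

theorem blockPerm_mul {n m : ℕ} (σ σ' : Equiv.Perm (Fin n)) (τ τ' : Equiv.Perm (Fin m)) :
    blockPerm (σ * σ') (τ * τ') = blockPerm σ τ * blockPerm σ' τ' := by
  ext i
  refine Fin.addCases (fun i => ?_) (fun i => ?_) i <;> simp

theorem blockPerm_one {n m : ℕ} : blockPerm (1 : Equiv.Perm (Fin n)) (1 : Equiv.Perm (Fin m)) = 1 := by
  ext i
  refine Fin.addCases (fun i => ?_) (fun i => ?_) i <;> simp

/-- Every permutation is uniquely an unshuffle composed with a permutation of the blocks. -/
theorem sum_perm_eq_unshuffles {W : Type*} [AddCommMonoid W] {s m : ℕ}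
    (g : Equiv.Perm (Fin (s + m)) → W) : ∑ τ, g τ =
      ∑ x ∈ unshuffles s (s + m) ×ˢ
        (Finset.univ : Finset (Equiv.Perm (Fin s) × Equiv.Perm (Fin m))),
          g (x.1 * blockPerm x.2.1 x.2.2) := by
  symm
  refine Finset.sum_nbij (fun x => x.1 * blockPerm x.2.1 x.2.2) (fun _ _ => Finset.mem_univ _) ?_ ?_
    fun _ _ => rfl
  · rintro ⟨σ, ρ1, ρ2⟩ h ⟨σ', ρ1', ρ2'⟩ h' e
    simp only [Finset.coe_product, Set.mem_prod, Finset.mem_coe, mem_unshuffles] at h h'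
    simp only at e
    -- Two unshuffles with the same product differ by a block permutation. Both are increasing on
    -- each block, which forces that permutation to be the identity.
    have e' : σ = σ' * blockPerm (ρ1' * ρ1⁻¹) (ρ2' * ρ2⁻¹) := by
      rw [blockPerm_mul, ← mul_assoc, ← e, mul_assoc, ← blockPerm_mul, mul_inv_cancel,
        mul_inv_cancel, blockPerm_one, mul_one]
    have h1 := h.1.1
    have h2 := h.1.2
    rw [e'] at h1 h2
    simp only [Equiv.Perm.mul_apply, blockPerm_castAdd, blockPerm_natAdd] at h1 h2
    have k1 := eq_one_of_strictMono_comp (ρ := ρ1' * ρ1⁻¹) h'.1.1 h1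
    have k2 := eq_one_of_strictMono_comp (ρ := ρ2' * ρ2⁻¹) h'.1.2 h2
    rw [k1, k2, blockPerm_one, mul_one] at e'
    rw [e', mul_inv_eq_one.1 k1, mul_inv_eq_one.1 k2]
  · intro τ _
    set f1 : Fin s → Fin (s + m) := fun i => τ (Fin.castAdd m i) with hf1
    set f2 : Fin m → Fin (s + m) := fun i => τ (Fin.natAdd s i) with hf2
    have i1 : Function.Injective f1 := τ.injective.comp (Fin.castAdd_injective s m)
    have i2 : Function.Injective f2 := τ.injective.comp (Fin.natAdd_injective m s)
    -- Sorting the values of `τ` on each block gives the unshuffle, and the inverse sorting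
    -- permutations give the block permutation.
    refine ⟨(τ * blockPerm (Tuple.sort f1) (Tuple.sort f2),
      (Tuple.sort f1)⁻¹, (Tuple.sort f2)⁻¹), ?_, ?_⟩
    · simp only [Finset.coe_product, Set.mem_prod, Finset.mem_coe, mem_unshuffles,
        Equiv.Perm.mul_apply, blockPerm_castAdd, blockPerm_natAdd, Finset.coe_univ, Set.mem_univ,
        and_true]
      exact ⟨(Tuple.monotone_sort f1).strictMono_of_injective (i1.comp (Tuple.sort f1).injective),
        (Tuple.monotone_sort f2).strictMono_of_injective (i2.comp (Tuple.sort f2).injective)⟩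
    · simp only
      rw [mul_assoc, ← blockPerm_mul, mul_inv_cancel, mul_inv_cancel, blockPerm_one, mul_one]

variable {ι : Type*} (deg : ι → ℤ)

/-- The symmetrization of a function of the words that is symmetric in the first `s` letters and in
the other ones is a sum over the unshuffles. -/
theorem permSum_eq_unshuffles {W : Type*} [AddCommGroup W] {s m : ℕ} (v : Fin (s + m) → ι)
    (F : List ι → W) (hF : ∀ (v : Fin (s + m) → ι) (ρ1 : Equiv.Perm (Fin s))
      (ρ2 : Equiv.Perm (Fin m)), F (List.ofFn (v ∘ blockPerm ρ1 ρ2)) =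
        koszulSign (blockPerm ρ1 ρ2) (fun i => 1 - deg (v i)) • F (List.ofFn v)) :
    permSum deg v F = (s.factorial * m.factorial) • ∑ σ ∈ unshuffles s (s + m),
      koszulSign σ (fun i => 1 - deg (v i)) • F (List.ofFn (v ∘ σ)) := by
  rw [permSum_apply, sum_perm_eq_unshuffles, Finset.sum_product, Finset.smul_sum]
  refine Finset.sum_congr rfl fun σ _ => ?_
  have h : ∀ x : Equiv.Perm (Fin s) × Equiv.Perm (Fin m),
      koszulSign (σ * blockPerm x.1 x.2) (fun i => 1 - deg (v i)) •
        F (List.ofFn (v ∘ ⇑(σ * blockPerm x.1 x.2))) =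
      koszulSign σ (fun i => 1 - deg (v i)) • F (List.ofFn (v ∘ σ)) := fun x => by
    rw [Equiv.Perm.coe_mul, ← Function.comp_assoc, hF, koszulSign_mul, smul_smul]
    have := koszulSign_mul_self (blockPerm x.1 x.2) ((fun i => 1 - deg (v i)) ∘ σ)
    rw [mul_assoc]
    erw [this]
    rw [mul_one]
  rw [Finset.sum_congr rfl fun x _ => h x, Finset.sum_const, Finset.card_univ, Fintype.card_prod,
    Fintype.card_perm, Fintype.card_perm, Fintype.card_fin, Fintype.card_fin]

end Unshuffles

/-! ### Exchange of blocks -/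

section Flip

variable {ι : Type*} (deg : ι → ℤ)

/-- The exchange of the first two of three blocks. -/
def blockFlip (l s m : ℕ) : Fin (s + l + m) ≃ Fin (l + s + m) :=
  finSumFinEquiv.symm.trans ((Equiv.sumCongr finAddFlip (Equiv.refl _)).trans finSumFinEquiv)

theorem blockFlip_castAdd {l s m : ℕ} (i : Fin (s + l)) :
    blockFlip l s m (Fin.castAdd m i) = Fin.castAdd m (finAddFlip i) := by
  simp [blockFlip]

theorem blockFlip_natAdd {l s m : ℕ} (i : Fin m) :
    blockFlip l s m (Fin.natAdd (s + l) i) = Fin.natAdd (l + s) i := by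
  simp [blockFlip]

theorem koszulSignEquiv_blockFlip {l s m : ℕ} (p : Fin (l + s + m) → ℤ) :
    koszulSignEquiv (blockFlip l s m) p = koszulSignEquiv (finAddFlip : Fin (s + l) ≃ Fin (l + s))
      fun i => p (Fin.castAdd m i) := by
  have h1 : ∀ (i : Fin (s + l)) (j : Fin m), ¬ Fin.natAdd (s + l) j < Fin.castAdd m i := fun i j =>
    (castAdd_lt_natAdd i j).not_gt
  have h1' : ∀ (i : Fin (l + s)) (j : Fin m), ¬ Fin.natAdd (l + s) j < Fin.castAdd m i := fun i j =>
    (castAdd_lt_natAdd i j).not_gt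
  have h2 : ∀ i j : Fin m, ¬ (Fin.natAdd (s + l) i < Fin.natAdd (s + l) j ∧
      Fin.natAdd (l + s) j < Fin.natAdd (l + s) i) := fun i j h => by
    simp only [Fin.lt_def, Fin.val_natAdd] at h
    omega
  have h3 : ∀ (i j : Fin (s + l)), (Fin.castAdd m i < Fin.castAdd m j) = (i < j) := fun _ _ => rfl
  have h4 : ∀ (i j : Fin (l + s)), (Fin.castAdd m i < Fin.castAdd m j) = (i < j) := fun _ _ => rfl
  have h5 : ∀ f : Fin (s + l + m) → ℤ, ∏ i, f i =
      (∏ i, f (Fin.castAdd m i)) * ∏ i, f (Fin.natAdd (s + l) i) := fun f => Fin.prod_univ_add f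
  simp only [koszulSignEquiv, h5, blockFlip_castAdd, blockFlip_natAdd, h1, h1', h2,
    false_and, and_false, if_false, Finset.prod_const_one, mul_one, h3, h4]

theorem append_comp_blockFlip {l s m : ℕ} (a : Fin l → ι) (w : Fin s → ι) (c : Fin m → ι) :
    Fin.append (Fin.append a w) c ∘ blockFlip l s m = Fin.append (Fin.append w a) c := by
  funext i
  refine Fin.addCases (fun i => ?_) (fun i => ?_) i
  · rw [Function.comp_apply, blockFlip_castAdd, Fin.append_left, Fin.append_left]
    refine Fin.addCases (fun i => ?_) (fun i => ?_) i <;> simp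
  · rw [Function.comp_apply, blockFlip_natAdd, Fin.append_right, Fin.append_right]

theorem koszulSignEquiv_blockFlip_append {l s m : ℕ} (a : Fin l → ι) (w : Fin s → ι)
    (c : Fin m → ι) : koszulSignEquiv (blockFlip l s m)
      (fun i => 1 - deg (Fin.append (Fin.append a w) c i)) =
      sgn (xdeg deg (List.ofFn a) * xdeg deg (List.ofFn w)) := by
  rw [koszulSignEquiv_blockFlip, koszulSignEquiv_finAddFlip, xdeg_ofFn, xdeg_ofFn, mul_comm]
  simp only [Fin.append_left, Fin.append_right]

theorem exists_append {l s m : ℕ} (v : Fin (l + s + m) → ι) :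
    ∃ (a : Fin l → ι) (w : Fin s → ι) (c : Fin m → ι), v = Fin.append (Fin.append a w) c :=
  ⟨fun i => v (Fin.castAdd m (Fin.castAdd s i)), fun i => v (Fin.castAdd m (Fin.natAdd l i)),
    fun i => v (Fin.natAdd (l + s) i), by
      funext i
      refine Fin.addCases (fun i => ?_) (fun i => ?_) i
      · rw [Fin.append_left]
        refine Fin.addCases (fun i => ?_) (fun i => ?_) i <;> simp
      · simp⟩

theorem ofFn_append_append {l s m : ℕ} (a : Fin l → ι) (w : Fin s → ι) (c : Fin m → ι) :
    List.ofFn (Fin.append (Fin.append a w) c) =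
      List.ofFn a ++ (List.ofFn w ++ List.ofFn c) := by
  rw [List.ofFn_fin_append, List.ofFn_fin_append, List.append_assoc]

theorem IsSymm.comp_equiv {V : Type*} [AddCommGroup V] {f : List ι → V} (hf : IsSymm deg f)
    {n m : ℕ} (hnm : n = m) (ρ : Fin n ≃ Fin m) (v : Fin m → ι) :
    f (List.ofFn (v ∘ ρ)) = koszulSignEquiv ρ (fun i => 1 - deg (v i)) • f (List.ofFn v) := by
  subst hnm
  exact hf n v ρ

/-- The exchange of two blocks in the argument of a symmetric function. -/
theorem IsSymm.append_flip {V : Type*} [AddCommGroup V] {f : List ι → V} (hf : IsSymm deg f)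
    (a w c : List ι) :
    f (a ++ (w ++ c)) = sgn (xdeg deg a * xdeg deg w) • f (w ++ (a ++ c)) := by
  have h := hf.comp_equiv deg (by omega) (blockFlip w.length a.length c.length)
    (Fin.append (Fin.append w.get a.get) c.get)
  rw [append_comp_blockFlip, koszulSignEquiv_blockFlip_append, ofFn_append_append,
    ofFn_append_append, List.ofFn_get, List.ofFn_get, List.ofFn_get, mul_comm] at h
  exact h

theorem take_drop_append {a w c : List ι} {l s : ℕ} (hl : a.length = l) (hs : w.length = s) :
    (a ++ (w ++ c)).take l = a ∧ ((a ++ (w ++ c)).drop l).take s = w ∧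
      ((a ++ (w ++ c)).drop l).drop s = c := by
  rw [List.take_left' hl, List.drop_left' hl, List.take_left' hs, List.drop_left' hs]
  exact ⟨rfl, rfl, rfl⟩

/-- Symmetrization does not see an exchange of blocks. -/
theorem permSum_flip {V : Type*} [AddCommGroup V] {l s m n : ℕ} (hn : n = l + s + m)
    (v : Fin n → ι) {H K : List ι → List ι → List ι → V}
    (h : ∀ a w c, H a w c = sgn (xdeg deg a * xdeg deg w) • K w a c) :
    (permSum deg v fun u => H (u.take l) ((u.drop l).take s) ((u.drop l).drop s)) =
      permSum deg v fun u => K (u.take s) ((u.drop s).take l) ((u.drop s).drop l) := by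
  subst hn
  refine permSum_equiv deg (by omega : s + l + m = l + s + m) (blockFlip l s m) v fun v => ?_
  obtain ⟨a, w, c, rfl⟩ := exists_append v
  rw [append_comp_blockFlip, koszulSignEquiv_blockFlip_append, ofFn_append_append,
    ofFn_append_append]
  obtain ⟨h1, h2, h3⟩ := take_drop_append (a := List.ofFn a) (w := List.ofFn w) (c := List.ofFn c)
    (l := l) (s := s) (by simp) (by simp)
  obtain ⟨h4, h5, h6⟩ := take_drop_append (a := List.ofFn w) (w := List.ofFn a) (c := List.ofFn c)
    (l := s) (s := l) (by simp) (by simp)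
  rw [h1, h2, h3, h4, h5, h6, h]

end Flip

/-! ### The square of a derivation of the symmetric algebra -/

section Square

variable {ι : Type*} {deg : ι → ℤ}
variable {k : Type*} [Ring k] {𝓀 : ℤ → AddSubgroup k} [GradedRing 𝓀]

variable (deg 𝓀) in
/-- The coefficient at `X^c` after the substitution of `∂ X^i` for the first letter. -/
def insertFirst (e : List ι → ι →₀ k) (j : ι) (w c : List ι) : k :=
  (e w).sum fun i x => x • twist 𝓀 (1 - deg i + xdeg deg w) (e (i :: c) j)

theorem IsSymm.apply_coord {e : List ι → ι →₀ k} (hs : IsSymm deg e) (j : ι) :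
    IsSymm deg fun u => e u j := fun n v σ => by
  change e _ j = _ • e _ j
  rw [hs n v σ, Finsupp.smul_apply]

/-- By symmetry of `e` the replaced letter `i` may be moved to the front past `a`. Combined with the
Leibniz sign this leaves `xdeg a * xdeg w`, independent of `i`. -/
theorem insertFirst_eq (e : List ι → ι →₀ k) (hs : IsSymm deg e) (j : ι) (a w c : List ι) :
    ((e w).sum fun i x => sgn (xdeg deg a * (1 - deg i + xdeg deg w)) •
      x • twist 𝓀 (1 - deg i + xdeg deg w) (e (a ++ i :: c) j)) =
      sgn (xdeg deg a * xdeg deg w) • insertFirst deg 𝓀 e j w (a ++ c) := by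
  rw [insertFirst, Finsupp.smul_sum]
  refine Finset.sum_congr rfl fun i _ => ?_
  have h := (hs.apply_coord j).append_flip deg a [i] c
  simp only [List.singleton_append, xdeg_cons, xdeg_nil, add_zero] at h
  beta_reduce
  rw [h, map_zsmul, smul_comm (e w i), smul_smul, ← sgn_add]
  congr 1
  apply sgn_eq_of_cast
  push_cast
  generalize (xdeg deg a : ZMod 2) = x
  generalize (xdeg deg w : ZMod 2) = y
  generalize (deg i : ZMod 2) = z
  revert x y z
  decide

/-- Symmetry holds separately in the inserted block and in the remaining letters, as required for
the passage to unshuffles. -/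
theorem insertFirst_comp (e : List ι → ι →₀ k) (hs : IsSymm deg e) (j : ι) {s m : ℕ}
    (v : Fin (s + m) → ι) (ρ1 : Equiv.Perm (Fin s)) (ρ2 : Equiv.Perm (Fin m)) :
    insertFirst deg 𝓀 e j ((List.ofFn (v ∘ blockPerm ρ1 ρ2)).take s)
        ((List.ofFn (v ∘ blockPerm ρ1 ρ2)).drop s) =
      koszulSign (blockPerm ρ1 ρ2) (fun i => 1 - deg (v i)) •
        insertFirst deg 𝓀 e j ((List.ofFn v).take s) ((List.ofFn v).drop s) := by
  obtain ⟨a, c, rfl⟩ : ∃ (a : Fin s → ι) (c : Fin m → ι), v = Fin.append a c :=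
    ⟨fun i => v (Fin.castAdd m i), fun i => v (Fin.natAdd s i), (Fin.append_castAdd_natAdd).symm⟩
  have e1 : Fin.append a c ∘ blockPerm ρ1 ρ2 = Fin.append (a ∘ ρ1) (c ∘ ρ2) := by
    funext i
    refine Fin.addCases (fun i => ?_) (fun i => ?_) i <;> simp
  have e2 : ∀ i, e (i :: List.ofFn (c ∘ ρ2)) j =
      koszulSign ρ2 (fun t => 1 - deg (c t)) • e (i :: List.ofFn c) j := fun i => by
    have h := hs.apply_coord j (1 + m) (Fin.append ![i] c) (blockPerm 1 ρ2)
    have e3 : Fin.append ![i] c ∘ blockPerm 1 ρ2 = Fin.append ![i] (c ∘ ρ2) := by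
      funext i
      refine Fin.addCases (fun i => ?_) (fun i => ?_) i <;> simp
    rw [e3, List.ofFn_fin_append, List.ofFn_fin_append, koszulSign_blockPerm, koszulSign_one,
      one_mul] at h
    simpa using h
  rw [e1, take_ofFn_add, take_ofFn_add, drop_ofFn_add, drop_ofFn_add, koszulSign_blockPerm]
  simp only [Fin.append_left, Fin.append_right]
  have h1 := xdeg_ofFn_comp deg a ρ1
  have h2 := hs s a ρ1
  change insertFirst deg 𝓀 e j (List.ofFn (a ∘ ρ1)) (List.ofFn (c ∘ ρ2)) = _
  simp only [insertFirst, h1, e2, map_zsmul, h2]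
  rw [Finsupp.sum_smul_index' (by simp), Finsupp.smul_sum]
  refine Finset.sum_congr rfl fun i _ => ?_
  beta_reduce
  rw [smul_assoc, smul_comm (e _ i), smul_smul]

variable [Algebra ℚ k]

/-- The square of a derivation of the symmetric algebra on a generator. -/
theorem sum_permSum_insertFirst {e : List ι → ι →₀ k} (hs : IsSymm deg e) (h0 : e [] = 0) (j : ι)
    (hsq : symm deg k (der deg 𝓀 e (der deg 𝓀 e (mono k [j]))) = 0) {n : ℕ} (v : Fin n → ι) :
    ∑ s ∈ Finset.Icc 1 n, (n + 1 - s) • (permSum deg v fun u =>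
      insertFirst deg 𝓀 e j (u.take s) (u.drop s)) = 0 := by
  set H : List ι → List ι → List ι → k := fun a w c => (e w).sum fun i x =>
    sgn (xdeg deg a * (1 - deg i + xdeg deg w)) •
      x • twist 𝓀 (1 - deg i + xdeg deg w) (e (a ++ i :: c) j) with hH
  have h1 : der deg 𝓀 e (der deg 𝓀 e (mono k [j])) =
      cut fun a b => cut (fun w c => H a w c) b := by
    funext u
    rw [der_apply]
    simp only [der_mono_single]
    rfl
  have h2 : permSum deg v (der deg 𝓀 e (der deg 𝓀 e (mono k [j]))) = 0 := by
    have h := congrFun hsq (List.ofFn v)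
    rw [symm_ofFn_eq] at h
    have h' := congrArg (fun x => n.factorial • x) h
    simp only [Pi.zero_apply, smul_zero] at h'
    rw [smul_comm, inv_factorial_smul_factorial] at h'
    exact h'
  rw [h1, permSum_cut] at h2
  refine Eq.trans ?_ h2
  have h3 : ∀ l ∈ Finset.range (n + 1),
      (permSum deg v fun u => cut (fun w c => H (u.take l) w c) (u.drop l)) =
        ∑ s ∈ Finset.range (n - l + 1), permSum deg v fun u =>
          H (u.take l) ((u.drop l).take s) ((u.drop l).drop s) := fun l _ => by
    rw [← map_sum]
    refine permSum_congr deg fun u hu => ?_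
    rw [cut, List.length_drop, hu, Finset.sum_apply]
  rw [Finset.sum_congr rfl h3, sum_range_range_eq n fun l s => permSum deg v fun u =>
          H (u.take l) ((u.drop l).take s) ((u.drop l).drop s)]
  · refine Finset.sum_congr rfl fun s hs' => ?_
    rw [Finset.mem_Icc] at hs'
    -- All `n + 1 - s` positions of a block of length `s` have the same symmetrization, since the
    -- block can be exchanged with the letters before it.
    have h4 : ∀ l ∈ Finset.range (n + 1 - s), (permSum deg v fun u =>
          H (u.take l) ((u.drop l).take s) ((u.drop l).drop s)) = permSum deg v fun u =>
            insertFirst deg 𝓀 e j (u.take s) (u.drop s) := fun l hl => by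
      rw [Finset.mem_range] at hl
      have := permSum_flip deg (l := l) (s := s) (m := n - l - s) (by omega) v (H := H)
        (K := fun w a c => insertFirst deg 𝓀 e j w (a ++ c)) fun a w c => insertFirst_eq e hs j a w c
      rw [this]
      simp only [List.take_append_drop]
    rw [Finset.sum_congr rfl h4, Finset.sum_const, Finset.card_range]
  · intro l
    refine (permSum_congr deg (g := 0) fun u _ => ?_).trans (map_zero _)
    simp only [hH, List.take_zero, h0, Finsupp.sum_zero_index, Pi.zero_apply]

/-- The passage to unshuffles produces `s! (n - s)!`, and the `n + 1 - s` positions of the block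
complete this to `s! (n + 1 - s)!`. -/
theorem sum_unshuffles_insertFirst {e : List ι → ι →₀ k} (hs : IsSymm deg e) (h0 : e [] = 0) (j : ι)
    (hsq : symm deg k (der deg 𝓀 e (der deg 𝓀 e (mono k [j]))) = 0) {n : ℕ} (v : Fin n → ι) :
    ∑ s ∈ Finset.Icc 1 n, (s.factorial * (n + 1 - s).factorial) • ∑ σ ∈ unshuffles s n,
      koszulSign σ (fun i => 1 - deg (v i)) • insertFirst deg 𝓀 e j
        ((List.ofFn (v ∘ σ)).take s) ((List.ofFn (v ∘ σ)).drop s) = 0 := by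
  rw [← sum_permSum_insertFirst hs h0 j hsq v]
  refine Finset.sum_congr rfl fun s hs' => ?_
  rw [Finset.mem_Icc] at hs'
  obtain ⟨m, rfl⟩ := Nat.exists_eq_add_of_le hs'.2
  rw [permSum_eq_unshuffles deg v _ fun v ρ1 ρ2 => insertFirst_comp e hs j v ρ1 ρ2, smul_smul,
    show s + m + 1 - s = m + 1 by omega, Nat.factorial_succ]
  congr 1
  ring

end Square

/-! ### `L∞` structures from square zero derivations -/

section LInfinity

/-- The extension of a finite sequence by zero. -/
def zeroExtend {X : Type*} [Zero X] {n : ℕ} (v : Fin n → X) (i : ℕ) : X :=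
  if h : i < n then v ⟨i, h⟩ else 0

theorem zeroExtend_coe {X : Type*} [Zero X] {n : ℕ} (v : Fin n → X) (i : Fin n) :
    zeroExtend v i = v i := dif_pos i.2

theorem zeroExtend_update {X : Type*} [Zero X] {n : ℕ} (v : Fin n → X) (i : Fin n) (x : X) :
    zeroExtend (Function.update v i x) = Function.update (zeroExtend v) (i : ℕ) x := by
  funext t
  by_cases h : t = i
  · subst h
    rw [zeroExtend_coe, Function.update_self, Function.update_self]
  · rw [Function.update_of_ne h, zeroExtend, zeroExtend]
    split_ifs with h'
    · rw [Function.update_of_ne fun e => h (congrArg Fin.val e)]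
    · rfl

theorem zeroExtend_update_comp {X : Type*} [Zero X] {n : ℕ} (v : Fin n → X)
    (σ : Equiv.Perm (Fin n)) (i : Fin n) (x : X) :
    zeroExtend (Function.update v i x ∘ σ) =
      Function.update (zeroExtend (v ∘ σ)) (σ.symm i : ℕ) x := by
  rw [Function.update_comp_equiv, zeroExtend_update]

theorem sum_range_zeroExtend {n : ℕ} (p : Fin n → ℤ) (i : Fin n) :
    ∑ t ∈ Finset.range i, zeroExtend p t = ∑ t ∈ Finset.univ.filter (· < i), p t := by
  rw [← sum_filter_lt i (zeroExtend p)]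
  exact Finset.sum_congr rfl fun t _ => zeroExtend_coe p t

variable {ι : Type*} {deg : ι → ℤ}
variable {k : Type*} [Ring k] {𝓀 : ℤ → AddSubgroup k} [GradedRing 𝓀]
variable {V : Type*} [AddCommGroup V] [Module k V] {𝒱 : ℤ → AddSubgroup V}

theorem zeroExtend_mem {n : ℕ} {p : Fin n → ℤ} {v : Fin n → V} (hv : ∀ i, v i ∈ 𝒱 (p i)) (i : ℕ) :
    zeroExtend v i ∈ 𝒱 (zeroExtend p i) := by
  rw [zeroExtend, zeroExtend]
  split_ifs
  · exact hv _
  · exact AddSubgroup.zero_mem _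

/-- The inner operation of an `L∞` term stands in the first place, so the computations for `A∞`
terms apply with position zero. -/
theorem lTerm_eq_aTerm (l : ∀ n : ℕ, MultilinearMap ℤ (fun _ : Fin n => V) V) {n s : ℕ}
    (v : Fin n → V) (σ : Equiv.Perm (Fin n)) :
    l (n + 1 - s) (fun t : Fin (n + 1 - s) =>
      let vσ : ℕ → V := fun i => if h : i < n then v (σ ⟨i, h⟩) else 0
      if (t : ℕ) = 0 then l s (fun q : Fin s => vσ q) else vσ (t + s - 1)) =
      aTerm l n s 0 (zeroExtend (v ∘ σ)) := by
  rw [aTerm]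
  congr 1
  funext t
  simp only [zero_add, Nat.not_lt_zero, if_false]
  rfl

theorem aTerm_zero_update_smul {l : ∀ n : ℕ, MultilinearMap ℤ (fun _ : Fin n => V) V}
    (hl : IsOperations 𝓀 𝒱 l) {n s : ℕ} (hs : 1 ≤ s) (hsn : s ≤ n) (i : Fin n) {p : Fin n → ℤ}
    {v : Fin n → V} (hv : ∀ i, v i ∈ 𝒱 (p i)) {q : ℤ} {x : k} (hx : x ∈ 𝓀 q) :
    aTerm l n s 0 (Function.update (zeroExtend v) i (x • v i)) =
      sgn (q * (n + 1 + ∑ t ∈ Finset.univ.filter (· < i), p t)) • x •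
        aTerm l n s 0 (zeroExtend v) := by
  have h := aTerm_update_smul hl hs (l := 0) (n := n) (by omega) i.2 (zeroExtend_mem hv) hx
  simp only [Finset.range_zero, Finset.sum_empty] at h
  rw [zeroExtend_coe, sum_range_zeroExtend, smul_comm x, smul_comm (sgn (q * _))] at h
  have h' := congrArg (fun y => sgn (((s : ℤ) + 1) * (((0 : ℕ) : ℤ) + 1) + s * (n + 0)) • y) h
  simpa only [smul_smul, ← mul_assoc, sgn_mul_self, one_mul, one_smul] using h'

/-- The coefficients multiplied by the factorials of the lengths. -/
def factorialGen (e : List ι → ι →₀ k) (u : List ι) : ι →₀ k := u.length.factorial • e u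

theorem IsHomogeneousGen.factorialGen {e : List ι → ι →₀ k} (he : IsHomogeneousGen deg 𝓀 e) :
    IsHomogeneousGen deg 𝓀 (factorialGen e) := fun u j => by
  rw [ChenHPT.factorialGen, Finsupp.smul_apply]
  exact AddSubgroup.nsmul_mem _ (he u j) _

theorem IsSymm.factorialGen {e : List ι → ι →₀ k} (hs : IsSymm deg e) :
    IsSymm deg (factorialGen e) := fun n v σ => by
  rw [ChenHPT.factorialGen, ChenHPT.factorialGen, hs n v σ, List.length_ofFn, List.length_ofFn,
    smul_comm]

/-- The inner word has the length of `w`, the outer word `i :: c` has one letter more than `c`. The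
factor is the one in `sum_unshuffles_insertFirst`, which motivates the rescaling by factorials. -/
theorem insertFirst_factorialGen (e : List ι → ι →₀ k) (j : ι) (w c : List ι) :
    insertFirst deg 𝓀 (factorialGen e) j w c =
      (w.length.factorial * (c.length + 1).factorial) • insertFirst deg 𝓀 e j w c := by
  simp only [insertFirst, factorialGen, List.length_cons, Finsupp.smul_apply, map_nsmul]
  rw [Finsupp.sum_smul_index' (by simp), Finsupp.smul_sum]
  refine Finset.sum_congr rfl fun i _ => ?_
  beta_reduce
  rw [smul_assoc, smul_comm (e w i), smul_smul]

variable (deg 𝓀) in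
/-- The operations corresponding to the derivation of the symmetric algebra with the
coefficients `e`. -/
def symmOperations (α : Module.Basis ι k V) (e : List ι → ι →₀ k) (n : ℕ) :
    MultilinearMap ℤ (fun _ : Fin n => V) V := operations deg 𝓀 α (factorialGen e) n

theorem opSign_comp {n : ℕ} (v : Fin n → ι) (σ : Equiv.Perm (Fin n)) (j : ι) :
    opSign deg (List.ofFn (v ∘ σ)) j =
      ((Equiv.Perm.sign σ : ℤˣ) : ℤ) * koszulSign σ (fun i => deg (v i)) *
        koszulSign σ (fun i => 1 - deg (v i)) * opSign deg (List.ofFn v) j := by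
  rw [opSign, opSign, barSign_comp, xdeg_ofFn_comp]
  ring

/-- On basis elements the symmetry of `e` gives the Koszul sign of the variables, which `opSign`
converts into the sign of `σ` and the Koszul sign of the arguments. Scalars are compatible with this
by `koszulSign_update`. -/
theorem antisymm_symmOperations (hk : IsGradedComm 𝓀) (hV : GradedSMulMem 𝓀 𝒱)
    (α : Module.Basis ι k V) (hα : ∀ j, α j ∈ 𝒱 (deg j))
    (hrepr : ∀ (p : ℤ) (v : V), v ∈ 𝒱 p → ∀ j, α.repr v j ∈ 𝓀 (p - deg j))
    {e : List ι → ι →₀ k} (he : IsHomogeneousGen deg 𝓀 e) (hs : IsSymm deg e) {n : ℕ} (hn : 1 ≤ n)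
    (p : Fin n → ℤ) (v : Fin n → V) (hv : ∀ i, v i ∈ 𝒱 (p i)) (σ : Equiv.Perm (Fin n)) :
    symmOperations deg 𝓀 α e n (v ∘ σ) =
      (((Equiv.Perm.sign σ : ℤˣ) : ℤ) * koszulSign σ p) • symmOperations deg 𝓀 α e n v := by
  have hm : IsOperations 𝓀 𝒱 (symmOperations deg 𝓀 α e) :=
    isOperations_operations hk hV α hα hrepr he.factorialGen
  rw [← sub_eq_zero]
  refine vanish_of_basis α hα hrepr Finset.univ (fun p v => symmOperations deg 𝓀 α e n (v ∘ σ) -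
      (((Equiv.Perm.sign σ : ℤˣ) : ℤ) * koszulSign σ p) • symmOperations deg 𝓀 α e n v)
    ?_ ?_ ?_ p v hv
  · intro i _ p v x y
    simp only [Function.update_comp_equiv, MultilinearMap.map_update_add, smul_add]
    abel
  · intro i _ p v hv q x hx h
    have h1 := hm.smul n hn p v hv i q x hx
    have h2 := hm.smul n hn (p ∘ σ) (v ∘ σ) (fun t => hv (σ t)) (σ.symm i) q x hx
    rw [Function.comp_apply, Equiv.apply_symm_apply] at h2
    rw [Function.update_comp_equiv, h1, h2, koszulSign_update, smul_smul, mul_assoc, mul_assoc,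
      ← sgn_add]
    set S1 := ∑ t ∈ Finset.univ.filter (· < i), p t
    set S2 := ∑ t ∈ Finset.univ.filter (· < σ.symm i), p (σ t) with hS2
    have h3 : sgn (q * (S1 + S2) + q * (n + S1)) = sgn (q * (n + S2)) := by
      apply sgn_eq_of_cast
      push_cast
      generalize (S1 : ZMod 2) = S1
      generalize (S2 : ZMod 2) = S2
      generalize (q : ZMod 2) = q
      generalize (n : ZMod 2) = n
      revert S1 S2 q n
      decide
    have h4 : ∑ t ∈ Finset.univ.filter (· < σ.symm i), (p ∘ σ) t = S2 := rfl
    have h5 : symmOperations deg 𝓀 α e n (v ∘ σ) =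
      (((Equiv.Perm.sign σ : ℤˣ) : ℤ) * koszulSign σ p) • symmOperations deg 𝓀 α e n v :=
      sub_eq_zero.1 h
    rw [h3, h4, h5, smul_comm x, smul_smul, sub_eq_zero]
    congr 1
    ring
  · intro p v _ hb
    choose u hu using fun i => hb i (Finset.mem_univ i)
    obtain rfl : p = fun i => deg (u i) := funext fun i => (hu i).1
    obtain rfl : v = fun i => α (u i) := funext fun i => (hu i).2
    refine α.repr.injective (Finsupp.ext fun j => ?_)
    have h1 := operations_basis (deg := deg) (𝓀 := 𝓀) α (factorialGen e) u j
    have h2 := operations_basis (deg := deg) (𝓀 := 𝓀) α (factorialGen e) (u ∘ σ) j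
    have h3 : (fun i => α (u i)) ∘ σ = fun i => α ((u ∘ σ) i) := rfl
    have h4 : factorialGen e (List.ofFn (u ∘ σ)) j = koszulSign σ (fun i => 1 - deg (u i)) •
        factorialGen e (List.ofFn u) j := hs.factorialGen.apply_coord j n u σ
    rw [h3, map_sub, map_zsmul, Finsupp.sub_apply, Finsupp.smul_apply, symmOperations, h1, h2,
      opSign_comp, h4, smul_smul, smul_smul, map_zero,
      Finsupp.zero_apply, sub_eq_zero]
    congr 1
    linear_combination (((Equiv.Perm.sign σ : ℤˣ) : ℤ) * koszulSign σ (fun i => deg (u i)) *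
      opSign deg (List.ofFn u) j) * koszulSign_mul_self σ (fun i => 1 - deg (u i))

/-- For the permuted word `opSign` produces the sign of `σ` and two Koszul signs. The sign of `σ`
and the Koszul sign of the arguments cancel against the relation; what remains is a term of `∂² (X
j)` with the Koszul sign of the variables and a global factor. -/
theorem repr_aTerm_symmOperations (hk : IsGradedComm 𝓀) (hV : GradedSMulMem 𝓀 𝒱)
    (α : Module.Basis ι k V) (hα : ∀ j, α j ∈ 𝒱 (deg j))
    (hrepr : ∀ (p : ℤ) (v : V), v ∈ 𝒱 p → ∀ j, α.repr v j ∈ 𝓀 (p - deg j))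
    {e : List ι → ι →₀ k} (he : IsHomogeneousGen deg 𝓀 e) (hs : IsSymm deg e) {n s : ℕ}
    (hs1 : 1 ≤ s) (hsn : s ≤ n) (u : Fin n → ι) (σ : Equiv.Perm (Fin n)) (j : ι) :
    (sgn (s * (n - s)) * ((Equiv.Perm.sign σ : ℤˣ) : ℤ) * koszulSign σ (fun i => deg (u i))) •
        α.repr (aTerm (symmOperations deg 𝓀 α e) n s 0 (zeroExtend ((fun i => α (u i)) ∘ σ))) j =
      -(opSign deg (List.ofFn u) j • (s.factorial * (n + 1 - s).factorial) •
        koszulSign σ (fun i => 1 - deg (u i)) • insertFirst deg 𝓀 e j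
          ((List.ofFn (u ∘ σ)).take s) ((List.ofFn (u ∘ σ)).drop s)) := by
  -- A default letter for the places from `n` on, which are never read.
  have u0 : ι := u ⟨0, by omega⟩
  set u' : ℕ → ι := fun i => if h : i < n then u (σ ⟨i, h⟩) else u0 with hu'
  set w := (List.ofFn (u ∘ σ)).take s with hw
  set c := (List.ofFn (u ∘ σ)).drop s with hc
  have hwl : w.length = s := by rw [hw, List.length_take, List.length_ofFn]; omega
  have hcl : c.length + 1 = n + 1 - s := by rw [hc, List.length_drop, List.length_ofFn]; omega
  have h := aTerm_basis hk hV α hα hrepr he.factorialGen (n := n) (s := s) (l := 0) hs1 (by omega)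
    u' (zeroExtend ((fun i => α (u i)) ∘ σ)) (fun i hi => by
      rw [zeroExtend, dif_pos hi, hu']
      simp only [dif_pos hi]
      rfl) [] w c (by simp) (by
      refine List.ext_getElem ?_ fun t h1 h2 => ?_
      · rw [hwl, List.length_ofFn]
      · rw [hwl] at h1
        simp [hw, hu', show t < n by omega]) (by
      refine List.ext_getElem ?_ fun t h1 h2 => ?_
      · rw [List.length_ofFn]
        omega
      · simp only [hc, List.getElem_drop, List.getElem_ofFn, hu', zero_add]
        rw [dif_pos (by omega)]
        rfl) j
  rw [insertFirst_eq _ hs.factorialGen, List.nil_append, List.nil_append, xdeg_nil, zero_mul,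
    sgn_zero, one_smul, insertFirst_factorialGen, hwl, hcl, hw, hc, List.take_append_drop,
    opSign_comp, ← hw, ← hc] at h
  simp only [Finset.range_zero, Finset.sum_empty] at h
  set E : ℤ := ((s : ℤ) + 1) * (((0 : ℕ) : ℤ) + 1) + s * (n + 0) with hE
  -- The sign of the `L∞` relation and that of the `A∞` relation at position zero differ by `-1` for
  -- every `s`.
  have h1 : sgn (s * (n - s)) * sgn E = -1 := by
    rw [← sgn_add, ← sgn_one]
    apply sgn_eq_of_cast
    rw [hE]
    push_cast
    generalize (s : ZMod 2) = s
    generalize (n : ZMod 2) = n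
    revert s n
    decide
  have h2 := congrArg (fun y => (sgn (s * (n - s)) * ((Equiv.Perm.sign σ : ℤˣ) : ℤ) *
    koszulSign σ (fun i => deg (u i)) * sgn E) • y) h
  simp only [smul_smul] at h2
  rw [mul_assoc _ (sgn E) (sgn E), sgn_mul_self, mul_one] at h2
  refine h2.trans ?_
  rw [smul_comm (s.factorial * (n + 1 - s).factorial) (koszulSign σ _), smul_smul, ← neg_smul]
  congr 1
  have h3 := koszulSign_mul_self σ (fun i => deg (u i))
  have h4 : ((Equiv.Perm.sign σ : ℤˣ) : ℤ) * ((Equiv.Perm.sign σ : ℤˣ) : ℤ) = 1 := by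
    rw [← Units.val_mul, Int.units_mul_self, Units.val_one]
  set K := koszulSign σ (fun i => deg (u i))
  set K' := koszulSign σ (fun i => 1 - deg (u i))
  set P := ((Equiv.Perm.sign σ : ℤˣ) : ℤ)
  set O := opSign deg (List.ofFn u) j
  calc _ = (sgn (s * (n - s)) * sgn E) * (P * P) * (K * K) * (K' * O) := by ring
    _ = _ := by rw [h1, h3, h4]; ring

variable [Algebra ℚ k]

/-- The operations corresponding to a square zero derivation of the symmetric algebra form an
`L∞` structure. -/
theorem isLInfinity_symmOperations (hk : IsGradedComm 𝓀) (hV : GradedSMulMem 𝓀 𝒱)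
    (α : Module.Basis ι k V) (hα : ∀ j, α j ∈ 𝒱 (deg j))
    (hrepr : ∀ (p : ℤ) (v : V), v ∈ 𝒱 p → ∀ j, α.repr v j ∈ 𝓀 (p - deg j))
    {e : List ι → ι →₀ k} (he : IsHomogeneousGen deg 𝓀 e) (hs : IsSymm deg e) (h0 : e [] = 0)
    (hsq : ∀ f : List ι → k, symm deg k (der deg 𝓀 e (der deg 𝓀 e f)) = 0) :
    IsLInfinity 𝓀 𝒱 (symmOperations deg 𝓀 α e) where
  toIsOperations := isOperations_operations hk hV α hα hrepr he.factorialGen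
  antisymm n hn p v hv σ := antisymm_symmOperations hk hV α hα hrepr he hs hn p v hv σ
  relation n hn p v hv := by
    have hm : IsOperations 𝓀 𝒱 (symmOperations deg 𝓀 α e) :=
      isOperations_operations hk hV α hα hrepr he.factorialGen
    simp only [lTerm_eq_aTerm]
    refine vanish_of_basis α hα hrepr Finset.univ (fun p v =>
      ∑ s ∈ Finset.Icc 1 n, ∑ σ ∈ unshuffles s n,
      (sgn (s * (n - s)) * ((Equiv.Perm.sign σ : ℤˣ) : ℤ) * koszulSign σ p) •
        aTerm (symmOperations deg 𝓀 α e) n s 0 (zeroExtend (v ∘ σ))) ?_ ?_ ?_ p v hv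
    · intro i _ p v x y
      rw [← Finset.sum_add_distrib]
      refine Finset.sum_congr rfl fun s hs' => ?_
      rw [← Finset.sum_add_distrib]
      refine Finset.sum_congr rfl fun σ _ => ?_
      rw [Finset.mem_Icc] at hs'
      rw [← smul_add, zeroExtend_update_comp, zeroExtend_update_comp, zeroExtend_update_comp,
        aTerm_update_add _ hs'.1 (by omega) (σ.symm i).2]
    · intro i _ p v hv q x hx h
      -- As in the `A∞` case, the factor acquired by a term does not depend on `s` and `σ`.
      have h1 : ∀ s ∈ Finset.Icc 1 n, ∀ σ ∈ unshuffles s n,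
          (sgn (s * (n - s)) * ((Equiv.Perm.sign σ : ℤˣ) : ℤ) *
            koszulSign σ (Function.update p i (q + p i))) •
              aTerm (symmOperations deg 𝓀 α e) n s 0
                (zeroExtend (Function.update v i (x • v i) ∘ σ)) =
          sgn (q * (n + 1 + ∑ t ∈ Finset.univ.filter (· < i), p t)) • x •
            (sgn (s * (n - s)) * ((Equiv.Perm.sign σ : ℤˣ) : ℤ) * koszulSign σ p) •
              aTerm (symmOperations deg 𝓀 α e) n s 0 (zeroExtend (v ∘ σ)) := fun s hs' σ _ => by
        rw [Finset.mem_Icc] at hs'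
        have h2 := aTerm_zero_update_smul hm hs'.1 hs'.2 (σ.symm i) (v := v ∘ σ) (p := p ∘ σ)
          (fun t => hv (σ t)) hx
        rw [Function.comp_apply, Equiv.apply_symm_apply] at h2
        rw [zeroExtend_update_comp, h2, koszulSign_update, smul_smul, smul_comm x, smul_smul]
        congr 1
        set S1 := ∑ t ∈ Finset.univ.filter (· < i), p t
        have h4 : ∑ t ∈ Finset.univ.filter (· < σ.symm i), (p ∘ σ) t =
          ∑ t ∈ Finset.univ.filter (· < σ.symm i), p (σ t) := rfl
        rw [h4]
        set S2 := ∑ t ∈ Finset.univ.filter (· < σ.symm i), p (σ t)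
        have h3 : sgn (q * (S1 + S2)) * sgn (q * (n + 1 + S2)) = sgn (q * (n + 1 + S1)) := by
          rw [← sgn_add]
          apply sgn_eq_of_cast
          push_cast
          generalize (S1 : ZMod 2) = S1
          generalize (S2 : ZMod 2) = S2
          generalize (q : ZMod 2) = q
          generalize (n : ZMod 2) = n
          revert S1 S2 q n
          decide
        rw [← h3]
        ring
      rw [Finset.sum_congr rfl fun s hs => Finset.sum_congr rfl (h1 s hs)]
      simp only [← Finset.smul_sum]
      rw [h, smul_zero, smul_zero]
    · intro p v _ hb
      choose u hu using fun i => hb i (Finset.mem_univ i)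
      obtain rfl : p = fun i => deg (u i) := funext fun i => (hu i).1
      obtain rfl : v = fun i => α (u i) := funext fun i => (hu i).2
      refine α.repr.injective (Finsupp.ext fun j => ?_)
      have h1 : ∀ s ∈ Finset.Icc 1 n, α.repr (∑ σ ∈ unshuffles s n,
          (sgn (s * (n - s)) * ((Equiv.Perm.sign σ : ℤˣ) : ℤ) *
            koszulSign σ (fun i => deg (u i))) • aTerm (symmOperations deg 𝓀 α e) n s 0
              (zeroExtend ((fun i => α (u i)) ∘ σ))) j =
          -(opSign deg (List.ofFn u) j • (s.factorial * (n + 1 - s).factorial) •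
            ∑ σ ∈ unshuffles s n, koszulSign σ (fun i => 1 - deg (u i)) • insertFirst deg 𝓀 e j
              ((List.ofFn (u ∘ σ)).take s) ((List.ofFn (u ∘ σ)).drop s)) := fun s hs' => by
        rw [Finset.mem_Icc] at hs'
        rw [map_sum, Finsupp.finsetSum_apply, Finset.smul_sum, Finset.smul_sum,
          ← Finset.sum_neg_distrib]
        refine Finset.sum_congr rfl fun σ _ => ?_
        rw [map_zsmul, Finsupp.smul_apply,
          repr_aTerm_symmOperations hk hV α hα hrepr he hs hs'.1 hs'.2 u σ j]
      rw [map_zero, Finsupp.zero_apply, map_sum, Finsupp.finsetSum_apply, Finset.sum_congr rfl h1,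
        Finset.sum_neg_distrib, ← Finset.smul_sum, sum_unshuffles_insertFirst hs h0 j (hsq _) u,
        smul_zero, neg_zero]

/-- The operations correspond to the derivation of the symmetric algebra. -/
theorem correspondsS_symmOperations (hk : IsGradedComm 𝓀) {A : Type*} [AddCommGroup A] [Module k A]
    {H : Submodule k A} (α : Module.Basis ι k H) {e : List ι → ι →₀ k}
    (he : IsHomogeneousGen deg 𝓀 e) (hs : IsSymm deg e) :
    CorrespondsS 𝓀 deg α (symmOperations deg 𝓀 α e) (derS 𝓀 hk he) := by
  intro u _ j
  have h1 : (symmMono deg k [j] : List ι → k) = mono k [j] :=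
    symm_eq_self deg (isSymm_of_length_le_one deg fun w hw => mono_of_ne fun h => by
      rw [h] at hw
      simp at hw)
  have h2 : pairing deg 𝓀 (derS 𝓀 hk he (symmMono deg k [j]) : List ι → k) (symmWord deg k u) =
      u.length.factorial • pairSign deg u • e u j := by
    -- Each permutation in `symmWord` gives the same value because `∂ (X j)` is symmetric; summing
    -- them produces the factorial which `factorialGen` accounts for.
    have h3 : ∀ σ : Equiv.Perm (Fin u.length),
        pairing deg 𝓀 (derS 𝓀 hk he (symmMono deg k [j]) : List ι → k)
          (koszulSign σ (fun i => deg (u.get i) - 1) •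
            Finsupp.single (List.ofFn (u.get ∘ σ)) 1) = pairSign deg u • e u j := fun σ => by
      rw [pairing_eq, map_zsmul, ← pairing_eq, pairing_single, twist_one_ground, mul_one,
        derS_symmMono_single hk he (symm_eq_self deg hs), hs, List.ofFn_get,
        pairSign_perm deg (ofFn_comp_perm u.get σ), List.ofFn_get, Finsupp.smul_apply,
        smul_comm (pairSign deg u), smul_smul]
      have h4 : (koszulSign σ fun i => deg (u.get i) - 1) =
          koszulSign σ fun i => 1 - deg (u.get i) := by
        rw [koszulSign, koszulSign]
        refine Finset.prod_congr rfl fun a _ => Finset.prod_congr rfl fun b _ => ?_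
        congr 2
        ring
      rw [h4, koszulSign_mul_self, one_smul]
    rw [symmWord, pairing_eq, map_sum]
    refine (Finset.sum_congr rfl fun σ _ => h3 σ).trans ?_
    rw [Finset.sum_const, Finset.card_univ,
      Fintype.card_perm, Fintype.card_fin]
  have h5 : (bar 𝓀 deg α (symmOperations deg 𝓀 α e) u) [j] =
      sgn (barExp deg u) • koszul 𝓀 (opSign deg u j • u.length.factorial • e u j) := by
    rw [bar, Finsupp.smul_apply, Finsupp.sum, Finsupp.finsetSum_apply, Finset.sum_eq_single j]
    · rw [Finsupp.single_eq_same, symmOperations, operations_basis, List.ofFn_get]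
      rfl
    · intro i _ hi
      rw [Finsupp.single_eq_of_ne]
      intro h
      exact hi (List.singleton_inj.1 h).symm
    · intro hj
      rw [Finsupp.notMem_support_iff.1 hj, map_zero, Finsupp.single_zero, Finsupp.zero_apply]
  have h6 : pairSign deg [j] = 1 := by simp [pairSign]
  rw [h2, h1, pairing_mono, h5, h6, one_smul, map_zsmul, map_zsmul, map_zsmul, map_nsmul,
    map_nsmul, koszul_apply, twist_twist, twist_of_mem 𝓀 _ (he u j), xdeg_cons, xdeg_nil]
  simp only [smul_comm _ u.length.factorial]
  rw [← smul_neg]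
  congr 1
  simp only [smul_smul]
  rw [← neg_smul]
  congr 1
  have h7 : -(sgn (1 - deg j) * sgn (xdeg deg u * deg j) *
      sgn ((1 - deg j + 0 + 1) * (2 - deg j - xdeg deg u))) = 1 := by
    have : (-1 : ℤ) = sgn 1 := sgn_one.symm
    rw [neg_eq_neg_one_mul, this, ← sgn_add, ← sgn_add, ← sgn_add, ← sgn_zero]
    apply sgn_eq_of_cast
    push_cast
    generalize (xdeg deg u : ZMod 2) = x
    generalize (deg j : ZMod 2) = y
    revert x y
    decide
  rw [opSign, barSign]
  linear_combination -(sgn (barExp deg u) * sgn (barExp deg u) * pairSign deg u) * h7 -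
    pairSign deg u * sgn_mul_self (barExp deg u)

end LInfinity

/-- Chen's construction for a differential graded Lie algebra. -/
theorem exists_symmFormalConnection {k : Type*} [Ring k] [Algebra ℚ k] (𝓀 : ℤ → AddSubgroup k)
    [GradedRing 𝓀] (hk : IsGradedComm 𝓀) {L : Type*} [AddCommGroup L] [Module k L]
    (ℒ : ℤ → AddSubgroup L) [DirectSum.Decomposition ℒ] (br : L →+ L →+ L) (d : L →ₛₗ[koszul 𝓀] L)
    (hL : IsDGLA 𝓀 ℒ br d) (H M : Submodule k L) (hs : IsCohSplitting ℒ d H M)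
    {ι : Type*} (deg : ι → ℤ) (α : Module.Basis ι k H) (hα : ∀ j, (α j : L) ∈ ℒ (deg j)) :
    ∃ (ω : List ι → L) (D : symmSeries deg k →ₛₗ[koszul 𝓀] symmSeries deg k)
      (part : ℕ → (symmSeries deg k →ₛₗ[koszul 𝓀] symmSeries deg k)),
      IsChenS deg 𝓀 ℒ br d H M α ω D part ∧
      HasDeg deg ℒ 1 ω ∧
      IsDerivationS deg 𝓀 D ∧ (∀ f, D (D f) = 0) ∧
      curvS deg 𝓀 ℒ br d D ω = 0 ∧
      ∃ l : ∀ n : ℕ, MultilinearMap ℤ (fun _ : Fin n => H) H,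
        IsLInfinity 𝓀 (subGrading ℒ H) l ∧ CorrespondsS 𝓀 deg α l D ∧
        ∃ l' : ∀ n : ℕ, MultilinearMap ℤ (fun _ : Fin n => Cohomology d) (Cohomology d),
          IsLInfinity 𝓀 (cohomologyGrading ℒ d) l' ∧ IsTransported 𝓀 hs.le_ker l l' := by
  have hB := hL.isGradedBilin_halfBr
  obtain ⟨e, ω, h⟩ := exists_isChenData deg true hB hL.d_mem hs α hα
  have he := h.gen_homogeneous
  obtain ⟨hcurv, hsq⟩ := h.curv_eq_zero hk hB hL.d_mem hL.d_d hL.d_halfBr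
    (hL.assoc_halfBr deg h.omega_deg) hs hα
  have hsymm : IsSymm deg e := by
    rw [← h.gen_fixed, proj_true]
    exact isSymm_symm deg e
  have h0 : e [] = 0 := h.gen_short [] (by simp)
  have hcurv' : curvS deg 𝓀 ℒ br d (derS 𝓀 hk he) ω = 0 := by
    rw [curvS, extendS_derS, ← hcurv, curv, proj_true, proj_true, conv_halfBr,
      symm_algebraMap_smul]
  have hsq' : ∀ f, derS 𝓀 hk he (derS 𝓀 hk he f) = 0 := fun f => by
    ext1
    rw [derS_coe, derS_coe, symm_der deg hk he]
    exact hsq f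
  have hV : GradedSMulMem 𝓀 (subGrading ℒ H) := fun p q x a hx ha => hL.smul_mem p q x a hx ha
  have hrepr : ∀ (p : ℤ) (v : H), v ∈ subGrading ℒ H p → ∀ j, α.repr v j ∈ 𝓀 (p - deg j) :=
    fun p v hv j => repr_mem hL.smul_mem α hα hv j
  have hl := isLInfinity_symmOperations (𝒱 := subGrading ℒ H) hk hV α hα hrepr he hsymm h0 hsq
  exact ⟨ω, derS 𝓀 hk he, _, h.isChenS hk hs, h.omega_deg, isDerivationS_derS hk he, hsq', hcurv',
    symmOperations deg 𝓀 α e, hl, correspondsS_symmOperations hk α he hsymm,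
    transport hs.equiv (symmOperations deg 𝓀 α e),
    hl.transport hs.equiv hs.equiv_mem (hs.equiv_symm_mem hL.d_mem hL.d_d), hs.isTransported _⟩

end

end ChenHPT

theorem mainTheorem2 {k : Type*} [Ring k] [Algebra ℚ k] (𝓀 : ℤ → AddSubgroup k) [GradedRing 𝓀]
    (hk : IsGradedComm 𝓀) :
    (∀ {A : Type*} [NonUnitalRing A] [Module k A] (𝒜 : ℤ → AddSubgroup A)
        [DirectSum.Decomposition 𝒜] (d : A →ₛₗ[koszul 𝓀] A) (_ : IsDGA 𝓀 𝒜 d)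
        (H M : Submodule k A) (hs : IsCohSplitting 𝒜 d H M)
        {ι : Type*} (deg : ι → ℤ) (α : Module.Basis ι k H) (_ : ∀ j, (α j : A) ∈ 𝒜 (deg j)),
      ∃ (ω : List ι → A) (D : (List ι → k) →ₛₗ[koszul 𝓀] (List ι → k))
        (part : ℕ → ((List ι → k) →ₛₗ[koszul 𝓀] (List ι → k))),
        IsChenT deg 𝓀 𝒜 d H M α ω D part ∧
        HasDeg deg 𝒜 1 ω ∧
        IsDerivationT deg 𝓀 D ∧ (∀ f, D (D f) = 0) ∧
        curvT deg 𝓀 𝒜 d D ω = 0 ∧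
        ∃ b : (List ι →₀ k) →ₛₗ[koszul 𝓀] (List ι →₀ k),
          IsCodifferential deg 𝓀 b ∧ IsTranspose deg 𝓀 D b ∧
          (∃ m : ∀ n : ℕ, MultilinearMap ℤ (fun _ : Fin n => H) H,
            IsAInfinity 𝓀 (subGrading 𝒜 H) m ∧ Corresponds 𝓀 deg α m b ∧
            ∃ m' : ∀ n : ℕ, MultilinearMap ℤ (fun _ : Fin n => Cohomology d) (Cohomology d),
              IsAInfinity 𝓀 (cohomologyGrading 𝒜 d) m' ∧ IsTransported 𝓀 hs.le_ker m m') ∧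
          ∃ τ : (List ι →₀ k) →ₛₗ[koszul 𝓀] A,
            IsTwistingCochain deg 𝓀 𝒜 d b τ ∧
            ∀ u, τ (Finsupp.single u 1) = -(pairSign deg u • ω u)) ∧
    (∀ {L : Type*} [AddCommGroup L] [Module k L] (ℒ : ℤ → AddSubgroup L)
        [DirectSum.Decomposition ℒ] (br : L →+ L →+ L) (d : L →ₛₗ[koszul 𝓀] L)
        (_ : IsDGLA 𝓀 ℒ br d)
        (H M : Submodule k L) (hs : IsCohSplitting ℒ d H M)
        {ι : Type*} (deg : ι → ℤ) (α : Module.Basis ι k H) (_ : ∀ j, (α j : L) ∈ ℒ (deg j)),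
      ∃ (ω : List ι → L) (D : symmSeries deg k →ₛₗ[koszul 𝓀] symmSeries deg k)
        (part : ℕ → (symmSeries deg k →ₛₗ[koszul 𝓀] symmSeries deg k)),
        IsChenS deg 𝓀 ℒ br d H M α ω D part ∧
        HasDeg deg ℒ 1 ω ∧
        IsDerivationS deg 𝓀 D ∧ (∀ f, D (D f) = 0) ∧
        curvS deg 𝓀 ℒ br d D ω = 0 ∧
        ∃ l : ∀ n : ℕ, MultilinearMap ℤ (fun _ : Fin n => H) H,
          IsLInfinity 𝓀 (subGrading ℒ H) l ∧ CorrespondsS 𝓀 deg α l D ∧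
          ∃ l' : ∀ n : ℕ, MultilinearMap ℤ (fun _ : Fin n => Cohomology d) (Cohomology d),
            IsLInfinity 𝓀 (cohomologyGrading ℒ d) l' ∧ IsTransported 𝓀 hs.le_ker l l') := by
  refine ⟨?_, ?_⟩
  · intro A _ _ 𝒜 _ d hA H M hs ι deg α hα
    exact exists_formalConnection 𝓀 hk 𝒜 d hA H M hs deg α hα
  · intro L _ _ ℒ _ br d hL H M hs ι deg α hα
    exact exists_symmFormalConnection 𝓀 hk ℒ br d hL H M hs deg α hα
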